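/- Let $T>0$, $H\in(\frac12,1)$, $\nu\in(0,1)$, $c_H=H(2H-1)$, and let $X=\{X(\varphi):\varphi\in\mathcal D(\mathbb R^2)\}$ be a centred Gaussian family on a probability space with $$E\big(X(\varphi)X(\psi)\big)=c_H\int_{[0,T]^2}du\,dv\,|u-v|^{2H-2}\int_{\mathbb R^2}dx\,dy\,|x-y|^{-\nu}\varphi(u,x)\psi(v,y).$$ Let $\sigma\in\mathcal C^3(\mathbb R)$ be bounded with bounded derivatives up to order 3. *Notation.* For bounded sets $A\subset\mathbb R^2$ of the kind used below, $X(\mathbf 1_A)$ is the $L^2(\Omega)$-limit of $X(\varphi_n)$ for uniformly bounded test functions $\varphi_n$ with supports in a common compact set and $\varphi_n\to\mathbf 1_A$ pointwise. For a function $Y$ of (time, position) put $(Y\circ\mathcal R_{-\pi/4})(s,t)=Y\big(\frac{t+s}{\sqrt2},\frac{t-s}{\sqrt2}\big)$, and let $D_T=\{(s,t):0\le s+t\le\sqrt2\,T\}$ be the rotated image of $[0,T]\times\mathbb R$. The rotated noise is $x(s,t)=\operatorname{sgn}(s)\operatorname{sgn}(t)\,X\big(\mathbf 1_{A(s,t)}\big)$,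 $(s,t)\in D_T$, where $A(s,t)$ is the set of (time, position) corresponding to $([0,s]\times[0,t])\cap D_T$ (with $[s,0]$, $[t,0]$ for negative $s,t$). For $D\subset\mathbb R^2$, $\mathcal C^{\gamma,\hat\gamma}(D)$ is the set of continuous $f$ on $D$ whose increments over rectangles $[s_1,s_2]\times[t_1,t_2]\subset D$ are bounded by $C(s_2-s_1)^\gamma(t_2-t_1)^{\hat\gamma}$, and $\mathcal H^{\gamma,\hat\gamma}(D)$ is the set of those which are moreover $\gamma$-Hölder in the first and $\hat\gamma$-Hölder in the second variable, uniformly in the other one. The Young integral $\iint_R f\,dx$ over a rectangle is the limit of the Riemann sums $\sum_{i,j} f(s_i,t_j)\Delta_{[s_i,s_{i+1}]\times[t_j,t_{j+1}]}x$ as the mesh tends to $0$. Let $C(s,t)$ be the triangle with corners $(s,t),(0,t+s),(0,t-s)$, and let $\iint_{C(s,t)}\sigma(Y)\,dX$ be the sum of the Young integrals, in the rotated coordinates, of $\sigma(Y)\circ\mathcal R_{-\pi/4}$ against $x$ over the pieces of any decomposition of the rotated triangle into countably many disjoint rectangles $(a_n,b_n]\times(c_n,d_n]$ with $\sum_n(b_n-a_n)^\gamma(d_n-c_n)^{\hat\gamma}<\infty$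 (up to its boundary; the sum is required not to depend on the decomposition). A *mild solution in the Young sense* of $\partial_s^2Y-\partial_t^2Y=\sigma(Y)\dot X$ on $[0,T]\times\mathbb R$ with $Y(0,\cdot)=\partial_sY(0,\cdot)=0$ is a function $Y:[0,T]\times\mathbb R\to\mathbb R$ for which there are $\gamma,\hat\gamma\in(\frac12,1)$, $\kappa\in(1-\gamma,1)$, $\hat\kappa\in(1-\hat\gamma,1)$ such that $x\in\mathcal C^{\gamma,\hat\gamma}(R\cap D_T)$ and $Y\circ\mathcal R_{-\pi/4}\in\mathcal H^{\kappa,\hat\kappa}(R\cap D_T)$ for every rectangle $R$, and $$Y(s,t)=\iint_{C(s,t)}\sigma(Y(u,v))\,X(du,dv)\qquad\text{for all }(s,t)\in[0,T]\times\mathbb R.$$ *Theorem.* The rotated noise $x$ has a version with almost surely continuous paths, and for every such version, almost surely, there is exactly one mild solution $Y$ in the Young sense. It satisfies $Y(0,t)=\partial_sY(0,t)=0$ for all $t$, and $Y\circ\mathcal R_{-\pi/4}\in\mathcal H^{\eta,\hat\eta}(R\cap D_T)$ for every rectangle $R$ and all $\eta,\hat\eta\in(0,1)$ with $\eta+\hat\eta<1+H-\frac\nu2$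 and $\max(\eta,\hat\eta)<H+\frac{1-\nu}2$ (the last condition is automatic if $\eta,\hat\eta\ge\frac12$). -/

import Mathlib

open MeasureTheory ProbabilityTheory Filter Topology Set

noncomputable section

namespace FracWave

/-- The space `𝓓(ℝ²)` of real test functions on the plane, the points being `(time, space)`.
(The order of smoothness is an `ℕ∞`, so that `⊤` means `C^∞`.) -/
abbrev PlaneTest : Type :=
  TestFunction (⊤ : TopologicalSpace.Opens (ℝ × ℝ)) ℝ (⊤ : ℕ∞)

/-! ### The fractional Brownian noise -/

/-- A centred Gaussian family indexed by test functions, with covariance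
`c_H ∫_{[0,T]²} du dv |u-v|^{2H-2} ∫_{ℝ²} dx dy |x-y|^{-ν} φ(u,x) ψ(v,y)`, `c_H = H(2H-1)`. -/
structure IsFractionalNoise {Ω : Type*} [MeasurableSpace Ω] (P : Measure Ω)
    (T H ν : ℝ) (X : PlaneTest → Ω → ℝ) : Prop where
  gaussian : IsGaussianProcess X P
  centered : ∀ φ, ∫ ω, X φ ω ∂P = 0
  covariance : ∀ φ ψ : PlaneTest,
    ∫ ω, X φ ω * X ψ ω ∂P =
      H * (2 * H - 1) * ∫ u in Icc 0 T, ∫ v in Icc 0 T,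
        |u - v| ^ (2 * H - 2) * ∫ x : ℝ, ∫ y : ℝ, |x - y| ^ (-ν) * (φ (u, x) * ψ (v, y))

/-- `Z` is the value `X(1_A)`: the limit in `L²(Ω)` of `X(φ_n)` for every sequence of test
functions that is uniformly bounded, supported in a common compact set, and converges pointwise
to the indicator function of `A`. -/
def IsNoiseOfSet {Ω : Type*} [MeasurableSpace Ω] (P : Measure Ω)
    (X : PlaneTest → Ω → ℝ) (A : Set (ℝ × ℝ)) (Z : Ω → ℝ) : Prop :=
  MemLp Z 2 P ∧
    ∀ φ : ℕ → PlaneTest,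
      (∃ K : Set (ℝ × ℝ), IsCompact K ∧ ∀ n, tsupport (φ n) ⊆ K) →
      (∃ C : ℝ, ∀ n p, |φ n p| ≤ C) →
      (∀ p, Tendsto (fun n => φ n p) atTop (𝓝 (A.indicator (fun _ => (1 : ℝ)) p))) →
      Tendsto (fun n => eLpNorm (fun ω => X (φ n) ω - Z ω) 2 P) atTop (𝓝 0)

/-! ### Rotation by 45 degrees

In the rotated coordinates `(s,t)` the time is `(t+s)/√2` and the position is `(t-s)/√2`;
conversely `s = (time - position)/√2` and `t = (time + position)/√2`. -/

/-- `f ∘ R_{-π/4}`: a function of `(time, position)` written in the rotated coordinates. -/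
def rotate (f : ℝ → ℝ → ℝ) : ℝ → ℝ → ℝ :=
  fun s t => f ((t + s) / √2) ((t - s) / √2)

/-- The image of `[0,T] × ℝ` in the rotated coordinates. -/
def strip (T : ℝ) : Set (ℝ × ℝ) := {p | 0 ≤ p.1 + p.2 ∧ p.1 + p.2 ≤ √2 * T}

/-- The set of `(time, position)` which in the rotated coordinates is
`([0,s] × [0,t]) ∩ strip T` (with `[s,0]`, `[t,0]` for negative `s`, `t`). -/
def anchoredRect (T s t : ℝ) : Set (ℝ × ℝ) :=
  {p | p.1 ∈ Icc 0 T ∧ (p.1 - p.2) / √2 ∈ uIcc 0 s ∧ (p.1 + p.2) / √2 ∈ uIcc 0 t}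

/-- `x` is a continuous version of the rotated noise, seen as a function of two variables on the
strip: `x(s,t) = ± X(1_{anchoredRect})`, the sign being that of the orientation of `[0,s] × [0,t]`,
so that the increment of `x` over a rectangle contained in the strip is the noise of that
rectangle. -/
structure IsRotatedNoise {Ω : Type*} [MeasurableSpace Ω] (P : Measure Ω) (T : ℝ)
    (X : PlaneTest → Ω → ℝ) (x : Ω → ℝ → ℝ → ℝ) : Prop where
  version : ∀ s t : ℝ, (s, t) ∈ strip T →
    ∃ Z : Ω → ℝ, IsNoiseOfSet P X (anchoredRect T s t) Z ∧
      ∀ᵐ ω ∂P, x ω s t = Real.sign s * Real.sign t * Z ω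
  continuous_paths : ∀ᵐ ω ∂P, ContinuousOn (fun p : ℝ × ℝ => x ω p.1 p.2) (strip T)

/-! ### Hölder spaces on subsets of the plane -/

/-- The increment of `f` over the rectangle `[s₁,s₂] × [t₁,t₂]`. -/
def rectIncr (f : ℝ → ℝ → ℝ) (s₁ s₂ t₁ t₂ : ℝ) : ℝ :=
  f s₁ t₁ - f s₁ t₂ - f s₂ t₁ + f s₂ t₂

/-- `f ∈ 𝒞^{γ,γ'}(D)`: continuity, and Hölder continuity of the rectangular increments. -/
structure MemC (γ γ' : ℝ) (D : Set (ℝ × ℝ)) (f : ℝ → ℝ → ℝ) : Prop where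
  continuousOn : ContinuousOn (fun p : ℝ × ℝ => f p.1 p.2) D
  rect : ∃ C : ℝ, ∀ s₁ s₂ t₁ t₂ : ℝ, s₁ < s₂ → t₁ < t₂ → Icc s₁ s₂ ×ˢ Icc t₁ t₂ ⊆ D →
    |rectIncr f s₁ s₂ t₁ t₂| ≤ C * ((s₂ - s₁) ^ γ * (t₂ - t₁) ^ γ')

/-- `f ∈ ℋ^{η,η'}(D)`: moreover `f` is Hölder continuous of order `η` in the first variable and
of order `η'` in the second one. -/
structure MemH (η η' : ℝ) (D : Set (ℝ × ℝ)) (f : ℝ → ℝ → ℝ) : Prop extends MemC η η' D f where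
  fst : ∃ C : ℝ, ∀ s₁ s₂ t : ℝ, (s₁, t) ∈ D → (s₂, t) ∈ D →
    |f s₂ t - f s₁ t| ≤ C * |s₂ - s₁| ^ η
  snd : ∃ C : ℝ, ∀ s t₁ t₂ : ℝ, (s, t₁) ∈ D → (s, t₂) ∈ D →
    |f s t₂ - f s t₁| ≤ C * |t₂ - t₁| ^ η'

/-- The part of the rectangle `[a,b] × [c,d]` of the rotated plane that lies in the strip. -/
def box (T a b c d : ℝ) : Set (ℝ × ℝ) := (Icc a b ×ˢ Icc c d) ∩ strip T

/-! ### Young integrals -/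

/-- `p 0, …, p n` is a subdivision of `[a,b]` of mesh less than `δ`. -/
def IsSubdivision (a b δ : ℝ) (n : ℕ) (p : ℕ → ℝ) : Prop :=
  p 0 = a ∧ p n = b ∧ ∀ i < n, p i ≤ p (i + 1) ∧ p (i + 1) - p i < δ

/-- `∫∫_{[a,b] × [c,d]} f dx = z` in the Young sense: the Riemann sums converge to `z` as the mesh
of the partition tends to zero. -/
def HasYoungIntegral (f x : ℝ → ℝ → ℝ) (a b c d z : ℝ) : Prop :=
  ∀ ε > 0, ∃ δ > 0, ∀ (m n : ℕ) (p q : ℕ → ℝ),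
    IsSubdivision a b δ m p → IsSubdivision c d δ n q →
    |∑ i ∈ Finset.range m, ∑ j ∈ Finset.range n,
        f (p i) (q j) * rectIncr x (p i) (p (i + 1)) (q j) (q (j + 1)) - z| < ε

/-- The light cone with vertex `(s,t)`: the triangle with corners `(s,t)`, `(0,t+s)`, `(0,t-s)`,
without its base. -/
def lightCone (s t : ℝ) : Set (ℝ × ℝ) := {p | 0 < p.1 ∧ |p.2 - t| ≤ s - p.1}

/-- The set of `(time, position)` which is the half-open rectangle `(a,b] × (c,d]` in the rotated
coordinates. -/
def charRect (a b c d : ℝ) : Set (ℝ × ℝ) :=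
  {p | (p.1 - p.2) / √2 ∈ Ioc a b ∧ (p.1 + p.2) / √2 ∈ Ioc c d}

/-- A decomposition of the light cone `C(s,t)` into countably many disjoint rectangles (with sides
parallel to the axes of the rotated coordinates) such that the sum of
`(b_n - a_n)^γ (d_n - c_n)^γ'` is finite. -/
structure IsConeTiling (γ γ' s t : ℝ) (a b c d : ℕ → ℝ) : Prop where
  fst_le : ∀ n, a n ≤ b n
  snd_le : ∀ n, c n ≤ d n
  disjoint : Pairwise fun m n =>
    Disjoint (charRect (a m) (b m) (c m) (d m)) (charRect (a n) (b n) (c n) (d n))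
  iUnion_eq : ⋃ n, charRect (a n) (b n) (c n) (d n) = lightCone s t
  summable : Summable fun n => (b n - a n) ^ γ * (d n - c n) ^ γ'

/-- `∫∫_{C(s,t)} F dX = z`: such decompositions of `C(s,t)` exist, and for each of them the Young
integrals over the pieces exist and sum up to `z`. Here `F` is a function of `(time, position)`,
and `x` is the driving function in the rotated coordinates. -/
def HasConeIntegral (γ γ' : ℝ) (F x : ℝ → ℝ → ℝ) (s t z : ℝ) : Prop :=
  (∃ a b c d : ℕ → ℝ, IsConeTiling γ γ' s t a b c d) ∧
    ∀ a b c d : ℕ → ℝ, IsConeTiling γ γ' s t a b c d →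
      ∃ I : ℕ → ℝ, (∀ n, HasYoungIntegral (rotate F) x (a n) (b n) (c n) (d n) (I n)) ∧ HasSum I z

/-! ### The wave equation -/

/-- `Y` is a mild solution, in the Young sense, of `∂²_s Y - ∂²_t Y = σ(Y) Ẋ` on `[0,T] × ℝ` with
zero initial data: on bounded sets the driving function `x` and `Y` (both in the rotated
coordinates) have Hölder exponents for which the Young integral makes sense, and
`Y(s,t) = ∫∫_{C(s,t)} σ(Y) dX` for all `(s,t) ∈ [0,T] × ℝ`. -/
def IsMildSolution (T : ℝ) (σ : ℝ → ℝ) (x : ℝ → ℝ → ℝ) (Y : ℝ → ℝ → ℝ) : Prop :=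
  ∃ γ γ' κ κ' : ℝ, γ ∈ Ioo (1 / 2) 1 ∧ γ' ∈ Ioo (1 / 2) 1 ∧
    κ ∈ Ioo (1 - γ) 1 ∧ κ' ∈ Ioo (1 - γ') 1 ∧
    (∀ a b c d : ℝ, MemC γ γ' (box T a b c d) x) ∧
    (∀ a b c d : ℝ, MemH κ κ' (box T a b c d) (rotate Y)) ∧
    ∀ s ∈ Icc 0 T, ∀ t : ℝ, HasConeIntegral γ γ' (fun u v => σ (Y u v)) x s t (Y s t)

end FracWave

end

/-! The argument has a pathwise half and a probabilistic half, joined by the class `IsDriver γ γ'`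
of continuous functions whose rectangular increments are locally bounded by products of powers of
the sides.

Pathwise half. If a function of intervals is additive up to an error of order larger than one, its
sums along subdivisions converge (`sewing_sum_bound`, `sewing_compare`). Used once in each variable,
this gives the Young integral over a rectangle with an explicit estimate as soon as κ + γ > 1 and κ'
+ γ' > 1 (`exists_youngIntegral`). A triangle is tiled by dyadic squares, and the Young integrals
over the tiles are summable because γ + γ' > 1. The sum does not depend on the tiling: replace x by
its Steklov averages, for which the Young integral is a Lebesgue integral with continuous density
and hence countably additive; the Young estimate is uniform in the averaging scale, so dominated
convergence over the tiles carries additivity to the limit (`exists_hasTriIntegral`).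

The integral equation is solved by Picard iteration on triangles, with oscillations measured at a
small scale δ. The integral over a cell of side δ gains δ^(γ+γ'), whereas an increment in one
variable is a sum over about 1/δ cells; since γ + γ' > 1 the gain wins, and functions with
oscillation at most 1 at scale δ are preserved whatever the size of the triangle, because σ is
bounded (`IsPotential.bounds`, `IsPotential.stable`). With the weight exp((s+t)/δ) the sums over
cells become geometric, and the map halves differences (`IsPotential.contract`). Rectangular
increments of σ(z) - σ(z') require the second derivative of σ to be Lipschitz, which is where three
derivatives enter. Existence is `exists_fixedPoint`, uniqueness `eq_of_isPotential`. A solution is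
itself an indefinite integral, so it inherits every pair of exponents of the driver
(`IsPotential.regularity`) and is of order s^(γ+γ') near time zero, whence the vanishing initial
velocity.

Probabilistic half. In rotated coordinates the noise of a rectangle with sides a, b has, up to a
constant, variance at most ab times the integral of |p+q|^(2H-2) |q-p|^(-ν) over |p| ≤ a, |q| ≤ b.
Inserting the factors (a/|p|)^(2η-1) (b/|q|)^(2η'-1), which are at least 1, leaves four negative
powers of pairwise independent linear forms. Each exponent is below one and their sum is below two
exactly when η + η' < 1 + H - ν/2, so the product is integrable and the variance is at most C a^(2η)
b^(2η') (`exists_noiseMeasure_le`). All moments of a Gaussian variable are powers of its variance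
(`eLpNorm_gaussian`), and a two-parameter Kolmogorov criterion, proved by dyadic chaining
(`ae_dyadicBound`, `isDriver_dyadicExt`), yields a version that is almost surely a driver for all
admissible exponents at once. Every other continuous version agrees with it on the strip. -/

noncomputable section

namespace FracWave

/-! ### Sewing along subdivisions -/

/-- The constant in the sewing estimate with exponent `θ`. -/
def sewConst (θ : ℝ) : ℝ := 2 / (1 - 2 ^ (1 - θ))

lemma two_rpow_one_sub_lt_one {θ : ℝ} (hθ : 1 < θ) : (2 : ℝ) ^ (1 - θ) < 1 :=
  Real.rpow_lt_one_of_one_lt_of_neg (by norm_num) (by linarith)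

lemma sewConst_nonneg {θ : ℝ} (hθ : 1 < θ) : 0 ≤ sewConst θ := by
  have := two_rpow_one_sub_lt_one hθ
  unfold sewConst
  exact div_nonneg (by norm_num) (by linarith)

lemma sewConst_eq {θ : ℝ} (hθ : 1 < θ) :
    sewConst θ * 2 ^ (1 - θ) + 2 = sewConst θ := by
  have := two_rpow_one_sub_lt_one hθ
  unfold sewConst
  have h : (1 - (2 : ℝ) ^ (1 - θ)) ≠ 0 := by linarith
  field_simp
  ring

lemma monotone_steps {n : ℕ} {p : ℕ → ℝ} (hp : ∀ i < n, p i ≤ p (i + 1)) {i j : ℕ} (hij : i ≤ j)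
    (hj : j ≤ n) : p i ≤ p j := by
  induction j, hij using Nat.le_induction with
  | base => exact le_rfl
  | succ j hj' ih => exact (ih (by omega)).trans (hp j (by omega))

/-- If `Ξ` is additive up to an error of order `θ > 1`, its sum along a subdivision is close to its
value on the whole interval. -/
theorem sewing_sum_bound {Ξ : ℝ → ℝ → ℝ} {M θ a b : ℝ} (hθ : 1 < θ) (hM : 0 ≤ M)
    (h0 : ∀ u, a ≤ u → u ≤ b → Ξ u u = 0)
    (h : ∀ u v w, a ≤ u → u ≤ v → v ≤ w → w ≤ b → |Ξ u w - Ξ u v - Ξ v w| ≤ M * (w - u) ^ θ)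
    (n : ℕ) : ∀ p : ℕ → ℝ, (∀ i < n, p i ≤ p (i + 1)) → a ≤ p 0 → p n ≤ b →
      |∑ i ∈ Finset.range n, Ξ (p i) (p (i + 1)) - Ξ (p 0) (p n)| ≤
        sewConst θ * M * (p n - p 0) ^ θ := by
  induction n using Nat.strong_induction_on with
  | _ n ih =>
  intro p hp ha hb
  have hC := sewConst_nonneg hθ
  rcases Nat.eq_zero_or_pos n with rfl | hn
  · simp [h0 (p 0) ha hb]
    positivity
  · have hle := monotone_steps hp (Nat.zero_le n) le_rfl
    -- Split at the cell `[p k, p (k + 1)]` containing the midpoint. The pieces on either side have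
    -- at most half the total length, so their errors add up to a fraction 2^(1-θ) of the claimed
    -- bound; the two defects created by the splitting supply the term 2 in `sewConst_eq`.
    have hex : ∃ k, (p 0 + p n) / 2 ≤ p (k + 1) := ⟨n - 1, by
      rw [Nat.sub_add_cancel hn]; linarith⟩
    classical
    obtain ⟨k, hk, hmin⟩ : ∃ k, (p 0 + p n) / 2 ≤ p (k + 1) ∧
        ∀ j < k, ¬ (p 0 + p n) / 2 ≤ p (j + 1) :=
      ⟨Nat.find hex, Nat.find_spec hex, fun j hj => Nat.find_min hex hj⟩
    have hkn : k < n := by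
      by_contra hkn
      refine hmin (n - 1) (by omega) ?_
      rw [Nat.sub_add_cancel hn]; linarith
    have hk' : p k ≤ (p 0 + p n) / 2 := by
      rcases Nat.eq_zero_or_pos k with rfl | hk0
      · linarith
      · have := hmin (k - 1) (by omega)
        rw [Nat.sub_add_cancel hk0] at this
        linarith
    have m1 := monotone_steps hp (Nat.zero_le k) hkn.le
    have m2 := hp k hkn
    have m3 := monotone_steps hp (show k + 1 ≤ n by omega) le_rfl
    have e1 := ih k hkn p (fun i hi => hp i (by omega)) ha (by linarith)
    have e3 := ih (n - (k + 1)) (by omega) (fun i => p (k + 1 + i))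
      (fun i hi => by simpa [add_assoc] using hp (k + 1 + i) (by omega)) (by simp; linarith)
      (by simp only [show k + 1 + (n - (k + 1)) = n by omega]; exact hb)
    simp only [show k + 1 + (n - (k + 1)) = n by omega, add_zero] at e3
    have hsum : ∑ i ∈ Finset.range n, Ξ (p i) (p (i + 1)) =
        ∑ i ∈ Finset.range k, Ξ (p i) (p (i + 1)) + Ξ (p k) (p (k + 1)) +
        ∑ i ∈ Finset.range (n - (k + 1)), Ξ (p (k + 1 + i)) (p (k + 1 + (i + 1))) := by
      conv_lhs => rw [show n = (k + 1) + (n - (k + 1)) by omega]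
      rw [Finset.sum_range_add, Finset.sum_range_succ]
      rfl
    have e2 := h (p 0) (p k) (p (k + 1)) ha m1 m2 (by linarith)
    have e4 := h (p 0) (p (k + 1)) (p n) ha (by linarith) m3 hb
    have hhalf : ((p n - p 0) / 2) ^ θ = 2 ^ (1 - θ) * (p n - p 0) ^ θ / 2 := by
      rw [Real.div_rpow (by linarith) (by norm_num), Real.rpow_sub (by norm_num), Real.rpow_one]
      have : (2 : ℝ) ^ θ ≠ 0 := by positivity
      field_simp
    have b1 : (p k - p 0) ^ θ ≤ ((p n - p 0) / 2) ^ θ :=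
      Real.rpow_le_rpow (by linarith) (by linarith) (by linarith)
    have b3 : (p n - p (k + 1)) ^ θ ≤ ((p n - p 0) / 2) ^ θ :=
      Real.rpow_le_rpow (by linarith) (by linarith) (by linarith)
    have b2 : (p (k + 1) - p 0) ^ θ ≤ (p n - p 0) ^ θ :=
      Real.rpow_le_rpow (by linarith) (by linarith) (by linarith)
    have c1 := mul_le_mul_of_nonneg_left b1 (mul_nonneg hC hM)
    have c3 := mul_le_mul_of_nonneg_left b3 (mul_nonneg hC hM)
    have c2 := mul_le_mul_of_nonneg_left b2 hM
    have hfin : sewConst θ * M * ((p n - p 0) / 2) ^ θ * 2 + 2 * (M * (p n - p 0) ^ θ) =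
        sewConst θ * M * (p n - p 0) ^ θ := by
      rw [hhalf]
      nth_rewrite 2 [← sewConst_eq hθ]
      ring
    rw [hsum, ← hfin]
    rw [abs_le] at e1 e2 e3 e4 ⊢
    constructor <;> linarith [e1.1, e1.2, e2.1, e2.2, e3.1, e3.2, e4.1, e4.2]

/-- Restriction of a real number to the interval `[u, v]`. -/
def clamp (u v r : ℝ) : ℝ := max u (min v r)

/-- Both sides are Ξ on the intersection of `[u, v]` and `[r, s]`, and zero when the intersection is
empty. This symmetry lets the common refinement of two subdivisions be summed in either order. -/
lemma clamp_pair {Ξ : ℝ → ℝ → ℝ} {a b u v r s : ℝ} (h0 : ∀ u, a ≤ u → u ≤ b → Ξ u u = 0)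
    (hu : a ≤ u) (huv : u ≤ v) (hv : v ≤ b) (hr : a ≤ r) (hrs : r ≤ s) (hs : s ≤ b) :
    Ξ (clamp u v r) (clamp u v s) = Ξ (clamp r s u) (clamp r s v) := by
  unfold clamp
  by_cases h1 : v < r
  · rw [min_eq_left h1.le, min_eq_left (by linarith), max_eq_right huv, min_eq_right (by linarith),
      max_eq_left (by linarith), min_eq_right (by linarith), max_eq_left (by linarith),
      h0 v (by linarith) hv, h0 r hr (by linarith)]
  by_cases h2 : s < u
  · rw [min_eq_right (by linarith), min_eq_right (by linarith), max_eq_left (by linarith),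
      max_eq_left (by linarith), min_eq_left (by linarith), min_eq_left (by linarith),
      max_eq_right (by linarith), h0 u hu (by linarith), h0 s (by linarith) hs]
  push Not at h1 h2
  rw [min_eq_right h1, min_eq_right h2, max_comm u r, max_eq_right (le_min huv h2),
    max_eq_right (le_min hrs h1), min_comm]

lemma sum_range_sub_real (p : ℕ → ℝ) (n : ℕ) :
    ∑ i ∈ Finset.range n, (p (i + 1) - p i) = p n - p 0 := Finset.sum_range_sub p n

lemma IsSubdivision.mono {a b δ : ℝ} {n : ℕ} {p : ℕ → ℝ} (hp : IsSubdivision a b δ n p) {i j : ℕ}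
    (hij : i ≤ j) (hj : j ≤ n) : p i ≤ p j :=
  monotone_steps (fun i hi => (hp.2.2 i hi).1) hij hj

lemma IsSubdivision.mem {a b δ : ℝ} {n : ℕ} {p : ℕ → ℝ} (hp : IsSubdivision a b δ n p) {i : ℕ}
    (hi : i ≤ n) : a ≤ p i ∧ p i ≤ b :=
  ⟨hp.1 ▸ hp.mono (Nat.zero_le i) hi, hp.2.1 ▸ hp.mono hi le_rfl⟩

lemma IsSubdivision.sum_rpow_le {a b δ θ : ℝ} {n : ℕ} {p : ℕ → ℝ} (hp : IsSubdivision a b δ n p)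
    (hθ : 1 < θ) :
    ∑ i ∈ Finset.range n, (p (i + 1) - p i) ^ θ ≤ (b - a) * δ ^ (θ - 1) := by
  calc ∑ i ∈ Finset.range n, (p (i + 1) - p i) ^ θ
      ≤ ∑ i ∈ Finset.range n, (p (i + 1) - p i) * δ ^ (θ - 1) := by
        refine Finset.sum_le_sum fun i hi => ?_
        obtain ⟨h1, h2⟩ := hp.2.2 i (Finset.mem_range.1 hi)
        rcases h1.eq_or_lt with h | h
        · rw [h, sub_self, Real.zero_rpow (by linarith)]; simp
        · have h3 : 0 < p (i + 1) - p i := by linarith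
          calc (p (i + 1) - p i) ^ θ = (p (i + 1) - p i) * (p (i + 1) - p i) ^ (θ - 1) := by
                rw [Real.rpow_sub h3, Real.rpow_one]; field_simp
            _ ≤ _ := by
                refine mul_le_mul_of_nonneg_left ?_ h3.le
                exact Real.rpow_le_rpow h3.le h2.le (by linarith)
    _ = (b - a) * δ ^ (θ - 1) := by
        rw [← Finset.sum_mul, sum_range_sub_real, hp.1, hp.2.1]

/-- For fixed i, the points of `q` clamped to `[p i, p (i + 1)]` subdivide that cell, so the double
sum is the sum along the common refinement and the sewing bound applies cell by cell. -/
lemma sewing_compare_aux {Ξ : ℝ → ℝ → ℝ} {M θ a b : ℝ} (hθ : 1 < θ) (hM : 0 ≤ M)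
    (h0 : ∀ u, a ≤ u → u ≤ b → Ξ u u = 0)
    (h : ∀ u v w, a ≤ u → u ≤ v → v ≤ w → w ≤ b → |Ξ u w - Ξ u v - Ξ v w| ≤ M * (w - u) ^ θ)
    {δ δ' : ℝ} {m n : ℕ} {p q : ℕ → ℝ} (hp : IsSubdivision a b δ m p)
    (hq : IsSubdivision a b δ' n q) :
    |∑ i ∈ Finset.range m, ∑ j ∈ Finset.range n,
        Ξ (clamp (p i) (p (i + 1)) (q j)) (clamp (p i) (p (i + 1)) (q (j + 1))) -
      ∑ i ∈ Finset.range m, Ξ (p i) (p (i + 1))| ≤ sewConst θ * M * ((b - a) * δ ^ (θ - 1)) := by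
  rw [← Finset.sum_sub_distrib]
  refine (Finset.abs_sum_le_sum_abs _ _).trans ?_
  calc _ ≤ ∑ i ∈ Finset.range m, sewConst θ * M * (p (i + 1) - p i) ^ θ := by
        refine Finset.sum_le_sum fun i hi => ?_
        have him := Finset.mem_range.1 hi
        obtain ⟨h1, h2⟩ := hp.2.2 i him
        obtain ⟨m1, m2⟩ := hp.mem him.le
        obtain ⟨m3, m4⟩ := hp.mem (show i + 1 ≤ m by omega)
        have e0 : clamp (p i) (p (i + 1)) (q 0) = p i := by
          unfold clamp; rw [hq.1, max_eq_left (le_trans (min_le_right _ _) m1)]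
        have en : clamp (p i) (p (i + 1)) (q n) = p (i + 1) := by
          unfold clamp; rw [hq.2.1, min_eq_left m4, max_eq_right h1]
        have := sewing_sum_bound hθ hM h0 h n (fun j => clamp (p i) (p (i + 1)) (q j))
          (fun j hj => max_le_max le_rfl (min_le_min le_rfl (hq.2.2 j hj).1))
          (by simp only [e0]; exact m1) (by simp only [en]; exact m4)
        simp only [e0, en] at this
        exact this
    _ = sewConst θ * M * ∑ i ∈ Finset.range m, (p (i + 1) - p i) ^ θ := by rw [Finset.mul_sum]
    _ ≤ _ := mul_le_mul_of_nonneg_left (hp.sum_rpow_le hθ)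
        (mul_nonneg (sewConst_nonneg hθ) hM)

/-- The sums along two fine subdivisions are close to each other. -/
theorem sewing_compare {Ξ : ℝ → ℝ → ℝ} {M θ a b : ℝ} (hθ : 1 < θ) (hM : 0 ≤ M)
    (h0 : ∀ u, a ≤ u → u ≤ b → Ξ u u = 0)
    (h : ∀ u v w, a ≤ u → u ≤ v → v ≤ w → w ≤ b → |Ξ u w - Ξ u v - Ξ v w| ≤ M * (w - u) ^ θ)
    {δ δ' : ℝ} {m n : ℕ} {p q : ℕ → ℝ} (hp : IsSubdivision a b δ m p)
    (hq : IsSubdivision a b δ' n q) :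
    |∑ i ∈ Finset.range m, Ξ (p i) (p (i + 1)) - ∑ j ∈ Finset.range n, Ξ (q j) (q (j + 1))| ≤
      sewConst θ * M * (b - a) * (δ ^ (θ - 1) + δ' ^ (θ - 1)) := by
  have e1 := sewing_compare_aux hθ hM h0 h hp hq
  have e2 := sewing_compare_aux hθ hM h0 h hq hp
  have e3 : ∑ i ∈ Finset.range m, ∑ j ∈ Finset.range n,
        Ξ (clamp (p i) (p (i + 1)) (q j)) (clamp (p i) (p (i + 1)) (q (j + 1))) =
      ∑ j ∈ Finset.range n, ∑ i ∈ Finset.range m,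
        Ξ (clamp (q j) (q (j + 1)) (p i)) (clamp (q j) (q (j + 1)) (p (i + 1))) := by
    rw [Finset.sum_comm]
    refine Finset.sum_congr rfl fun j hj => Finset.sum_congr rfl fun i hi => ?_
    have hi' := Finset.mem_range.1 hi
    have hj' := Finset.mem_range.1 hj
    exact clamp_pair h0 (hp.mem hi'.le).1 (hp.2.2 i hi').1 (hp.mem hi').2
      (hq.mem hj'.le).1 (hq.2.2 j hj').1 (hq.mem hj').2
  rw [e3] at e1
  rw [abs_le] at e1 e2 ⊢
  constructor <;> linarith [e1.1, e1.2, e2.1, e2.2]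

/-- Estimate of the Riemann sums of the one-dimensional Young integral. -/
theorem young_sum_bound {g ξ : ℝ → ℝ} {κ γ A B c d : ℝ} (hκ : 0 < κ) (hγ : 0 < γ)
    (hκγ : 1 < κ + γ) (hA : 0 ≤ A) (hB : 0 ≤ B)
    (hg : ∀ u v, c ≤ u → u ≤ v → v ≤ d → |g u - g v| ≤ A * (v - u) ^ κ)
    (hξ : ∀ u v, c ≤ u → u ≤ v → v ≤ d → |ξ v - ξ u| ≤ B * (v - u) ^ γ)
    {δ : ℝ} {n : ℕ} {q : ℕ → ℝ} (hq : IsSubdivision c d δ n q) :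
    |∑ j ∈ Finset.range n, g (q j) * (ξ (q (j + 1)) - ξ (q j))| ≤
      (|g c| + sewConst (κ + γ) * A * (d - c) ^ κ) * B * (d - c) ^ γ := by
  have hcd : c ≤ d := by have := hq.mono (Nat.zero_le n) le_rfl; rwa [hq.1, hq.2.1] at this
  have key := sewing_sum_bound (Ξ := fun u v => g u * (ξ v - ξ u)) (M := A * B) (a := c) (b := d)
    hκγ (mul_nonneg hA hB) (fun u _ _ => by simp) (fun u v w hu huv hvw hw => by
      -- The defect of additivity is a product of an increment of g and one of ξ, hence of order κ +
      -- γ > 1.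
      have e : g u * (ξ w - ξ u) - g u * (ξ v - ξ u) - g v * (ξ w - ξ v) =
        (g u - g v) * (ξ w - ξ v) := by ring
      rw [e, abs_mul, Real.rpow_add_of_nonneg (by linarith) hκ.le hγ.le]
      calc |g u - g v| * |ξ w - ξ v| ≤ (A * (v - u) ^ κ) * (B * (w - v) ^ γ) :=
            mul_le_mul (hg u v hu huv (by linarith)) (hξ v w (by linarith) hvw hw) (abs_nonneg _)
              (mul_nonneg hA (Real.rpow_nonneg (by linarith) _))
        _ ≤ (A * (w - u) ^ κ) * (B * (w - u) ^ γ) := by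
            have : 0 ≤ (w - u) ^ κ := Real.rpow_nonneg (by linarith) _
            have : 0 ≤ A * (w - u) ^ κ := by positivity
            gcongr
        _ = _ := by ring) n q (fun i hi => (hq.2.2 i hi).1) hq.1.ge hq.2.1.le
  rw [hq.1, hq.2.1, Real.rpow_add_of_nonneg (by linarith) hκ.le hγ.le] at key
  have h1 : |g c * (ξ d - ξ c)| ≤ |g c| * (B * (d - c) ^ γ) := by
    rw [abs_mul]
    exact mul_le_mul_of_nonneg_left (hξ c d le_rfl hcd le_rfl) (abs_nonneg _)
  have h2 := abs_sub_abs_le_abs_sub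
    (∑ j ∈ Finset.range n, g (q j) * (ξ (q (j + 1)) - ξ (q j))) (g c * (ξ d - ξ c))
  have h3 : (|g c| + sewConst (κ + γ) * A * (d - c) ^ κ) * B * (d - c) ^ γ =
    |g c| * (B * (d - c) ^ γ) + sewConst (κ + γ) * (A * B) * ((d - c) ^ κ * (d - c) ^ γ) := by ring
  rw [h3]
  linarith

/-! ### Young integrals over rectangles -/

/-- Increments of `x` over subrectangles of `[a,b] × [c,d]` are bounded by `K` times the product
of the powers `γ`, `γ'` of the sides. -/
def RectBound (γ γ' K a b c d : ℝ) (x : ℝ → ℝ → ℝ) : Prop :=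
  ∀ s₁ s₂ t₁ t₂ : ℝ, a ≤ s₁ → s₁ ≤ s₂ → s₂ ≤ b → c ≤ t₁ → t₁ ≤ t₂ → t₂ ≤ d →
    |rectIncr x s₁ s₂ t₁ t₂| ≤ K * ((s₂ - s₁) ^ γ * (t₂ - t₁) ^ γ')

/-- Quantitative Hölder regularity of an integrand on the rectangle `[a,b] × [c,d]`. -/
structure HolderRect (κ κ' M₀ M₁ M₂ M₁₂ a b c d : ℝ) (f : ℝ → ℝ → ℝ) : Prop where
  corner : |f a c| ≤ M₀
  fst : ∀ s₁ s₂ t : ℝ, a ≤ s₁ → s₁ ≤ s₂ → s₂ ≤ b → c ≤ t → t ≤ d →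
    |f s₂ t - f s₁ t| ≤ M₁ * (s₂ - s₁) ^ κ
  snd : ∀ s t₁ t₂ : ℝ, a ≤ s → s ≤ b → c ≤ t₁ → t₁ ≤ t₂ → t₂ ≤ d →
    |f s t₂ - f s t₁| ≤ M₂ * (t₂ - t₁) ^ κ'
  rect : RectBound κ κ' M₁₂ a b c d f

/-- The function with the two variables exchanged. -/
def transpose (f : ℝ → ℝ → ℝ) : ℝ → ℝ → ℝ := fun s t => f t s

lemma rectIncr_transpose (x : ℝ → ℝ → ℝ) (s₁ s₂ t₁ t₂ : ℝ) :
    rectIncr (transpose x) t₁ t₂ s₁ s₂ = rectIncr x s₁ s₂ t₁ t₂ := by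
  unfold rectIncr transpose; ring

lemma RectBound.transpose {γ γ' K a b c d : ℝ} {x : ℝ → ℝ → ℝ} (h : RectBound γ γ' K a b c d x) :
    RectBound γ' γ K c d a b (transpose x) := fun t₁ t₂ s₁ s₂ h1 h2 h3 h4 h5 h6 => by
  rw [rectIncr_transpose, mul_comm (_ ^ _)]
  exact h s₁ s₂ t₁ t₂ h4 h5 h6 h1 h2 h3

lemma HolderRect.transpose {κ κ' M₀ M₁ M₂ M₁₂ a b c d : ℝ} {f : ℝ → ℝ → ℝ}
    (h : HolderRect κ κ' M₀ M₁ M₂ M₁₂ a b c d f) :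
    HolderRect κ' κ M₀ M₂ M₁ M₁₂ c d a b (transpose f) where
  corner := h.corner
  fst s₁ s₂ t h1 h2 h3 h4 h5 := h.snd t s₁ s₂ h4 h5 h1 h2 h3
  snd s t₁ t₂ h1 h2 h3 h4 h5 := h.fst t₁ t₂ s h3 h4 h5 h1 h2
  rect := h.rect.transpose

/-- Riemann sums of the Young integral. -/
def youngSum (f x : ℝ → ℝ → ℝ) (m n : ℕ) (p q : ℕ → ℝ) : ℝ :=
  ∑ i ∈ Finset.range m, ∑ j ∈ Finset.range n,
    f (p i) (q j) * rectIncr x (p i) (p (i + 1)) (q j) (q (j + 1))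

lemma youngSum_transpose (f x : ℝ → ℝ → ℝ) (m n : ℕ) (p q : ℕ → ℝ) :
    youngSum (transpose f) (transpose x) n m q p = youngSum f x m n p q := by
  unfold youngSum
  rw [Finset.sum_comm]
  simp only [rectIncr_transpose]
  rfl

/-- The sum in the second direction, as a function of the interval in the first direction. -/
def stripSum (f x : ℝ → ℝ → ℝ) (n : ℕ) (q : ℕ → ℝ) (u v : ℝ) : ℝ :=
  ∑ j ∈ Finset.range n, f u (q j) * rectIncr x u v (q j) (q (j + 1))

section

variable {κ κ' γ γ' K M₀ M₁ M₂ M₁₂ a b c d : ℝ} {f x : ℝ → ℝ → ℝ}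

lemma stripSum_self (f x : ℝ → ℝ → ℝ) (n : ℕ) (q : ℕ → ℝ) (u : ℝ) : stripSum f x n q u u = 0 := by
  simp [stripSum, rectIncr]

/-- With the subdivision of the second variable frozen, the defect in the first variable is itself a
one-dimensional Young sum in the second variable, of an increment of f against an increment of x.
The one-dimensional estimate bounds it, uniformly in that subdivision. -/
lemma stripSum_defect (hκ : 0 < κ) (hκ' : 0 < κ') (hγ : 0 < γ) (hγ' : 0 < γ')
    (h' : 1 < κ' + γ') (hK : 0 ≤ K) (hM₁ : 0 ≤ M₁) (hM₁₂ : 0 ≤ M₁₂)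
    (hf : HolderRect κ κ' M₀ M₁ M₂ M₁₂ a b c d f) (hx : RectBound γ γ' K a b c d x)
    {δ : ℝ} {n : ℕ} {q : ℕ → ℝ} (hq : IsSubdivision c d δ n q)
    (u v w : ℝ) (hu : a ≤ u) (huv : u ≤ v) (hvw : v ≤ w) (hw : w ≤ b) :
    |stripSum f x n q u w - stripSum f x n q u v - stripSum f x n q v w| ≤
      (M₁ + sewConst (κ' + γ') * M₁₂ * (d - c) ^ κ') * K * (d - c) ^ γ' * (w - u) ^ (κ + γ) := by
  have hcd : c ≤ d := by have := hq.mono (Nat.zero_le n) le_rfl; rwa [hq.1, hq.2.1] at this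
  have e : stripSum f x n q u w - stripSum f x n q u v - stripSum f x n q v w =
      ∑ j ∈ Finset.range n, (f u (q j) - f v (q j)) *
        ((x w (q (j + 1)) - x v (q (j + 1))) - (x w (q j) - x v (q j))) := by
    unfold stripSum
    rw [← Finset.sum_sub_distrib, ← Finset.sum_sub_distrib]
    refine Finset.sum_congr rfl fun j _ => ?_
    unfold rectIncr; ring
  have hvu : 0 ≤ (v - u) ^ κ := Real.rpow_nonneg (by linarith) _
  have hwv : 0 ≤ (w - v) ^ γ := Real.rpow_nonneg (by linarith) _
  have hC := sewConst_nonneg h'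
  have hdκ : 0 ≤ (d - c) ^ κ' := Real.rpow_nonneg (by linarith) _
  have hdγ : 0 ≤ (d - c) ^ γ' := Real.rpow_nonneg (by linarith) _
  rw [e]
  refine (young_sum_bound (g := fun t => f u t - f v t) (ξ := fun t => x w t - x v t)
    (A := M₁₂ * (v - u) ^ κ) (B := K * (w - v) ^ γ) hκ' hγ' h' (mul_nonneg hM₁₂ hvu)
    (mul_nonneg hK hwv) (fun t₁ t₂ h1 h2 h3 => ?_) (fun t₁ t₂ h1 h2 h3 => ?_) hq).trans ?_
  · have := hf.rect u v t₁ t₂ hu huv (by linarith) h1 h2 h3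
    calc _ = |rectIncr f u v t₁ t₂| := by unfold rectIncr; congr 1; ring
      _ ≤ _ := this.trans (by rw [mul_assoc])
  · have := hx v w t₁ t₂ (by linarith) hvw hw h1 h2 h3
    calc _ = |rectIncr x v w t₁ t₂| := by unfold rectIncr; congr 1; ring
      _ ≤ _ := this.trans (by rw [mul_assoc])
  · have h1 : |f u c - f v c| ≤ M₁ * (v - u) ^ κ := by
      rw [abs_sub_comm]; exact hf.fst u v c hu huv (by linarith) le_rfl hcd
    calc _ ≤ (M₁ * (v - u) ^ κ + sewConst (κ' + γ') * (M₁₂ * (v - u) ^ κ) * (d - c) ^ κ') *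
          (K * (w - v) ^ γ) * (d - c) ^ γ' := by gcongr
      _ = (M₁ + sewConst (κ' + γ') * M₁₂ * (d - c) ^ κ') * K * (d - c) ^ γ' *
          ((v - u) ^ κ * (w - v) ^ γ) := by ring
      _ ≤ (M₁ + sewConst (κ' + γ') * M₁₂ * (d - c) ^ κ') * K * (d - c) ^ γ' *
          ((w - u) ^ κ * (w - u) ^ γ) := by
        have : 0 ≤ (w - u) ^ κ := Real.rpow_nonneg (by linarith) _
        gcongr
      _ = _ := by rw [Real.rpow_add_of_nonneg (by linarith) hκ.le hγ.le]

/-- The constant in the estimate of Young integrals over rectangles. -/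
def youngConst (κ κ' γ γ' : ℝ) : ℝ := (1 + sewConst (κ + γ)) * (1 + sewConst (κ' + γ'))

lemma youngConst_nonneg (h : 1 < κ + γ) (h' : 1 < κ' + γ') : 0 ≤ youngConst κ κ' γ γ' := by
  have := sewConst_nonneg h
  have := sewConst_nonneg h'
  unfold youngConst; positivity

/-- Sewing in the first variable compares the double sum with the single strip over `[a, b]`, which
is a one-dimensional Young sum in the second variable. -/
theorem youngSum_bound (hκ : 0 < κ) (hκ' : 0 < κ') (hγ : 0 < γ) (hγ' : 0 < γ')
    (h : 1 < κ + γ) (h' : 1 < κ' + γ') (hK : 0 ≤ K) (hM₁ : 0 ≤ M₁) (hM₂ : 0 ≤ M₂) (hM₁₂ : 0 ≤ M₁₂)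
    (hf : HolderRect κ κ' M₀ M₁ M₂ M₁₂ a b c d f) (hx : RectBound γ γ' K a b c d x)
    {δ : ℝ} {m n : ℕ} {p q : ℕ → ℝ} (hp : IsSubdivision a b δ m p) (hq : IsSubdivision c d δ n q) :
    |youngSum f x m n p q| ≤ youngConst κ κ' γ γ' * K * ((b - a) ^ γ * (d - c) ^ γ') *
      (M₀ + M₁ * (b - a) ^ κ + M₂ * (d - c) ^ κ' + M₁₂ * ((b - a) ^ κ * (d - c) ^ κ')) := by
  have hab : a ≤ b := by have := hp.mono (Nat.zero_le m) le_rfl; rwa [hp.1, hp.2.1] at this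
  have hcd : c ≤ d := by have := hq.mono (Nat.zero_le n) le_rfl; rwa [hq.1, hq.2.1] at this
  have hC := sewConst_nonneg h
  have hC' := sewConst_nonneg h'
  have hM₀ : 0 ≤ M₀ := (abs_nonneg _).trans hf.corner
  have n1 : 0 ≤ (d - c) ^ κ' := Real.rpow_nonneg (by linarith) _
  have n2 : 0 ≤ (d - c) ^ γ' := Real.rpow_nonneg (by linarith) _
  have n3 : 0 ≤ (b - a) ^ κ := Real.rpow_nonneg (by linarith) _
  have n4 : 0 ≤ (b - a) ^ γ := Real.rpow_nonneg (by linarith) _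
  have e1 := sewing_sum_bound (Ξ := stripSum f x n q) h
    (M := (M₁ + sewConst (κ' + γ') * M₁₂ * (d - c) ^ κ') * K * (d - c) ^ γ') (a := a) (b := b)
    (by positivity) (fun u _ _ => stripSum_self f x n q u)
    (stripSum_defect hκ hκ' hγ hγ' h' hK hM₁ hM₁₂ hf hx hq) m p (fun i hi => (hp.2.2 i hi).1)
    hp.1.ge hp.2.1.le
  rw [hp.1, hp.2.1] at e1
  have e2 : |stripSum f x n q a b| ≤
      (|f a c| + sewConst (κ' + γ') * M₂ * (d - c) ^ κ') * (K * (b - a) ^ γ) * (d - c) ^ γ' := by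
    have : stripSum f x n q a b = ∑ j ∈ Finset.range n, f a (q j) *
        ((x b (q (j + 1)) - x a (q (j + 1))) - (x b (q j) - x a (q j))) :=
      Finset.sum_congr rfl fun j _ => by unfold rectIncr; ring
    rw [this]
    refine young_sum_bound (g := fun t => f a t) (ξ := fun t => x b t - x a t) hκ' hγ' h' hM₂
      (mul_nonneg hK n4) (fun t₁ t₂ h1 h2 h3 => ?_) (fun t₁ t₂ h1 h2 h3 => ?_) hq
    · rw [abs_sub_comm]; exact hf.snd a t₁ t₂ le_rfl hab h1 h2 h3
    · have := hx a b t₁ t₂ le_rfl hab le_rfl h1 h2 h3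
      calc _ = |rectIncr x a b t₁ t₂| := by unfold rectIncr; congr 1; ring
        _ ≤ _ := this.trans (by rw [mul_assoc])
  have e3 : youngSum f x m n p q = ∑ i ∈ Finset.range m, stripSum f x n q (p i) (p (i + 1)) := rfl
  have e4 := abs_sub_abs_le_abs_sub (∑ i ∈ Finset.range m, stripSum f x n q (p i) (p (i + 1)))
    (stripSum f x n q a b)
  rw [e3]
  have e5 : (|f a c| + sewConst (κ' + γ') * M₂ * (d - c) ^ κ') * (K * (b - a) ^ γ) * (d - c) ^ γ' ≤
    (M₀ + sewConst (κ' + γ') * M₂ * (d - c) ^ κ') * (K * (b - a) ^ γ) * (d - c) ^ γ' := by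
    have := hf.corner
    gcongr
  rw [Real.rpow_add_of_nonneg (by linarith) hκ.le hγ.le] at e1
  have hfinal : sewConst (κ + γ) *
      ((M₁ + sewConst (κ' + γ') * M₁₂ * (d - c) ^ κ') * K * (d - c) ^ γ') *
      ((b - a) ^ κ * (b - a) ^ γ) +
      (M₀ + sewConst (κ' + γ') * M₂ * (d - c) ^ κ') * (K * (b - a) ^ γ) * (d - c) ^ γ' ≤
      youngConst κ κ' γ γ' * K * ((b - a) ^ γ * (d - c) ^ γ') *
      (M₀ + M₁ * (b - a) ^ κ + M₂ * (d - c) ^ κ' + M₁₂ * ((b - a) ^ κ * (d - c) ^ κ')) := by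
    rw [← sub_nonneg]
    unfold youngConst
    set C := sewConst (κ + γ)
    set C' := sewConst (κ' + γ')
    have : (1 + C) * (1 + C') * K * ((b - a) ^ γ * (d - c) ^ γ') *
      (M₀ + M₁ * (b - a) ^ κ + M₂ * (d - c) ^ κ' + M₁₂ * ((b - a) ^ κ * (d - c) ^ κ')) -
      (C * ((M₁ + C' * M₁₂ * (d - c) ^ κ') * K * (d - c) ^ γ') * ((b - a) ^ κ * (b - a) ^ γ) +
      (M₀ + C' * M₂ * (d - c) ^ κ') * (K * (b - a) ^ γ) * (d - c) ^ γ') =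
      K * ((b - a) ^ γ * (d - c) ^ γ') * (M₀ * (C + C' + C * C') +
        M₁ * (b - a) ^ κ * (1 + C' + C * C') + M₂ * (d - c) ^ κ' * (1 + C + C * C') +
        M₁₂ * ((b - a) ^ κ * (d - c) ^ κ') * (1 + C + C')) := by ring
    rw [this]
    positivity
  linarith

/-- Modulus of convergence of the Riemann sums. -/
def meshRate (κ κ' γ γ' δ : ℝ) : ℝ := δ ^ (κ + γ - 1) + δ ^ (κ' + γ' - 1)

lemma youngSum_compare_fst (hκ : 0 < κ) (hκ' : 0 < κ') (hγ : 0 < γ) (hγ' : 0 < γ')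
    (h : 1 < κ + γ) (h' : 1 < κ' + γ') (hK : 0 ≤ K) (hM₁ : 0 ≤ M₁) (hM₁₂ : 0 ≤ M₁₂)
    (hf : HolderRect κ κ' M₀ M₁ M₂ M₁₂ a b c d f) (hx : RectBound γ γ' K a b c d x)
    {δ δ' δ'' : ℝ} {m m' n : ℕ} {p p' q : ℕ → ℝ} (hp : IsSubdivision a b δ m p)
    (hp' : IsSubdivision a b δ' m' p') (hq : IsSubdivision c d δ'' n q) :
    |youngSum f x m n p q - youngSum f x m' n p' q| ≤ sewConst (κ + γ) *
      ((M₁ + sewConst (κ' + γ') * M₁₂ * (d - c) ^ κ') * K * (d - c) ^ γ') * (b - a) *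
      (δ ^ (κ + γ - 1) + δ' ^ (κ + γ - 1)) := by
  have hcd : c ≤ d := by have := hq.mono (Nat.zero_le n) le_rfl; rwa [hq.1, hq.2.1] at this
  have hC' := sewConst_nonneg h'
  have n1 : 0 ≤ (d - c) ^ κ' := Real.rpow_nonneg (by linarith) _
  have n2 : 0 ≤ (d - c) ^ γ' := Real.rpow_nonneg (by linarith) _
  exact sewing_compare (Ξ := stripSum f x n q) h (by positivity)
    (fun u _ _ => stripSum_self f x n q u)
    (stripSum_defect hκ hκ' hγ hγ' h' hK hM₁ hM₁₂ hf hx hq) hp hp'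

/-- The constant of the modulus of convergence of the Riemann sums. -/
def youngErr (κ κ' γ γ' K M₁ M₂ M₁₂ a b c d : ℝ) : ℝ :=
  sewConst (κ + γ) *
      ((M₁ + sewConst (κ' + γ') * M₁₂ * (d - c) ^ κ') * K * (d - c) ^ γ') * (b - a) +
  sewConst (κ' + γ') *
      ((M₂ + sewConst (κ + γ) * M₁₂ * (b - a) ^ κ) * K * (b - a) ^ γ) * (d - c)

/-- One subdivision is changed at a time; changing the second one is the same estimate for the
transposed functions. -/
theorem youngSum_compare (hκ : 0 < κ) (hκ' : 0 < κ') (hγ : 0 < γ) (hγ' : 0 < γ')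
    (h : 1 < κ + γ) (h' : 1 < κ' + γ') (hK : 0 ≤ K) (hM₁ : 0 ≤ M₁) (hM₂ : 0 ≤ M₂) (hM₁₂ : 0 ≤ M₁₂)
    (hf : HolderRect κ κ' M₀ M₁ M₂ M₁₂ a b c d f) (hx : RectBound γ γ' K a b c d x)
    {δ δ' : ℝ} (hδ : 0 < δ) (hδ' : 0 < δ') {m m' n n' : ℕ} {p p' q q' : ℕ → ℝ}
    (hp : IsSubdivision a b δ m p)
    (hp' : IsSubdivision a b δ' m' p') (hq : IsSubdivision c d δ n q)
    (hq' : IsSubdivision c d δ' n' q') :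
    |youngSum f x m n p q - youngSum f x m' n' p' q'| ≤ youngErr κ κ' γ γ' K M₁ M₂ M₁₂ a b c d *
      (meshRate κ κ' γ γ' δ + meshRate κ κ' γ γ' δ') := by
  have hab : a ≤ b := by have := hp.mono (Nat.zero_le m) le_rfl; rwa [hp.1, hp.2.1] at this
  have hcd : c ≤ d := by have := hq.mono (Nat.zero_le n) le_rfl; rwa [hq.1, hq.2.1] at this
  have e1 := youngSum_compare_fst hκ hκ' hγ hγ' h h' hK hM₁ hM₁₂ hf hx hp hp' hq
  have e2 := youngSum_compare_fst hκ' hκ hγ' hγ h' h hK hM₂ hM₁₂ hf.transpose hx.transpose hq hq' hp'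
  rw [youngSum_transpose, youngSum_transpose] at e2
  have hC := sewConst_nonneg h
  have hC' := sewConst_nonneg h'
  have n1 : 0 ≤ (d - c) ^ κ' := Real.rpow_nonneg (by linarith) _
  have n2 : 0 ≤ (d - c) ^ γ' := Real.rpow_nonneg (by linarith) _
  have n3 : 0 ≤ (b - a) ^ κ := Real.rpow_nonneg (by linarith) _
  have n4 : 0 ≤ (b - a) ^ γ := Real.rpow_nonneg (by linarith) _
  have r1 : 0 ≤ δ ^ (κ + γ - 1) := Real.rpow_nonneg hδ.le _
  have r2 : 0 ≤ δ' ^ (κ + γ - 1) := Real.rpow_nonneg hδ'.le _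
  have r3 : 0 ≤ δ ^ (κ' + γ' - 1) := Real.rpow_nonneg hδ.le _
  have r4 : 0 ≤ δ' ^ (κ' + γ' - 1) := Real.rpow_nonneg hδ'.le _
  have hba : 0 ≤ b - a := by linarith
  have hdc : 0 ≤ d - c := by linarith
  unfold youngErr meshRate
  set A := sewConst (κ + γ) *
      ((M₁ + sewConst (κ' + γ') * M₁₂ * (d - c) ^ κ') * K * (d - c) ^ γ') * (b - a)
  set B := sewConst (κ' + γ') *
      ((M₂ + sewConst (κ + γ) * M₁₂ * (b - a) ^ κ) * K * (b - a) ^ γ) * (d - c)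
  have hA : 0 ≤ A := by positivity
  have hB : 0 ≤ B := by positivity
  have e3 := abs_sub_le (youngSum f x m n p q) (youngSum f x m' n p' q) (youngSum f x m' n' p' q')
  have f1 := mul_nonneg hA r3
  have f2 := mul_nonneg hA r4
  have f3 := mul_nonneg hB r1
  have f4 := mul_nonneg hB r2
  have : (A + B) * (δ ^ (κ + γ - 1) + δ ^ (κ' + γ' - 1) +
    (δ' ^ (κ + γ - 1) + δ' ^ (κ' + γ' - 1))) = A * (δ ^ (κ + γ - 1) + δ' ^ (κ + γ - 1)) +
    B * (δ ^ (κ' + γ' - 1) + δ' ^ (κ' + γ' - 1)) + (A * δ ^ (κ' + γ' - 1) + A * δ' ^ (κ' + γ' - 1) +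
    B * δ ^ (κ + γ - 1) + B * δ' ^ (κ + γ - 1)) := by ring
  linarith

/-- The uniform subdivision of `[a, b]` into `n + 1` pieces. -/
def uniformSubdiv (a b : ℝ) (n : ℕ) (i : ℕ) : ℝ := a + i * ((b - a) / (n + 1))

lemma isSubdivision_uniform {a b : ℝ} (hab : a ≤ b) (n : ℕ) {δ : ℝ} (hδ : (b - a) / (n + 1) < δ) :
    IsSubdivision a b δ (n + 1) (uniformSubdiv a b n) := by
  have hn : (0 : ℝ) < n + 1 := by positivity
  have hs : 0 ≤ (b - a) / (n + 1) := div_nonneg (by linarith) hn.le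
  refine ⟨by simp [uniformSubdiv], ?_, fun i _ => ?_⟩
  · unfold uniformSubdiv
    push_cast
    field_simp
    ring
  · have : uniformSubdiv a b n (i + 1) = uniformSubdiv a b n i + (b - a) / (n + 1) := by
      unfold uniformSubdiv; push_cast; ring
    rw [this]
    exact ⟨by linarith, by linarith⟩

lemma tendsto_meshRate (h : 1 < κ + γ) (h' : 1 < κ' + γ') {u : ℕ → ℝ}
    (hu : Tendsto u atTop (𝓝 0)) : Tendsto (fun n => meshRate κ κ' γ γ' (u n)) atTop (𝓝 0) := by
  have e1 := hu.rpow_const (p := κ + γ - 1) (Or.inr (by linarith))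
  have e2 := hu.rpow_const (p := κ' + γ' - 1) (Or.inr (by linarith))
  rw [Real.zero_rpow (by linarith)] at e1 e2
  simpa [meshRate] using e1.add e2

lemma tendsto_const_div_nat (A : ℝ) : Tendsto (fun n : ℕ => A / ((n : ℝ) + 1)) atTop (𝓝 0) :=
  tendsto_const_nhds.div_atTop (tendsto_atTop_add_const_right _ _ tendsto_natCast_atTop_atTop)

lemma exists_subdivision {a b δ : ℝ} (hab : a ≤ b) (hδ : 0 < δ) :
    ∃ (n : ℕ) (p : ℕ → ℝ), IsSubdivision a b δ n p := by
  obtain ⟨n, hn⟩ := (((tendsto_const_div_nat (b - a)).eventually (gt_mem_nhds hδ))).exists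
  exact ⟨n + 1, _, isSubdivision_uniform hab n hn⟩

lemma HasYoungIntegral.unique {z z' : ℝ} (hab : a ≤ b) (hcd : c ≤ d)
    (h : HasYoungIntegral f x a b c d z) (h' : HasYoungIntegral f x a b c d z') : z = z' := by
  by_contra hne
  have hpos : 0 < |z - z'| / 2 := by
    have := abs_pos.2 (sub_ne_zero.2 hne); positivity
  obtain ⟨δ, hδ, H⟩ := h _ hpos
  obtain ⟨δ', hδ', H'⟩ := h' _ hpos
  obtain ⟨m, p, hp⟩ := exists_subdivision hab (lt_min hδ hδ')
  obtain ⟨n, q, hq⟩ := exists_subdivision hcd (lt_min hδ hδ')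
  have e1 := H m n p q ⟨hp.1, hp.2.1, fun i hi => ⟨(hp.2.2 i hi).1, (hp.2.2 i hi).2.trans_le
    (min_le_left _ _)⟩⟩ ⟨hq.1, hq.2.1, fun i hi => ⟨(hq.2.2 i hi).1, (hq.2.2 i hi).2.trans_le
    (min_le_left _ _)⟩⟩
  have e2 := H' m n p q ⟨hp.1, hp.2.1, fun i hi => ⟨(hp.2.2 i hi).1, (hp.2.2 i hi).2.trans_le
    (min_le_right _ _)⟩⟩ ⟨hq.1, hq.2.1, fun i hi => ⟨(hq.2.2 i hi).1, (hq.2.2 i hi).2.trans_le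
    (min_le_right _ _)⟩⟩
  have e3 := abs_sub_le z (∑ i ∈ Finset.range m, ∑ j ∈ Finset.range n,
        f (p i) (q j) * rectIncr x (p i) (p (i + 1)) (q j) (q (j + 1))) z'
  rw [abs_sub_comm z (Finset.sum _ _)] at e3
  linarith

/-- Existence of the Young integral over a rectangle, with the rate of convergence of the Riemann
sums and the Young estimate. -/
theorem exists_youngIntegral (hκ : 0 < κ) (hκ' : 0 < κ') (hγ : 0 < γ) (hγ' : 0 < γ')
    (h : 1 < κ + γ) (h' : 1 < κ' + γ') (hK : 0 ≤ K) (hM₁ : 0 ≤ M₁) (hM₂ : 0 ≤ M₂) (hM₁₂ : 0 ≤ M₁₂)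
    (hab : a ≤ b) (hcd : c ≤ d)
    (hf : HolderRect κ κ' M₀ M₁ M₂ M₁₂ a b c d f) (hx : RectBound γ γ' K a b c d x) :
    ∃ z, HasYoungIntegral f x a b c d z ∧
      |z| ≤ youngConst κ κ' γ γ' * K * ((b - a) ^ γ * (d - c) ^ γ') *
        (M₀ + M₁ * (b - a) ^ κ + M₂ * (d - c) ^ κ' + M₁₂ * ((b - a) ^ κ * (d - c) ^ κ')) ∧
      ∀ δ > 0, ∀ (m n : ℕ) (p q : ℕ → ℝ), IsSubdivision a b δ m p → IsSubdivision c d δ n q →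
        |youngSum f x m n p q - z| ≤
          youngErr κ κ' γ γ' K M₁ M₂ M₁₂ a b c d * meshRate κ κ' γ γ' δ := by
  -- A common mesh A / (n + 1) for both sides; the extra 1 keeps it positive and the mesh inequality
  -- strict even for degenerate rectangles.
  set A := b - a + (d - c) + 1 with hA
  have hA0 : 0 < A := by linarith
  set E := youngErr κ κ' γ γ' K M₁ M₂ M₁₂ a b c d with hE
  let S : ℕ → ℝ := fun n => youngSum f x (n + 1) (n + 1) (uniformSubdiv a b n) (uniformSubdiv c d n)
  have hδ : ∀ n : ℕ, 0 < A / ((n : ℝ) + 1) := fun n => by positivity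
  have hP : ∀ n : ℕ, IsSubdivision a b (A / ((n : ℝ) + 1)) (n + 1) (uniformSubdiv a b n) :=
    fun n => isSubdivision_uniform hab n (by gcongr; linarith)
  have hQ : ∀ n : ℕ, IsSubdivision c d (A / ((n : ℝ) + 1)) (n + 1) (uniformSubdiv c d n) :=
    fun n => isSubdivision_uniform hcd n (by gcongr; linarith)
  have hr := tendsto_meshRate h h' (tendsto_const_div_nat A)
  have cmp : ∀ δ > 0, ∀ (m n : ℕ) (p q : ℕ → ℝ), IsSubdivision a b δ m p →
      IsSubdivision c d δ n q → ∀ k : ℕ, |youngSum f x m n p q - S k| ≤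
        E * (meshRate κ κ' γ γ' δ + meshRate κ κ' γ γ' (A / ((k : ℝ) + 1))) :=
    fun δ hδ' m n p q hp hq k => youngSum_compare hκ hκ' hγ hγ' h h' hK hM₁ hM₂ hM₁₂ hf hx hδ'
      (hδ k) hp (hP k) hq (hQ k)
  have hcau : CauchySeq S := by
    rw [Metric.cauchySeq_iff']
    intro ε hε
    have hlim : Tendsto (fun k : ℕ => (|E| + 1) * meshRate κ κ' γ γ' (A / ((k : ℝ) + 1))) atTop
      (𝓝 0) := by simpa using hr.const_mul (|E| + 1)
    obtain ⟨N, hN⟩ := eventually_atTop.1 (hlim.eventually (gt_mem_nhds (half_pos hε)))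
    refine ⟨N, fun n hn => ?_⟩
    have hmn : ∀ k : ℕ, 0 ≤ meshRate κ κ' γ γ' (A / ((k : ℝ) + 1)) := fun k => by
      unfold meshRate; have := hδ k; positivity
    have e1 := cmp _ (hδ n) _ _ _ _ (hP n) (hQ n) N
    have e2 := hN n hn
    have e3 := hN N le_rfl
    rw [Real.dist_eq]
    have e4 : E * (meshRate κ κ' γ γ' (A / ((n : ℝ) + 1)) + meshRate κ κ' γ γ' (A / ((N : ℝ) + 1)))
      ≤ (|E| + 1) * (meshRate κ κ' γ γ' (A / ((n : ℝ) + 1)) +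
        meshRate κ κ' γ γ' (A / ((N : ℝ) + 1))) :=
      mul_le_mul_of_nonneg_right (by linarith [le_abs_self E]) (add_nonneg (hmn n) (hmn N))
    calc |S n - S N| ≤ _ := e1
      _ ≤ _ := e4
      _ < ε := by rw [mul_add]; linarith
  obtain ⟨z, hz⟩ := cauchySeq_tendsto_of_complete hcau
  have hrate : ∀ δ > 0, ∀ (m n : ℕ) (p q : ℕ → ℝ), IsSubdivision a b δ m p →
      IsSubdivision c d δ n q → |youngSum f x m n p q - z| ≤ E * meshRate κ κ' γ γ' δ := by
    intro δ hδ' m n p q hp hq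
    refine le_of_tendsto_of_tendsto' ((tendsto_const_nhds.sub hz).abs) ?_ (cmp δ hδ' m n p q hp hq)
    simpa using (tendsto_const_nhds.add hr).const_mul E
  refine ⟨z, ?_, ?_, hrate⟩
  · intro ε hε
    have hlim : Tendsto (fun k : ℕ => E * meshRate κ κ' γ γ' (A / ((k : ℝ) + 1))) atTop (𝓝 0) := by
      simpa using hr.const_mul E
    obtain ⟨N, hN⟩ := (hlim.eventually (gt_mem_nhds hε)).exists
    exact ⟨_, hδ N, fun m n p q hp hq => (hrate _ (hδ N) m n p q hp hq).trans_lt hN⟩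
  · exact le_of_tendsto hz.abs (Eventually.of_forall fun n =>
      youngSum_bound hκ hκ' hγ hγ' h h' hK hM₁ hM₂ hM₁₂ hf hx (hP n) (hQ n))

end

end FracWave

end

noncomputable section

namespace FracWave

/-! ### Elementary properties of Young integrals -/

lemma IsSubdivision.eq_of_eq {a δ : ℝ} {n : ℕ} {p : ℕ → ℝ} (hp : IsSubdivision a a δ n p) {i : ℕ}
    (hi : i ≤ n) : p i = a := le_antisymm (hp.mem hi).2 (hp.mem hi).1

lemma hasYoungIntegral_of_eq_fst (f x : ℝ → ℝ → ℝ) (a c d : ℝ) :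
    HasYoungIntegral f x a a c d 0 := by
  intro ε hε
  refine ⟨1, one_pos, fun m n p q hp _ => ?_⟩
  rw [Finset.sum_eq_zero fun i hi => Finset.sum_eq_zero fun j _ => ?_]
  · simpa using hε
  · have hi' := Finset.mem_range.1 hi
    rw [hp.eq_of_eq hi'.le, hp.eq_of_eq (show i + 1 ≤ m from hi')]
    simp [rectIncr]

lemma hasYoungIntegral_of_eq_snd (f x : ℝ → ℝ → ℝ) (a b c : ℝ) :
    HasYoungIntegral f x a b c c 0 := by
  intro ε hε
  refine ⟨1, one_pos, fun m n p q _ hq => ?_⟩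
  rw [Finset.sum_eq_zero fun i _ => Finset.sum_eq_zero fun j hj => ?_]
  · simpa using hε
  · have hj' := Finset.mem_range.1 hj
    rw [hq.eq_of_eq hj'.le, hq.eq_of_eq (show j + 1 ≤ n from hj')]
    simp [rectIncr]

lemma HasYoungIntegral.congr {f x x' : ℝ → ℝ → ℝ} {a b c d z : ℝ}
    (h : HasYoungIntegral f x a b c d z)
    (hx : ∀ s ∈ Icc a b, ∀ t ∈ Icc c d, x s t = x' s t) : HasYoungIntegral f x' a b c d z := by
  intro ε hε
  obtain ⟨δ, hδ, H⟩ := h ε hε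
  refine ⟨δ, hδ, fun m n p q hp hq => ?_⟩
  convert H m n p q hp hq using 5 with i hi j hj
  have hi' := Finset.mem_range.1 hi
  have hj' := Finset.mem_range.1 hj
  have p1 : p i ∈ Icc a b := hp.mem hi'.le
  have p2 : p (i + 1) ∈ Icc a b := hp.mem hi'
  have q1 : q j ∈ Icc c d := hq.mem hj'.le
  have q2 : q (j + 1) ∈ Icc c d := hq.mem hj'
  simp only [rectIncr, hx _ p1 _ q1, hx _ p1 _ q2, hx _ p2 _ q1, hx _ p2 _ q2]

lemma HasYoungIntegral.sub {f f' x : ℝ → ℝ → ℝ} {a b c d z z' : ℝ}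
    (h : HasYoungIntegral f x a b c d z) (h' : HasYoungIntegral f' x a b c d z') :
    HasYoungIntegral (fun s t => f s t - f' s t) x a b c d (z - z') := by
  intro ε hε
  obtain ⟨δ, hδ, H⟩ := h _ (half_pos hε)
  obtain ⟨δ', hδ', H'⟩ := h' _ (half_pos hε)
  refine ⟨min δ δ', lt_min hδ hδ', fun m n p q hp hq => ?_⟩
  have e1 := H m n p q ⟨hp.1, hp.2.1, fun i hi => ⟨(hp.2.2 i hi).1, (hp.2.2 i hi).2.trans_le
    (min_le_left _ _)⟩⟩ ⟨hq.1, hq.2.1, fun i hi => ⟨(hq.2.2 i hi).1, (hq.2.2 i hi).2.trans_le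
    (min_le_left _ _)⟩⟩
  have e2 := H' m n p q ⟨hp.1, hp.2.1, fun i hi => ⟨(hp.2.2 i hi).1, (hp.2.2 i hi).2.trans_le
    (min_le_right _ _)⟩⟩ ⟨hq.1, hq.2.1, fun i hi => ⟨(hq.2.2 i hi).1, (hq.2.2 i hi).2.trans_le
    (min_le_right _ _)⟩⟩
  simp only [sub_mul, Finset.sum_sub_distrib]
  rw [abs_lt] at e1 e2 ⊢
  constructor <;> linarith [e1.1, e1.2, e2.1, e2.2]

/-! ### Tilings of triangles -/

/-- The light cone in rotated coordinates. -/
def triSet (s t : ℝ) : Set (ℝ × ℝ) := {p | 0 < p.1 + p.2 ∧ p.1 ≤ s ∧ p.2 ≤ t}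

/-- A tiling of a plane set by half-open rectangles. -/
structure IsTiling {ι : Type*} (γ γ' : ℝ) (E : Set (ℝ × ℝ)) (a b c d : ι → ℝ) : Prop where
  fst_le : ∀ n, a n ≤ b n
  snd_le : ∀ n, c n ≤ d n
  disjoint : Pairwise fun m n =>
    Disjoint (Ioc (a m) (b m) ×ˢ Ioc (c m) (d m)) (Ioc (a n) (b n) ×ˢ Ioc (c n) (d n))
  iUnion_eq : ⋃ n, Ioc (a n) (b n) ×ˢ Ioc (c n) (d n) = E
  summable : Summable fun n => (b n - a n) ^ γ * (d n - c n) ^ γ'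

/-- The integral of `f` against `x` over a triangle, in rotated coordinates. -/
def HasTriIntegral (γ γ' : ℝ) (f x : ℝ → ℝ → ℝ) (s t z : ℝ) : Prop :=
  (∃ a b c d : ℕ → ℝ, IsTiling γ γ' (triSet s t) a b c d) ∧
    ∀ a b c d : ℕ → ℝ, IsTiling γ γ' (triSet s t) a b c d →
      ∃ I : ℕ → ℝ, (∀ n, HasYoungIntegral f x (a n) (b n) (c n) (d n) (I n)) ∧ HasSum I z

/-- From `(time, position)` to rotated coordinates. -/
def toRot (p : ℝ × ℝ) : ℝ × ℝ := ((p.1 - p.2) / √2, (p.1 + p.2) / √2)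

lemma sqrt_two_mul_self : √2 * √2 = (2 : ℝ) := Real.mul_self_sqrt (by norm_num)

lemma toRot_rot (s t : ℝ) : toRot ((t + s) / √2, (t - s) / √2) = (s, t) := by
  have h : √2 ≠ 0 := by positivity
  have h2 : √2 ^ 2 = (2 : ℝ) := Real.sq_sqrt (by norm_num)
  ext <;> simp only [toRot] <;> field_simp <;> rw [h2] <;> ring

lemma toRot_surjective : Function.Surjective toRot := fun p => ⟨_, toRot_rot p.1 p.2⟩

/-- In rotated coordinates the two characteristic sides of the cone are parallel to the axes and the
base at time zero is the antidiagonal. From here on cones are replaced by `triSet`. -/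
lemma lightCone_eq_preimage (u v : ℝ) :
    lightCone u v = toRot ⁻¹' triSet ((u - v) / √2) ((u + v) / √2) := by
  have h : 0 < √2 := by positivity
  ext p
  simp only [lightCone, triSet, toRot, mem_ofPred_eq, mem_preimage, abs_le,
    div_le_div_iff_of_pos_right h, ← add_div]
  rw [div_pos_iff_of_pos_right h]
  constructor
  · rintro ⟨h1, h2, h3⟩; exact ⟨by linarith, by linarith, by linarith⟩
  · rintro ⟨h1, h2, h3⟩; exact ⟨by linarith, by linarith, by linarith⟩

lemma isConeTiling_iff {γ γ' u v : ℝ} {a b c d : ℕ → ℝ} :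
    IsConeTiling γ γ' u v a b c d ↔ IsTiling γ γ' (triSet ((u - v) / √2) ((u + v) / √2)) a b c d := by
  constructor
  · rintro ⟨h1, h2, h3, h4, h5⟩
    refine ⟨h1, h2, fun m n hmn => ?_, ?_, h5⟩
    · exact Disjoint.of_preimage toRot_surjective (h3 hmn)
    · apply toRot_surjective.preimage_injective
      rw [preimage_iUnion, ← lightCone_eq_preimage, ← h4]
      rfl
  · rintro ⟨h1, h2, h3, h4, h5⟩
    refine ⟨h1, h2, fun m n hmn => ?_, ?_, h5⟩
    · exact (h3 hmn).preimage toRot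
    · rw [lightCone_eq_preimage, ← h4, preimage_iUnion]
      rfl

lemma hasConeIntegral_iff {γ γ' u v z : ℝ} {F x : ℝ → ℝ → ℝ} :
    HasConeIntegral γ γ' F x u v z ↔
      HasTriIntegral γ γ' (rotate F) x ((u - v) / √2) ((u + v) / √2) z := by
  unfold HasConeIntegral HasTriIntegral
  simp only [isConeTiling_iff]

lemma IsTiling.reindex {ι ι' : Type*} {γ γ' : ℝ} {E : Set (ℝ × ℝ)} {a b c d : ι → ℝ}
    (h : IsTiling γ γ' E a b c d) (e : ι' ≃ ι) :
    IsTiling γ γ' E (a ∘ e) (b ∘ e) (c ∘ e) (d ∘ e) where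
  fst_le n := h.fst_le _
  snd_le n := h.snd_le _
  disjoint m n hmn := h.disjoint (e.injective.ne hmn)
  iUnion_eq := by
    rw [← h.iUnion_eq]
    exact e.surjective.iUnion_comp (fun n => Ioc (a n) (b n) ×ˢ Ioc (c n) (d n))
  summable := (e.summable_iff (f := fun n => (b n - a n) ^ γ * (d n - c n) ^ γ')).2 h.summable

/-- Since `HasSum` is unconditional, the index set may be any countably infinite type: ℕ × ℕ for the
dyadic tiling, sum types for glued tilings. -/
lemma HasTriIntegral.exists_hasSum {ι : Type*} [Countable ι] [Infinite ι] {γ γ' s t z : ℝ}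
    {f x : ℝ → ℝ → ℝ} (h : HasTriIntegral γ γ' f x s t z) {a b c d : ι → ℝ}
    (ht : IsTiling γ γ' (triSet s t) a b c d) :
    ∃ I : ι → ℝ, (∀ n, HasYoungIntegral f x (a n) (b n) (c n) (d n) (I n)) ∧ HasSum I z := by
  obtain ⟨e⟩ : Nonempty (ℕ ≃ ι) := nonempty_equiv_of_countable
  obtain ⟨I, hI, hz⟩ := h.2 _ _ _ _ (ht.reindex e)
  refine ⟨I ∘ e.symm, fun n => ?_, ?_⟩
  · have := hI (e.symm n)
    simpa using this
  · rwa [← e.hasSum_iff, Function.comp_assoc, Equiv.symm_comp_self, Function.comp_id]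

/-- The nonempty tiles lie in the triangle. -/
lemma IsTiling.mem {ι : Type*} {γ γ' s t : ℝ} {a b c d : ι → ℝ}
    (h : IsTiling γ γ' (triSet s t) a b c d) {n : ι} (h1 : a n < b n) (h2 : c n < d n) :
    0 ≤ a n + c n ∧ b n ≤ s ∧ d n ≤ t := by
  have hsub : Ioc (a n) (b n) ×ˢ Ioc (c n) (d n) ⊆ triSet s t := by
    rw [← h.iUnion_eq]; exact subset_iUnion (fun n => Ioc (a n) (b n) ×ˢ Ioc (c n) (d n)) n
  refine ⟨?_, (hsub (show (b n, d n) ∈ _ from ⟨⟨h1, le_rfl⟩, ⟨h2, le_rfl⟩⟩)).2⟩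
  by_contra hneg
  push Not at hneg
  -- A tile whose lower left corner lies below the antidiagonal would contain the point `(a n + ε, c
  -- n + ε)`, whose coordinates have sum at most 0.
  set ε := min (min (b n - a n) (d n - c n)) (-(a n + c n) / 2) with hε
  have e0 : 0 < ε := lt_min (lt_min (by linarith) (by linarith)) (by linarith)
  have e1 : ε ≤ b n - a n := (min_le_left _ _).trans (min_le_left _ _)
  have e2 : ε ≤ d n - c n := (min_le_left _ _).trans (min_le_right _ _)
  have e3 : ε ≤ -(a n + c n) / 2 := min_le_right _ _
  have := (hsub (show (a n + ε, c n + ε) ∈ _ from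
    ⟨⟨by simp [e0], by simp; linarith⟩, ⟨by simp [e0], by simp; linarith⟩⟩)).1
  simp only at this
  linarith

lemma IsTiling.sumElim {ι ι' : Type*} {γ γ' : ℝ} {E E' : Set (ℝ × ℝ)} {a b c d : ι → ℝ}
    {a' b' c' d' : ι' → ℝ} (h : IsTiling γ γ' E a b c d) (h' : IsTiling γ γ' E' a' b' c' d')
    (hE : Disjoint E E') :
    IsTiling γ γ' (E ∪ E') (Sum.elim a a') (Sum.elim b b') (Sum.elim c c') (Sum.elim d d') where
  fst_le := by rintro (n | n); exacts [h.fst_le n, h'.fst_le n]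
  snd_le := by rintro (n | n); exacts [h.snd_le n, h'.snd_le n]
  disjoint := by
    have hs : ∀ n, Ioc (a n) (b n) ×ˢ Ioc (c n) (d n) ⊆ E := fun n => by
      rw [← h.iUnion_eq]; exact subset_iUnion (fun n => Ioc (a n) (b n) ×ˢ Ioc (c n) (d n)) n
    have hs' : ∀ n, Ioc (a' n) (b' n) ×ˢ Ioc (c' n) (d' n) ⊆ E' := fun n => by
      rw [← h'.iUnion_eq]; exact subset_iUnion (fun n => Ioc (a' n) (b' n) ×ˢ Ioc (c' n) (d' n)) n
    rintro (m | m) (n | n) hmn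
    · exact h.disjoint fun e => hmn (by rw [e])
    · exact hE.mono (hs m) (hs' n)
    · exact hE.symm.mono (hs' m) (hs n)
    · exact h'.disjoint fun e => hmn (by rw [e])
  iUnion_eq := by
    rw [iUnion_sum, ← h.iUnion_eq, ← h'.iUnion_eq]
    rfl
  summable := by
    have := h.summable.hasSum.sum (f := fun n : ι ⊕ ι' =>
      (Sum.elim b b' n - Sum.elim a a' n) ^ γ * (Sum.elim d d' n - Sum.elim c c' n) ^ γ')
      h'.summable.hasSum
    exact this.summable

lemma isTiling_rect {γ γ' a b c d : ℝ} (hab : a ≤ b) (hcd : c ≤ d) :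
    IsTiling γ γ' (Ioc a b ×ˢ Ioc c d) (fun _ : Unit => a) (fun _ => b) (fun _ => c)
      (fun _ => d) where
  fst_le _ := hab
  snd_le _ := hcd
  disjoint m n hmn := absurd (Subsingleton.elim m n) hmn
  iUnion_eq := iUnion_const _
  summable := summable_of_hasFiniteSupport (Set.toFinite _)

/-! ### The dyadic tiling -/

/-- Side of the squares of the level `k` of the dyadic tiling. -/
def dyadicSide (s t : ℝ) (k : ℕ) : ℝ := (s + t) / 2 ^ (k + 1)

/-- Left end of the tiles of the dyadic tiling. -/
def dyadicLeft (s t : ℝ) (i : ℕ × ℕ) : ℝ :=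
  if i.2 < 2 ^ i.1 then -t + (2 * i.2 + 1) * dyadicSide s t i.1 else 0

/-- Right end of the tiles of the dyadic tiling. -/
def dyadicRight (s t : ℝ) (i : ℕ × ℕ) : ℝ :=
  if i.2 < 2 ^ i.1 then -t + (2 * i.2 + 2) * dyadicSide s t i.1 else 0

/-- Lower end of the tiles of the dyadic tiling. -/
def dyadicLower (s t : ℝ) (i : ℕ × ℕ) : ℝ :=
  if i.2 < 2 ^ i.1 then t - (2 * i.2 + 1) * dyadicSide s t i.1 else 0

/-- Upper end of the tiles of the dyadic tiling. -/
def dyadicUpper (s t : ℝ) (i : ℕ × ℕ) : ℝ :=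
  if i.2 < 2 ^ i.1 then t - 2 * i.2 * dyadicSide s t i.1 else 0

/-- Level k has 2^k squares; the indices with `i.2 ≥ 2 ^ i.1` are padding, with all four ends equal
to 0, so that the family can be indexed by ℕ × ℕ. -/
lemma dyadic_fst_sub (s t : ℝ) (i : ℕ × ℕ) : dyadicRight s t i - dyadicLeft s t i =
    if i.2 < 2 ^ i.1 then dyadicSide s t i.1 else 0 := by
  unfold dyadicRight dyadicLeft; split_ifs <;> ring

lemma dyadic_snd_sub (s t : ℝ) (i : ℕ × ℕ) : dyadicUpper s t i - dyadicLower s t i =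
    if i.2 < 2 ^ i.1 then dyadicSide s t i.1 else 0 := by
  unfold dyadicUpper dyadicLower; split_ifs <;> ring

/-- The dyadic weights, whose sum is finite for `θ > 1`. -/
def dyadicWeight (θ : ℝ) (i : ℕ × ℕ) : ℝ := if i.2 < 2 ^ i.1 then ((1 / 2 : ℝ) ^ (i.1 + 1)) ^ θ else 0

lemma dyadicWeight_nonneg (θ : ℝ) (i : ℕ × ℕ) : 0 ≤ dyadicWeight θ i := by
  unfold dyadicWeight; split_ifs <;> positivity

/-- Level k contributes 2^k tiles of weight 2^(-(k+1)θ), so the level sums are geometric with ratio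
2^(1-θ) < 1. -/
lemma summable_dyadicWeight {θ : ℝ} (hθ : 1 < θ) : Summable (dyadicWeight θ) := by
  have hfib : ∀ k : ℕ, HasSum (fun j => dyadicWeight θ (k, j))
      (2 ^ k * ((1 / 2 : ℝ) ^ (k + 1)) ^ θ) := by
    intro k
    have : HasSum (fun j => dyadicWeight θ (k, j))
        (∑ j ∈ Finset.range (2 ^ k), dyadicWeight θ (k, j)) := by
      refine hasSum_sum_of_ne_finset_zero fun j hj => ?_
      simp only [Finset.mem_range] at hj
      simp [dyadicWeight, hj]
    convert this using 1
    rw [Finset.sum_congr rfl (g := fun _ => ((1 / 2 : ℝ) ^ (k + 1)) ^ θ)]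
    · simp
    · intro j hj; simp [dyadicWeight, Finset.mem_range.1 hj]
  rw [summable_prod_of_nonneg (dyadicWeight_nonneg θ)]
  refine ⟨fun k => (hfib k).summable, ?_⟩
  simp only [fun k => (hfib k).tsum_eq]
  have hr : 2 * (1 / 2 : ℝ) ^ θ < 1 := by
    have : (1 / 2 : ℝ) ^ θ < (1 / 2 : ℝ) ^ (1 : ℝ) :=
      Real.rpow_lt_rpow_of_exponent_gt (by norm_num) (by norm_num) hθ
    rw [Real.rpow_one] at this
    linarith
  have hg := (summable_geometric_of_lt_one (by positivity) hr).mul_left ((1 / 2 : ℝ) ^ θ)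
  refine hg.congr fun k => ?_
  rw [mul_pow, pow_succ, Real.mul_rpow (by positivity) (by positivity), ← Real.rpow_natCast,
    ← Real.rpow_natCast ((1 / 2 : ℝ) ^ θ), ← Real.rpow_mul (by norm_num), ← Real.rpow_natCast,
    ← Real.rpow_mul (by norm_num)]
  rw [mul_comm θ]; ring

/-- The sum of the dyadic weights. -/
def dyadicConst (θ : ℝ) : ℝ := ∑' i, dyadicWeight θ i

lemma dyadicConst_nonneg (θ : ℝ) : 0 ≤ dyadicConst θ := tsum_nonneg (dyadicWeight_nonneg θ)

lemma dyadic_size {γ γ' s t : ℝ} (hst : 0 ≤ s + t) (hγ : 0 < γ) (hγ' : 0 < γ') (i : ℕ × ℕ) :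
    (dyadicRight s t i - dyadicLeft s t i) ^ γ * (dyadicUpper s t i - dyadicLower s t i) ^ γ' =
      (s + t) ^ (γ + γ') * dyadicWeight (γ + γ') i := by
  rw [dyadic_fst_sub, dyadic_snd_sub, dyadicWeight, dyadicSide]
  split_ifs
  · rw [← Real.rpow_add_of_nonneg (by positivity) hγ.le hγ'.le, div_eq_mul_inv,
      Real.mul_rpow hst (by positivity)]
    simp
  · rw [Real.zero_rpow hγ.ne']; simp

/-- With U = (p.1 + t)/(s + t) and V = (t - p.2)/(s + t), membership of p in the triangle reads 0 ≤
V < U ≤ 1. The tile of p is read off from the dyadic number of least level strictly between V and U: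
its numerator is odd, and the two neighbouring numbers of that level belong to a lower level, hence
do not lie strictly between. -/
lemma exists_dyadic_between {U V : ℝ} (hV : 0 ≤ V) (hVU : V < U) (hU : U ≤ 1) :
    ∃ k j : ℕ, j < 2 ^ k ∧ (2 * j : ℝ) / 2 ^ (k + 1) ≤ V ∧ V < (2 * j + 1) / 2 ^ (k + 1) ∧
      (2 * j + 1) / 2 ^ (k + 1) < U ∧ U ≤ (2 * j + 2) / 2 ^ (k + 1) := by
  have hex : ∃ n : ℕ, ∃ m : ℕ, V < m / 2 ^ n ∧ (m : ℝ) / 2 ^ n < U := by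
    obtain ⟨n, hn⟩ := exists_pow_lt_of_lt_one (sub_pos.2 hVU) (show (1 / 2 : ℝ) < 1 by norm_num)
    have h2 : (0 : ℝ) < 2 ^ n := by positivity
    refine ⟨n, ⌊V * 2 ^ n⌋₊ + 1, ?_, ?_⟩
    · rw [lt_div_iff₀ h2]; push_cast; exact Nat.lt_floor_add_one _
    · have := Nat.floor_le (show 0 ≤ V * 2 ^ n by positivity)
      rw [one_div, inv_pow, inv_lt_iff_one_lt_mul₀ h2] at hn
      rw [div_lt_iff₀ h2]; push_cast; nlinarith
  classical
  obtain ⟨n, ⟨m, hm1, hm2⟩, hmin⟩ : ∃ n : ℕ, (∃ m : ℕ, V < m / 2 ^ n ∧ (m : ℝ) / 2 ^ n < U) ∧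
      ∀ l < n, ¬ ∃ m : ℕ, V < m / 2 ^ l ∧ (m : ℝ) / 2 ^ l < U :=
    ⟨Nat.find hex, Nat.find_spec hex, fun l hl => Nat.find_min hex hl⟩
  obtain _ | k := n
  · exfalso
    simp only [pow_zero, div_one] at hm1 hm2
    have h1 : (0 : ℝ) < m := hV.trans_lt hm1
    have h2 : (m : ℝ) < 1 := hm2.trans_le hU
    norm_cast at h1 h2
    omega
  have hno := hmin k (Nat.lt_succ_self k)
  push Not at hno
  have half : ∀ r : ℝ, 2 * r / 2 ^ (k + 1) = r / 2 ^ k := fun r => by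
    rw [pow_succ, mul_comm (2 ^ k)]; exact mul_div_mul_left _ _ two_ne_zero
  rcases Nat.even_or_odd' m with ⟨j, rfl | rfl⟩
  · exfalso
    push_cast at hm1 hm2
    rw [half] at hm1 hm2
    exact absurd hm2 (not_lt.2 (hno j hm1))
  · push_cast at hm1 hm2
    refine ⟨k, j, ?_, ?_, hm1, hm2, ?_⟩
    · have h2 : (0 : ℝ) < 2 ^ (k + 1) := by positivity
      have := hm2.trans_le hU
      rw [div_lt_one h2] at this
      have h3 : 2 * j + 1 < 2 ^ (k + 1) := by exact_mod_cast this
      rw [pow_succ] at h3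
      omega
    · by_contra hc
      push Not at hc
      rw [half] at hc
      have := hno j hc
      refine absurd hm2 (not_lt.2 (this.trans ?_))
      rw [← half]; gcongr; linarith
    · by_contra hc
      push Not at hc
      have e : (2 * (j : ℝ) + 2) / 2 ^ (k + 1) = ((j + 1 : ℕ) : ℝ) / 2 ^ k := by
        rw [← half]; push_cast; ring
      rw [e] at hc
      refine absurd hc (not_lt.2 (hno (j + 1) (hm1.trans_le ?_)))
      rw [← e]; gcongr; linarith

/-- On the finer level the other midpoint has numerator (2j'+1) 2^l, strictly between 2j and 2j + 2.
It therefore equals 2j + 1, and parity forces l = 0. -/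
lemma dyadic_unique {k k' j j' : ℕ} {U V : ℝ}
    (h1 : (2 * j : ℝ) / 2 ^ (k + 1) ≤ V) (h2 : V < (2 * j + 1) / 2 ^ (k + 1))
    (h3 : (2 * j + 1) / 2 ^ (k + 1) < U) (h4 : U ≤ (2 * j + 2) / 2 ^ (k + 1))
    (h2' : V < (2 * j' + 1) / 2 ^ (k' + 1))
    (h3' : (2 * j' + 1) / 2 ^ (k' + 1) < U) (hk : k' ≤ k) :
    k = k' ∧ j = j' := by
  obtain ⟨l, rfl⟩ := Nat.exists_eq_add_of_le hk
  have e : (2 * (j' : ℝ) + 1) / 2 ^ (k' + 1) = (2 * j' + 1) * 2 ^ l / 2 ^ (k' + l + 1) := by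
    rw [show k' + l + 1 = (k' + 1) + l by ring, pow_add _ (k' + 1)]
    field_simp
  have hp : (0 : ℝ) < 2 ^ (k' + l + 1) := by positivity
  have a1 := h1.trans_lt h2'
  have a2 := h3'.trans_le h4
  rw [e, div_lt_div_iff_of_pos_right hp] at a1 a2
  have b1 : 2 * j < (2 * j' + 1) * 2 ^ l := by exact_mod_cast a1
  have b2 : (2 * j' + 1) * 2 ^ l < 2 * j + 2 := by exact_mod_cast a2
  have b3 : (2 * j' + 1) * 2 ^ l = 2 * j + 1 := by omega
  rcases Nat.eq_zero_or_pos l with rfl | hl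
  · simp at b3; exact ⟨rfl, by omega⟩
  · exfalso
    obtain ⟨l, rfl⟩ := Nat.exists_eq_add_of_lt hl
    rw [zero_add, pow_succ, show (2 * j' + 1) * (2 ^ l * 2) = 2 * ((2 * j' + 1) * 2 ^ l) by ring] at b3
    omega

lemma mem_dyadic_iff {s t : ℝ} (hst : 0 < s + t) (i : ℕ × ℕ) (p : ℝ × ℝ) :
    p ∈ Ioc (dyadicLeft s t i) (dyadicRight s t i) ×ˢ Ioc (dyadicLower s t i) (dyadicUpper s t i) ↔
      i.2 < 2 ^ i.1 ∧ (2 * i.2 : ℝ) / 2 ^ (i.1 + 1) ≤ (t - p.2) / (s + t) ∧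
        (t - p.2) / (s + t) < (2 * i.2 + 1) / 2 ^ (i.1 + 1) ∧
        (2 * i.2 + 1) / 2 ^ (i.1 + 1) < (p.1 + t) / (s + t) ∧
        (p.1 + t) / (s + t) ≤ (2 * i.2 + 2) / 2 ^ (i.1 + 1) := by
  unfold dyadicLeft dyadicRight dyadicLower dyadicUpper dyadicSide
  by_cases h : i.2 < 2 ^ i.1
  · have hp : (0 : ℝ) < 2 ^ (i.1 + 1) := by positivity
    simp only [mem_prod, mem_Ioc, h, true_and, if_true]
    rw [le_div_iff₀ hst, div_lt_iff₀ hst, lt_div_iff₀ hst, div_le_iff₀ hst]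
    have e : ∀ r : ℝ, r / 2 ^ (i.1 + 1) * (s + t) = r * ((s + t) / 2 ^ (i.1 + 1)) := fun r => by ring
    simp only [e]
    constructor
    · rintro ⟨⟨h1, h2⟩, h3, h4⟩; refine ⟨?_, ?_, ?_, ?_⟩ <;> linarith
    · rintro ⟨h1, h2, h3, h4⟩; refine ⟨⟨?_, ?_⟩, ?_, ?_⟩ <;> linarith
  · simp [h]

/-- The dyadic squares tile the triangle. -/
theorem dyadic_tiling {γ γ' s t : ℝ} (hst : 0 ≤ s + t) (hγ : 0 < γ) (hγ' : 0 < γ')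
    (h : 1 < γ + γ') :
    IsTiling γ γ' (triSet s t) (dyadicLeft s t) (dyadicRight s t) (dyadicLower s t) (dyadicUpper s t) where
  fst_le i := by
    rw [← sub_nonneg, dyadic_fst_sub]; unfold dyadicSide; split_ifs <;> positivity
  snd_le i := by
    rw [← sub_nonneg, dyadic_snd_sub]; unfold dyadicSide; split_ifs <;> positivity
  disjoint := by
    rcases hst.eq_or_lt with h0 | hst
    · intro i i' _
      have : Ioc (dyadicLeft s t i) (dyadicRight s t i) = ∅ := by
        apply Ioc_eq_empty
        have := dyadic_fst_sub s t i
        simp only [dyadicSide, ← h0, zero_div, ite_self] at this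
        linarith
      simp [this]
    · intro i i' hne
      rw [Set.disjoint_left]
      intro p hp hp'
      rw [mem_dyadic_iff hst] at hp hp'
      obtain ⟨_, a1, a2, a3, a4⟩ := hp
      obtain ⟨_, b1, b2, b3, b4⟩ := hp'
      apply hne
      rcases le_total i'.1 i.1 with hk | hk
      · exact Prod.ext_iff.2 (dyadic_unique a1 a2 a3 a4 b2 b3 hk)
      · exact (Prod.ext_iff.2 (dyadic_unique b1 b2 b3 b4 a2 a3 hk)).symm
  iUnion_eq := by
    rcases hst.eq_or_lt with h0 | hst
    · have e1 : triSet s t = ∅ := by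
        ext p
        simp only [triSet, mem_ofPred_eq, mem_empty_iff_false, iff_false]
        rintro ⟨h1, h2, h3⟩; linarith
      rw [e1, iUnion_eq_empty]
      intro i
      have : Ioc (dyadicLeft s t i) (dyadicRight s t i) = ∅ := by
        apply Ioc_eq_empty
        have := dyadic_fst_sub s t i
        simp only [dyadicSide, ← h0, zero_div, ite_self] at this
        linarith
      simp [this]
    · ext p
      simp only [mem_iUnion, mem_dyadic_iff hst, triSet, mem_ofPred_eq]
      constructor
      · rintro ⟨i, hi, h1, h2, h3, h4⟩
        have hp : (0 : ℝ) < 2 ^ (i.1 + 1) := by positivity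
        have hi' : (2 * (i.2 : ℝ) + 2) ≤ 2 ^ (i.1 + 1) := by
          rw [pow_succ]
          have : ((i.2 + 1 : ℕ) : ℝ) ≤ ((2 ^ i.1 : ℕ) : ℝ) := by exact_mod_cast hi
          push_cast at this
          linarith
        have a1 := h2.trans h3
        rw [div_lt_div_iff_of_pos_right hst] at a1
        have a2 := h4.trans ((div_le_one hp).2 hi')
        rw [div_le_one hst] at a2
        have a3 : 0 ≤ (t - p.2) / (s + t) := le_trans (by positivity) h1
        rw [le_div_iff₀ hst] at a3
        exact ⟨by linarith, by linarith, by linarith⟩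
      · rintro ⟨h1, h2, h3⟩
        obtain ⟨k, j, hkj⟩ := exists_dyadic_between (U := (p.1 + t) / (s + t))
          (V := (t - p.2) / (s + t)) (div_nonneg (by linarith) hst.le)
          ((div_lt_div_iff_of_pos_right hst).2 (by linarith)) ((div_le_one hst).2 (by linarith))
        exact ⟨(k, j), hkj⟩
  summable := by
    simp only [dyadic_size hst hγ hγ']
    exact (summable_dyadicWeight h).mul_left _

lemma exists_tiling_triSet {γ γ' s t : ℝ} (hst : 0 ≤ s + t) (hγ : 0 < γ) (hγ' : 0 < γ')
    (h : 1 < γ + γ') : ∃ a b c d : ℕ → ℝ, IsTiling γ γ' (triSet s t) a b c d :=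
  ⟨_, _, _, _, (dyadic_tiling hst hγ hγ' h).reindex (Denumerable.eqv (ℕ × ℕ)).symm⟩

end FracWave

end

noncomputable section

namespace FracWave

/-! ### Potentials -/

/-- `y` is the indefinite integral `∫∫ f dx` over triangles with vertices `s ≤ S₀`, `t ≤ T₀`,
expressed through its increments over rectangles and the dyadic tilings of the triangles. -/
structure IsPotential (f x : ℝ → ℝ → ℝ) (S₀ T₀ : ℝ) (y : ℝ → ℝ → ℝ) : Prop where
  rect : ∀ s₁ s₂ t₁ t₂, 0 ≤ s₁ + t₁ → s₁ ≤ s₂ → t₁ ≤ t₂ → s₂ ≤ S₀ → t₂ ≤ T₀ →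
    HasYoungIntegral f x s₁ s₂ t₁ t₂ (rectIncr y s₁ s₂ t₁ t₂)
  tri : ∀ s t, 0 ≤ s + t → s ≤ S₀ → t ≤ T₀ → ∃ I : ℕ × ℕ → ℝ,
    (∀ i, HasYoungIntegral f x (dyadicLeft s t i) (dyadicRight s t i) (dyadicLower s t i)
      (dyadicUpper s t i) (I i)) ∧ HasSum I (y s t)

/-- Cutting along the line s = s₁ leaves a triangle on the left, a small triangle at the bottom
right with vertex (s₂, -s₁), and a column. Cutting the column at t₁ isolates the rectangle whose
integral has to be a rectangular increment. -/
lemma triSet_split {s₁ s₂ t₁ t₂ : ℝ} (h1 : 0 ≤ s₁ + t₁) (hs : s₁ ≤ s₂) (ht : t₁ ≤ t₂) :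
    triSet s₁ t₂ ∪ (triSet s₂ (-s₁) ∪ (Ioc s₁ s₂ ×ˢ Ioc (-s₁) t₁ ∪ Ioc s₁ s₂ ×ˢ Ioc t₁ t₂)) =
      triSet s₂ t₂ := by
  ext ⟨u, v⟩
  simp only [triSet, mem_union, mem_ofPred_eq, mem_prod, mem_Ioc]
  constructor
  · rintro (⟨a1, a2, a3⟩ | ⟨a1, a2, a3⟩ | ⟨⟨a1, a2⟩, a3, a4⟩ | ⟨⟨a1, a2⟩, a3, a4⟩) <;>
      refine ⟨?_, ?_, ?_⟩ <;> linarith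
  · rintro ⟨a1, a2, a3⟩
    rcases le_or_gt u s₁ with b1 | b1
    · exact Or.inl ⟨a1, b1, a3⟩
    rcases le_or_gt v (-s₁) with b2 | b2
    · exact Or.inr (Or.inl ⟨a1, a2, b2⟩)
    rcases le_or_gt v t₁ with b3 | b3
    · exact Or.inr (Or.inr (Or.inl ⟨⟨b1, a2⟩, b2, b3⟩))
    · exact Or.inr (Or.inr (Or.inr ⟨⟨b1, a2⟩, b3, a3⟩))

/-- Dyadic tilings of the two small triangles, together with the two rectangles, form an admissible
tiling of the large triangle; independence of the tiling turns this into additivity. -/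
lemma HasTriIntegral.split {γ γ' : ℝ} (hγ : 0 < γ) (hγ' : 0 < γ') (h : 1 < γ + γ')
    {f x y : ℝ → ℝ → ℝ} {s₁ s₂ t₁ t₂ : ℝ} (h1 : 0 ≤ s₁ + t₁) (hs : s₁ ≤ s₂) (ht : t₁ ≤ t₂)
    (hA : HasTriIntegral γ γ' f x s₁ t₂ (y s₁ t₂))
    (hB : HasTriIntegral γ γ' f x s₂ (-s₁) (y s₂ (-s₁)))
    (hC : HasTriIntegral γ γ' f x s₂ t₂ (y s₂ t₂)) :
    ∃ z₀ z₁, HasYoungIntegral f x s₁ s₂ (-s₁) t₁ z₀ ∧ HasYoungIntegral f x s₁ s₂ t₁ t₂ z₁ ∧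
      y s₂ t₂ = y s₁ t₂ + (y s₂ (-s₁) + (z₀ + z₁)) := by
  have tA := dyadic_tiling (s := s₁) (t := t₂) (by linarith) hγ hγ' h
  have tB := dyadic_tiling (s := s₂) (t := -s₁) (by linarith) hγ hγ' h
  have tR : IsTiling γ γ' (Ioc s₁ s₂ ×ˢ Ioc (-s₁) t₁) _ _ _ _ :=
    isTiling_rect hs (by linarith)
  have tR' : IsTiling γ γ' (Ioc s₁ s₂ ×ˢ Ioc t₁ t₂) _ _ _ _ :=
    isTiling_rect hs ht
  have d1 : Disjoint (Ioc s₁ s₂ ×ˢ Ioc (-s₁) t₁) (Ioc s₁ s₂ ×ˢ Ioc t₁ t₂) := by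
    rw [Set.disjoint_left]
    rintro ⟨u, v⟩ ⟨_, a⟩ ⟨_, b⟩
    exact absurd a.2 (not_le.2 b.1)
  have d2 : Disjoint (triSet s₂ (-s₁)) (Ioc s₁ s₂ ×ˢ Ioc (-s₁) t₁ ∪ Ioc s₁ s₂ ×ˢ Ioc t₁ t₂) := by
    rw [Set.disjoint_left]
    rintro ⟨u, v⟩ ⟨_, _, a⟩ (⟨_, b⟩ | ⟨_, b⟩)
    · exact absurd a (not_le.2 b.1)
    · exact absurd a (not_le.2 (lt_of_le_of_lt (by linarith) b.1))
  have d3 : Disjoint (triSet s₁ t₂)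
      (triSet s₂ (-s₁) ∪ (Ioc s₁ s₂ ×ˢ Ioc (-s₁) t₁ ∪ Ioc s₁ s₂ ×ˢ Ioc t₁ t₂)) := by
    rw [Set.disjoint_left]
    rintro ⟨u, v⟩ ⟨_, a, _⟩ (⟨b, _, c⟩ | ⟨b, _⟩ | ⟨b, _⟩)
    · simp only at a b c; linarith
    · exact absurd a (not_le.2 b.1)
    · exact absurd a (not_le.2 b.1)
  have tall := tA.sumElim (tB.sumElim (tR.sumElim tR' d1) d2) d3
  rw [triSet_split h1 hs ht] at tall
  obtain ⟨I, hI, hsum⟩ := hC.exists_hasSum tall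
  obtain ⟨IA, hIA, hsumA⟩ := hA.exists_hasSum tA
  obtain ⟨IB, hIB, hsumB⟩ := hB.exists_hasSum tB
  refine ⟨I (Sum.inr (Sum.inr (Sum.inl ()))), I (Sum.inr (Sum.inr (Sum.inr ()))),
    hI (Sum.inr (Sum.inr (Sum.inl ()))), hI (Sum.inr (Sum.inr (Sum.inr ()))), ?_⟩
  have eA : I ∘ Sum.inl = IA := funext fun i =>
    (hI (Sum.inl i)).unique (tA.fst_le i) (tA.snd_le i) (hIA i)
  have eB : (I ∘ Sum.inr) ∘ Sum.inl = IB := funext fun i =>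
    (hI (Sum.inr (Sum.inl i))).unique (tB.fst_le i) (tB.snd_le i) (hIB i)
  refine hsum.unique (HasSum.sum (eA ▸ hsumA) (HasSum.sum (eB ▸ hsumB) (HasSum.sum ?_ ?_)))
  · exact hasSum_unique _
  · exact hasSum_unique _

/-- Integrals over triangles form a potential. -/
theorem isPotential_of_hasTriIntegral {γ γ' : ℝ} (hγ : 0 < γ) (hγ' : 0 < γ') (h : 1 < γ + γ')
    {f x y : ℝ → ℝ → ℝ} {S₀ T₀ : ℝ}
    (hy : ∀ s t, 0 ≤ s + t → s ≤ S₀ → t ≤ T₀ → HasTriIntegral γ γ' f x s t (y s t)) :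
    IsPotential f x S₀ T₀ y where
  rect s₁ s₂ t₁ t₂ h1 hs ht hS hT := by
    have hB := hy s₂ (-s₁) (by linarith) hS (by linarith)
    obtain ⟨z₀, z₁, i0, i1, e⟩ := HasTriIntegral.split hγ hγ' h h1 hs ht
      (hy s₁ t₂ (by linarith) (by linarith) hT) hB (hy s₂ t₂ (by linarith) hS hT)
    -- The same decomposition for the vertex (s₂, t₁), where the upper rectangle is degenerate. The
    -- bottom triangle and the lower rectangle are common to both and cancel, leaving z₁.
    obtain ⟨z₀', z₁', i0', i1', e'⟩ := HasTriIntegral.split hγ hγ' h h1 hs (le_refl t₁)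
      (hy s₁ t₁ h1 (by linarith) (by linarith)) hB (hy s₂ t₁ (by linarith) hS (by linarith))
    have e0 := i0.unique hs (by linarith) i0'
    have e1 := i1'.unique hs le_rfl (hasYoungIntegral_of_eq_snd f x s₁ s₂ t₁)
    have : rectIncr y s₁ s₂ t₁ t₂ = z₁ := by unfold rectIncr; linarith
    rwa [this]
  tri s t h1 hS hT := (hy s t h1 hS hT).exists_hasSum (dyadic_tiling h1 hγ hγ' h)

lemma IsPotential.sub {f f' x y y' : ℝ → ℝ → ℝ} {S₀ T₀ : ℝ} (h : IsPotential f x S₀ T₀ y)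
    (h' : IsPotential f' x S₀ T₀ y') :
    IsPotential (fun s t => f s t - f' s t) x S₀ T₀ (fun s t => y s t - y' s t) where
  rect s₁ s₂ t₁ t₂ h1 hs ht hS hT := by
    have := (h.rect s₁ s₂ t₁ t₂ h1 hs ht hS hT).sub (h'.rect s₁ s₂ t₁ t₂ h1 hs ht hS hT)
    convert this using 1
    unfold rectIncr; ring
  tri s t h1 hS hT := by
    obtain ⟨I, hI, hz⟩ := h.tri s t h1 hS hT
    obtain ⟨I', hI', hz'⟩ := h'.tri s t h1 hS hT
    exact ⟨fun i => I i - I' i, fun i => (hI i).sub (hI' i), hz.sub hz'⟩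

/-! ### Steklov averages of the integrator -/

/-- The density of the Steklov average of `x` at scale `ε`. -/
def stekDensity (x : ℝ → ℝ → ℝ) (ε s t : ℝ) : ℝ := rectIncr x s (s + ε) t (t + ε) / ε ^ 2

/-- The (anchored) Steklov average of `x` at scale `ε`. -/
def stekMean (x : ℝ → ℝ → ℝ) (ε s t : ℝ) : ℝ := ∫ u in 0..s, ∫ v in 0..t, stekDensity x ε u v

/-- Both sides equal the integral of h over [d, d+ε] minus that over [c, c+ε]. Used in each
variable, this exchanges the averaging scale with the sides of the rectangle. -/
lemma integral_shift_sub {h : ℝ → ℝ} (hh : Continuous h) (c d ε : ℝ) :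
    ∫ t in c..d, (h (t + ε) - h t) = ∫ v in 0..ε, (h (d + v) - h (c + v)) := by
  rw [intervalIntegral.integral_sub ((by fun_prop : Continuous fun t => h (t + ε)).intervalIntegrable
    _ _) (hh.intervalIntegrable _ _), intervalIntegral.integral_sub
    ((by fun_prop : Continuous fun t => h (d + t)).intervalIntegrable _ _)
    ((by fun_prop : Continuous fun t => h (c + t)).intervalIntegrable _ _),
    intervalIntegral.integral_comp_add_right, intervalIntegral.integral_comp_add_left,
    intervalIntegral.integral_comp_add_left, add_zero, add_zero,
    intervalIntegral.integral_interval_sub_interval_comm (hh.intervalIntegrable _ _)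
      (hh.intervalIntegrable _ _) (hh.intervalIntegrable _ _),
    intervalIntegral.integral_symm c, intervalIntegral.integral_symm d]
  ring

lemma continuous_rectIncr_shift {x : ℝ → ℝ → ℝ} (hx : Continuous fun p : ℝ × ℝ => x p.1 p.2)
    (s₁ s₂ t₁ t₂ : ℝ) :
    Continuous fun p : ℝ × ℝ => rectIncr x (s₁ + p.1) (s₂ + p.1) (t₁ + p.2) (t₂ + p.2) := by
  have h : ∀ a b : ℝ, Continuous fun p : ℝ × ℝ => x (a + p.1) (b + p.2) := fun a b =>
    hx.comp (by fun_prop : Continuous fun p : ℝ × ℝ => ((a + p.1, b + p.2) : ℝ × ℝ))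
  unfold rectIncr
  exact (((h s₁ t₁).sub (h s₁ t₂)).sub (h s₂ t₁)).add (h s₂ t₂)

lemma continuous_stekDensity {x : ℝ → ℝ → ℝ} (hx : Continuous fun p : ℝ × ℝ => x p.1 p.2)
    (ε : ℝ) :
    Continuous fun p : ℝ × ℝ => stekDensity x ε p.1 p.2 := by
  have := continuous_rectIncr_shift hx 0 ε 0 ε
  simp only [zero_add, add_comm ε] at this
  exact this.div_const _

lemma rectIncr_stekMean {x : ℝ → ℝ → ℝ} (hx : Continuous fun p : ℝ × ℝ => x p.1 p.2)
    (ε s₁ s₂ t₁ t₂ : ℝ) :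
    rectIncr (stekMean x ε) s₁ s₂ t₁ t₂ = ∫ u in s₁..s₂, ∫ v in t₁..t₂, stekDensity x ε u v := by
  have hc := continuous_stekDensity hx ε
  have h1 : ∀ c d : ℝ, Continuous fun u => ∫ v in c..d, stekDensity x ε u v := fun c d =>
    intervalIntegral.continuous_parametric_intervalIntegral_of_continuous' hc c d
  have h2 : ∀ u c, IntervalIntegrable (stekDensity x ε u) volume 0 c := fun u c =>
    (hc.comp (by fun_prop : Continuous fun v : ℝ => ((u, v) : ℝ × ℝ))).intervalIntegrable _ _
  have e1 : ∀ t, stekMean x ε s₂ t - stekMean x ε s₁ t =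
      ∫ u in s₁..s₂, ∫ v in 0..t, stekDensity x ε u v := fun t =>
    intervalIntegral.integral_interval_sub_left ((h1 0 t).intervalIntegrable _ _)
      ((h1 0 t).intervalIntegrable _ _)
  have e2 : rectIncr (stekMean x ε) s₁ s₂ t₁ t₂ =
      (stekMean x ε s₂ t₂ - stekMean x ε s₁ t₂) - (stekMean x ε s₂ t₁ - stekMean x ε s₁ t₁) := by
    unfold rectIncr; ring
  rw [e2, e1, e1, ← intervalIntegral.integral_sub ((h1 0 t₂).intervalIntegrable _ _)
      ((h1 0 t₁).intervalIntegrable _ _)]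
  refine intervalIntegral.integral_congr fun u _ => ?_
  exact intervalIntegral.integral_interval_sub_left (h2 u t₂) (h2 u t₁)

/-- As averages of translated increments of x, the increments of the Steklov mean inherit the bounds
of x with the same constant and converge to the increments of x as ε tends to 0. -/
lemma rectIncr_stekMean_eq_average {x : ℝ → ℝ → ℝ} (hx : Continuous fun p : ℝ × ℝ => x p.1 p.2)
    (ε s₁ s₂ t₁ t₂ : ℝ) :
    rectIncr (stekMean x ε) s₁ s₂ t₁ t₂ =
      (∫ u in 0..ε, ∫ v in 0..ε, rectIncr x (s₁ + u) (s₂ + u) (t₁ + v) (t₂ + v)) / ε ^ 2 := by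
  have hx1 : ∀ s, Continuous fun t => x s t := fun s =>
    hx.comp (by fun_prop : Continuous fun t : ℝ => ((s, t) : ℝ × ℝ))
  rw [rectIncr_stekMean hx]
  simp only [stekDensity, intervalIntegral.integral_div]
  congr 1
  have e1 : ∀ s, ∫ t in t₁..t₂, rectIncr x s (s + ε) t (t + ε) =
      ∫ v in 0..ε, ((x (s + ε) (t₂ + v) - x s (t₂ + v)) - (x (s + ε) (t₁ + v) - x s (t₁ + v))) := by
    intro s
    rw [← integral_shift_sub (h := fun t => x (s + ε) t - x s t) ((hx1 _).sub (hx1 _))]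
    refine intervalIntegral.integral_congr fun t _ => ?_
    simp only [rectIncr]; ring
  have hm : Continuous fun s => ∫ v in 0..ε, (x s (t₂ + v) - x s (t₁ + v)) := by
    refine intervalIntegral.continuous_parametric_intervalIntegral_of_continuous' ?_ _ _
    exact (hx.comp (by fun_prop : Continuous fun p : ℝ × ℝ => ((p.1, t₂ + p.2) : ℝ × ℝ))).sub
      (hx.comp (by fun_prop : Continuous fun p : ℝ × ℝ => ((p.1, t₁ + p.2) : ℝ × ℝ)))
  have hi : ∀ s t, IntervalIntegrable (fun v => x s (t + v)) volume 0 ε := fun s t =>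
    ((hx1 s).comp (by fun_prop : Continuous fun v : ℝ => t + v)).intervalIntegrable _ _
  have e2 : ∀ s s', (∫ v in 0..ε, ((x s' (t₂ + v) - x s (t₂ + v)) -
      (x s' (t₁ + v) - x s (t₁ + v)))) = (∫ v in 0..ε, (x s' (t₂ + v) - x s' (t₁ + v))) -
      ∫ v in 0..ε, (x s (t₂ + v) - x s (t₁ + v)) := by
    intro s s'
    rw [← intervalIntegral.integral_sub ((hi s' t₂).sub (hi s' t₁)) ((hi s t₂).sub (hi s t₁))]
    refine intervalIntegral.integral_congr fun t _ => ?_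
    ring
  simp only [e1, e2]
  rw [integral_shift_sub hm]
  refine intervalIntegral.integral_congr fun u _ => ?_
  rw [← e2]
  refine intervalIntegral.integral_congr fun t _ => ?_
  simp only [rectIncr]; ring

/-- Translations by at most ε ≤ 1 preserve the sides of a rectangle and keep it inside the one
enlarged by 1. The constant is uniform in ε, which is what dominated convergence over tilings needs.
-/
lemma rectBound_stekMean {x : ℝ → ℝ → ℝ} (hx : Continuous fun p : ℝ × ℝ => x p.1 p.2)
    {γ γ' K a b c d ε : ℝ} (hε : 0 < ε) (hε1 : ε ≤ 1)
    (hK : RectBound γ γ' K a (b + 1) c (d + 1) x) :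
    RectBound γ γ' K a b c d (stekMean x ε) := by
  intro s₁ s₂ t₁ t₂ h1 h2 h3 h4 h5 h6
  rw [rectIncr_stekMean_eq_average hx, abs_div, abs_of_pos (show 0 < ε ^ 2 by positivity),
    div_le_iff₀ (by positivity)]
  have h0 : ∀ r ∈ uIoc (0 : ℝ) ε, 0 ≤ r ∧ r ≤ 1 := fun r hr => by
    rw [uIoc_of_le hε.le] at hr; exact ⟨hr.1.le, hr.2.trans hε1⟩
  have key := intervalIntegral.norm_integral_le_of_norm_le_const (a := 0) (b := ε)
    (f := fun u => ∫ v in 0..ε, rectIncr x (s₁ + u) (s₂ + u) (t₁ + v) (t₂ + v))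
    (C := K * ((s₂ - s₁) ^ γ * (t₂ - t₁) ^ γ') * |ε - 0|) (fun u hu => by
      refine intervalIntegral.norm_integral_le_of_norm_le_const fun v hv => ?_
      have hu := h0 u hu
      have hv := h0 v hv
      have := hK (s₁ + u) (s₂ + u) (t₁ + v) (t₂ + v) (by linarith) (by linarith) (by linarith)
        (by linarith) (by linarith) (by linarith)
      rwa [add_sub_add_right_eq_sub, add_sub_add_right_eq_sub] at this)
  rw [Real.norm_eq_abs] at key
  refine key.trans (le_of_eq ?_)
  rw [sub_zero, abs_of_pos hε]; ring

lemma tendsto_rectIncr_stekMean {x : ℝ → ℝ → ℝ} (hx : Continuous fun p : ℝ × ℝ => x p.1 p.2)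
    {e : ℕ → ℝ} (he : ∀ n, 0 < e n) (he0 : Tendsto e atTop (𝓝 0))
    (s₁ s₂ t₁ t₂ : ℝ) :
    Tendsto (fun n => rectIncr (stekMean x (e n)) s₁ s₂ t₁ t₂) atTop
      (𝓝 (rectIncr x s₁ s₂ t₁ t₂)) := by
  rw [Metric.tendsto_atTop]
  intro η hη
  have hc := continuous_rectIncr_shift hx s₁ s₂ t₁ t₂
  have hc0 := Metric.continuousAt_iff.1 (hc.continuousAt (x := ((0, 0) : ℝ × ℝ))) (η / 2) (half_pos hη)
  obtain ⟨δ, hδ, H⟩ := hc0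
  obtain ⟨N, hN⟩ := eventually_atTop.1 (he0.eventually (gt_mem_nhds hδ))
  refine ⟨N, fun n hn => ?_⟩
  set ε := e n with hε
  have hε0 : 0 < ε := he n
  have hεδ : ε < δ := hN n hn
  have hbd : ∀ u ∈ uIoc (0 : ℝ) ε, ∀ v ∈ uIoc (0 : ℝ) ε,
      ‖rectIncr x (s₁ + u) (s₂ + u) (t₁ + v) (t₂ + v) - rectIncr x s₁ s₂ t₁ t₂‖ ≤ η / 2 := by
    intro u hu v hv
    rw [uIoc_of_le hε0.le] at hu hv
    have : dist ((u, v) : ℝ × ℝ) (0, 0) < δ := by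
      rw [Prod.dist_eq, Real.dist_eq, Real.dist_eq, sub_zero, sub_zero, abs_of_pos hu.1,
        abs_of_pos hv.1]
      exact max_lt (hu.2.trans_lt hεδ) (hv.2.trans_lt hεδ)
    have := H this
    simp only [add_zero] at this
    exact this.le
  have hi : ∀ u, IntervalIntegrable
      (fun v => rectIncr x (s₁ + u) (s₂ + u) (t₁ + v) (t₂ + v)) volume 0 ε := fun u =>
    (hc.comp (by fun_prop : Continuous fun v : ℝ => ((u, v) : ℝ × ℝ))).intervalIntegrable _ _
  have hi2 : Continuous fun u => ∫ v in 0..ε,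
      rectIncr x (s₁ + u) (s₂ + u) (t₁ + v) (t₂ + v) :=
    intervalIntegral.continuous_parametric_intervalIntegral_of_continuous' hc _ _
  have e1 : rectIncr (stekMean x ε) s₁ s₂ t₁ t₂ - rectIncr x s₁ s₂ t₁ t₂ =
      (∫ u in 0..ε, ∫ v in 0..ε, (rectIncr x (s₁ + u) (s₂ + u) (t₁ + v) (t₂ + v) -
        rectIncr x s₁ s₂ t₁ t₂)) / ε ^ 2 := by
    rw [rectIncr_stekMean_eq_average hx]
    have : ∀ u, ∫ v in 0..ε, (rectIncr x (s₁ + u) (s₂ + u) (t₁ + v) (t₂ + v) -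
        rectIncr x s₁ s₂ t₁ t₂) = (∫ v in 0..ε, rectIncr x (s₁ + u) (s₂ + u) (t₁ + v) (t₂ + v)) -
        ε * rectIncr x s₁ s₂ t₁ t₂ := fun u => by
      rw [intervalIntegral.integral_sub (hi u) intervalIntegrable_const]
      simp
    simp only [this]
    rw [intervalIntegral.integral_sub (hi2.intervalIntegrable _ _) intervalIntegrable_const]
    simp only [intervalIntegral.integral_const, sub_zero, smul_eq_mul]
    field_simp
  have key := intervalIntegral.norm_integral_le_of_norm_le_const (a := 0) (b := ε)
    (f := fun u => ∫ v in 0..ε, (rectIncr x (s₁ + u) (s₂ + u) (t₁ + v) (t₂ + v) -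
        rectIncr x s₁ s₂ t₁ t₂)) (C := η / 2 * |ε - 0|) (fun u hu =>
      intervalIntegral.norm_integral_le_of_norm_le_const fun v hv => hbd u hu v hv)
  rw [Real.dist_eq, e1, abs_div, abs_of_pos (show 0 < ε ^ 2 by positivity),
    div_lt_iff₀ (by positivity)]
  rw [Real.norm_eq_abs, sub_zero, abs_of_pos hε0] at key
  nlinarith [mul_pos hε0 hε0]

end FracWave

end

/-! ### Young integrals against Steklov averages, and integrals over triangles -/

noncomputable section

namespace FracWave

lemma clamp_mem {u v : ℝ} (h : u ≤ v) (r : ℝ) : clamp u v r ∈ Icc u v :=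
  ⟨le_max_left _ _, max_le h (min_le_left _ _)⟩

lemma clamp_of_mem {u v r : ℝ} (h : r ∈ Icc u v) : clamp u v r = r := by
  unfold clamp; rw [min_eq_right h.2, max_eq_right h.1]

lemma continuous_clamp (u v : ℝ) : Continuous (clamp u v) := by
  unfold clamp; fun_prop

section

variable {κ κ' γ γ' K M₀ M₁ M₂ M₁₂ a b c d : ℝ} {f x : ℝ → ℝ → ℝ}

lemma HolderRect.abs_sub_fst (hf : HolderRect κ κ' M₀ M₁ M₂ M₁₂ a b c d f) {s₁ s₂ t : ℝ}
    (h1 : s₁ ∈ Icc a b) (h2 : s₂ ∈ Icc a b) (ht : t ∈ Icc c d) :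
    |f s₁ t - f s₂ t| ≤ M₁ * |s₁ - s₂| ^ κ := by
  rcases le_total s₂ s₁ with h | h
  · rw [abs_of_nonneg (sub_nonneg.2 h)]; exact hf.fst s₂ s₁ t h2.1 h h1.2 ht.1 ht.2
  · rw [abs_sub_comm, abs_sub_comm s₁, abs_of_nonneg (sub_nonneg.2 h)]
    exact hf.fst s₁ s₂ t h1.1 h h2.2 ht.1 ht.2

lemma HolderRect.abs_sub_le (hf : HolderRect κ κ' M₀ M₁ M₂ M₁₂ a b c d f) {s₁ s₂ t₁ t₂ : ℝ}
    (h1 : s₁ ∈ Icc a b) (h2 : s₂ ∈ Icc a b) (ht1 : t₁ ∈ Icc c d) (ht2 : t₂ ∈ Icc c d) :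
    |f s₁ t₁ - f s₂ t₂| ≤ M₁ * |s₁ - s₂| ^ κ + M₂ * |t₁ - t₂| ^ κ' :=
  (_root_.abs_sub_le _ (f s₂ t₁) _).trans (add_le_add (hf.abs_sub_fst h1 h2 ht1)
    (hf.transpose.abs_sub_fst ht1 ht2 h2))

lemma HolderRect.continuousOn (hκ : 0 < κ) (hκ' : 0 < κ')
    (hf : HolderRect κ κ' M₀ M₁ M₂ M₁₂ a b c d f) :
    ContinuousOn (fun p : ℝ × ℝ => f p.1 p.2) (Icc a b ×ˢ Icc c d) := by
  rintro ⟨s, t⟩ ⟨hs, ht⟩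
  have hlim : Tendsto (fun p : ℝ × ℝ => M₁ * |p.1 - s| ^ κ + M₂ * |p.2 - t| ^ κ') (𝓝 (s, t))
      (𝓝 0) := by
    have : Continuous fun p : ℝ × ℝ => M₁ * |p.1 - s| ^ κ + M₂ * |p.2 - t| ^ κ' := by
      refine (continuous_const.mul (Continuous.rpow_const (by fun_prop) fun _ => Or.inr hκ.le)).add
        (continuous_const.mul (Continuous.rpow_const (by fun_prop) fun _ => Or.inr hκ'.le))
    have h := this.tendsto (s, t)
    simpa [Real.zero_rpow hκ.ne', Real.zero_rpow hκ'.ne'] using h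
  rw [ContinuousWithinAt, tendsto_iff_dist_tendsto_zero]
  refine squeeze_zero' (Eventually.of_forall fun _ => dist_nonneg) ?_
    (hlim.mono_left nhdsWithin_le_nhds)
  filter_upwards [self_mem_nhdsWithin] with p hp
  rw [Real.dist_eq]
  exact hf.abs_sub_le hp.1 hs hp.2 ht

/-- For the Steklov average of the integrator the Young integral is a Lebesgue integral. -/
theorem hasYoungIntegral_stekMean (hκ : 0 < κ) (hκ' : 0 < κ') (hM₁ : 0 ≤ M₁) (hM₂ : 0 ≤ M₂)
    (hab : a ≤ b) (hcd : c ≤ d)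
    (hf : HolderRect κ κ' M₀ M₁ M₂ M₁₂ a b c d f) (hx : Continuous fun p : ℝ × ℝ => x p.1 p.2)
    (ε : ℝ) :
    HasYoungIntegral f (stekMean x ε) a b c d
      (∫ p in Ioc a b ×ˢ Ioc c d, f p.1 p.2 * stekDensity x ε p.1 p.2) := by
  set g := stekDensity x ε with hg
  have hgc : Continuous fun p : ℝ × ℝ => g p.1 p.2 := continuous_stekDensity hx ε
  -- Clamping extends f continuously to the whole plane without changing it on the rectangle, so all
  -- the iterated integrals below have continuous integrands.
  set F : ℝ → ℝ → ℝ := fun s t => f (clamp a b s) (clamp c d t) with hF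
  have hFc : Continuous fun p : ℝ × ℝ => F p.1 p.2 :=
    (hf.continuousOn hκ hκ').comp_continuous
      (((continuous_clamp a b).comp continuous_fst).prodMk
        ((continuous_clamp c d).comp continuous_snd))
      fun p => ⟨clamp_mem hab _, clamp_mem hcd _⟩
  have hFg : Continuous fun p : ℝ × ℝ => F p.1 p.2 * g p.1 p.2 := hFc.mul hgc
  have e0 : ∫ p in Ioc a b ×ˢ Ioc c d, f p.1 p.2 * g p.1 p.2 =
      ∫ s in a..b, ∫ t in c..d, F s t * g s t := by
    rw [intervalIntegral.integral_of_le hab]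
    simp only [intervalIntegral.integral_of_le hcd]
    rw [← setIntegral_prod (fun p : ℝ × ℝ => F p.1 p.2 * g p.1 p.2)]
    · refine setIntegral_congr_fun (measurableSet_Ioc.prod measurableSet_Ioc) fun p hp => ?_
      simp only [hF, clamp_of_mem (Ioc_subset_Icc_self hp.1), clamp_of_mem (Ioc_subset_Icc_self hp.2)]
    · exact (hFg.continuousOn.integrableOn_compact (isCompact_Icc.prod isCompact_Icc)).mono_set
        (prod_mono Ioc_subset_Icc_self Ioc_subset_Icc_self)
  obtain ⟨G, hG⟩ := (isCompact_Icc.prod isCompact_Icc : IsCompact (Icc a b ×ˢ Icc c d)).exists_bound_of_continuousOn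
    hgc.continuousOn
  have hG0 : 0 ≤ G := (norm_nonneg _).trans (hG (a, c) ⟨left_mem_Icc.2 hab, left_mem_Icc.2 hcd⟩)
  have main : ∀ δ > 0, ∀ (m n : ℕ) (p q : ℕ → ℝ), IsSubdivision a b δ m p →
      IsSubdivision c d δ n q →
      |youngSum f (stekMean x ε) m n p q - ∫ s in a..b, ∫ t in c..d, F s t * g s t| ≤
        (M₁ * δ ^ κ + M₂ * δ ^ κ') * G * ((b - a) * (d - c)) := by
    intro δ hδ m n p q hp hq
    have hin : ∀ s c d, IntervalIntegrable (fun t => F s t * g s t) volume c d := fun s c d =>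
      (hFg.comp (by fun_prop : Continuous fun t : ℝ => ((s, t) : ℝ × ℝ))).intervalIntegrable _ _
    have hin' : ∀ r s c d, IntervalIntegrable (fun t => r * g s t) volume c d := fun r s c d =>
      (continuous_const.mul (hgc.comp (by fun_prop : Continuous fun t : ℝ =>
        ((s, t) : ℝ × ℝ)))).intervalIntegrable _ _
    have hout : ∀ c d a b, IntervalIntegrable (fun s => ∫ t in c..d, F s t * g s t) volume a b :=
      fun c d a b => (intervalIntegral.continuous_parametric_intervalIntegral_of_continuous' hFg
        c d).intervalIntegrable _ _
    have hout' : ∀ r c d a b, IntervalIntegrable (fun s => ∫ t in c..d, r * g s t) volume a b :=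
      fun r c d a b => (intervalIntegral.continuous_parametric_intervalIntegral_of_continuous'
        (f := fun s t => r * g s t) (continuous_const.mul hgc) c d).intervalIntegrable _ _
    have e1 : ∫ s in a..b, ∫ t in c..d, F s t * g s t =
        ∑ i ∈ Finset.range m, ∑ j ∈ Finset.range n,
          ∫ s in (p i)..(p (i + 1)), ∫ t in (q j)..(q (j + 1)), F s t * g s t := by
      conv_lhs => rw [← hp.1, ← hp.2.1, ← intervalIntegral.sum_integral_adjacent_intervals
        (fun k _ => hout c d _ _)]
      refine Finset.sum_congr rfl fun i _ => ?_
      rw [← intervalIntegral.integral_finsetSum fun j _ => hout _ _ _ _]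
      refine intervalIntegral.integral_congr fun s _ => ?_
      rw [intervalIntegral.sum_integral_adjacent_intervals (fun k _ => hin s _ _), hq.1, hq.2.1]
    have e2 : youngSum f (stekMean x ε) m n p q - ∫ s in a..b, ∫ t in c..d, F s t * g s t =
        ∑ i ∈ Finset.range m, ∑ j ∈ Finset.range n,
          ∫ s in (p i)..(p (i + 1)), ∫ t in (q j)..(q (j + 1)),
            (f (p i) (q j) - F s t) * g s t := by
      rw [e1, youngSum, ← Finset.sum_sub_distrib]
      refine Finset.sum_congr rfl fun i _ => ?_
      rw [← Finset.sum_sub_distrib]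
      refine Finset.sum_congr rfl fun j _ => ?_
      rw [rectIncr_stekMean hx, ← intervalIntegral.integral_const_mul]
      simp only [← intervalIntegral.integral_const_mul]
      rw [← intervalIntegral.integral_sub (hout' _ _ _ _ _) (hout _ _ _ _)]
      refine intervalIntegral.integral_congr fun s _ => ?_
      rw [← intervalIntegral.integral_sub (hin' _ _ _ _) (hin _ _ _)]
      refine intervalIntegral.integral_congr fun t _ => ?_
      simp only [hg]
      ring
    rw [e2]
    set R := (M₁ * δ ^ κ + M₂ * δ ^ κ') * G with hR
    have cell : ∀ i ∈ Finset.range m, ∀ j ∈ Finset.range n,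
        |∫ s in (p i)..(p (i + 1)), ∫ t in (q j)..(q (j + 1)),
            (f (p i) (q j) - F s t) * g s t| ≤
          R * ((p (i + 1) - p i) * (q (j + 1) - q j)) := by
      intro i hi j hj
      have hi' := Finset.mem_range.1 hi
      have hj' := Finset.mem_range.1 hj
      obtain ⟨pi1, pi2⟩ := hp.2.2 i hi'
      obtain ⟨qj1, qj2⟩ := hq.2.2 j hj'
      have key := intervalIntegral.norm_integral_le_of_norm_le_const (a := p i) (b := p (i + 1))
        (f := fun s => ∫ t in (q j)..(q (j + 1)), (f (p i) (q j) - F s t) * g s t)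
        (C := R * |q (j + 1) - q j|) (fun s hs => by
          refine intervalIntegral.norm_integral_le_of_norm_le_const fun t ht => ?_
          rw [uIoc_of_le pi1] at hs
          rw [uIoc_of_le qj1] at ht
          have hs' : s ∈ Icc a b := ⟨(hp.mem hi'.le).1.trans hs.1.le, hs.2.trans (hp.mem hi').2⟩
          have ht' : t ∈ Icc c d := ⟨(hq.mem hj'.le).1.trans ht.1.le, ht.2.trans (hq.mem hj').2⟩
          rw [norm_mul, Real.norm_eq_abs, hR]
          refine mul_le_mul ?_ (hG (s, t) ⟨hs', ht'⟩) (norm_nonneg _) (by positivity)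
          simp only [hF, clamp_of_mem hs', clamp_of_mem ht']
          refine (hf.abs_sub_le (hp.mem hi'.le) hs' (hq.mem hj'.le) ht').trans ?_
          have b1 : |p i - s| ≤ δ := by
            rw [abs_sub_comm, abs_of_nonneg (by linarith [hs.1])]; linarith [hs.2]
          have b2 : |q j - t| ≤ δ := by
            rw [abs_sub_comm, abs_of_nonneg (by linarith [ht.1])]; linarith [ht.2]
          gcongr)
      rw [Real.norm_eq_abs, abs_of_nonneg (sub_nonneg.2 qj1), abs_of_nonneg (sub_nonneg.2 pi1)]
        at key
      exact key.trans (le_of_eq (by ring))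
    refine (Finset.abs_sum_le_sum_abs _ _).trans ((Finset.sum_le_sum fun i hi =>
      (Finset.abs_sum_le_sum_abs _ _).trans (Finset.sum_le_sum fun j hj => cell i hi j hj)).trans
      (le_of_eq ?_))
    simp only [← Finset.mul_sum]
    rw [sum_range_sub_real, ← Finset.sum_mul, sum_range_sub_real, hp.1, hp.2.1, hq.1, hq.2.1]
  rw [e0]
  intro η hη
  have hlim : Tendsto (fun δ : ℝ => (M₁ * δ ^ κ + M₂ * δ ^ κ') * G * ((b - a) * (d - c)))
      (𝓝[>] 0) (𝓝 0) := by
    have hc : Continuous fun δ : ℝ => (M₁ * δ ^ κ + M₂ * δ ^ κ') * G * ((b - a) * (d - c)) := by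
      refine Continuous.mul (Continuous.mul ?_ continuous_const) continuous_const
      exact (continuous_const.mul (continuous_id.rpow_const fun _ => Or.inr hκ.le)).add
        (continuous_const.mul (continuous_id.rpow_const fun _ => Or.inr hκ'.le))
    have h := hc.tendsto 0
    simp only [Real.zero_rpow hκ.ne', Real.zero_rpow hκ'.ne', mul_zero, add_zero, zero_mul] at h
    exact h.mono_left nhdsWithin_le_nhds
  obtain ⟨δ, hδ1, hδ2⟩ := ((hlim.eventually (gt_mem_nhds hη)).and self_mem_nhdsWithin).exists
  exact ⟨δ, hδ2, fun m n p q hp hq => (main δ hδ2 m n p q hp hq).trans_lt hδ1⟩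

/-- The Young integrals against the Steklov averages converge to the Young integral. -/
theorem tendsto_integral_stekDensity (hκ : 0 < κ) (hκ' : 0 < κ') (hγ : 0 < γ) (hγ' : 0 < γ')
    (h : 1 < κ + γ) (h' : 1 < κ' + γ') (hK : 0 ≤ K) (hM₁ : 0 ≤ M₁) (hM₂ : 0 ≤ M₂) (hM₁₂ : 0 ≤ M₁₂)
    (hab : a ≤ b) (hcd : c ≤ d)
    (hf : HolderRect κ κ' M₀ M₁ M₂ M₁₂ a b c d f) (hx : Continuous fun p : ℝ × ℝ => x p.1 p.2)
    (hxK : RectBound γ γ' K a (b + 1) c (d + 1) x)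
    {e : ℕ → ℝ} (he : ∀ n, 0 < e n) (he1 : ∀ n, e n ≤ 1) (he0 : Tendsto e atTop (𝓝 0)) {z : ℝ}
    (hz : HasYoungIntegral f x a b c d z) :
    Tendsto (fun k => ∫ p in Ioc a b ×ˢ Ioc c d, f p.1 p.2 * stekDensity x (e k) p.1 p.2) atTop
      (𝓝 z) ∧
    ∀ k, |∫ p in Ioc a b ×ˢ Ioc c d, f p.1 p.2 * stekDensity x (e k) p.1 p.2| ≤
      youngConst κ κ' γ γ' * K * ((b - a) ^ γ * (d - c) ^ γ') *
        (M₀ + M₁ * (b - a) ^ κ + M₂ * (d - c) ^ κ' + M₁₂ * ((b - a) ^ κ * (d - c) ^ κ')) := by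
  set J : ℕ → ℝ := fun k => ∫ p in Ioc a b ×ˢ Ioc c d, f p.1 p.2 * stekDensity x (e k) p.1 p.2
  have hyx : RectBound γ γ' K a b c d x := fun s₁ s₂ t₁ t₂ h1 h2 h3 h4 h5 h6 =>
    hxK s₁ s₂ t₁ t₂ h1 h2 (by linarith) h4 h5 (by linarith)
  have hJ : ∀ k, |J k| ≤ youngConst κ κ' γ γ' * K * ((b - a) ^ γ * (d - c) ^ γ') *
        (M₀ + M₁ * (b - a) ^ κ + M₂ * (d - c) ^ κ' + M₁₂ * ((b - a) ^ κ * (d - c) ^ κ')) ∧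
      ∀ δ > 0, ∀ (m n : ℕ) (p q : ℕ → ℝ), IsSubdivision a b δ m p → IsSubdivision c d δ n q →
        |youngSum f (stekMean x (e k)) m n p q - J k| ≤
          youngErr κ κ' γ γ' K M₁ M₂ M₁₂ a b c d * meshRate κ κ' γ γ' δ := by
    intro k
    obtain ⟨w, hw, hw2⟩ := exists_youngIntegral hκ hκ' hγ hγ' h h' hK hM₁ hM₂ hM₁₂ hab hcd hf
      (rectBound_stekMean hx (he k) (he1 k) hxK)
    have : w = J k := hw.unique hab hcd
      (hasYoungIntegral_stekMean hκ hκ' hM₁ hM₂ hab hcd hf hx (e k))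
    rwa [this] at hw2
  refine ⟨?_, fun k => (hJ k).1⟩
  obtain ⟨w, hw, -, hrate⟩ := exists_youngIntegral hκ hκ' hγ hγ' h h' hK hM₁ hM₂ hM₁₂ hab hcd hf hyx
  obtain rfl : w = z := hw.unique hab hcd hz
  rw [Metric.tendsto_atTop]
  intro η hη
  set E := youngErr κ κ' γ γ' K M₁ M₂ M₁₂ a b c d
  have hlim : Tendsto (fun k : ℕ => E * meshRate κ κ' γ γ' (1 / ((k : ℝ) + 1))) atTop (𝓝 0) := by
    simpa using (tendsto_meshRate h h' (tendsto_const_div_nat 1)).const_mul E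
  -- The rate of convergence of Riemann sums is the same for x and for all its averages. So one
  -- fixed fine pair of subdivisions serves them all, and along it only finitely many increments
  -- have to converge.
  obtain ⟨N, hN⟩ := (hlim.eventually (gt_mem_nhds (show 0 < η / 3 by positivity))).exists
  set δ : ℝ := 1 / ((N : ℝ) + 1) with hδ
  have hδ0 : 0 < δ := by positivity
  obtain ⟨m, p, hp⟩ := exists_subdivision hab hδ0
  obtain ⟨n, q, hq⟩ := exists_subdivision hcd hδ0
  have hS : Tendsto (fun k => youngSum f (stekMean x (e k)) m n p q) atTop
      (𝓝 (youngSum f x m n p q)) :=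
    tendsto_finsetSum _ fun i _ => tendsto_finsetSum _ fun j _ =>
      (tendsto_rectIncr_stekMean hx he he0 _ _ _ _).const_mul _
  obtain ⟨k₀, hk₀⟩ := (Metric.tendsto_atTop.1 hS) (η / 3) (by positivity)
  refine ⟨k₀, fun k hk => ?_⟩
  have a1 := hk₀ k hk
  have a2 := (hJ k).2 δ hδ0 m n p q hp hq
  have a3 := hrate δ hδ0 m n p q hp hq
  rw [Real.dist_eq] at a1 ⊢
  rw [abs_lt] at a1 ⊢
  rw [abs_le] at a2 a3
  constructor <;> linarith [a1.1, a1.2, a2.1, a2.2, a3.1, a3.2]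

end

/-! ### Existence of integrals over triangles -/

/-- Quantitative Hölder regularity on the triangle with vertex `(S₀, T₀)`. -/
structure HolderTri (κ κ' M S₀ T₀ : ℝ) (f : ℝ → ℝ → ℝ) : Prop where
  sup : ∀ s t, 0 ≤ s + t → s ≤ S₀ → t ≤ T₀ → |f s t| ≤ M
  fst : ∀ s₁ s₂ t, 0 ≤ s₁ + t → s₁ ≤ s₂ → s₂ ≤ S₀ → t ≤ T₀ → |f s₂ t - f s₁ t| ≤ M * (s₂ - s₁) ^ κ
  snd : ∀ s t₁ t₂, 0 ≤ s + t₁ → t₁ ≤ t₂ → s ≤ S₀ → t₂ ≤ T₀ → |f s t₂ - f s t₁| ≤ M * (t₂ - t₁) ^ κ'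
  rect : ∀ s₁ s₂ t₁ t₂, 0 ≤ s₁ + t₁ → s₁ ≤ s₂ → t₁ ≤ t₂ → s₂ ≤ S₀ → t₂ ≤ T₀ →
    |rectIncr f s₁ s₂ t₁ t₂| ≤ M * ((s₂ - s₁) ^ κ * (t₂ - t₁) ^ κ')

section

variable {κ κ' γ γ' K M S₀ T₀ : ℝ} {f x : ℝ → ℝ → ℝ}

lemma HolderTri.holderRect (hf : HolderTri κ κ' M S₀ T₀ f) {a b c d : ℝ} (h : 0 ≤ a + c)
    (hab : a ≤ b) (hcd : c ≤ d) (hb : b ≤ S₀) (hd : d ≤ T₀) : HolderRect κ κ' M M M M a b c d f where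
  corner := hf.sup a c h (hab.trans hb) (hcd.trans hd)
  fst s₁ s₂ t h1 h2 h3 h4 h5 := hf.fst s₁ s₂ t (by linarith) h2 (by linarith) (by linarith)
  snd s t₁ t₂ h1 h2 h3 h4 h5 := hf.snd s t₁ t₂ (by linarith) h4 (by linarith) (by linarith)
  rect s₁ s₂ t₁ t₂ h1 h2 h3 h4 h5 h6 :=
    hf.rect s₁ s₂ t₁ t₂ (by linarith) h2 h5 (by linarith) (by linarith)

lemma HolderTri.mono (hf : HolderTri κ κ' M S₀ T₀ f) {S₁ T₁ : ℝ} (hS : S₁ ≤ S₀) (hT : T₁ ≤ T₀) :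
    HolderTri κ κ' M S₁ T₁ f where
  sup s t h1 h2 h3 := hf.sup s t h1 (h2.trans hS) (h3.trans hT)
  fst s₁ s₂ t h1 h2 h3 h4 := hf.fst s₁ s₂ t h1 h2 (h3.trans hS) (h4.trans hT)
  snd s t₁ t₂ h1 h2 h3 h4 := hf.snd s t₁ t₂ h1 h2 (h3.trans hS) (h4.trans hT)
  rect s₁ s₂ t₁ t₂ h1 h2 h3 h4 h5 := hf.rect s₁ s₂ t₁ t₂ h1 h2 h3 (h4.trans hS) (h5.trans hT)

/-- The closed triangle with vertex `(S₀, T₀)`. -/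
def closedTri (S₀ T₀ : ℝ) : Set (ℝ × ℝ) := {p | 0 ≤ p.1 + p.2 ∧ p.1 ≤ S₀ ∧ p.2 ≤ T₀}

lemma isCompact_closedTri (S₀ T₀ : ℝ) : IsCompact (closedTri S₀ T₀) := by
  have hcl : IsClosed (closedTri S₀ T₀) :=
    (isClosed_le (f := fun _ : ℝ × ℝ => (0 : ℝ)) (g := fun p => p.1 + p.2) (by fun_prop)
      (by fun_prop)).inter
      ((isClosed_le (f := fun p : ℝ × ℝ => p.1) (g := fun _ => S₀) (by fun_prop) (by fun_prop)).inter
        (isClosed_le (f := fun p : ℝ × ℝ => p.2) (g := fun _ => T₀) (by fun_prop) (by fun_prop)))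
  refine IsCompact.of_isClosed_subset
    (isCompact_Icc.prod isCompact_Icc : IsCompact (Icc (-T₀) S₀ ×ˢ Icc (-S₀) T₀)) hcl ?_
  rintro ⟨s, t⟩ ⟨h1, h2, h3⟩
  simp only at h1 h2 h3
  exact ⟨⟨by linarith, h2⟩, ⟨by linarith, h3⟩⟩

lemma triSet_subset_closedTri (S₀ T₀ : ℝ) : triSet S₀ T₀ ⊆ closedTri S₀ T₀ :=
  fun _ hp => ⟨hp.1.le, hp.2⟩

lemma HolderTri.continuousOn (hκ : 0 < κ) (hκ' : 0 < κ') (hf : HolderTri κ κ' M S₀ T₀ f) :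
    ContinuousOn (fun p : ℝ × ℝ => f p.1 p.2) (closedTri S₀ T₀) := by
  rintro ⟨s, t⟩ hst
  have hlim : Tendsto (fun p : ℝ × ℝ => M * |p.1 - s| ^ κ + M * |p.2 - t| ^ κ') (𝓝 (s, t))
      (𝓝 0) := by
    have : Continuous fun p : ℝ × ℝ => M * |p.1 - s| ^ κ + M * |p.2 - t| ^ κ' := by
      refine (continuous_const.mul (Continuous.rpow_const (by fun_prop) fun _ => Or.inr hκ.le)).add
        (continuous_const.mul (Continuous.rpow_const (by fun_prop) fun _ => Or.inr hκ'.le))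
    have h := this.tendsto (s, t)
    simpa [Real.zero_rpow hκ.ne', Real.zero_rpow hκ'.ne'] using h
  rw [ContinuousWithinAt, tendsto_iff_dist_tendsto_zero]
  refine squeeze_zero' (Eventually.of_forall fun _ => dist_nonneg) ?_
    (hlim.mono_left nhdsWithin_le_nhds)
  filter_upwards [self_mem_nhdsWithin] with p hp
  obtain ⟨u, v⟩ := p
  obtain ⟨p1, p2, p3⟩ := hp
  obtain ⟨q1, q2, q3⟩ := hst
  simp only at p1 p2 p3 q1 q2 q3 ⊢
  rw [Real.dist_eq]
  have hfst : ∀ u s v : ℝ, 0 ≤ u + v → 0 ≤ s + v → u ≤ S₀ → s ≤ S₀ → v ≤ T₀ →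
      |f u v - f s v| ≤ M * |u - s| ^ κ := by
    intro u s v h1 h2 h3 h4 h5
    rcases le_total s u with h | h
    · rw [abs_of_nonneg (sub_nonneg.2 h)]; exact hf.fst s u v h2 h h3 h5
    · rw [abs_sub_comm, abs_sub_comm u, abs_of_nonneg (sub_nonneg.2 h)]
      exact hf.fst u s v h1 h h4 h5
  have hsnd : ∀ u v t : ℝ, 0 ≤ u + v → 0 ≤ u + t → u ≤ S₀ → v ≤ T₀ → t ≤ T₀ →
      |f u v - f u t| ≤ M * |v - t| ^ κ' := by
    intro u v t h1 h2 h3 h4 h5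
    rcases le_total t v with h | h
    · rw [abs_of_nonneg (sub_nonneg.2 h)]; exact hf.snd u t v h2 h h3 h4
    · rw [abs_sub_comm, abs_sub_comm v, abs_of_nonneg (sub_nonneg.2 h)]
      exact hf.snd u v t h1 h h3 h5
  -- The sums u + t and s + v add up to (u + v) + (s + t) ≥ 0, so at least one of the corners (u,
  -- t), (s, v) lies in the triangle and can serve as intermediate point.
  rcases le_total 0 (u + t) with h | h
  · refine (abs_sub_le _ (f u t) _).trans ?_
    linarith [hfst u s t h q1 p2 q2 q3, hsnd u v t p1 h p2 p3 q3]
  · refine (abs_sub_le _ (f s v) _).trans ?_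
    have h2 : 0 ≤ s + v := by linarith
    linarith [hfst u s v p1 h2 p2 q2 p3, hsnd s v t h2 q1 q2 p3 q3]

/-- The integral over a triangle exists and does not depend on the tiling. -/
theorem exists_hasTriIntegral (hκ : 0 < κ) (hκ' : 0 < κ') (hγ : 0 < γ) (hγ' : 0 < γ')
    (h : 1 < κ + γ) (h' : 1 < κ' + γ') (hγγ : 1 < γ + γ') (hK : 0 ≤ K)
    (hst : 0 ≤ S₀ + T₀) (hf : HolderTri κ κ' M S₀ T₀ f)
    (hx : Continuous fun p : ℝ × ℝ => x p.1 p.2)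
    (hxK : RectBound γ γ' K (-T₀) (S₀ + 1) (-S₀) (T₀ + 1) x) :
    ∃ z, HasTriIntegral γ γ' f x S₀ T₀ z := by
  have hM : 0 ≤ M := (abs_nonneg _).trans (hf.sup S₀ T₀ hst le_rfl le_rfl)
  set e : ℕ → ℝ := fun n => 1 / ((n : ℝ) + 1) with he
  have he0 : ∀ n, 0 < e n := fun n => by positivity
  have he1 : ∀ n, e n ≤ 1 := fun n => by
    simp only [he]; rw [div_le_one (by positivity)]; linarith [Nat.cast_nonneg (α := ℝ) n]
  have hel : Tendsto e atTop (𝓝 0) := tendsto_const_div_nat 1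
  set L := S₀ + T₀ with hL
  set B := youngConst κ κ' γ γ' * K * (M + M * L ^ κ + M * L ^ κ' + M * (L ^ κ * L ^ κ')) with hB
  -- For any tiling the sum of the Young integrals is identified as the limit of the Lebesgue
  -- integrals over the whole triangle, an expression in which the tiling no longer appears. The
  -- tiles have sides at most L, so B times the summable tile sizes dominates every term uniformly
  -- in the averaging scale.
  have key : ∀ a b c d : ℕ → ℝ, IsTiling γ γ' (triSet S₀ T₀) a b c d → ∃ I : ℕ → ℝ,
      (∀ n, HasYoungIntegral f x (a n) (b n) (c n) (d n) (I n)) ∧ Summable I ∧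
      Tendsto (fun k => ∫ p in triSet S₀ T₀, f p.1 p.2 * stekDensity x (e k) p.1 p.2) atTop
        (𝓝 (∑' n, I n)) := by
    intro a b c d ht
    have hn : ∀ n, ∃ z, HasYoungIntegral f x (a n) (b n) (c n) (d n) z ∧
        Tendsto (fun k => ∫ p in Ioc (a n) (b n) ×ˢ Ioc (c n) (d n),
          f p.1 p.2 * stekDensity x (e k) p.1 p.2) atTop (𝓝 z) ∧
        ∀ k, |∫ p in Ioc (a n) (b n) ×ˢ Ioc (c n) (d n),
          f p.1 p.2 * stekDensity x (e k) p.1 p.2| ≤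
            B * ((b n - a n) ^ γ * (d n - c n) ^ γ') := by
      intro n
      rcases (ht.fst_le n).eq_or_lt with hab | hab
      · refine ⟨0, ?_, ?_, ?_⟩
        · rw [hab]; exact hasYoungIntegral_of_eq_fst f x _ _ _
        · simp [hab]
        · intro k; simp [hab, Real.zero_rpow hγ.ne']
      rcases (ht.snd_le n).eq_or_lt with hcd | hcd
      · refine ⟨0, ?_, ?_, ?_⟩
        · rw [hcd]; exact hasYoungIntegral_of_eq_snd f x _ _ _
        · simp [hcd]
        · intro k; simp [hcd, Real.zero_rpow hγ'.ne']
      obtain ⟨m1, m2, m3⟩ := ht.mem hab hcd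
      have hfR := hf.holderRect m1 hab.le hcd.le m2 m3
      have hxR : RectBound γ γ' K (a n) (b n + 1) (c n) (d n + 1) x :=
        fun s₁ s₂ t₁ t₂ h1 h2 h3 h4 h5 h6 => hxK s₁ s₂ t₁ t₂ (by linarith) h2 (by linarith)
          (by linarith) h5 (by linarith)
      obtain ⟨z, hz, -⟩ := exists_youngIntegral hκ hκ' hγ hγ' h h' hK hM hM hM hab.le hcd.le hfR
        (fun s₁ s₂ t₁ t₂ h1 h2 h3 h4 h5 h6 => hxR s₁ s₂ t₁ t₂ h1 h2 (by linarith) h4 h5 (by linarith))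
      obtain ⟨r1, r2⟩ := tendsto_integral_stekDensity hκ hκ' hγ hγ' h h' hK hM hM hM hab.le hcd.le
        hfR hx hxR he0 he1 hel hz
      refine ⟨z, hz, r1, fun k => (r2 k).trans ?_⟩
      have l1 : b n - a n ≤ L := by linarith
      have l2 : d n - c n ≤ L := by linarith
      have l3 : 0 ≤ b n - a n := by linarith
      have l4 : 0 ≤ d n - c n := by linarith
      have hC := youngConst_nonneg h h'
      rw [hB]
      calc _ ≤ youngConst κ κ' γ γ' * K * ((b n - a n) ^ γ * (d n - c n) ^ γ') *
            (M + M * L ^ κ + M * L ^ κ' + M * (L ^ κ * L ^ κ')) := by gcongr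
        _ = _ := by ring
    choose I hI1 hI2 hI3 using hn
    have hIb : ∀ n, |I n| ≤ B * ((b n - a n) ^ γ * (d n - c n) ^ γ') := fun n =>
      le_of_tendsto (hI2 n).abs (Eventually.of_forall (hI3 n))
    have hsum := ht.summable.mul_left B
    refine ⟨I, hI1, Summable.of_norm_bounded hsum hIb, ?_⟩
    have hdom := tendsto_tsum_of_dominated_convergence (𝓕 := atTop) hsum hI2
      (Eventually.of_forall fun k n => hI3 n k)
    refine hdom.congr fun k => ?_
    have hint : IntegrableOn (fun p : ℝ × ℝ => f p.1 p.2 * stekDensity x (e k) p.1 p.2)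
        (⋃ n, Ioc (a n) (b n) ×ˢ Ioc (c n) (d n)) := by
      rw [ht.iUnion_eq]
      exact (((hf.continuousOn hκ hκ').mul (continuous_stekDensity hx
        (e k)).continuousOn).integrableOn_compact (isCompact_closedTri S₀ T₀)).mono_set
          (triSet_subset_closedTri S₀ T₀)
    have := hasSum_integral_iUnion (fun n => measurableSet_Ioc.prod measurableSet_Ioc)
      ht.disjoint hint
    rw [this.tsum_eq, ht.iUnion_eq]
  obtain ⟨a, b, c, d, ht⟩ := exists_tiling_triSet hst hγ hγ' hγγ
  obtain ⟨I, hI, hIs, hIl⟩ := key a b c d ht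
  refine ⟨∑' n, I n, ⟨a, b, c, d, ht⟩, fun a' b' c' d' ht' => ?_⟩
  obtain ⟨I', hI', hIs', hIl'⟩ := key a' b' c' d' ht'
  refine ⟨I', hI', ?_⟩
  rw [tendsto_nhds_unique hIl hIl']
  exact hIs'.hasSum

end

end FracWave

end

noncomputable section

namespace FracWave

/-! ### Weighted Hölder bounds at scale `δ` -/

/-- Increments of `f` over intervals and rectangles with sides at most `δ` in a triangle, measured
relative to the scale `δ` and a weight `w` depending on the time. -/
structure OscBound (κ κ' δ S₀ T₀ : ℝ) (w : ℝ → ℝ) (B : ℝ) (f : ℝ → ℝ → ℝ) : Prop where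
  fst : ∀ s₁ s₂ t, 0 ≤ s₁ + t → s₁ ≤ s₂ → s₂ - s₁ ≤ δ → s₂ ≤ S₀ → t ≤ T₀ →
    |f s₂ t - f s₁ t| ≤ B * w (s₂ + t) * ((s₂ - s₁) / δ) ^ κ
  snd : ∀ s t₁ t₂, 0 ≤ s + t₁ → t₁ ≤ t₂ → t₂ - t₁ ≤ δ → s ≤ S₀ → t₂ ≤ T₀ →
    |f s t₂ - f s t₁| ≤ B * w (s + t₂) * ((t₂ - t₁) / δ) ^ κ'
  rect : ∀ s₁ s₂ t₁ t₂, 0 ≤ s₁ + t₁ → s₁ ≤ s₂ → s₂ - s₁ ≤ δ → t₁ ≤ t₂ → t₂ - t₁ ≤ δ →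
    s₂ ≤ S₀ → t₂ ≤ T₀ →
    |rectIncr f s₁ s₂ t₁ t₂| ≤ B * w (s₂ + t₂) * (((s₂ - s₁) / δ) ^ κ * ((t₂ - t₁) / δ) ^ κ')

/-- Weighted bound of the values of `f` in a triangle. -/
def SupBound (S₀ T₀ : ℝ) (w : ℝ → ℝ) (B : ℝ) (f : ℝ → ℝ → ℝ) : Prop :=
  ∀ s t, 0 ≤ s + t → s ≤ S₀ → t ≤ T₀ → |f s t| ≤ B * w (s + t)

/-- Bound of the increments of the integrator over the rectangles contained in a triangle. -/
def TriBound (γ γ' K S₀ T₀ : ℝ) (x : ℝ → ℝ → ℝ) : Prop :=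
  ∀ s₁ s₂ t₁ t₂, 0 ≤ s₁ + t₁ → s₁ ≤ s₂ → t₁ ≤ t₂ → s₂ ≤ S₀ → t₂ ≤ T₀ →
    |rectIncr x s₁ s₂ t₁ t₂| ≤ K * ((s₂ - s₁) ^ γ * (t₂ - t₁) ^ γ')

/-- The sums of the weight along arithmetic progressions of step `δ` are bounded by `G` times the
largest term. -/
def WeightSum (δ L G : ℝ) (w : ℝ → ℝ) : Prop :=
  ∀ r ≤ L, ∀ n : ℕ, (∀ k < n, (k : ℝ) * δ ≤ r) → ∑ k ∈ Finset.range n, w (r - k * δ) ≤ G * w r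

/-- The interval `[l, t]` is walked from its right end in steps of length δ, the last one cut off at
l; each step is charged to the weight at its right end, which is one of the points t - kδ. -/
lemma abs_sub_le_of_steps {g W : ℝ → ℝ} {l t δ E G : ℝ} (hδ : 0 < δ) (hlt : l ≤ t) (hE : 0 ≤ E)
    (hstep : ∀ u v, l ≤ u → u ≤ v → v ≤ t → v - u ≤ δ → |g v - g u| ≤ E * W v)
    (hsum : ∀ n : ℕ, (∀ k < n, (k : ℝ) * δ ≤ t - l) →
      ∑ k ∈ Finset.range n, W (t - k * δ) ≤ G) :
    |g t - g l| ≤ E * G := by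
  set n := ⌈(t - l) / δ⌉₊ with hn
  set u : ℕ → ℝ := fun k => max l (t - k * δ) with hu
  have hu0 : u 0 = t := by simp [hu, hlt]
  have hun : u n = l := by
    have := Nat.le_ceil ((t - l) / δ)
    rw [div_le_iff₀ hδ] at this
    simp only [hu]; rw [max_eq_left]; linarith
  have hk : ∀ k < n, (k : ℝ) * δ ≤ t - l := fun k hk => by
    have := Nat.lt_ceil.1 hk
    rw [lt_div_iff₀ hδ] at this
    exact this.le
  have e1 : g t - g l = ∑ k ∈ Finset.range n, (g (u k) - g (u (k + 1))) := by
    rw [Finset.sum_range_sub' (fun k => g (u k)), hu0, hun]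
  rw [e1]
  calc _ ≤ ∑ k ∈ Finset.range n, E * W (t - k * δ) := by
        refine (Finset.abs_sum_le_sum_abs _ _).trans (Finset.sum_le_sum fun k hkn => ?_)
        have h1 := hk k (Finset.mem_range.1 hkn)
        have h2 : u k = t - k * δ := max_eq_right (by linarith)
        rw [← h2]
        refine hstep _ _ (le_max_left _ _) ?_ ?_ ?_
        · refine max_le_max le_rfl ?_
          push_cast; linarith
        · rw [h2]; nlinarith [Nat.cast_nonneg (α := ℝ) k]
        · have : t - ((k + 1 : ℕ) : ℝ) * δ ≤ u (k + 1) := le_max_right _ _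
          push_cast at this
          rw [h2]; linarith
    _ = E * ∑ k ∈ Finset.range n, W (t - k * δ) := by rw [Finset.mul_sum]
    _ ≤ E * G := mul_le_mul_of_nonneg_left (hsum n hk) hE

section

variable {κ κ' γ γ' K B δ S₀ T₀ G : ℝ} {w : ℝ → ℝ} {f x y : ℝ → ℝ → ℝ}

lemma mul_rpow_div_le {M r δ κ : ℝ} (hM : 0 ≤ M) (hr : 0 ≤ r) (hδ : 0 < δ) (hrδ : r ≤ δ)
    (hκ : 0 ≤ κ) : M / δ ^ κ * r ^ κ ≤ M := by
  rw [div_mul_eq_mul_div, div_le_iff₀ (Real.rpow_pos_of_pos hδ _)]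
  gcongr

/-- Young estimate over a small rectangle. -/
lemma abs_youngIntegral_le (hκ : 0 < κ) (hκ' : 0 < κ') (hγ : 0 < γ) (hγ' : 0 < γ')
    (h : 1 < κ + γ) (h' : 1 < κ' + γ') (hK : 0 ≤ K) (hB : 0 ≤ B) (hδ : 0 < δ)
    (hw0 : ∀ r, 0 ≤ w r) (hw : Monotone w)
    (hsup : SupBound S₀ T₀ w B f) (hosc : OscBound κ κ' δ S₀ T₀ w B f)
    (hx : TriBound γ γ' K S₀ T₀ x) {s₁ s₂ t₁ t₂ z : ℝ} (h0 : 0 ≤ s₁ + t₁) (hs : s₁ ≤ s₂)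
    (hsδ : s₂ - s₁ ≤ δ) (ht : t₁ ≤ t₂) (htδ : t₂ - t₁ ≤ δ) (hS : s₂ ≤ S₀) (hT : t₂ ≤ T₀)
    (hz : HasYoungIntegral f x s₁ s₂ t₁ t₂ z) :
    |z| ≤ 4 * youngConst κ κ' γ γ' * K * B * w (s₂ + t₂) * ((s₂ - s₁) ^ γ * (t₂ - t₁) ^ γ') := by
  set W := B * w (s₂ + t₂) with hW
  have hW0 : 0 ≤ W := mul_nonneg hB (hw0 _)
  have p1 : 0 < δ ^ κ := Real.rpow_pos_of_pos hδ _
  have p2 : 0 < δ ^ κ' := Real.rpow_pos_of_pos hδ _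
  have hle : ∀ r, r ≤ s₂ + t₂ → B * w r ≤ W := fun r hr => mul_le_mul_of_nonneg_left (hw hr) hB
  -- By monotonicity the weight may be evaluated at the upper right corner throughout. Since the
  -- sides are at most δ, each of the four terms of the Young estimate is then at most W; hence the
  -- factor 4.
  have hf : HolderRect κ κ' W (W / δ ^ κ) (W / δ ^ κ') (W / (δ ^ κ * δ ^ κ')) s₁ s₂ t₁ t₂ f := by
    refine ⟨(hsup _ _ h0 (by linarith) (by linarith)).trans (hle _ (by linarith)), ?_, ?_, ?_⟩
    · intro u v r h1 h2 h3 h4 h5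
      refine (hosc.fst u v r (by linarith) h2 (by linarith) (by linarith) (by linarith)).trans ?_
      rw [Real.div_rpow (by linarith) hδ.le, div_mul_eq_mul_div, ← mul_div_assoc]
      have := hle (v + r) (by linarith)
      have : 0 ≤ (v - u) ^ κ := Real.rpow_nonneg (by linarith) _
      gcongr
    · intro r u v h1 h2 h3 h4 h5
      refine (hosc.snd r u v (by linarith) h4 (by linarith) (by linarith) (by linarith)).trans ?_
      rw [Real.div_rpow (by linarith) hδ.le, div_mul_eq_mul_div, ← mul_div_assoc]
      have := hle (r + v) (by linarith)
      have : 0 ≤ (v - u) ^ κ' := Real.rpow_nonneg (by linarith) _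
      gcongr
    · intro u v r r' h1 h2 h3 h4 h5 h6
      refine (hosc.rect u v r r' (by linarith) h2 (by linarith) h5 (by linarith) (by linarith)
        (by linarith)).trans ?_
      rw [Real.div_rpow (by linarith) hδ.le, Real.div_rpow (by linarith) hδ.le, div_mul_div_comm,
        div_mul_eq_mul_div, ← mul_div_assoc]
      have := hle (v + r') (by linarith)
      have : 0 ≤ (v - u) ^ κ := Real.rpow_nonneg (by linarith) _
      have : 0 ≤ (r' - r) ^ κ' := Real.rpow_nonneg (by linarith) _
      gcongr
  obtain ⟨z', hz', hb, -⟩ := exists_youngIntegral hκ hκ' hγ hγ' h h' hK (by positivity)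
    (by positivity) (by positivity) hs ht hf (fun u v r r' h1 h2 h3 h4 h5 h6 =>
      hx u v r r' (by linarith) h2 h5 (by linarith) (by linarith))
  obtain rfl := hz'.unique hs ht hz
  have b1 := mul_rpow_div_le hW0 (sub_nonneg.2 hs) hδ hsδ hκ.le
  have b2 := mul_rpow_div_le hW0 (sub_nonneg.2 ht) hδ htδ hκ'.le
  have b3 : W / (δ ^ κ * δ ^ κ') * ((s₂ - s₁) ^ κ * (t₂ - t₁) ^ κ') ≤ W := by
    have := mul_rpow_div_le (M := W / δ ^ κ * (s₂ - s₁) ^ κ)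
      (by have : 0 ≤ (s₂ - s₁) ^ κ := Real.rpow_nonneg (by linarith) _
          positivity) (sub_nonneg.2 ht) hδ htδ hκ'.le
    refine le_trans (le_of_eq ?_) (this.trans b1)
    field_simp
  have hC := youngConst_nonneg h h'
  have n1 : 0 ≤ (s₂ - s₁) ^ γ := Real.rpow_nonneg (by linarith) _
  have n2 : 0 ≤ (t₂ - t₁) ^ γ' := Real.rpow_nonneg (by linarith) _
  refine hb.trans ?_
  calc _ ≤ youngConst κ κ' γ γ' * K * ((s₂ - s₁) ^ γ * (t₂ - t₁) ^ γ') * (W + W + W + W) := by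
        gcongr
    _ = _ := by rw [hW]; ring

/-- Bounds of the increments of a function by `A` times powers of the sides. -/
structure IncrBound (γ γ' δ S₀ T₀ : ℝ) (w : ℝ → ℝ) (A A' : ℝ) (y : ℝ → ℝ → ℝ) : Prop where
  rect : ∀ s₁ s₂ t₁ t₂, 0 ≤ s₁ + t₁ → s₁ ≤ s₂ → s₂ - s₁ ≤ δ → t₁ ≤ t₂ → t₂ - t₁ ≤ δ →
    s₂ ≤ S₀ → t₂ ≤ T₀ →
    |rectIncr y s₁ s₂ t₁ t₂| ≤ A * w (s₂ + t₂) * ((s₂ - s₁) ^ γ * (t₂ - t₁) ^ γ')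
  fst : ∀ s₁ s₂ t, 0 ≤ s₁ + t → s₁ ≤ s₂ → s₂ - s₁ ≤ δ → s₂ ≤ S₀ → t ≤ T₀ →
    |y s₂ t - y s₁ t| ≤ A' * w (s₂ + t) * ((s₂ - s₁) ^ γ * δ ^ γ')
  snd : ∀ s t₁ t₂, 0 ≤ s + t₁ → t₁ ≤ t₂ → t₂ - t₁ ≤ δ → s ≤ S₀ → t₂ ≤ T₀ →
    |y s t₂ - y s t₁| ≤ A' * w (s + t₂) * (δ ^ γ * (t₂ - t₁) ^ γ')
  tri : ∀ s t, 0 ≤ s + t → s + t ≤ δ → s ≤ S₀ → t ≤ T₀ →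
    |y s t| ≤ A' * w (s + t) * (s + t) ^ (γ + γ')

/-- A triangle with vertex on the antidiagonal is empty, and all its dyadic tiles are degenerate. -/
lemma IsPotential.eq_zero (hy : IsPotential f x S₀ T₀ y) {s : ℝ} (hS : s ≤ S₀) (hT : -s ≤ T₀) :
    y s (-s) = 0 := by
  obtain ⟨I, hI, hsum⟩ := hy.tri s (-s) (by simp) hS hT
  have h1 : I = fun _ => 0 := by
    funext i
    have e1 := dyadic_fst_sub s (-s) i
    have e2 := dyadic_snd_sub s (-s) i
    simp only [dyadicSide, add_neg_cancel, zero_div, ite_self] at e1 e2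
    have e3 : dyadicRight s (-s) i = dyadicLeft s (-s) i := by linarith
    have := hI i
    rw [e3] at this
    exact this.unique le_rfl (by linarith) (hasYoungIntegral_of_eq_fst f x _ _ _)
  rw [h1] at hsum
  exact hsum.unique hasSum_zero

/-- The increment from (s₁, t) to (s₂, t) is the integral over the part of the triangle between s₁
and s₂: a column of cells of height at most δ, whose weights sum to at most G times the largest,
standing on the triangle with vertex (s₂, -s₁), whose dyadic tiles contribute `dyadicConst`. The
condition κ ≤ γ is not needed here, which is what later makes regularity for all exponents possible.
-/
theorem IsPotential.incrBound (hκ : 0 < κ) (hκ' : 0 < κ') (hγ : 0 < γ) (hγ' : 0 < γ')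
    (h : 1 < κ + γ) (h' : 1 < κ' + γ') (hγγ : 1 < γ + γ') (hK : 0 ≤ K) (hB : 0 ≤ B) (hδ : 0 < δ)
    (hG : 0 ≤ G) (hw0 : ∀ r, 0 ≤ w r) (hw : Monotone w) (hwG : WeightSum δ (S₀ + T₀) G w)
    (hsup : SupBound S₀ T₀ w B f) (hosc : OscBound κ κ' δ S₀ T₀ w B f)
    (hx : TriBound γ γ' K S₀ T₀ x) (hy : IsPotential f x S₀ T₀ y) :
    IncrBound γ γ' δ S₀ T₀ w (4 * youngConst κ κ' γ γ' * K * B)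
      (4 * youngConst κ κ' γ γ' * K * B * (G + dyadicConst (γ + γ'))) y := by
  set A := 4 * youngConst κ κ' γ γ' * K * B with hA
  set D := dyadicConst (γ + γ') with hD
  have hC := youngConst_nonneg h h'
  have hA0 : 0 ≤ A := by positivity
  have hD0 : 0 ≤ D := dyadicConst_nonneg _
  have hrect : ∀ s₁ s₂ t₁ t₂, 0 ≤ s₁ + t₁ → s₁ ≤ s₂ → s₂ - s₁ ≤ δ → t₁ ≤ t₂ → t₂ - t₁ ≤ δ →
      s₂ ≤ S₀ → t₂ ≤ T₀ →
      |rectIncr y s₁ s₂ t₁ t₂| ≤ A * w (s₂ + t₂) * ((s₂ - s₁) ^ γ * (t₂ - t₁) ^ γ') :=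
    fun s₁ s₂ t₁ t₂ h0 hs hsδ ht htδ hS hT => abs_youngIntegral_le hκ hκ' hγ hγ' h h' hK hB hδ hw0 hw
      hsup hosc hx h0 hs hsδ ht htδ hS hT (hy.rect s₁ s₂ t₁ t₂ h0 hs ht hS hT)
  have htri : ∀ s t, 0 ≤ s + t → s + t ≤ δ → s ≤ S₀ → t ≤ T₀ →
      |y s t| ≤ A * D * w (s + t) * (s + t) ^ (γ + γ') := by
    intro s t h0 hstδ hS hT
    obtain ⟨I, hI, hsum⟩ := hy.tri s t h0 hS hT
    have ht := dyadic_tiling h0 hγ hγ' hγγ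
    have hb : ∀ i, ‖I i‖ ≤ A * w (s + t) * ((s + t) ^ (γ + γ') * dyadicWeight (γ + γ') i) := by
      intro i
      rw [← dyadic_size h0 hγ hγ', Real.norm_eq_abs]
      have hi := hI i
      have l1 := ht.fst_le i
      have l2 := ht.snd_le i
      rcases l1.eq_or_lt with hab | hab
      · have : I i = 0 := hi.unique l1 l2 (by rw [hab]; exact hasYoungIntegral_of_eq_fst f x _ _ _)
        rw [this, hab, sub_self, Real.zero_rpow hγ.ne']; simp
      rcases l2.eq_or_lt with hcd | hcd
      · have : I i = 0 := hi.unique l1 l2 (by rw [hcd]; exact hasYoungIntegral_of_eq_snd f x _ _ _)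
        rw [this, hcd, sub_self, Real.zero_rpow hγ'.ne']; simp
      obtain ⟨m1, m2, m3⟩ := ht.mem hab hcd
      refine (abs_youngIntegral_le hκ hκ' hγ hγ' h h' hK hB hδ hw0 hw hsup hosc hx m1 l1
        (by linarith) l2 (by linarith) (by linarith) (by linarith) hi).trans ?_
      have n1 : 0 ≤ (dyadicRight s t i - dyadicLeft s t i) ^ γ := Real.rpow_nonneg (by linarith) _
      have n2 : 0 ≤ (dyadicUpper s t i - dyadicLower s t i) ^ γ' := Real.rpow_nonneg (by linarith) _
      have := hw (show dyadicRight s t i + dyadicUpper s t i ≤ s + t by linarith)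
      rw [← hA]
      gcongr
    have := tsum_of_norm_bounded
      (((summable_dyadicWeight hγγ).hasSum.mul_left ((s + t) ^ (γ + γ'))).mul_left (A * w (s + t))) hb
    rw [hsum.tsum_eq, Real.norm_eq_abs] at this
    refine this.trans (le_of_eq ?_)
    rw [hD, dyadicConst]; ring
  refine ⟨hrect, ?_, ?_, ?_⟩
  · intro s₁ s₂ t h0 hs hsδ hS hT
    have n1 : 0 ≤ (s₂ - s₁) ^ γ := Real.rpow_nonneg (by linarith) _
    have e1 := abs_sub_le_of_steps (g := fun u => y s₂ u - y s₁ u) (W := fun u => w (s₂ + u))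
      (l := -s₁) (t := t) (E := A * ((s₂ - s₁) ^ γ * δ ^ γ')) (G := G * w (s₂ + t)) hδ
      (by linarith) (by positivity)
      (fun u v h1 h2 h3 h4 => by
        have := hrect s₁ s₂ u v (by linarith) hs hsδ h2 h4 hS (by linarith)
        have e : y s₂ v - y s₁ v - (y s₂ u - y s₁ u) = rectIncr y s₁ s₂ u v := by
          unfold rectIncr; ring
        simp only [e]
        refine this.trans ?_
        calc A * w (s₂ + v) * ((s₂ - s₁) ^ γ * (v - u) ^ γ')
            ≤ A * w (s₂ + v) * ((s₂ - s₁) ^ γ * δ ^ γ') := by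
              have := hw0 (s₂ + v)
              have : 0 ≤ v - u := by linarith
              gcongr
          _ = _ := by ring)
      (fun n hn => by
        have := hwG (s₂ + t) (by linarith) n (fun k hk => (hn k hk).trans (by linarith))
        simpa only [add_sub_assoc] using this)
    have e2 := htri s₂ (-s₁) (by linarith) (by linarith) hS (by linarith)
    have e3 : y s₁ (-s₁) = 0 := hy.eq_zero (by linarith) (by linarith)
    have e4 : |y s₂ (-s₁)| ≤ A * D * w (s₂ + t) * ((s₂ - s₁) ^ γ * δ ^ γ') := by
      refine e2.trans ?_
      rw [← sub_eq_add_neg, Real.rpow_add_of_nonneg (by linarith) hγ.le hγ'.le]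
      have := hw (show s₂ - s₁ ≤ s₂ + t by linarith)
      have := hw0 (s₂ + t)
      have : 0 ≤ s₂ - s₁ := by linarith
      have := hw0 (s₂ - s₁)
      gcongr
    simp only [e3, sub_zero] at e1
    have e5 := abs_sub_abs_le_abs_sub (y s₂ t - y s₁ t) (y s₂ (-s₁))
    have e6 : A * (G + D) * w (s₂ + t) * ((s₂ - s₁) ^ γ * δ ^ γ') =
      A * ((s₂ - s₁) ^ γ * δ ^ γ') * (G * w (s₂ + t)) +
        A * D * w (s₂ + t) * ((s₂ - s₁) ^ γ * δ ^ γ') := by ring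
    rw [e6]; linarith
  · intro s t₁ t₂ h0 ht htδ hS hT
    have n1 : 0 ≤ (t₂ - t₁) ^ γ' := Real.rpow_nonneg (by linarith) _
    have e1 := abs_sub_le_of_steps (g := fun u => y u t₂ - y u t₁) (W := fun u => w (u + t₂))
      (l := -t₁) (t := s) (E := A * (δ ^ γ * (t₂ - t₁) ^ γ')) (G := G * w (s + t₂)) hδ
      (by linarith) (by positivity)
      (fun u v h1 h2 h3 h4 => by
        have := hrect u v t₁ t₂ (by linarith) h2 h4 ht htδ (by linarith) hT
        have e : y v t₂ - y v t₁ - (y u t₂ - y u t₁) = rectIncr y u v t₁ t₂ := by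
          unfold rectIncr; ring
        simp only [e]
        refine this.trans ?_
        calc A * w (v + t₂) * ((v - u) ^ γ * (t₂ - t₁) ^ γ')
            ≤ A * w (v + t₂) * (δ ^ γ * (t₂ - t₁) ^ γ') := by
              have := hw0 (v + t₂)
              have : 0 ≤ v - u := by linarith
              gcongr
          _ = _ := by ring)
      (fun n hn => by
        have := hwG (s + t₂) (by linarith) n (fun k hk => (hn k hk).trans (by linarith))
        refine le_trans (le_of_eq (Finset.sum_congr rfl fun k _ => ?_)) this
        congr 1; ring)
    have e2 := htri (-t₁) t₂ (by linarith) (by linarith) (by linarith) hT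
    have e3 : y (-t₁) t₁ = 0 := by
      have := hy.eq_zero (s := -t₁) (by linarith) (by linarith)
      rwa [neg_neg] at this
    have e4 : |y (-t₁) t₂| ≤ A * D * w (s + t₂) * (δ ^ γ * (t₂ - t₁) ^ γ') := by
      refine e2.trans ?_
      rw [neg_add_eq_sub, Real.rpow_add_of_nonneg (by linarith) hγ.le hγ'.le]
      have := hw (show t₂ - t₁ ≤ s + t₂ by linarith)
      have := hw0 (s + t₂)
      have : 0 ≤ t₂ - t₁ := by linarith
      have := hw0 (t₂ - t₁)
      gcongr
    simp only [e3, sub_zero] at e1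
    have e5 := abs_sub_abs_le_abs_sub (y s t₂ - y s t₁) (y (-t₁) t₂)
    have e6 : A * (G + D) * w (s + t₂) * (δ ^ γ * (t₂ - t₁) ^ γ') =
      A * (δ ^ γ * (t₂ - t₁) ^ γ') * (G * w (s + t₂)) +
        A * D * w (s + t₂) * (δ ^ γ * (t₂ - t₁) ^ γ') := by ring
    rw [e6]; linarith
  · intro s t h0 h1 h2 h3
    refine (htri s t h0 h1 h2 h3).trans ?_
    have := hw0 (s + t)
    have : 0 ≤ (s + t) ^ (γ + γ') := Real.rpow_nonneg h0 _
    gcongr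
    linarith

/-- The indefinite integral gains a power of the scale `δ`. -/
theorem IsPotential.bounds (hκ : 0 < κ) (hκ' : 0 < κ') (hκγ : κ ≤ γ) (hκγ' : κ' ≤ γ')
    (h : 1 < κ + γ) (h' : 1 < κ' + γ') (hγγ : 1 < γ + γ') (hK : 0 ≤ K) (hB : 0 ≤ B) (hδ : 0 < δ)
    (hG : 1 ≤ G) (hw0 : ∀ r, 0 ≤ w r) (hw : Monotone w) (hwG : WeightSum δ (S₀ + T₀) G w)
    (hsup : SupBound S₀ T₀ w B f) (hosc : OscBound κ κ' δ S₀ T₀ w B f)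
    (hx : TriBound γ γ' K S₀ T₀ x) (hy : IsPotential f x S₀ T₀ y) :
    OscBound κ κ' δ S₀ T₀ w (4 * youngConst κ κ' γ γ' * K * B * (G + dyadicConst (γ + γ')) *
      δ ^ (γ + γ')) y ∧
    SupBound S₀ T₀ w (4 * youngConst κ κ' γ γ' * K * B * (G + dyadicConst (γ + γ')) *
      δ ^ (γ + γ') * G) y := by
  have hγ : 0 < γ := by linarith
  have hγ' : 0 < γ' := by linarith
  obtain ⟨hr, h1, h2, -⟩ := hy.incrBound hκ hκ' hγ hγ' h h' hγγ hK hB hδ (by linarith) hw0 hw hwG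
    hsup hosc hx
  set A := 4 * youngConst κ κ' γ γ' * K * B with hA
  set D := dyadicConst (γ + γ') with hD
  have hC := youngConst_nonneg h h'
  have hA0 : 0 ≤ A := by positivity
  have hD0 : 0 ≤ D := dyadicConst_nonneg _
  have hG0 : 0 ≤ G := by linarith
  -- For r ≤ δ the exponent of r / δ can be lowered from γ to κ for free, leaving δ^γ as the gain.
  have hsc : ∀ {r κ γ : ℝ}, 0 < κ → κ ≤ γ → 0 ≤ r → r ≤ δ → r ^ γ ≤ δ ^ γ * (r / δ) ^ κ := by
    intro r κ γ hκ hκγ hr hrδ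
    have e : r ^ γ = δ ^ γ * (r / δ) ^ γ := by
      rw [← Real.mul_rpow hδ.le (by positivity)]; congr 1; field_simp
    rw [e]
    refine mul_le_mul_of_nonneg_left ?_ (by positivity)
    exact Real.rpow_le_rpow_of_exponent_ge_of_imp (by positivity) ((div_le_one hδ).2 hrδ) hκγ
      (fun _ h0 => by linarith)
  have hadd : δ ^ (γ + γ') = δ ^ γ * δ ^ γ' := Real.rpow_add hδ _ _
  refine ⟨⟨?_, ?_, ?_⟩, ?_⟩
  · intro s₁ s₂ t h0 hs hsδ hS hT
    refine (h1 s₁ s₂ t h0 hs hsδ hS hT).trans ?_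
    rw [hadd]
    have := hsc hκ hκγ (sub_nonneg.2 hs) hsδ
    have := hw0 (s₂ + t)
    calc _ ≤ A * (G + D) * w (s₂ + t) * (δ ^ γ * ((s₂ - s₁) / δ) ^ κ * δ ^ γ') := by gcongr
      _ = _ := by ring
  · intro s t₁ t₂ h0 ht htδ hS hT
    refine (h2 s t₁ t₂ h0 ht htδ hS hT).trans ?_
    rw [hadd]
    have := hsc hκ' hκγ' (sub_nonneg.2 ht) htδ
    have := hw0 (s + t₂)
    calc _ ≤ A * (G + D) * w (s + t₂) * (δ ^ γ * (δ ^ γ' * ((t₂ - t₁) / δ) ^ κ')) := by gcongr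
      _ = _ := by ring
  · intro s₁ s₂ t₁ t₂ h0 hs hsδ ht htδ hS hT
    refine (hr s₁ s₂ t₁ t₂ h0 hs hsδ ht htδ hS hT).trans ?_
    rw [hadd]
    have a1 := hsc hκ hκγ (sub_nonneg.2 hs) hsδ
    have a2 := hsc hκ' hκγ' (sub_nonneg.2 ht) htδ
    have := hw0 (s₂ + t₂)
    have : 0 ≤ (t₂ - t₁) ^ γ' := Real.rpow_nonneg (by linarith) _
    have : 0 ≤ (s₂ - s₁) ^ γ := Real.rpow_nonneg (by linarith) _
    have : 0 ≤ ((s₂ - s₁) / δ) ^ κ := Real.rpow_nonneg (div_nonneg (by linarith) hδ.le) _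
    have : 0 ≤ ((t₂ - t₁) / δ) ^ κ' := Real.rpow_nonneg (div_nonneg (by linarith) hδ.le) _
    have hGD : A ≤ A * (G + D) := le_mul_of_one_le_right hA0 (by linarith)
    calc _ ≤ A * (G + D) * w (s₂ + t₂) *
          ((δ ^ γ * ((s₂ - s₁) / δ) ^ κ) * (δ ^ γ' * ((t₂ - t₁) / δ) ^ κ')) := by gcongr
      _ = _ := by ring
  · intro s t h0 hS hT
    -- The values are reached by a second walk in steps of length δ, starting on the antidiagonal
    -- where y vanishes; it costs one more factor G.
    have e1 := abs_sub_le_of_steps (g := fun u => y u t) (W := fun u => w (u + t))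
      (l := -t) (t := s) (E := A * (G + D) * δ ^ (γ + γ')) (G := G * w (s + t)) hδ
      (by linarith) (by positivity)
      (fun u v a1 a2 a3 a4 => by
        refine (h1 u v t (by linarith) a2 a4 (by linarith) hT).trans ?_
        rw [hadd]
        have := hw0 (v + t)
        have : 0 ≤ v - u := by linarith
        calc _ ≤ A * (G + D) * w (v + t) * (δ ^ γ * δ ^ γ') := by gcongr
          _ = _ := by ring)
      (fun n hn => by
        have := hwG (s + t) (by linarith) n (fun k hk => (hn k hk).trans (by linarith))
        refine le_trans (le_of_eq (Finset.sum_congr rfl fun k _ => ?_)) this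
        congr 1; ring)
    have e3 : y (-t) t = 0 := by
      have := hy.eq_zero (s := -t) (by linarith) (by linarith)
      rwa [neg_neg] at this
    simp only [e3, sub_zero] at e1
    exact e1.trans (le_of_eq (by ring))

end

/-- At most L/δ + 1 steps of length δ fit. This loss of one power of δ is affordable because the
integral gains δ^(γ+γ') with γ + γ' > 1. -/
lemma weightSum_one {δ L : ℝ} (hδ : 0 < δ) (hL : 0 ≤ L) :
    WeightSum δ L (L / δ + 1) (fun _ => 1) := by
  intro r hr n hn
  simp only [Finset.sum_const, Finset.card_range, nsmul_eq_mul, mul_one]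
  rcases Nat.eq_zero_or_pos n with rfl | h0
  · simp; positivity
  · have := hn (n - 1) (by omega)
    rw [Nat.cast_sub h0, Nat.cast_one] at this
    have h2 : ((n : ℝ) - 1) ≤ L / δ := by rw [le_div_iff₀ hδ]; linarith
    linarith

/-- Along steps of length δ the exponential weight decays by the factor 1/e ≤ 1/2, so the sum is at
most twice its largest term, independently of L and δ. This is what makes the contraction global in
time. -/
lemma weightSum_exp {δ L : ℝ} (hδ : 0 < δ) :
    WeightSum δ L 2 (fun r => Real.exp (r / δ)) := by
  intro r hr n hn
  have e : ∀ k : ℕ, Real.exp ((r - k * δ) / δ) = Real.exp (r / δ) * (Real.exp (-1)) ^ k := by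
    intro k
    rw [← Real.exp_nat_mul, ← Real.exp_add]; congr 1; field_simp; ring
  simp only [e, ← Finset.mul_sum]
  rw [mul_comm]
  refine mul_le_mul_of_nonneg_right ?_ (Real.exp_pos _).le
  have h2 : Real.exp (-1) ≤ 1 / 2 := by
    rw [Real.exp_neg, one_div]
    refine inv_anti₀ (by norm_num) ?_
    have := Real.add_one_le_exp (1 : ℝ); linarith
  calc ∑ k ∈ Finset.range n, Real.exp (-1) ^ k ≤ ∑ k ∈ Finset.range n, (1 / 2 : ℝ) ^ k :=
        Finset.sum_le_sum fun k _ => by gcongr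
    _ ≤ 2 := sum_geometric_two_le n

end FracWave

end

noncomputable section

namespace FracWave

/-! ### Composition with the nonlinearity -/

/-- `τ` is differentiable with a bounded and Lipschitz derivative. -/
structure SmoothBound (C : ℝ) (τ : ℝ → ℝ) : Prop where
  differentiable : Differentiable ℝ τ
  bound : ∀ r, |τ r| ≤ C
  deriv_bound : ∀ r, |deriv τ r| ≤ C
  deriv_lip : ∀ r r', |deriv τ r - deriv τ r'| ≤ C * |r - r'|

lemma abs_sub_le_of_deriv_le {τ : ℝ → ℝ} {C : ℝ} (hτ : Differentiable ℝ τ)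
    (hC : ∀ r, |deriv τ r| ≤ C) (r r' : ℝ) : |τ r - τ r'| ≤ C * |r - r'| :=
  convex_univ.norm_image_sub_le_of_norm_deriv_le (𝕜 := ℝ) (fun x _ => hτ x) (fun x _ => hC x)
    (mem_univ _) (mem_univ _)

lemma SmoothBound.lip {C : ℝ} {τ : ℝ → ℝ} (h : SmoothBound C τ) (r r' : ℝ) :
    |τ r - τ r'| ≤ C * |r - r'| := abs_sub_le_of_deriv_le h.differentiable h.deriv_bound r r'

/-- Replacing d by the fourth corner b + c - a of a parallelogram costs C times the rectangular
increment. What remains is the increment between a and b of r ↦ τ(r + (c - a)) - τ(r), whose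
derivative is at most C |c - a|. -/
lemma SmoothBound.rect {C : ℝ} {τ : ℝ → ℝ} (h : SmoothBound C τ) (a b c d : ℝ) :
    |τ a - τ b - τ c + τ d| ≤ C * |a - b - c + d| + C * (|b - a| * |c - a|) := by
  have e1 := h.lip d (b + c - a)
  have hd : Differentiable ℝ fun r => τ (r + (c - a)) - τ r :=
    (h.differentiable.comp (by fun_prop : Differentiable ℝ fun r : ℝ => r + (c - a))).sub
      h.differentiable
  have e2 := abs_sub_le_of_deriv_le hd (C := C * |c - a|) (fun r => by
    have : deriv (fun r => τ (r + (c - a)) - τ r) r = deriv τ (r + (c - a)) - deriv τ r := by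
      have h1 : DifferentiableAt ℝ (fun r => τ (r + (c - a))) r :=
        (h.differentiable _).comp r (by fun_prop : DifferentiableAt ℝ (fun r : ℝ => r + (c - a)) r)
      rw [deriv_fun_sub h1 (h.differentiable r), deriv_comp_add_const]
    rw [this]
    refine (h.deriv_lip _ _).trans (le_of_eq ?_)
    simp) b a
  rw [show b + (c - a) = b + c - a by ring, show a + (c - a) = c by ring] at e2
  rw [show d - (b + c - a) = a - b - c + d by ring] at e1
  rw [abs_le] at e1 e2 ⊢
  constructor <;> nlinarith [e1.1, e1.2, e2.1, e2.2]

section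

variable {κ κ' δ S₀ T₀ B C : ℝ} {w : ℝ → ℝ} {σ : ℝ → ℝ} {z z' : ℝ → ℝ → ℝ}

/-- Composition with a smooth function. -/
lemma OscBound.comp (hδ : 0 < δ) (hσ : SmoothBound C σ)
    (hz : OscBound κ κ' δ S₀ T₀ (fun _ => 1) 1 z) :
    SupBound S₀ T₀ (fun _ => 1) (2 * C) (fun s t => σ (z s t)) ∧
    OscBound κ κ' δ S₀ T₀ (fun _ => 1) (2 * C) (fun s t => σ (z s t)) := by
  have hC : 0 ≤ C := (abs_nonneg _).trans (hσ.bound 0)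
  refine ⟨fun s t _ _ _ => (hσ.bound _).trans (by linarith), ?_, ?_, ?_⟩
  · intro s₁ s₂ t h0 hs hsδ hS hT
    have := hz.fst s₁ s₂ t h0 hs hsδ hS hT
    have n1 : 0 ≤ ((s₂ - s₁) / δ) ^ κ := Real.rpow_nonneg (div_nonneg (by linarith) hδ.le) _
    have e := hσ.lip (z s₂ t) (z s₁ t)
    have := mul_le_mul_of_nonneg_left this hC
    nlinarith [mul_nonneg hC n1]
  · intro s t₁ t₂ h0 ht htδ hS hT
    have := hz.snd s t₁ t₂ h0 ht htδ hS hT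
    have n1 : 0 ≤ ((t₂ - t₁) / δ) ^ κ' := Real.rpow_nonneg (div_nonneg (by linarith) hδ.le) _
    have e := hσ.lip (z s t₂) (z s t₁)
    have := mul_le_mul_of_nonneg_left this hC
    nlinarith [mul_nonneg hC n1]
  · intro s₁ s₂ t₁ t₂ h0 hs hsδ ht htδ hS hT
    have n1 : 0 ≤ ((s₂ - s₁) / δ) ^ κ := Real.rpow_nonneg (div_nonneg (by linarith) hδ.le) _
    have n2 : 0 ≤ ((t₂ - t₁) / δ) ^ κ' := Real.rpow_nonneg (div_nonneg (by linarith) hδ.le) _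
    have e1 := hz.fst s₁ s₂ t₁ h0 hs hsδ hS (by linarith)
    have e2 := hz.snd s₁ t₁ t₂ h0 ht htδ (by linarith) hT
    have e3 := hz.rect s₁ s₂ t₁ t₂ h0 hs hsδ ht htδ hS hT
    simp only [mul_one, one_mul] at e1 e2 e3 ⊢
    have e := hσ.rect (z s₁ t₁) (z s₁ t₂) (z s₂ t₁) (z s₂ t₂)
    refine e.trans ?_
    have p1 := mul_le_mul e2 e1 (abs_nonneg _) n2
    calc C * |z s₁ t₁ - z s₁ t₂ - z s₂ t₁ + z s₂ t₂| +
          C * (|z s₁ t₂ - z s₁ t₁| * |z s₂ t₁ - z s₁ t₁|)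
        ≤ C * (((s₂ - s₁) / δ) ^ κ * ((t₂ - t₁) / δ) ^ κ') +
          C * (((t₂ - t₁) / δ) ^ κ' * ((s₂ - s₁) / δ) ^ κ) := by
          gcongr; exact e3
      _ = _ := by ring

lemma abs_convexComb_le {a b θ r : ℝ} (h0 : 0 ≤ θ) (h1 : θ ≤ 1) (ha : |a| ≤ r) (hb : |b| ≤ r) :
    |b + θ * (a - b)| ≤ r := by
  rw [abs_le] at *
  constructor <;> nlinarith

/-- Difference of two compositions with a smooth function. -/
lemma OscBound.comp_sub (hδ : 0 < δ) (hB : 0 ≤ B) (hw0 : ∀ r, 0 ≤ w r) (hw : Monotone w)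
    (hσ : SmoothBound C σ) (hσ' : SmoothBound C (deriv σ))
    (hz : OscBound κ κ' δ S₀ T₀ (fun _ => 1) 1 z) (hz' : OscBound κ κ' δ S₀ T₀ (fun _ => 1) 1 z')
    (hd : OscBound κ κ' δ S₀ T₀ w B (fun s t => z s t - z' s t))
    (hs : SupBound S₀ T₀ w B (fun s t => z s t - z' s t)) :
    SupBound S₀ T₀ w (5 * C * B) (fun s t => σ (z s t) - σ (z' s t)) ∧
    OscBound κ κ' δ S₀ T₀ w (5 * C * B) (fun s t => σ (z s t) - σ (z' s t)) := by
  have hC : 0 ≤ C := (abs_nonneg _).trans (hσ.bound 0)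
  refine ⟨?_, ?_, ?_, ?_⟩
  · intro s t h0 hS hT
    have e1 := hs s t h0 hS hT
    have e2 := hσ.lip (z s t) (z' s t)
    have e3 := mul_le_mul_of_nonneg_left e1 hC
    have := mul_nonneg hC (mul_nonneg hB (hw0 (s + t)))
    nlinarith
  · intro s₁ s₂ t h0 hs' hsδ hS hT
    have n1 : 0 ≤ ((s₂ - s₁) / δ) ^ κ := Real.rpow_nonneg (div_nonneg (by linarith) hδ.le) _
    have e0 := hs s₁ t h0 (by linarith) hT
    have e1 := hd.fst s₁ s₂ t h0 hs' hsδ hS hT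
    have e2 := hz'.fst s₁ s₂ t h0 hs' hsδ hS hT
    -- An increment of the difference σ(z) - σ(z') is itself a rectangular increment of σ, one
    -- direction being the passage from z' to z and the other the passage from s₁ to s₂.
    have e := hσ.rect (z' s₁ t) (z s₁ t) (z' s₂ t) (z s₂ t)
    have e0' : |z s₁ t - z' s₁ t| ≤ B * w (s₂ + t) :=
      e0.trans (mul_le_mul_of_nonneg_left (hw (by linarith)) hB)
    simp only [mul_one, one_mul] at e2
    set W := B * w (s₂ + t) with hW
    have hW0 : 0 ≤ W := mul_nonneg hB (hw0 _)
    have p1 := mul_le_mul e0' e2 (abs_nonneg _) hW0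
    calc |σ (z s₂ t) - σ (z' s₂ t) - (σ (z s₁ t) - σ (z' s₁ t))|
        = |σ (z' s₁ t) - σ (z s₁ t) - σ (z' s₂ t) + σ (z s₂ t)| := by congr 1; ring
      _ ≤ C * |z' s₁ t - z s₁ t - z' s₂ t + z s₂ t| +
          C * (|z s₁ t - z' s₁ t| * |z' s₂ t - z' s₁ t|) := e
      _ = C * |z s₂ t - z' s₂ t - (z s₁ t - z' s₁ t)| +
          C * (|z s₁ t - z' s₁ t| * |z' s₂ t - z' s₁ t|) := by congr 3; ring
      _ ≤ C * (W * ((s₂ - s₁) / δ) ^ κ) + C * (W * ((s₂ - s₁) / δ) ^ κ) := by gcongr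
      _ ≤ 5 * C * B * w (s₂ + t) * ((s₂ - s₁) / δ) ^ κ := by
          have := mul_nonneg hC (mul_nonneg hW0 n1)
          rw [show 5 * C * B * w (s₂ + t) * ((s₂ - s₁) / δ) ^ κ =
            5 * (C * (W * ((s₂ - s₁) / δ) ^ κ)) by rw [hW]; ring]
          linarith
  · intro s t₁ t₂ h0 ht htδ hS hT
    have n1 : 0 ≤ ((t₂ - t₁) / δ) ^ κ' := Real.rpow_nonneg (div_nonneg (by linarith) hδ.le) _
    have e0 := hs s t₁ h0 hS (by linarith)
    have e1 := hd.snd s t₁ t₂ h0 ht htδ hS hT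
    have e2 := hz'.snd s t₁ t₂ h0 ht htδ hS hT
    have e := hσ.rect (z' s t₁) (z s t₁) (z' s t₂) (z s t₂)
    have e0' : |z s t₁ - z' s t₁| ≤ B * w (s + t₂) :=
      e0.trans (mul_le_mul_of_nonneg_left (hw (by linarith)) hB)
    simp only [mul_one, one_mul] at e2
    set W := B * w (s + t₂) with hW
    have hW0 : 0 ≤ W := mul_nonneg hB (hw0 _)
    have p1 := mul_le_mul e0' e2 (abs_nonneg _) hW0
    calc |σ (z s t₂) - σ (z' s t₂) - (σ (z s t₁) - σ (z' s t₁))|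
        = |σ (z' s t₁) - σ (z s t₁) - σ (z' s t₂) + σ (z s t₂)| := by congr 1; ring
      _ ≤ C * |z' s t₁ - z s t₁ - z' s t₂ + z s t₂| +
          C * (|z s t₁ - z' s t₁| * |z' s t₂ - z' s t₁|) := e
      _ = C * |z s t₂ - z' s t₂ - (z s t₁ - z' s t₁)| +
          C * (|z s t₁ - z' s t₁| * |z' s t₂ - z' s t₁|) := by congr 3; ring
      _ ≤ C * (W * ((t₂ - t₁) / δ) ^ κ') + C * (W * ((t₂ - t₁) / δ) ^ κ') := by gcongr
      _ ≤ 5 * C * B * w (s + t₂) * ((t₂ - t₁) / δ) ^ κ' := by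
          have := mul_nonneg hC (mul_nonneg hW0 n1)
          rw [show 5 * C * B * w (s + t₂) * ((t₂ - t₁) / δ) ^ κ' =
            5 * (C * (W * ((t₂ - t₁) / δ) ^ κ')) by rw [hW]; ring]
          linarith
  · intro s₁ s₂ t₁ t₂ h0 hs' hsδ ht htδ hS hT
    set ra := ((s₂ - s₁) / δ) ^ κ with hra
    set rb := ((t₂ - t₁) / δ) ^ κ' with hrb
    have n1 : 0 ≤ ra := Real.rpow_nonneg (div_nonneg (by linarith) hδ.le) _
    have n2 : 0 ≤ rb := Real.rpow_nonneg (div_nonneg (by linarith) hδ.le) _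
    set W := B * w (s₂ + t₂) with hW
    have hW0 : 0 ≤ W := mul_nonneg hB (hw0 _)
    have d0 : |z s₂ t₂ - z' s₂ t₂| ≤ W := hs s₂ t₂ (by linarith) hS hT
    have d1 : |(z s₂ t₂ - z' s₂ t₂) - (z s₁ t₂ - z' s₁ t₂)| ≤ W * ra :=
      hd.fst s₁ s₂ t₂ (by linarith) hs' hsδ hS hT
    have d2 : |(z s₂ t₂ - z' s₂ t₂) - (z s₂ t₁ - z' s₂ t₁)| ≤ W * rb :=
      hd.snd s₂ t₁ t₂ (by linarith) ht htδ hS hT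
    have d3 := hd.rect s₁ s₂ t₁ t₂ h0 hs' hsδ ht htδ hS hT
    have a1 := hz.fst s₁ s₂ t₁ h0 hs' hsδ hS (by linarith)
    have a2 := hz.snd s₁ t₁ t₂ h0 ht htδ (by linarith) hT
    have a3 := hz.rect s₁ s₂ t₁ t₂ h0 hs' hsδ ht htδ hS hT
    have b1 := hz'.fst s₁ s₂ t₁ h0 hs' hsδ hS (by linarith)
    have b2 := hz'.snd s₁ t₁ t₂ h0 ht htδ (by linarith) hT
    have b3 := hz'.rect s₁ s₂ t₁ t₂ h0 hs' hsδ ht htδ hS hT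
    rw [← hW, ← hra, ← hrb] at d3
    simp only [mul_one, one_mul, ← hra, ← hrb] at a1 a2 a3 b1 b2 b3
    simp only [rectIncr] at a3 b3 d3 ⊢
    -- Interpolate between z' and z. The derivative in θ of the rectangular increment of σ(ζ) is the
    -- rectangular increment of the product σ'(ζ)(z - z'), and the mean value inequality integrates
    -- it from 0 to 1. The bound `SmoothBound C (deriv σ)`, hence a Lipschitz second derivative of
    -- σ, is needed for the increment of σ'(ζ).
    let ζ : ℝ → ℝ → ℝ → ℝ := fun θ s t => z' s t + θ * (z s t - z' s t)
    let φ : ℝ → ℝ := fun θ => σ (ζ θ s₁ t₁) - σ (ζ θ s₁ t₂) - σ (ζ θ s₂ t₁) + σ (ζ θ s₂ t₂)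
    have hder1 : ∀ θ s t, HasDerivAt (fun θ => σ (ζ θ s t))
        (deriv σ (ζ θ s t) * (z s t - z' s t)) θ := by
      intro θ s t
      have h1 : HasDerivAt (fun θ => ζ θ s t) (z s t - z' s t) θ := by
        have := ((hasDerivAt_id θ).mul_const (z s t - z' s t)).const_add (z' s t)
        simpa [ζ] using this
      exact (hσ.differentiable _).hasDerivAt.comp θ h1
    have hder : ∀ θ, HasDerivAt φ (deriv σ (ζ θ s₁ t₁) * (z s₁ t₁ - z' s₁ t₁) -
        deriv σ (ζ θ s₁ t₂) * (z s₁ t₂ - z' s₁ t₂) - deriv σ (ζ θ s₂ t₁) * (z s₂ t₁ - z' s₂ t₁) +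
        deriv σ (ζ θ s₂ t₂) * (z s₂ t₂ - z' s₂ t₂)) θ := fun θ =>
      (((hder1 θ s₁ t₁).sub (hder1 θ s₁ t₂)).sub (hder1 θ s₂ t₁)).add (hder1 θ s₂ t₂)
    have hbound : ∀ θ ∈ Icc (0 : ℝ) 1, ‖deriv φ θ‖ ≤ 5 * C * W * (ra * rb) := by
      intro θ hθ
      rw [(hder θ).deriv, Real.norm_eq_abs]
      have c1 : |ζ θ s₂ t₁ - ζ θ s₁ t₁| ≤ ra := by
        have := abs_convexComb_le hθ.1 hθ.2 a1 b1
        convert this using 2; simp only [ζ]; ring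
      have c2 : |ζ θ s₁ t₂ - ζ θ s₁ t₁| ≤ rb := by
        have := abs_convexComb_le hθ.1 hθ.2 a2 b2
        convert this using 2; simp only [ζ]; ring
      have c3 : |ζ θ s₁ t₁ - ζ θ s₁ t₂ - ζ θ s₂ t₁ + ζ θ s₂ t₂| ≤ ra * rb := by
        have := abs_convexComb_le hθ.1 hθ.2 a3 b3
        convert this using 2; simp only [ζ]; ring
      have u0 := hσ'.bound (ζ θ s₁ t₁)
      have u1 : |deriv σ (ζ θ s₂ t₁) - deriv σ (ζ θ s₁ t₁)| ≤ C * ra :=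
        (hσ'.lip _ _).trans (mul_le_mul_of_nonneg_left c1 hC)
      have u2 : |deriv σ (ζ θ s₁ t₂) - deriv σ (ζ θ s₁ t₁)| ≤ C * rb :=
        (hσ'.lip _ _).trans (mul_le_mul_of_nonneg_left c2 hC)
      have u3 : |deriv σ (ζ θ s₁ t₁) - deriv σ (ζ θ s₁ t₂) - deriv σ (ζ θ s₂ t₁) +
          deriv σ (ζ θ s₂ t₂)| ≤ 2 * C * (ra * rb) := by
        refine (hσ'.rect _ _ _ _).trans ?_
        have p1 := mul_le_mul c2 c1 (abs_nonneg _) n2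
        calc _ ≤ C * (ra * rb) + C * (rb * ra) := by gcongr
          _ = _ := by ring
      -- Discrete Leibniz rule for the rectangular increment of a product. The four terms contribute
      -- 2C, C, C and C, whence the constant 5.
      have e : deriv σ (ζ θ s₁ t₁) * (z s₁ t₁ - z' s₁ t₁) -
          deriv σ (ζ θ s₁ t₂) * (z s₁ t₂ - z' s₁ t₂) - deriv σ (ζ θ s₂ t₁) * (z s₂ t₁ - z' s₂ t₁) +
          deriv σ (ζ θ s₂ t₂) * (z s₂ t₂ - z' s₂ t₂) =
          (deriv σ (ζ θ s₁ t₁) - deriv σ (ζ θ s₁ t₂) - deriv σ (ζ θ s₂ t₁) + deriv σ (ζ θ s₂ t₂)) *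
            (z s₂ t₂ - z' s₂ t₂) +
          (deriv σ (ζ θ s₂ t₁) - deriv σ (ζ θ s₁ t₁)) *
            ((z s₂ t₂ - z' s₂ t₂) - (z s₂ t₁ - z' s₂ t₁)) +
          (deriv σ (ζ θ s₁ t₂) - deriv σ (ζ θ s₁ t₁)) *
            ((z s₂ t₂ - z' s₂ t₂) - (z s₁ t₂ - z' s₁ t₂)) +
          deriv σ (ζ θ s₁ t₁) * (z s₁ t₁ - z' s₁ t₁ - (z s₁ t₂ - z' s₁ t₂) -
            (z s₂ t₁ - z' s₂ t₁) + (z s₂ t₂ - z' s₂ t₂)) := by ring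
      rw [e]
      refine (abs_add_le _ _).trans ((add_le_add_left ((abs_add_le _ _).trans
        (add_le_add_left (abs_add_le _ _) _)) _).trans ?_)
      simp only [abs_mul]
      have q1 := mul_le_mul u3 d0 (abs_nonneg _) (by positivity)
      have q2 := mul_le_mul u1 d2 (abs_nonneg _) (by positivity)
      have q3 := mul_le_mul u2 d1 (abs_nonneg _) (by positivity)
      have q4 := mul_le_mul u0 d3 (abs_nonneg _) hC
      linarith
    have mv := (convex_Icc (0 : ℝ) 1).norm_image_sub_le_of_norm_deriv_le (𝕜 := ℝ) (f := φ)
      (fun θ _ => (hder θ).differentiableAt) hbound (left_mem_Icc.2 zero_le_one)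
      (right_mem_Icc.2 zero_le_one)
    have e1 : φ 1 - φ 0 = σ (z s₁ t₁) - σ (z' s₁ t₁) - (σ (z s₁ t₂) - σ (z' s₁ t₂)) -
        (σ (z s₂ t₁) - σ (z' s₂ t₁)) + (σ (z s₂ t₂) - σ (z' s₂ t₂)) := by
      simp only [φ, ζ, one_mul, zero_mul, add_zero, add_sub_cancel]; ring
    rw [e1, sub_zero, norm_one, mul_one, Real.norm_eq_abs] at mv
    refine mv.trans (le_of_eq ?_)
    rw [hW]; ring

end

end FracWave

end

/-! ### Invariance, contraction and uniqueness on a triangle -/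

noncomputable section

namespace FracWave

lemma exists_smoothBound {σ : ℝ → ℝ} (hσ : ContDiff ℝ 3 σ)
    (hσb : ∃ C : ℝ, ∀ k ≤ 3, ∀ r : ℝ, |iteratedDeriv k σ r| ≤ C) :
    ∃ C, SmoothBound C σ ∧ SmoothBound C (deriv σ) := by
  obtain ⟨C, hC⟩ := hσb
  have h1 : iteratedDeriv 1 σ = deriv σ := iteratedDeriv_one
  have h2 : iteratedDeriv 2 σ = deriv (deriv σ) := by rw [iteratedDeriv_succ, h1]
  have h3 : iteratedDeriv 3 σ = deriv (deriv (deriv σ)) := by rw [iteratedDeriv_succ, h2]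
  have d0 : Differentiable ℝ σ := hσ.differentiable (by norm_num)
  have d1 : Differentiable ℝ (deriv σ) := by
    rw [← h1]; exact hσ.differentiable_iteratedDeriv 1 (by norm_num)
  have d2 : Differentiable ℝ (deriv (deriv σ)) := by
    rw [← h2]; exact hσ.differentiable_iteratedDeriv 2 (by norm_num)
  have b0 : ∀ r, |σ r| ≤ C := fun r => by simpa using hC 0 (by norm_num) r
  have b1 : ∀ r, |deriv σ r| ≤ C := fun r => by simpa [h1] using hC 1 (by norm_num) r
  have b2 : ∀ r, |deriv (deriv σ) r| ≤ C := fun r => by simpa [h2] using hC 2 (by norm_num) r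
  have b3 : ∀ r, |deriv (deriv (deriv σ)) r| ≤ C := fun r => by
    simpa [h3] using hC 3 (by norm_num) r
  exact ⟨C, ⟨d0, b0, b1, abs_sub_le_of_deriv_le d1 b2⟩, ⟨d1, b1, b2, abs_sub_le_of_deriv_le d2 b3⟩⟩

section

variable {κ κ' γ γ' K M B C δ S₀ T₀ L : ℝ} {w : ℝ → ℝ} {σ : ℝ → ℝ} {f x y y' z z' : ℝ → ℝ → ℝ}

lemma OscBound.mono (hδ : 0 < δ) (hw0 : ∀ r, 0 ≤ w r) {B' : ℝ} (hBB : B ≤ B')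
    (h : OscBound κ κ' δ S₀ T₀ w B f) : OscBound κ κ' δ S₀ T₀ w B' f where
  fst s₁ s₂ t h0 hs hsδ hS hT := (h.fst s₁ s₂ t h0 hs hsδ hS hT).trans (by
    have : 0 ≤ ((s₂ - s₁) / δ) ^ κ := Real.rpow_nonneg (div_nonneg (by linarith) hδ.le) _
    have := hw0 (s₂ + t)
    gcongr)
  snd s t₁ t₂ h0 ht htδ hS hT := (h.snd s t₁ t₂ h0 ht htδ hS hT).trans (by
    have : 0 ≤ ((t₂ - t₁) / δ) ^ κ' := Real.rpow_nonneg (div_nonneg (by linarith) hδ.le) _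
    have := hw0 (s + t₂)
    gcongr)
  rect s₁ s₂ t₁ t₂ h0 hs hsδ ht htδ hS hT := (h.rect s₁ s₂ t₁ t₂ h0 hs hsδ ht htδ hS hT).trans (by
    have : 0 ≤ ((s₂ - s₁) / δ) ^ κ := Real.rpow_nonneg (div_nonneg (by linarith) hδ.le) _
    have : 0 ≤ ((t₂ - t₁) / δ) ^ κ' := Real.rpow_nonneg (div_nonneg (by linarith) hδ.le) _
    have := hw0 (s₂ + t₂)
    gcongr)

lemma SupBound.mono (hw0 : ∀ r, 0 ≤ w r) {B' : ℝ} (hBB : B ≤ B')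
    (h : SupBound S₀ T₀ w B f) : SupBound S₀ T₀ w B' f := fun s t h0 hS hT =>
  (h s t h0 hS hT).trans (mul_le_mul_of_nonneg_right hBB (hw0 _))

lemma OscBound.weight (hδ : 0 < δ) (hB : 0 ≤ B) (hw1 : ∀ r, 0 ≤ r → 1 ≤ w r)
    (h : OscBound κ κ' δ S₀ T₀ (fun _ => 1) B f) : OscBound κ κ' δ S₀ T₀ w B f where
  fst s₁ s₂ t h0 hs hsδ hS hT := (h.fst s₁ s₂ t h0 hs hsδ hS hT).trans (by
    have : 0 ≤ ((s₂ - s₁) / δ) ^ κ := Real.rpow_nonneg (div_nonneg (by linarith) hδ.le) _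
    have := hw1 (s₂ + t) (by linarith)
    gcongr)
  snd s t₁ t₂ h0 ht htδ hS hT := (h.snd s t₁ t₂ h0 ht htδ hS hT).trans (by
    have : 0 ≤ ((t₂ - t₁) / δ) ^ κ' := Real.rpow_nonneg (div_nonneg (by linarith) hδ.le) _
    have := hw1 (s + t₂) (by linarith)
    gcongr)
  rect s₁ s₂ t₁ t₂ h0 hs hsδ ht htδ hS hT := (h.rect s₁ s₂ t₁ t₂ h0 hs hsδ ht htδ hS hT).trans (by
    have : 0 ≤ ((s₂ - s₁) / δ) ^ κ := Real.rpow_nonneg (div_nonneg (by linarith) hδ.le) _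
    have : 0 ≤ ((t₂ - t₁) / δ) ^ κ' := Real.rpow_nonneg (div_nonneg (by linarith) hδ.le) _
    have := hw1 (s₂ + t₂) (by linarith)
    gcongr)

lemma SupBound.weight (hB : 0 ≤ B) (hw1 : ∀ r, 0 ≤ r → 1 ≤ w r)
    (h : SupBound S₀ T₀ (fun _ => 1) B f) : SupBound S₀ T₀ w B f := fun s t h0 hS hT =>
  (h s t h0 hS hT).trans (mul_le_mul_of_nonneg_left (hw1 _ h0) hB)

lemma OscBound.sub {B' : ℝ} {g : ℝ → ℝ → ℝ} (h : OscBound κ κ' δ S₀ T₀ w B f)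
    (h' : OscBound κ κ' δ S₀ T₀ w B' g) :
    OscBound κ κ' δ S₀ T₀ w (B + B') (fun s t => f s t - g s t) where
  fst s₁ s₂ t h0 hs hsδ hS hT := by
    have a := h.fst s₁ s₂ t h0 hs hsδ hS hT
    have b := h'.fst s₁ s₂ t h0 hs hsδ hS hT
    rw [add_mul, add_mul]
    rw [abs_le] at *
    constructor <;> linarith [a.1, a.2, b.1, b.2]
  snd s t₁ t₂ h0 ht htδ hS hT := by
    have a := h.snd s t₁ t₂ h0 ht htδ hS hT
    have b := h'.snd s t₁ t₂ h0 ht htδ hS hT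
    rw [add_mul, add_mul]
    rw [abs_le] at *
    constructor <;> linarith [a.1, a.2, b.1, b.2]
  rect s₁ s₂ t₁ t₂ h0 hs hsδ ht htδ hS hT := by
    have a := h.rect s₁ s₂ t₁ t₂ h0 hs hsδ ht htδ hS hT
    have b := h'.rect s₁ s₂ t₁ t₂ h0 hs hsδ ht htδ hS hT
    rw [add_mul, add_mul]
    unfold rectIncr at *
    rw [abs_le] at *
    constructor <;> linarith [a.1, a.2, b.1, b.2]

lemma SupBound.sub {B' : ℝ} {g : ℝ → ℝ → ℝ} (h : SupBound S₀ T₀ w B f)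
    (h' : SupBound S₀ T₀ w B' g) : SupBound S₀ T₀ w (B + B') (fun s t => f s t - g s t) := by
  intro s t h0 hS hT
  have a := h s t h0 hS hT
  have b := h' s t h0 hS hT
  rw [add_mul]
  exact (abs_sub _ _).trans (add_le_add a b)

/-- A bound at scale `δ` gives a Hölder bound. -/
lemma OscBound.holderTri (hκ : 0 < κ) (hκ' : 0 < κ') (hδ : 0 < δ) (hB : 0 ≤ B)
    (hs : SupBound S₀ T₀ (fun _ => 1) B f)
    (h : OscBound κ κ' δ S₀ T₀ (fun _ => 1) B f) :
    HolderTri κ κ' (4 * B * ((1 + (δ ^ κ)⁻¹) * (1 + (δ ^ κ')⁻¹))) S₀ T₀ f := by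
  have p1 : 0 ≤ (δ ^ κ)⁻¹ := by positivity
  have p2 : 0 ≤ (δ ^ κ')⁻¹ := by positivity
  set Q := (1 + (δ ^ κ)⁻¹) * (1 + (δ ^ κ')⁻¹) with hQ
  have q0 : 1 ≤ Q := by nlinarith [mul_nonneg p1 p2]
  have q1 : (δ ^ κ)⁻¹ ≤ Q := by nlinarith [mul_nonneg p1 p2]
  have q2 : (δ ^ κ')⁻¹ ≤ Q := by nlinarith [mul_nonneg p1 p2]
  have q3 : (δ ^ κ)⁻¹ * (δ ^ κ')⁻¹ ≤ Q := by nlinarith [mul_nonneg p1 p2]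
  -- Increments over lengths larger than δ are controlled by the values alone, because r / δ is then
  -- larger than 1. Each variable costs a factor 2, hence the 4 for rectangles.
  have hone : ∀ {r κ : ℝ}, 0 < κ → ¬ r ≤ δ → 1 ≤ (r / δ) ^ κ := fun {r κ} hκ hr =>
    Real.one_le_rpow ((one_le_div hδ).2 (not_le.1 hr).le) hκ.le
  simp only [SupBound, mul_one] at hs
  have fst : ∀ s₁ s₂ t, 0 ≤ s₁ + t → s₁ ≤ s₂ → s₂ ≤ S₀ → t ≤ T₀ →
      |f s₂ t - f s₁ t| ≤ 2 * B * ((s₂ - s₁) / δ) ^ κ := by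
    intro s₁ s₂ t h0 h1 hS hT
    by_cases hl : s₂ - s₁ ≤ δ
    · have := h.fst s₁ s₂ t h0 h1 hl hS hT
      have n : 0 ≤ ((s₂ - s₁) / δ) ^ κ := Real.rpow_nonneg (div_nonneg (by linarith) hδ.le) _
      nlinarith [mul_nonneg hB n]
    · have := hone hκ hl
      have a := hs s₁ t h0 (by linarith) hT
      have b := hs s₂ t (by linarith) hS hT
      have := (abs_sub (f s₂ t) (f s₁ t))
      nlinarith
  have snd : ∀ s t₁ t₂, 0 ≤ s + t₁ → t₁ ≤ t₂ → s ≤ S₀ → t₂ ≤ T₀ →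
      |f s t₂ - f s t₁| ≤ 2 * B * ((t₂ - t₁) / δ) ^ κ' := by
    intro s t₁ t₂ h0 h1 hS hT
    by_cases hl : t₂ - t₁ ≤ δ
    · have := h.snd s t₁ t₂ h0 h1 hl hS hT
      have n : 0 ≤ ((t₂ - t₁) / δ) ^ κ' := Real.rpow_nonneg (div_nonneg (by linarith) hδ.le) _
      nlinarith [mul_nonneg hB n]
    · have := hone hκ' hl
      have a := hs s t₁ h0 hS (by linarith)
      have b := hs s t₂ (by linarith) hS hT
      have := (abs_sub (f s t₂) (f s t₁))
      nlinarith
  refine ⟨fun s t h0 hS hT => (hs s t h0 hS hT).trans (by nlinarith), ?_, ?_, ?_⟩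
  · intro s₁ s₂ t h0 h1 hS hT
    refine (fst s₁ s₂ t h0 h1 hS hT).trans ?_
    have n : 0 ≤ (s₂ - s₁) ^ κ := Real.rpow_nonneg (by linarith) _
    rw [Real.div_rpow (by linarith) hδ.le, div_eq_mul_inv]
    calc 2 * B * ((s₂ - s₁) ^ κ * (δ ^ κ)⁻¹) ≤ 4 * B * ((s₂ - s₁) ^ κ * Q) := by
          gcongr; norm_num
      _ = _ := by ring
  · intro s t₁ t₂ h0 h1 hS hT
    refine (snd s t₁ t₂ h0 h1 hS hT).trans ?_
    have n : 0 ≤ (t₂ - t₁) ^ κ' := Real.rpow_nonneg (by linarith) _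
    rw [Real.div_rpow (by linarith) hδ.le, div_eq_mul_inv]
    calc 2 * B * ((t₂ - t₁) ^ κ' * (δ ^ κ')⁻¹) ≤ 4 * B * ((t₂ - t₁) ^ κ' * Q) := by
          gcongr; norm_num
      _ = _ := by ring
  · intro s₁ s₂ t₁ t₂ h0 h1 h2 hS hT
    have n : 0 ≤ (s₂ - s₁) ^ κ := Real.rpow_nonneg (by linarith) _
    have n' : 0 ≤ (t₂ - t₁) ^ κ' := Real.rpow_nonneg (by linarith) _
    set ra := ((s₂ - s₁) / δ) ^ κ with hra
    set rb := ((t₂ - t₁) / δ) ^ κ' with hrb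
    have na : 0 ≤ ra := Real.rpow_nonneg (div_nonneg (by linarith) hδ.le) _
    have nb : 0 ≤ rb := Real.rpow_nonneg (div_nonneg (by linarith) hδ.le) _
    have key : |rectIncr f s₁ s₂ t₁ t₂| ≤ 4 * B * (ra * rb) := by
      by_cases hl : s₂ - s₁ ≤ δ
      · by_cases hl' : t₂ - t₁ ≤ δ
        · have := h.rect s₁ s₂ t₁ t₂ h0 h1 hl h2 hl' hS hT
          nlinarith [mul_nonneg hB (mul_nonneg na nb)]
        · have hb1 : 1 ≤ rb := hone hκ' hl'
          have a := fst s₁ s₂ t₁ h0 h1 hS (by linarith)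
          have b := fst s₁ s₂ t₂ (by linarith) h1 hS hT
          have e : rectIncr f s₁ s₂ t₁ t₂ = (f s₂ t₂ - f s₁ t₂) - (f s₂ t₁ - f s₁ t₁) := by
            unfold rectIncr; ring
          rw [e]
          have c := abs_sub (f s₂ t₂ - f s₁ t₂) (f s₂ t₁ - f s₁ t₁)
          nlinarith [mul_nonneg (mul_nonneg hB na) (sub_nonneg.2 hb1)]
      · have hb1 : 1 ≤ ra := hone hκ hl
        have a := snd s₁ t₁ t₂ h0 h2 (by linarith) hT
        have b := snd s₂ t₁ t₂ (by linarith) h2 hS hT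
        have e : rectIncr f s₁ s₂ t₁ t₂ = (f s₂ t₂ - f s₂ t₁) - (f s₁ t₂ - f s₁ t₁) := by
          unfold rectIncr; ring
        rw [e]
        have c := abs_sub (f s₂ t₂ - f s₂ t₁) (f s₁ t₂ - f s₁ t₁)
        nlinarith [mul_nonneg (mul_nonneg hB nb) (sub_nonneg.2 hb1)]
    refine key.trans ?_
    rw [hra, hrb, Real.div_rpow (by linarith) hδ.le, Real.div_rpow (by linarith) hδ.le,
      div_eq_mul_inv, div_eq_mul_inv]
    calc 4 * B * ((s₂ - s₁) ^ κ * (δ ^ κ)⁻¹ * ((t₂ - t₁) ^ κ' * (δ ^ κ')⁻¹))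
        = 4 * B * ((s₂ - s₁) ^ κ * (t₂ - t₁) ^ κ' * ((δ ^ κ)⁻¹ * (δ ^ κ')⁻¹)) := by ring
      _ ≤ 4 * B * ((s₂ - s₁) ^ κ * (t₂ - t₁) ^ κ' * Q) := by gcongr
      _ = _ := by ring

/-- A Hölder bound gives a bound at any scale. -/
lemma HolderTri.oscBound (hδ : 0 < δ) (hf : HolderTri κ κ' M S₀ T₀ f)
    (h1 : M * δ ^ κ ≤ B) (h2 : M * δ ^ κ' ≤ B) (h3 : M * (δ ^ κ * δ ^ κ') ≤ B) :
    OscBound κ κ' δ S₀ T₀ (fun _ => 1) B f where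
  fst s₁ s₂ t h0 hs hsδ hS hT := (hf.fst s₁ s₂ t h0 hs hS hT).trans (by
    have n : 0 ≤ (s₂ - s₁) ^ κ := Real.rpow_nonneg (by linarith) _
    have p : 0 < δ ^ κ := Real.rpow_pos_of_pos hδ _
    rw [Real.div_rpow (by linarith) hδ.le, mul_one, ← mul_div_assoc, le_div_iff₀ p]
    calc M * (s₂ - s₁) ^ κ * δ ^ κ = M * δ ^ κ * (s₂ - s₁) ^ κ := by ring
      _ ≤ _ := by gcongr)
  snd s t₁ t₂ h0 ht htδ hS hT := (hf.snd s t₁ t₂ h0 ht hS hT).trans (by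
    have n : 0 ≤ (t₂ - t₁) ^ κ' := Real.rpow_nonneg (by linarith) _
    have p : 0 < δ ^ κ' := Real.rpow_pos_of_pos hδ _
    rw [Real.div_rpow (by linarith) hδ.le, mul_one, ← mul_div_assoc, le_div_iff₀ p]
    calc M * (t₂ - t₁) ^ κ' * δ ^ κ' = M * δ ^ κ' * (t₂ - t₁) ^ κ' := by ring
      _ ≤ _ := by gcongr)
  rect s₁ s₂ t₁ t₂ h0 hs hsδ ht htδ hS hT := (hf.rect s₁ s₂ t₁ t₂ h0 hs ht hS hT).trans (by
    have n : 0 ≤ (s₂ - s₁) ^ κ := Real.rpow_nonneg (by linarith) _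
    have p : 0 < δ ^ κ := Real.rpow_pos_of_pos hδ _
    have n' : 0 ≤ (t₂ - t₁) ^ κ' := Real.rpow_nonneg (by linarith) _
    have p' : 0 < δ ^ κ' := Real.rpow_pos_of_pos hδ _
    rw [Real.div_rpow (by linarith) hδ.le, Real.div_rpow (by linarith) hδ.le, mul_one,
      div_mul_div_comm, ← mul_div_assoc, le_div_iff₀ (by positivity)]
    calc M * ((s₂ - s₁) ^ κ * (t₂ - t₁) ^ κ') * (δ ^ κ * δ ^ κ') =
          M * (δ ^ κ * δ ^ κ') * ((s₂ - s₁) ^ κ * (t₂ - t₁) ^ κ') := by ring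
      _ ≤ _ := by gcongr)

/-- The scale `δ` is small enough for the fixed point argument on triangles of size `L`. -/
structure SmallScale (κ κ' γ γ' K C L δ : ℝ) : Prop where
  pos : 0 < δ
  stable : 4 * youngConst κ κ' γ γ' * K * (2 * C) * (L / δ + 1 + dyadicConst (γ + γ')) *
    δ ^ (γ + γ') ≤ 1
  contract : 4 * youngConst κ κ' γ γ' * K * (5 * C) * (2 + dyadicConst (γ + γ')) *
    δ ^ (γ + γ') * 2 ≤ 1 / 2

/-- The critical term is (L/δ) δ^(γ+γ') = L δ^(γ+γ'-1), which tends to 0 because γ + γ' > 1. -/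
lemma eventually_smallScale (hγγ : 1 < γ + γ') (K C L : ℝ) :
    ∀ᶠ δ in 𝓝[>] (0 : ℝ), SmallScale κ κ' γ γ' K C L δ := by
  set D := dyadicConst (γ + γ')
  set Y := youngConst κ κ' γ γ'
  have t1 : Tendsto (fun δ : ℝ => δ ^ (γ + γ')) (𝓝[>] 0) (𝓝 0) := by
    have : ContinuousAt (fun δ : ℝ => δ ^ (γ + γ')) 0 :=
      Real.continuousAt_rpow_const 0 _ (Or.inr (by linarith))
    have h := this.tendsto
    rw [Real.zero_rpow (by linarith)] at h
    exact h.mono_left nhdsWithin_le_nhds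
  have t2 : Tendsto (fun δ : ℝ => δ ^ (γ + γ' - 1)) (𝓝[>] 0) (𝓝 0) := by
    have : ContinuousAt (fun δ : ℝ => δ ^ (γ + γ' - 1)) 0 :=
      Real.continuousAt_rpow_const 0 _ (Or.inr (by linarith))
    have h := this.tendsto
    rw [Real.zero_rpow (by linarith)] at h
    exact h.mono_left nhdsWithin_le_nhds
  have l1 : Tendsto (fun δ : ℝ => 4 * Y * K * (2 * C) * (L * δ ^ (γ + γ' - 1) +
      (1 + D) * δ ^ (γ + γ'))) (𝓝[>] 0) (𝓝 0) := by
    have := ((t2.const_mul L).add (t1.const_mul (1 + D))).const_mul (4 * Y * K * (2 * C))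
    simpa using this
  have l2 : Tendsto (fun δ : ℝ => 4 * Y * K * (5 * C) * (2 + D) * δ ^ (γ + γ') * 2)
      (𝓝[>] 0) (𝓝 0) := by
    have := (t1.const_mul (4 * Y * K * (5 * C) * (2 + D))).mul_const 2
    simpa using this
  filter_upwards [self_mem_nhdsWithin, l1.eventually (gt_mem_nhds one_pos),
    l2.eventually (gt_mem_nhds (show (0 : ℝ) < 1 / 2 by norm_num))] with δ h0 h1 h2
  refine ⟨h0, le_trans (le_of_eq ?_) h1.le, h2.le⟩
  rw [Real.rpow_sub h0, Real.rpow_one]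
  have : δ ≠ 0 := ne_of_gt h0
  field_simp
  ring

/-- The integral map preserves the set of functions with small oscillations at scale `δ`. -/
lemma IsPotential.stable (hκ : 0 < κ) (hκ' : 0 < κ') (hκγ : κ ≤ γ) (hκγ' : κ' ≤ γ')
    (h : 1 < κ + γ) (h' : 1 < κ' + γ') (hγγ : 1 < γ + γ') (hK : 0 ≤ K) (hL : 0 ≤ S₀ + T₀)
    (hδ : SmallScale κ κ' γ γ' K C (S₀ + T₀) δ) (hσ : SmoothBound C σ)
    (hx : TriBound γ γ' K S₀ T₀ x) (hz : OscBound κ κ' δ S₀ T₀ (fun _ => 1) 1 z)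
    (hy : IsPotential (fun s t => σ (z s t)) x S₀ T₀ y) :
    OscBound κ κ' δ S₀ T₀ (fun _ => 1) 1 y ∧
      SupBound S₀ T₀ (fun _ => 1) ((S₀ + T₀) / δ + 1) y := by
  have hC : 0 ≤ C := (abs_nonneg _).trans (hσ.bound 0)
  have hδ0 := hδ.pos
  obtain ⟨c1, c2⟩ := hz.comp hδ0 hσ
  have hG : 1 ≤ (S₀ + T₀) / δ + 1 := by have : 0 ≤ (S₀ + T₀) / δ := by positivity
                                        linarith
  obtain ⟨b1, b2⟩ := hy.bounds hκ hκ' hκγ hκγ' h h' hγγ hK (by positivity) hδ0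
    hG (fun _ => zero_le_one) (fun _ _ _ => le_rfl)
    (weightSum_one hδ0 hL) c1 c2 hx
  refine ⟨b1.mono hδ0 (fun _ => zero_le_one) hδ.stable, b2.mono (fun _ => zero_le_one) ?_⟩
  have := mul_le_mul_of_nonneg_right hδ.stable (show 0 ≤ (S₀ + T₀) / δ + 1 by linarith)
  linarith

/-- The integral map is a contraction for the weighted bounds. -/
lemma IsPotential.contract (hκ : 0 < κ) (hκ' : 0 < κ') (hκγ : κ ≤ γ) (hκγ' : κ' ≤ γ')
    (h : 1 < κ + γ) (h' : 1 < κ' + γ') (hγγ : 1 < γ + γ') (hK : 0 ≤ K) (hB : 0 ≤ B)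
    (hδ : SmallScale κ κ' γ γ' K C L δ) (hσ : SmoothBound C σ) (hσ' : SmoothBound C (deriv σ))
    (hx : TriBound γ γ' K S₀ T₀ x)
    (hz : OscBound κ κ' δ S₀ T₀ (fun _ => 1) 1 z) (hz' : OscBound κ κ' δ S₀ T₀ (fun _ => 1) 1 z')
    (hd : OscBound κ κ' δ S₀ T₀ (fun r => Real.exp (r / δ)) B (fun s t => z s t - z' s t))
    (hs : SupBound S₀ T₀ (fun r => Real.exp (r / δ)) B (fun s t => z s t - z' s t))
    (hy : IsPotential (fun s t => σ (z s t)) x S₀ T₀ y)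
    (hy' : IsPotential (fun s t => σ (z' s t)) x S₀ T₀ y') :
    OscBound κ κ' δ S₀ T₀ (fun r => Real.exp (r / δ)) (B / 2) (fun s t => y s t - y' s t) ∧
    SupBound S₀ T₀ (fun r => Real.exp (r / δ)) (B / 2) (fun s t => y s t - y' s t) := by
  have hC : 0 ≤ C := (abs_nonneg _).trans (hσ.bound 0)
  have hδ0 := hδ.pos
  have hw0 : ∀ r, 0 ≤ Real.exp (r / δ) := fun r => (Real.exp_pos _).le
  have hw : Monotone fun r => Real.exp (r / δ) := fun r r' hr =>
    Real.exp_le_exp.2 (by gcongr)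
  obtain ⟨c1, c2⟩ := hz.comp_sub hδ0 hB hw0 hw hσ hσ' hz' hd hs
  obtain ⟨b1, b2⟩ := (hy.sub hy').bounds hκ hκ' hκγ hκγ' h h' hγγ hK (by positivity) hδ0
    one_le_two hw0 hw (weightSum_exp hδ0) c1 c2 hx
  have hY := youngConst_nonneg h h'
  have hD := dyadicConst_nonneg (γ + γ')
  have e := mul_le_mul_of_nonneg_right hδ.contract hB
  have e' : 0 ≤ 4 * youngConst κ κ' γ γ' * K * (5 * C) * (2 + dyadicConst (γ + γ')) *
    δ ^ (γ + γ') * B := by positivity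
  exact ⟨b1.mono hδ0 hw0 (by nlinarith), b2.mono hw0 (by nlinarith)⟩

/-- Uniqueness on a triangle. -/
theorem eq_of_isPotential (hκ : 0 < κ) (hκ' : 0 < κ') (hκγ : κ ≤ γ) (hκγ' : κ' ≤ γ')
    (h : 1 < κ + γ) (h' : 1 < κ' + γ') (hγγ : 1 < γ + γ') (hK : 0 ≤ K)
    (hσ : SmoothBound C σ) (hσ' : SmoothBound C (deriv σ)) (hx : TriBound γ γ' K S₀ T₀ x)
    (hyM : HolderTri κ κ' M S₀ T₀ y) (hyM' : HolderTri κ κ' M S₀ T₀ y')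
    (hy : IsPotential (fun s t => σ (y s t)) x S₀ T₀ y)
    (hy' : IsPotential (fun s t => σ (y' s t)) x S₀ T₀ y') {s t : ℝ} (h0 : 0 ≤ s + t)
    (hS : s ≤ S₀) (hT : t ≤ T₀) : y s t = y' s t := by
  have hM : 0 ≤ M := (abs_nonneg _).trans (hyM.sup s t h0 hS hT)
  have t0 : ∀ κ : ℝ, 0 < κ → Tendsto (fun δ : ℝ => δ ^ κ) (𝓝[>] 0) (𝓝 0) := fun κ hκ => by
    have h := (Real.continuousAt_rpow_const 0 κ (Or.inr hκ.le)).tendsto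
    rw [Real.zero_rpow hκ.ne'] at h
    exact h.mono_left nhdsWithin_le_nhds
  have l1 : Tendsto (fun δ : ℝ => M * δ ^ κ) (𝓝[>] 0) (𝓝 0) := by
    simpa using (t0 κ hκ).const_mul M
  have l2 : Tendsto (fun δ : ℝ => M * δ ^ κ') (𝓝[>] 0) (𝓝 0) := by
    simpa using (t0 κ' hκ').const_mul M
  have l3 : Tendsto (fun δ : ℝ => M * (δ ^ κ * δ ^ κ')) (𝓝[>] 0) (𝓝 0) := by
    simpa using ((t0 κ hκ).mul (t0 κ' hκ')).const_mul M
  -- The scale is chosen so that the map contracts and both solutions have oscillation at most 1.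
  -- The size parameter L is set to 0, as the field `contract`, the only one needed besides
  -- positivity, does not involve it.
  obtain ⟨δ, hδ, h1, h2, h3⟩ := ((eventually_smallScale (κ := κ) (κ' := κ') hγγ K C 0).and
    ((l1.eventually (gt_mem_nhds one_pos)).and ((l2.eventually (gt_mem_nhds one_pos)).and
      (l3.eventually (gt_mem_nhds one_pos))))).exists
  have hδ0 := hδ.pos
  have o := hyM.oscBound hδ0 h1.le h2.le h3.le
  have o' := hyM'.oscBound hδ0 h1.le h2.le h3.le
  have hw1 : ∀ r, 0 ≤ r → 1 ≤ Real.exp (r / δ) := fun r hr => Real.one_le_exp (by positivity)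
  have hw0 : ∀ r, 0 ≤ Real.exp (r / δ) := fun r => (Real.exp_pos _).le
  have s1 : SupBound S₀ T₀ (fun _ => 1) M y := fun s t h0 hS hT =>
    (hyM.sup s t h0 hS hT).trans (by simp)
  have s1' : SupBound S₀ T₀ (fun _ => 1) M y' := fun s t h0 hS hT =>
    (hyM'.sup s t h0 hS hT).trans (by simp)
  set B := 2 + 2 * M with hB
  -- Both functions are fixed by the integral map, so every application of the contraction halves
  -- the bound on the same difference.
  have key : ∀ n : ℕ, OscBound κ κ' δ S₀ T₀ (fun r => Real.exp (r / δ)) (B / 2 ^ n)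
      (fun s t => y s t - y' s t) ∧
      SupBound S₀ T₀ (fun r => Real.exp (r / δ)) (B / 2 ^ n) (fun s t => y s t - y' s t) := by
    intro n
    induction n with
    | zero =>
      rw [pow_zero, div_one]
      exact ⟨((o.sub o').weight hδ0 (by norm_num) hw1).mono hδ0 hw0 (by linarith),
        ((s1.sub s1').weight (by linarith) hw1).mono hw0 (by linarith)⟩
    | succ n ih =>
      have := IsPotential.contract hκ hκ' hκγ hκγ' h h' hγγ hK (by positivity) hδ hσ hσ' hx o o'
        ih.1 ih.2 hy hy'
      rwa [div_div, ← pow_succ] at this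
  have hlim : Tendsto (fun n : ℕ => B / 2 ^ n * Real.exp ((s + t) / δ)) atTop (𝓝 0) := by
    have : Tendsto (fun n : ℕ => B / 2 ^ n) atTop (𝓝 0) :=
      tendsto_const_nhds.div_atTop (tendsto_pow_atTop_atTop_of_one_lt one_lt_two)
    simpa using this.mul_const (Real.exp ((s + t) / δ))
  have := ge_of_tendsto' hlim (fun n => (key n).2 s t h0 hS hT)
  exact sub_eq_zero.1 (abs_eq_zero.1 (le_antisymm this (abs_nonneg _)))

end

end FracWave

end

noncomputable section

namespace FracWave

/-! ### Picard iteration -/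

/-- A continuous function on the plane whose rectangular increments are locally Hölder
continuous. -/
structure IsDriver (γ γ' : ℝ) (x : ℝ → ℝ → ℝ) : Prop where
  continuous : Continuous fun p : ℝ × ℝ => x p.1 p.2
  bound : ∀ N : ℕ, ∃ K, 0 ≤ K ∧ RectBound γ γ' K (-N) N (-N) N x

open Classical in
/-- The integral map `z ↦ ∫∫ σ(z) dx` over triangles. -/
def picardMap (γ γ' : ℝ) (σ : ℝ → ℝ) (x z : ℝ → ℝ → ℝ) : ℝ → ℝ → ℝ := fun s t =>
  if h : ∃ v, HasTriIntegral γ γ' (fun s t => σ (z s t)) x s t v then h.choose else 0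

/-- Uniform smallness of the oscillations at prescribed scales on all large triangles. -/
def LocallyTame (κ κ' : ℝ) (δ : ℕ → ℝ) (z : ℝ → ℝ → ℝ) : Prop :=
  ∀ N : ℕ, OscBound κ κ' (δ N) N N (fun _ => 1) 1 z

/-- The Picard iterates. -/
def picardIter (γ γ' : ℝ) (σ : ℝ → ℝ) (x : ℝ → ℝ → ℝ) : ℕ → ℝ → ℝ → ℝ
  | 0 => fun _ _ => 0
  | n + 1 => picardMap γ γ' σ x (picardIter γ γ' σ x n)

/-- The limit of the Picard iterates. -/
def picardLim (γ γ' : ℝ) (σ : ℝ → ℝ) (x : ℝ → ℝ → ℝ) : ℝ → ℝ → ℝ := fun s t =>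
  limUnder atTop fun n => picardIter γ γ' σ x n s t

lemma triBound_of_rectBound {γ γ' K S₀ T₀ a b c d : ℝ} {x : ℝ → ℝ → ℝ}
    (h : RectBound γ γ' K a b c d x) (ha : a ≤ -T₀) (hb : S₀ ≤ b) (hc : c ≤ -S₀) (hd : T₀ ≤ d) :
    TriBound γ γ' K S₀ T₀ x := fun s₁ s₂ t₁ t₂ h0 hs ht hS hT =>
  h s₁ s₂ t₁ t₂ (by linarith) hs (by linarith) (by linarith) ht (by linarith)

section

variable {κ κ' γ γ' C : ℝ} {σ : ℝ → ℝ} {δ K : ℕ → ℝ} {x y z z' : ℝ → ℝ → ℝ}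

lemma picardMap_spec (hκ : 0 < κ) (hκ' : 0 < κ') (hγ : 0 < γ) (hγ' : 0 < γ')
    (h : 1 < κ + γ) (h' : 1 < κ' + γ') (hγγ : 1 < γ + γ') (hx : IsDriver γ γ' x)
    (hσ : SmoothBound C σ) (hδ : ∀ N, 0 < δ N) (hz : LocallyTame κ κ' δ z) {s t : ℝ}
    (h0 : 0 ≤ s + t) :
    HasTriIntegral γ γ' (fun s t => σ (z s t)) x s t (picardMap γ γ' σ x z s t) := by
  have key : ∃ v, HasTriIntegral γ γ' (fun s t => σ (z s t)) x s t v := by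
    obtain ⟨N, hN⟩ := exists_nat_ge (max s t)
    have hs : s ≤ N := (le_max_left _ _).trans hN
    have ht : t ≤ N := (le_max_right _ _).trans hN
    have hC : 0 ≤ C := (abs_nonneg _).trans (hσ.bound 0)
    obtain ⟨c1, c2⟩ := (hz N).comp (hδ N) hσ
    have hf := (c2.holderTri hκ hκ' (hδ N) (by positivity) c1).mono hs ht
    obtain ⟨K, hK, hxK⟩ := hx.bound (N + 1)
    refine exists_hasTriIntegral hκ hκ' hγ hγ' h h' hγγ hK h0 hf hx.continuous ?_
    intro s₁ s₂ t₁ t₂ h1 h2 h3 h4 h5 h6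
    push_cast at hxK
    exact hxK s₁ s₂ t₁ t₂ (by linarith) h2 (by linarith) (by linarith) h5 (by linarith)
  rw [picardMap, dif_pos key]
  exact key.choose_spec

lemma picardMap_isPotential (hκ : 0 < κ) (hκ' : 0 < κ') (hγ : 0 < γ) (hγ' : 0 < γ')
    (h : 1 < κ + γ) (h' : 1 < κ' + γ') (hγγ : 1 < γ + γ') (hx : IsDriver γ γ' x)
    (hσ : SmoothBound C σ) (hδ : ∀ N, 0 < δ N) (hz : LocallyTame κ κ' δ z) (S₀ T₀ : ℝ) :
    IsPotential (fun s t => σ (z s t)) x S₀ T₀ (picardMap γ γ' σ x z) :=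
  isPotential_of_hasTriIntegral hγ hγ' hγγ fun _ _ h0 _ _ =>
    picardMap_spec hκ hκ' hγ hγ' h h' hγγ hx hσ hδ hz h0

/-- Existence of solutions of the integral equation in the half plane `0 ≤ s + t`. -/
theorem exists_fixedPoint (hκ : 0 < κ) (hκ' : 0 < κ') (hκγ : κ ≤ γ) (hκγ' : κ' ≤ γ')
    (h : 1 < κ + γ) (h' : 1 < κ' + γ') (hγγ : 1 < γ + γ')
    (hx : IsDriver γ γ' x) (hσ : SmoothBound C σ) (hσ' : SmoothBound C (deriv σ)) :
    ∃ y : ℝ → ℝ → ℝ,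
      (∀ s t, 0 ≤ s + t → HasTriIntegral γ γ' (fun s t => σ (y s t)) x s t (y s t)) ∧
      ∀ N : ℕ, ∃ M, HolderTri κ κ' M N N y := by
  have hγ : 0 < γ := by linarith
  have hγ' : 0 < γ' := by linarith
  choose K hK hxK using hx.bound
  -- The triangle with vertex (N, N) contains the backward triangles of all its points, so the
  -- iteration can be studied on each of these triangles separately, with its own scale `δ N`,
  -- although the iterates are global functions.
  choose δ hδ using fun N : ℕ =>
    (eventually_smallScale (κ := κ) (κ' := κ') hγγ (K N) C ((N : ℝ) + N)).exists
  have hδ0 : ∀ N, 0 < δ N := fun N => (hδ N).pos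
  have hxT : ∀ N : ℕ, TriBound γ γ' (K N) N N x := fun N =>
    triBound_of_rectBound (hxK N) le_rfl le_rfl le_rfl le_rfl
  have hpot : ∀ {z}, LocallyTame κ κ' δ z → ∀ S₀ T₀,
      IsPotential (fun s t => σ (z s t)) x S₀ T₀ (picardMap γ γ' σ x z) := fun hz S₀ T₀ =>
    picardMap_isPotential hκ hκ' hγ hγ' h h' hγγ hx hσ hδ0 hz S₀ T₀
  have hstab : ∀ {z}, LocallyTame κ κ' δ z → ∀ N : ℕ,
      OscBound κ κ' (δ N) N N (fun _ => 1) 1 (picardMap γ γ' σ x z) ∧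
      SupBound N N (fun _ => 1) (((N : ℝ) + N) / δ N + 1) (picardMap γ γ' σ x z) := fun hz N =>
    IsPotential.stable hκ hκ' hκγ hκγ' h h' hγγ (hK N) (by positivity) (hδ N) hσ (hxT N) (hz N)
      (hpot hz N N)
  set y : ℕ → ℝ → ℝ → ℝ := picardIter γ γ' σ x with hy
  have hysucc : ∀ n, y (n + 1) = picardMap γ γ' σ x (y n) := fun n => rfl
  have htame : ∀ n, LocallyTame κ κ' δ (y n) := by
    intro n
    induction n with
    | zero =>
      intro N
      have hd := hδ0 N
      refine ⟨fun s₁ s₂ t h0 hs _ _ _ => ?_, fun s t₁ t₂ h0 ht _ _ _ => ?_,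
        fun s₁ s₂ t₁ t₂ h0 hs _ ht _ _ _ => ?_⟩
      · have : 0 ≤ ((s₂ - s₁) / δ N) ^ κ := Real.rpow_nonneg (div_nonneg (by linarith) hd.le) _
        simpa [hy, picardIter] using this
      · have : 0 ≤ ((t₂ - t₁) / δ N) ^ κ' := Real.rpow_nonneg (div_nonneg (by linarith) hd.le) _
        simpa [hy, picardIter] using this
      · have h1 : 0 ≤ ((s₂ - s₁) / δ N) ^ κ := Real.rpow_nonneg (div_nonneg (by linarith) hd.le) _
        have h2 : 0 ≤ ((t₂ - t₁) / δ N) ^ κ' := Real.rpow_nonneg (div_nonneg (by linarith) hd.le) _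
        simpa [hy, picardIter, rectIncr] using mul_nonneg h1 h2
    | succ n ih => exact fun N => (hstab ih N).1
  -- The 2 bounds the difference of two oscillations, each at most 1; the rest is the bound on the
  -- values of the first iterate.
  set B : ℕ → ℝ := fun N => 2 + (((N : ℝ) + N) / δ N + 1) with hB
  have hB0 : ∀ N, 0 ≤ B N := fun N => by have := hδ0 N; positivity
  have hw1 : ∀ N, ∀ r, 0 ≤ r → 1 ≤ Real.exp (r / δ N) := fun N r hr =>
    Real.one_le_exp (div_nonneg hr (hδ0 N).le)
  have hw0 : ∀ N, ∀ r, 0 ≤ Real.exp (r / δ N) := fun N r => (Real.exp_pos _).le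
  have hdiff : ∀ N n : ℕ,
      OscBound κ κ' (δ N) N N (fun r => Real.exp (r / δ N)) (B N / 2 ^ n)
        (fun s t => y (n + 1) s t - y n s t) ∧
      SupBound N N (fun r => Real.exp (r / δ N)) (B N / 2 ^ n)
        (fun s t => y (n + 1) s t - y n s t) := by
    intro N n
    have hd := hδ0 N
    have hq : 0 ≤ ((N : ℝ) + N) / δ N := by positivity
    induction n with
    | zero =>
      rw [pow_zero, div_one]
      have s0 : SupBound N N (fun _ => 1) 0 (y 0) := fun s t _ _ _ => by simp [hy, picardIter]
      refine ⟨(((htame 1 N).sub (htame 0 N)).weight hd (by norm_num) (hw1 N)).mono hd (hw0 N) ?_,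
        (((hstab (htame 0) N).2.sub s0).weight (by linarith) (hw1 N)).mono (hw0 N) ?_⟩
      · simp only [hB]; linarith
      · simp only [hB]; linarith
    | succ n ih =>
      have := IsPotential.contract hκ hκ' hκγ hκγ' h h' hγγ (hK N)
        (div_nonneg (hB0 N) (by positivity)) (hδ N) hσ hσ' (hxT N) (htame (n + 1) N) (htame n N)
        ih.1 ih.2 (hpot (htame (n + 1)) N N) (hpot (htame n) N N)
      rwa [div_div, ← pow_succ] at this
  have geo : ∀ {u : ℕ → ℝ} {b q : ℝ}, (∀ n, |u (n + 1) - u n| ≤ b / 2 ^ n * q) →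
      ∀ n, dist (u n) (u (n + 1)) ≤ (2 * (b * q)) / 2 / 2 ^ n := by
    intro u b q hu n
    rw [dist_comm, Real.dist_eq]
    refine (hu n).trans (le_of_eq ?_)
    field_simp
  have hlim : ∀ s t, 0 ≤ s + t →
      Tendsto (fun n => y n s t) atTop (𝓝 (picardLim γ γ' σ x s t)) := by
    intro s t h0
    obtain ⟨N, hN⟩ := exists_nat_ge (max s t)
    have hs : s ≤ N := (le_max_left _ _).trans hN
    have ht : t ≤ N := (le_max_right _ _).trans hN
    have hc : CauchySeq fun n => y n s t := cauchySeq_of_le_geometric_two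
      (geo (u := fun n => y n s t) fun n => (hdiff N n).2 s t h0 hs ht)
    exact hc.tendsto_limUnder
  set Y := picardLim γ γ' σ x with hY
  have bound : ∀ {u : ℕ → ℝ} {b q v : ℝ}, (∀ n, |u (n + 1) - u n| ≤ b / 2 ^ n * q) →
      Tendsto u atTop (𝓝 v) → ∀ n, |v - u n| ≤ 2 * b / 2 ^ n * q := by
    intro u b q v hu hv n
    have := dist_le_of_le_geometric_two_of_tendsto (geo hu) hv n
    rw [dist_comm, Real.dist_eq] at this
    refine this.trans (le_of_eq ?_)
    ring
  have hrectlim : ∀ s₁ s₂ t₁ t₂, 0 ≤ s₁ + t₁ → s₁ ≤ s₂ → t₁ ≤ t₂ →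
      Tendsto (fun n => rectIncr (y n) s₁ s₂ t₁ t₂) atTop (𝓝 (rectIncr Y s₁ s₂ t₁ t₂)) :=
    fun s₁ s₂ t₁ t₂ h0 hs ht =>
      (((hlim s₁ t₁ h0).sub (hlim s₁ t₂ (by linarith))).sub (hlim s₂ t₁ (by linarith))).add
        (hlim s₂ t₂ (by linarith))
  have hYtame : LocallyTame κ κ' δ Y := by
    intro N
    refine ⟨fun s₁ s₂ t h0 hs hd hS hT => ?_, fun s t₁ t₂ h0 ht hd hS hT => ?_,
      fun s₁ s₂ t₁ t₂ h0 hs hd ht hd' hS hT => ?_⟩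
    · exact le_of_tendsto' ((hlim s₂ t (by linarith)).sub (hlim s₁ t h0)).abs
        fun n => (htame n N).fst s₁ s₂ t h0 hs hd hS hT
    · exact le_of_tendsto' ((hlim s t₂ (by linarith)).sub (hlim s t₁ h0)).abs
        fun n => (htame n N).snd s t₁ t₂ h0 ht hd hS hT
    · exact le_of_tendsto' (hrectlim s₁ s₂ t₁ t₂ h0 hs ht).abs
        fun n => (htame n N).rect s₁ s₂ t₁ t₂ h0 hs hd ht hd' hS hT
  -- The successive differences are bounded by a geometric series of ratio 1/2 in each of the
  -- seminorms; summing the tail doubles the constant.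
  have hYdiff : ∀ N n : ℕ,
      OscBound κ κ' (δ N) N N (fun r => Real.exp (r / δ N)) (2 * B N / 2 ^ n)
        (fun s t => Y s t - y n s t) ∧
      SupBound N N (fun r => Real.exp (r / δ N)) (2 * B N / 2 ^ n)
        (fun s t => Y s t - y n s t) := by
    intro N n
    refine ⟨⟨fun s₁ s₂ t h0 hs hd hS hT => ?_, fun s t₁ t₂ h0 ht hd hS hT => ?_,
      fun s₁ s₂ t₁ t₂ h0 hs hd ht hd' hS hT => ?_⟩, fun s t h0 hS hT => ?_⟩
    · have := bound (u := fun n => y n s₂ t - y n s₁ t) (b := B N)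
        (q := Real.exp ((s₂ + t) / δ N) * ((s₂ - s₁) / δ N) ^ κ) (fun n => by
          have := (hdiff N n).1.fst s₁ s₂ t h0 hs hd hS hT
          rw [← mul_assoc]; convert this using 2; ring)
        ((hlim s₂ t (by linarith)).sub (hlim s₁ t h0)) n
      rw [← mul_assoc] at this
      convert this using 2; ring
    · have := bound (u := fun n => y n s t₂ - y n s t₁) (b := B N)
        (q := Real.exp ((s + t₂) / δ N) * ((t₂ - t₁) / δ N) ^ κ') (fun n => by
          have := (hdiff N n).1.snd s t₁ t₂ h0 ht hd hS hT
          rw [← mul_assoc]; convert this using 2; ring)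
        ((hlim s t₂ (by linarith)).sub (hlim s t₁ h0)) n
      rw [← mul_assoc] at this
      convert this using 2; ring
    · have := bound (u := fun n => rectIncr (y n) s₁ s₂ t₁ t₂) (b := B N)
        (q := Real.exp ((s₂ + t₂) / δ N) * (((s₂ - s₁) / δ N) ^ κ * ((t₂ - t₁) / δ N) ^ κ'))
        (fun n => by
          have := (hdiff N n).1.rect s₁ s₂ t₁ t₂ h0 hs hd ht hd' hS hT
          rw [← mul_assoc]; convert this using 2; simp only [rectIncr]; ring)
        (hrectlim s₁ s₂ t₁ t₂ h0 hs ht) n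
      rw [← mul_assoc] at this
      convert this using 2; simp only [rectIncr]; ring
    · exact bound (u := fun n => y n s t) (fun n => (hdiff N n).2 s t h0 hS hT) (hlim s t h0) n
  -- The image of Y and y (n + 1) are the images of Y and y n, so the contraction and the tail bound
  -- show that y (n + 1) converges to the image of Y, while it converges to Y by construction.
  have hfix : ∀ s t, 0 ≤ s + t → picardMap γ γ' σ x Y s t = Y s t := by
    intro s t h0
    obtain ⟨N, hN⟩ := exists_nat_ge (max s t)
    have hs : s ≤ N := (le_max_left _ _).trans hN
    have ht : t ≤ N := (le_max_right _ _).trans hN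
    have c : ∀ n, |picardMap γ γ' σ x Y s t - y (n + 1) s t| ≤
        2 * B N / 2 ^ n / 2 * Real.exp ((s + t) / δ N) := fun n =>
      (IsPotential.contract hκ hκ' hκγ hκγ' h h' hγγ (hK N)
        (div_nonneg (mul_nonneg zero_le_two (hB0 N)) (by positivity)) (hδ N) hσ hσ' (hxT N)
        (hYtame N) (htame n N) (hYdiff N n).1 (hYdiff N n).2 (hpot hYtame N N)
        (hpot (htame n) N N)).2 s t h0 hs ht
    have l0 : Tendsto (fun n : ℕ => 2 * B N / 2 ^ n / 2 * Real.exp ((s + t) / δ N)) atTop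
        (𝓝 0) := by
      have : Tendsto (fun n : ℕ => 2 * B N / 2 ^ n) atTop (𝓝 0) :=
        tendsto_const_nhds.div_atTop (tendsto_pow_atTop_atTop_of_one_lt one_lt_two)
      simpa using (this.div_const 2).mul_const (Real.exp ((s + t) / δ N))
    have l1 : Tendsto (fun n => picardMap γ γ' σ x Y s t - y (n + 1) s t) atTop (𝓝 0) :=
      squeeze_zero_norm c l0
    have l2 : Tendsto (fun n => picardMap γ γ' σ x Y s t - y (n + 1) s t) atTop
        (𝓝 (picardMap γ γ' σ x Y s t - Y s t)) :=
      tendsto_const_nhds.sub ((hlim s t h0).comp (tendsto_add_atTop_nat 1))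
    exact sub_eq_zero.1 (tendsto_nhds_unique l2 l1)
  refine ⟨Y, fun s t h0 => ?_, fun N => ?_⟩
  · have := picardMap_spec hκ hκ' hγ hγ' h h' hγγ hx hσ hδ0 hYtame h0
    rwa [hfix s t h0] at this
  · have hd := hδ0 N
    have hq : 0 ≤ ((N : ℝ) + N) / δ N := by positivity
    have s1 : SupBound N N (fun _ => 1) (((N : ℝ) + N) / δ N + 1) Y := fun s t h0 hS hT => by
      rw [← hfix s t h0]; exact (hstab hYtame N).2 s t h0 hS hT
    exact ⟨_, ((hYtame N).mono hd (fun _ => zero_le_one) (by linarith)).holderTri hκ hκ' hd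
      (by linarith) s1⟩

/-- Bounds, at a given scale, of the composition of a Hölder function with a smooth one. -/
lemma HolderTri.comp_bounds {N : ℕ} {M d : ℝ} (hκ : 0 < κ) (hκ' : 0 < κ') (hd0 : 0 < d)
    (hσ : SmoothBound C σ) (hyM : HolderTri κ κ' M N N y) :
    ∃ B, 0 ≤ B ∧ SupBound N N (fun _ => 1) B (fun s t => σ (y s t)) ∧
      OscBound κ κ' d N N (fun _ => 1) B (fun s t => σ (y s t)) := by
  have hM : 0 ≤ M := (abs_nonneg _).trans (hyM.sup N N (by positivity) le_rfl le_rfl)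
  have hC : 0 ≤ C := (abs_nonneg _).trans (hσ.bound 0)
  have t0 : ∀ κ : ℝ, 0 < κ → Tendsto (fun δ : ℝ => δ ^ κ) (𝓝[>] 0) (𝓝 0) := fun κ hκ => by
    have h := (Real.continuousAt_rpow_const 0 κ (Or.inr hκ.le)).tendsto
    rw [Real.zero_rpow hκ.ne'] at h
    exact h.mono_left nhdsWithin_le_nhds
  have l1 : Tendsto (fun δ : ℝ => M * δ ^ κ) (𝓝[>] 0) (𝓝 0) := by
    simpa using (t0 κ hκ).const_mul M
  have l2 : Tendsto (fun δ : ℝ => M * δ ^ κ') (𝓝[>] 0) (𝓝 0) := by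
    simpa using (t0 κ' hκ').const_mul M
  have l3 : Tendsto (fun δ : ℝ => M * (δ ^ κ * δ ^ κ')) (𝓝[>] 0) (𝓝 0) := by
    simpa using ((t0 κ hκ).mul (t0 κ' hκ')).const_mul M
  -- `OscBound.comp` requires oscillations at most 1, so the composition is estimated at an
  -- auxiliary small scale δ; the resulting Hölder bound is then read at the given scale d.
  obtain ⟨δ, hδ0, h1, h2, h3⟩ := ((show ∀ᶠ δ in 𝓝[>] (0 : ℝ), 0 < δ from
    self_mem_nhdsWithin).and ((l1.eventually (gt_mem_nhds one_pos)).and ((l2.eventually (gt_mem_nhds one_pos)).and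
      (l3.eventually (gt_mem_nhds one_pos))))).exists
  have hδ0 : 0 < δ := hδ0
  obtain ⟨c1, c2⟩ := (hyM.oscBound hδ0 h1.le h2.le h3.le).comp hδ0 hσ
  have hf := c2.holderTri hκ hκ' hδ0 (by positivity) c1
  set M' := 4 * (2 * C) * ((1 + (δ ^ κ)⁻¹) * (1 + (δ ^ κ')⁻¹)) with hM'
  have hM'0 : 0 ≤ M' := by positivity
  have hdκ : 0 < d ^ κ := Real.rpow_pos_of_pos hd0 _
  have hdκ' : 0 < d ^ κ' := Real.rpow_pos_of_pos hd0 _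
  set B := M' * ((1 + d ^ κ) * (1 + d ^ κ')) with hB
  have b0 : M' ≤ B := le_mul_of_one_le_right hM'0 (by nlinarith [mul_pos hdκ hdκ'])
  have b1 : M' * d ^ κ ≤ B := mul_le_mul_of_nonneg_left (by nlinarith [mul_pos hdκ hdκ']) hM'0
  have b2 : M' * d ^ κ' ≤ B := mul_le_mul_of_nonneg_left (by nlinarith [mul_pos hdκ hdκ']) hM'0
  have b3 : M' * (d ^ κ * d ^ κ') ≤ B :=
    mul_le_mul_of_nonneg_left (by nlinarith [mul_pos hdκ hdκ']) hM'0
  have hB0 : 0 ≤ B := hM'0.trans b0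
  clear_value B M'
  have sup : SupBound N N (fun _ => 1) B (fun s t => σ (y s t)) := fun s t h0 hS hT => by
    rw [mul_one]; exact (hf.sup s t h0 hS hT).trans b0
  have osc : OscBound κ κ' d N N (fun _ => 1) B (fun s t => σ (y s t)) := by
    refine ⟨fun s₁ s₂ t h0 hs _ hS hT => ?_, fun s t₁ t₂ h0 ht _ hS hT => ?_,
      fun s₁ s₂ t₁ t₂ h0 hs _ ht _ hS hT => ?_⟩
    · refine (hf.fst s₁ s₂ t h0 hs hS hT).trans ?_
      rw [Real.div_rpow (by linarith) hd0.le, mul_one, mul_div_assoc', le_div_iff₀ hdκ]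
      nlinarith [mul_le_mul_of_nonneg_right b1 (Real.rpow_nonneg (sub_nonneg.2 hs) κ)]
    · refine (hf.snd s t₁ t₂ h0 ht hS hT).trans ?_
      rw [Real.div_rpow (by linarith) hd0.le, mul_one, mul_div_assoc', le_div_iff₀ hdκ']
      nlinarith [mul_le_mul_of_nonneg_right b2 (Real.rpow_nonneg (sub_nonneg.2 ht) κ')]
    · refine (hf.rect s₁ s₂ t₁ t₂ h0 hs ht hS hT).trans ?_
      rw [Real.div_rpow (by linarith) hd0.le, Real.div_rpow (by linarith) hd0.le, mul_one,
        div_mul_div_comm, mul_div_assoc', le_div_iff₀ (by positivity)]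
      have := mul_nonneg (Real.rpow_nonneg (sub_nonneg.2 hs) κ)
        (Real.rpow_nonneg (sub_nonneg.2 ht) κ')
      nlinarith [mul_le_mul_of_nonneg_right b3 this]
  exact ⟨B, hB0, sup, osc⟩

/-- Regularity of solutions: they inherit the Hölder exponents of the driver. -/
theorem IsPotential.regularity {N : ℕ} {M η η' : ℝ} (hκ : 0 < κ) (hκ' : 0 < κ')
    (h : 1 < κ + η) (h' : 1 < κ' + η') (hη : 0 < η) (hη' : 0 < η') (hηη : 1 < η + η')
    (hx : IsDriver η η' x) (hσ : SmoothBound C σ) (hyM : HolderTri κ κ' M N N y)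
    (hy : IsPotential (fun s t => σ (y s t)) x N N y) :
    ∃ A, HolderTri η η' A N N y ∧
      ∀ s t : ℝ, 0 ≤ s + t → s ≤ N → t ≤ N → |y s t| ≤ A * (s + t) ^ (η + η') := by
  obtain ⟨K, hK, hxK⟩ := hx.bound N
  have hxT : TriBound η η' K N N x := triBound_of_rectBound hxK le_rfl le_rfl le_rfl le_rfl
  -- This scale exceeds every side of a rectangle in the triangle with vertex (N, N), so bounds on
  -- increments of length at most d cover all increments. No smallness is needed, since y is already
  -- known to be a solution.
  set d : ℝ := 2 * N + 1 with hd
  have hd0 : 0 < d := by positivity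
  obtain ⟨B, hB0, sup, osc⟩ := hyM.comp_bounds hκ hκ' hd0 hσ
  obtain ⟨r, f, g, tr⟩ := hy.incrBound hκ hκ' hη hη' h h' hηη hK hB0 hd0
    (add_nonneg (div_nonneg (by positivity) hd0.le) zero_le_one) (fun _ => zero_le_one)
    (fun _ _ _ => le_rfl) (weightSum_one hd0 (by positivity)) sup osc hxT
  set A₀ := 4 * youngConst κ κ' η η' * K * B with hA₀
  set A₁ := A₀ * (((N : ℝ) + N) / d + 1 + dyadicConst (η + η')) with hA₁
  have hY0 := youngConst_nonneg h h'
  have hD0 := dyadicConst_nonneg (η + η')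
  have hA₀0 : 0 ≤ A₀ := by rw [hA₀]; positivity
  have hA₁0 : 0 ≤ A₁ := by rw [hA₁]; positivity
  have p1 : 1 ≤ d ^ η := Real.one_le_rpow (by rw [hd]; linarith [(Nat.cast_nonneg N : (0 : ℝ) ≤ N)]) hη.le
  have p2 : 1 ≤ d ^ η' := Real.one_le_rpow (by rw [hd]; linarith [(Nat.cast_nonneg N : (0 : ℝ) ≤ N)]) hη'.le
  have p12 : 1 ≤ d ^ η * d ^ η' := one_le_mul_of_one_le_of_one_le p1 p2
  set A := A₀ + A₁ * (d ^ η * d ^ η') with hA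
  have a0 : A₀ ≤ A := le_add_of_nonneg_right (by positivity)
  have a1 : A₁ ≤ A := by nlinarith
  have a2 : A₁ * d ^ η' ≤ A := by nlinarith [mul_le_mul_of_nonneg_left (le_mul_of_one_le_left (by positivity : 0 ≤ d ^ η') p1) hA₁0]
  have a3 : A₁ * d ^ η ≤ A := by nlinarith [mul_le_mul_of_nonneg_left (le_mul_of_one_le_right (by positivity : 0 ≤ d ^ η) p2) hA₁0]
  have hA0 : 0 ≤ A := hA₀0.trans a0
  have tri : ∀ s t : ℝ, 0 ≤ s + t → s ≤ N → t ≤ N → |y s t| ≤ A₁ * (s + t) ^ (η + η') :=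
    fun s t h0 hS hT => by
      simpa using tr s t h0 (by rw [hd]; linarith) hS hT
  have hdle : 2 * (N : ℝ) ≤ d := by rw [hd]; linarith
  clear_value A A₁ A₀ d
  refine ⟨A * (1 + d ^ (η + η')), ⟨fun s t h0 hS hT => ?_, fun s₁ s₂ t h0 hs hS hT => ?_,
    fun s t₁ t₂ h0 ht hS hT => ?_, fun s₁ s₂ t₁ t₂ h0 hs ht hS hT => ?_⟩, fun s t h0 hS hT => ?_⟩
  all_goals have hp : 0 ≤ d ^ (η + η') := by positivity
  all_goals have hA1 : A ≤ A * (1 + d ^ (η + η')) := le_mul_of_one_le_right hA0 (by linarith)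
  · have := Real.rpow_le_rpow h0 (show s + t ≤ d by linarith)
      (show 0 ≤ η + η' by linarith)
    have e := tri s t h0 hS hT
    nlinarith [mul_le_mul_of_nonneg_left this hA₁0, mul_le_mul_of_nonneg_right a1 hp]
  · have e := f s₁ s₂ t h0 hs (by linarith) hS hT
    have n := Real.rpow_nonneg (sub_nonneg.2 hs) η
    rw [mul_one, mul_comm ((s₂ - s₁) ^ η), ← mul_assoc] at e
    exact e.trans (mul_le_mul_of_nonneg_right (a2.trans hA1) n)
  · have e := g s t₁ t₂ h0 ht (by linarith) hS hT
    have n := Real.rpow_nonneg (sub_nonneg.2 ht) η'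
    rw [mul_one, ← mul_assoc] at e
    exact e.trans (mul_le_mul_of_nonneg_right (a3.trans hA1) n)
  · have e := r s₁ s₂ t₁ t₂ h0 hs (by linarith) ht (by linarith) hS hT
    have n := mul_nonneg (Real.rpow_nonneg (sub_nonneg.2 hs) η)
      (Real.rpow_nonneg (sub_nonneg.2 ht) η')
    rw [mul_one] at e
    exact e.trans (mul_le_mul_of_nonneg_right (a0.trans hA1) n)
  · have e := tri s t h0 hS hT
    have n := Real.rpow_nonneg h0 (η + η')
    exact e.trans (mul_le_mul_of_nonneg_right (a1.trans hA1) n)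

end

end FracWave

end

noncomputable section

namespace FracWave

/-! ### Dyadic chaining -/

/-- The dyadic point `k / 2 ^ n`. -/
def dyad (n : ℕ) (k : ℤ) : ℝ := k * (1 / 2) ^ n

lemma dyad_add_one (n : ℕ) (k : ℤ) : dyad n (k + 1) - dyad n k = (1 / 2) ^ n := by
  simp only [dyad]; push_cast; ring

lemma dyad_two_mul (n : ℕ) (k : ℤ) : dyad (n + 1) (2 * k) = dyad n k := by
  simp only [dyad, pow_succ]; push_cast; ring

lemma dyad_mono (n : ℕ) {k l : ℤ} (h : k ≤ l) : dyad n k ≤ dyad n l := by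
  have : (k : ℝ) ≤ l := by exact_mod_cast h
  unfold dyad
  gcongr

/-- The constant in the chaining estimate. -/
def chainConst (N : ℕ) (γ : ℝ) : ℝ := 2 * N + 2 + 2 / (2 ^ γ - 1)

lemma chainConst_nonneg (N : ℕ) {γ : ℝ} (hγ : 0 < γ) : 0 ≤ chainConst N γ := by
  have : (1 : ℝ) < 2 ^ γ := Real.one_lt_rpow (by norm_num) hγ
  have : 0 < (2 : ℝ) ^ γ - 1 := by linarith
  unfold chainConst
  positivity

/-- An interval between points of level n + 1 is one between points of level n plus at most one step
at each end, or has no more than two steps in all. The subtracted term is slack for the induction: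
its coefficient c' solves 2 + c' = c' 2^γ, so that passing to the next level releases exactly the
two end steps. At level 0 there are at most 2N unit steps. -/
lemma chaining {g : ℝ → ℝ} {A γ : ℝ} {N : ℕ} (hγ : 0 < γ) (hA : 0 ≤ A)
    (h : ∀ n : ℕ, ∀ k : ℤ, -(N * 2 ^ n) ≤ k → k + 1 ≤ N * 2 ^ n →
      |g (dyad n (k + 1)) - g (dyad n k)| ≤ A * ((1 / 2) ^ n) ^ γ) (n : ℕ) :
    ∀ k l : ℤ, k < l → -(N * 2 ^ n) ≤ k → l ≤ N * 2 ^ n →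
      |g (dyad n l) - g (dyad n k)| ≤
        A * (chainConst N γ * (dyad n l - dyad n k) ^ γ - 2 / (2 ^ γ - 1) * ((1 / 2) ^ n) ^ γ) := by
  have h2 : (1 : ℝ) < 2 ^ γ := Real.one_lt_rpow (by norm_num) hγ
  have h2' : 0 < (2 : ℝ) ^ γ - 1 := by linarith
  set c' := 2 / ((2 : ℝ) ^ γ - 1) with hc'
  have hc'0 : 0 < c' := by positivity
  have hcc : 2 + c' = c' * 2 ^ γ := by rw [hc']; field_simp; ring
  induction n with
  | zero =>
    intro k l hkl hk hl
    simp only [pow_zero, mul_one] at hk hl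
    obtain ⟨r, rfl⟩ : ∃ r : ℕ, l = k + r := ⟨(l - k).toNat, by omega⟩
    have step : ∀ r : ℕ, k + r ≤ N → |g (dyad 0 (k + r)) - g (dyad 0 k)| ≤ r * A := by
      intro r
      induction r with
      | zero => simp
      | succ r ih =>
        intro hr
        push_cast at hr
        have e1 := ih (by omega)
        have e2 := h 0 (k + r) (by simp; omega) (by simp; omega)
        simp only [pow_zero, Real.one_rpow, mul_one] at e2
        push_cast
        rw [← add_assoc]
        have := abs_sub_le (g (dyad 0 (k + r + 1))) (g (dyad 0 (k + r))) (g (dyad 0 k))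
        linarith
    have hr1 : (1 : ℝ) ≤ r := by have : 1 ≤ r := by omega
                                 exact_mod_cast this
    have hrN : (r : ℝ) ≤ 2 * N := by have : r ≤ 2 * N := by omega
                                     exact_mod_cast this
    have e : dyad 0 (k + r) - dyad 0 k = r := by simp [dyad]
    rw [e, pow_zero, Real.one_rpow, mul_one]
    refine (step r hl).trans ?_
    rw [mul_comm]
    refine mul_le_mul_of_nonneg_left ?_ hA
    have p : 1 ≤ (r : ℝ) ^ γ := Real.one_le_rpow hr1 hγ.le
    have q : chainConst N γ = 2 * N + 2 + c' := rfl
    have : chainConst N γ * 1 ≤ chainConst N γ * (r : ℝ) ^ γ :=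
      mul_le_mul_of_nonneg_left p (chainConst_nonneg N hγ)
    linarith
  | succ n ih =>
    intro k l hkl hk hl
    set u := ((1 : ℝ) / 2) ^ (n + 1) with hu
    have hu0 : 0 < u := by positivity
    have hun : ((1 / 2) ^ n : ℝ) = 2 * u := by rw [hu, pow_succ]; ring
    have huγ : ((1 / 2 : ℝ) ^ n) ^ γ = 2 ^ γ * u ^ γ := by
      rw [hun, Real.mul_rpow (by norm_num) hu0.le]
    have huγ0 : 0 ≤ u ^ γ := Real.rpow_nonneg hu0.le _
    set P : ℤ := N * 2 ^ n with hP
    have hP2 : (N : ℤ) * 2 ^ (n + 1) = 2 * P := by rw [hP, pow_succ]; ring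
    rw [hP2] at hk hl
    have h1 := h (n + 1)
    rw [hP2] at h1
    obtain ⟨k', hk'⟩ : ∃ k' : ℤ, 2 * k' = k ∨ 2 * k' = k + 1 := by
      rcases Int.even_or_odd' k with ⟨q, hq | hq⟩
      · exact ⟨q, by omega⟩
      · exact ⟨q + 1, by omega⟩
    obtain ⟨l', hl'⟩ : ∃ l' : ℤ, 2 * l' = l ∨ 2 * l' + 1 = l := by
      rcases Int.even_or_odd' l with ⟨q, hq | hq⟩
      · exact ⟨q, by omega⟩
      · exact ⟨q, by omega⟩
    clear_value P
    have ek : |g (dyad n k') - g (dyad (n + 1) k)| ≤ A * u ^ γ := by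
      rw [← dyad_two_mul n k']
      rcases hk' with hq | hq
      · rw [hq, sub_self, abs_zero]; positivity
      · rw [hq]; exact h1 k (by omega) (by omega)
    have el : |g (dyad (n + 1) l) - g (dyad n l')| ≤ A * u ^ γ := by
      rw [← dyad_two_mul n l']
      rcases hl' with hq | hq
      · rw [hq, sub_self, abs_zero]; positivity
      · rw [← hq]; exact h1 (2 * l') (by omega) (by omega)
    have hlen : u ≤ dyad (n + 1) l - dyad (n + 1) k := by
      have := dyad_mono (n + 1) (show k + 1 ≤ l by omega)
      have := dyad_add_one (n + 1) k
      linarith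
    have tri : |g (dyad (n + 1) l) - g (dyad (n + 1) k)| ≤
        A * u ^ γ + |g (dyad n l') - g (dyad n k')| + A * u ^ γ := by
      rw [abs_le] at ek el ⊢
      have := abs_le.1 (le_refl |g (dyad n l') - g (dyad n k')|)
      constructor <;> linarith [ek.1, ek.2, el.1, el.2, this.1, this.2]
    refine tri.trans ?_
    rcases (show k' ≤ l' by omega).eq_or_lt with heq | hlt
    · rw [heq, sub_self, abs_zero]
      have p : u ^ γ ≤ (dyad (n + 1) l - dyad (n + 1) k) ^ γ := Real.rpow_le_rpow hu0.le hlen hγ.le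
      have q : 2 + c' ≤ chainConst N γ := by
        have : chainConst N γ = 2 * N + 2 + c' := rfl
        have : (0 : ℝ) ≤ N := Nat.cast_nonneg N
        linarith
      have r : (2 + c') * u ^ γ ≤ chainConst N γ * (dyad (n + 1) l - dyad (n + 1) k) ^ γ :=
        mul_le_mul q p huγ0 (chainConst_nonneg N hγ)
      have := mul_le_mul_of_nonneg_left r hA
      nlinarith
    · have e := ih k' l' hlt (by omega) (by omega)
      rw [huγ] at e
      have m1 : dyad n l' ≤ dyad (n + 1) l := by
        rw [← dyad_two_mul n l']; exact dyad_mono _ (by omega)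
      have m2 : dyad (n + 1) k ≤ dyad n k' := by
        rw [← dyad_two_mul n k']; exact dyad_mono _ (by omega)
      have m3 := dyad_mono n hlt.le
      have p : (dyad n l' - dyad n k') ^ γ ≤ (dyad (n + 1) l - dyad (n + 1) k) ^ γ :=
        Real.rpow_le_rpow (by linarith) (by linarith) hγ.le
      have p' := mul_le_mul_of_nonneg_left p (chainConst_nonneg N hγ)
      have e2 : A * (chainConst N γ * (dyad n l' - dyad n k') ^ γ - c' * (2 ^ γ * u ^ γ)) ≤
          A * (chainConst N γ * (dyad (n + 1) l - dyad (n + 1) k) ^ γ - c' * (2 ^ γ * u ^ γ)) :=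
        mul_le_mul_of_nonneg_left (by linarith) hA
      have e3 : c' * (2 ^ γ * u ^ γ) = (2 + c') * u ^ γ := by rw [hcc]; ring
      rw [e3] at e2 e
      have : A * u ^ γ + A * (chainConst N γ * (dyad (n + 1) l - dyad (n + 1) k) ^ γ
          - (2 + c') * u ^ γ) + A * u ^ γ = A * (chainConst N γ *
          (dyad (n + 1) l - dyad (n + 1) k) ^ γ - c' * u ^ γ) := by ring
      linarith

/-- Hölder continuity on the dyadic points of a given level. -/
lemma chaining_le {g : ℝ → ℝ} {A γ : ℝ} {N : ℕ} (hγ : 0 < γ) (hA : 0 ≤ A)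
    (h : ∀ n : ℕ, ∀ k : ℤ, -(N * 2 ^ n) ≤ k → k + 1 ≤ N * 2 ^ n →
      |g (dyad n (k + 1)) - g (dyad n k)| ≤ A * ((1 / 2) ^ n) ^ γ) (n : ℕ) {k l : ℤ} (hkl : k ≤ l)
    (hk : -(N * 2 ^ n) ≤ k) (hl : l ≤ N * 2 ^ n) :
    |g (dyad n l) - g (dyad n k)| ≤ A * (chainConst N γ * (dyad n l - dyad n k) ^ γ) := by
  rcases hkl.eq_or_lt with rfl | hlt
  · simp [Real.zero_rpow hγ.ne']
  · refine (chaining hγ hA h n k l hlt hk hl).trans (mul_le_mul_of_nonneg_left ?_ hA)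
    have h2 : (1 : ℝ) < 2 ^ γ := Real.one_lt_rpow (by norm_num) hγ
    have : 0 < (2 : ℝ) ^ γ - 1 := by linarith
    have : 0 ≤ 2 / ((2 : ℝ) ^ γ - 1) * (((1 : ℝ) / 2) ^ n) ^ γ := by positivity
    linarith

/-- Bounds of the increments of `f` over the dyadic rectangles of `[-N, N]²`. -/
def DyadicBound (γ γ' K : ℝ) (N : ℕ) (f : ℝ → ℝ → ℝ) : Prop :=
  ∀ n m : ℕ, ∀ k l : ℤ, -(N * 2 ^ n) ≤ k → k + 1 ≤ N * 2 ^ n → -(N * 2 ^ m) ≤ l →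
    l + 1 ≤ N * 2 ^ m → |rectIncr f (dyad n k) (dyad n (k + 1)) (dyad m l) (dyad m (l + 1))| ≤
      K * (((1 / 2) ^ n) ^ γ * ((1 / 2) ^ m) ^ γ')

/-- Chaining in the first variable for the increments over a fixed dyadic interval of the second,
then chaining in the second; the constants multiply. -/
lemma DyadicBound.rect {γ γ' K : ℝ} {N : ℕ} {f : ℝ → ℝ → ℝ} (hγ : 0 < γ) (hγ' : 0 < γ')
    (hK : 0 ≤ K) (h : DyadicBound γ γ' K N f) {n m : ℕ} {k k' l l' : ℤ} (hk : k ≤ k')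
    (hkN : -(N * 2 ^ n) ≤ k) (hkN' : k' ≤ N * 2 ^ n) (hl : l ≤ l') (hlN : -(N * 2 ^ m) ≤ l)
    (hlN' : l' ≤ N * 2 ^ m) :
    |rectIncr f (dyad n k) (dyad n k') (dyad m l) (dyad m l')| ≤
      K * (chainConst N γ * chainConst N γ') *
        ((dyad n k' - dyad n k) ^ γ * (dyad m l' - dyad m l) ^ γ') := by
  have hc := chainConst_nonneg N hγ
  have hd : 0 ≤ (dyad n k' - dyad n k) ^ γ :=
    Real.rpow_nonneg (sub_nonneg.2 (dyad_mono n hk)) _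
  have step1 : ∀ m : ℕ, ∀ l : ℤ, -(N * 2 ^ m) ≤ l → l + 1 ≤ N * 2 ^ m →
      |(f (dyad n k') (dyad m (l + 1)) - f (dyad n k) (dyad m (l + 1))) -
        (f (dyad n k') (dyad m l) - f (dyad n k) (dyad m l))| ≤
      K * (chainConst N γ * (dyad n k' - dyad n k) ^ γ) * ((1 / 2) ^ m) ^ γ' := by
    intro m l hl hl'
    have hp : 0 ≤ (((1 : ℝ) / 2) ^ m) ^ γ' := by positivity
    have := chaining_le (g := fun s => f s (dyad m (l + 1)) - f s (dyad m l))
      (A := K * (((1 : ℝ) / 2) ^ m) ^ γ') hγ (by positivity) (fun n k hk hk' => by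
        refine (le_of_eq ?_).trans ((h n m k l hk hk' hl hl').trans (le_of_eq (by ring)))
        unfold rectIncr; congr 1; ring) n hk hkN hkN'
    refine (le_of_eq ?_).trans (this.trans (le_of_eq (by ring)))
    congr 1; ring
  have := chaining_le (g := fun t => f (dyad n k') t - f (dyad n k) t)
    (A := K * (chainConst N γ * (dyad n k' - dyad n k) ^ γ)) hγ' (by positivity) step1 m hl hlN hlN'
  refine (le_of_eq ?_).trans (this.trans (le_of_eq (by ring)))
  unfold rectIncr; congr 1; ring

/-! ### Extension from the dyadic points -/

/-- The largest dyadic point of level `n` below `s`. -/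
def dyadFloor (n : ℕ) (s : ℝ) : ℝ := dyad n ⌊s * 2 ^ n⌋

lemma dyadFloor_mono (n : ℕ) {s t : ℝ} (h : s ≤ t) : dyadFloor n s ≤ dyadFloor n t :=
  dyad_mono n (Int.floor_le_floor (by gcongr))

lemma dyadFloor_le (n : ℕ) (s : ℝ) : dyadFloor n s ≤ s := by
  have := Int.floor_le (s * 2 ^ n)
  simp only [dyadFloor, dyad, one_div, inv_pow]
  rw [← div_eq_mul_inv, div_le_iff₀ (by positivity)]
  exact this

lemma lt_dyadFloor_add (n : ℕ) (s : ℝ) : s < dyadFloor n s + (1 / 2) ^ n := by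
  have := Int.lt_floor_add_one (s * 2 ^ n)
  simp only [dyadFloor, dyad, one_div, inv_pow]
  rw [← div_eq_mul_inv, ← one_div, ← add_div, lt_div_iff₀ (by positivity)]
  exact this

lemma dyadFloor_zero (n : ℕ) : dyadFloor n 0 = 0 := by simp [dyadFloor, dyad]

lemma tendsto_dyadFloor (s : ℝ) : Tendsto (fun n => dyadFloor n s) atTop (𝓝 s) := by
  have h : Tendsto (fun n : ℕ => s - (1 / 2 : ℝ) ^ n) atTop (𝓝 (s - 0)) :=
    tendsto_const_nhds.sub (tendsto_pow_atTop_nhds_zero_of_lt_one (by norm_num) (by norm_num))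
  rw [sub_zero] at h
  exact tendsto_of_tendsto_of_tendsto_of_le_of_le h tendsto_const_nhds
    (fun n => by linarith [lt_dyadFloor_add n s]) (fun n => dyadFloor_le n s)

lemma floor_mem {N n : ℕ} {s : ℝ} (h : s ∈ Icc (-(N : ℝ)) N) :
    -((N : ℤ) * 2 ^ n) ≤ ⌊s * 2 ^ n⌋ ∧ ⌊s * 2 ^ n⌋ ≤ (N : ℤ) * 2 ^ n := by
  have h2 : (0 : ℝ) < 2 ^ n := by positivity
  constructor
  · rw [Int.le_floor]; push_cast; nlinarith [h.1]
  · have : (⌊s * 2 ^ n⌋ : ℝ) ≤ N * 2 ^ n := (Int.floor_le _).trans (by nlinarith [h.2])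
    exact_mod_cast this

/-- The extension by continuity of the restriction of `f` to the dyadic points. -/
def dyadicExt (f : ℝ → ℝ → ℝ) : ℝ → ℝ → ℝ := fun s t =>
  limUnder atTop fun n => f (dyadFloor n s) (dyadFloor n t)

/-- A common refinement of two dyadic points. -/
lemma dyad_refine (n j : ℕ) (k : ℤ) : dyad (n + j) (k * 2 ^ j) = dyad n k := by
  simp only [dyad, pow_add]
  push_cast
  have : (2 : ℝ) ^ j * (1 / 2) ^ j = 1 := by rw [← mul_pow]; norm_num
  linear_combination (k : ℝ) * (1 / 2) ^ n * this

/-- Points of levels n and n' are both points of level n + n'. Allowing different levels is what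
gives the Cauchy property along n. -/
lemma DyadicBound.dyadFloor_rect {γ γ' K : ℝ} {N : ℕ} {f : ℝ → ℝ → ℝ} (hγ : 0 < γ) (hγ' : 0 < γ')
    (hK : 0 ≤ K) (h : DyadicBound γ γ' K N f) {n n' m m' : ℕ} {s s' t t' : ℝ}
    (hs : s ∈ Icc (-(N : ℝ)) N) (hs' : s' ∈ Icc (-(N : ℝ)) N) (ht : t ∈ Icc (-(N : ℝ)) N)
    (ht' : t' ∈ Icc (-(N : ℝ)) N) (hss : dyadFloor n s ≤ dyadFloor n' s')
    (htt : dyadFloor m t ≤ dyadFloor m' t') :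
    |rectIncr f (dyadFloor n s) (dyadFloor n' s') (dyadFloor m t) (dyadFloor m' t')| ≤
      K * (chainConst N γ * chainConst N γ') *
        ((dyadFloor n' s' - dyadFloor n s) ^ γ * (dyadFloor m' t' - dyadFloor m t) ^ γ') := by
  have key : ∀ {n n' : ℕ} {s s' : ℝ}, s ∈ Icc (-(N : ℝ)) N → s' ∈ Icc (-(N : ℝ)) N →
      dyadFloor n s ≤ dyadFloor n' s' → ∃ (q : ℕ) (k k' : ℤ), dyadFloor n s = dyad q k ∧
        dyadFloor n' s' = dyad q k' ∧ k ≤ k' ∧ -((N : ℤ) * 2 ^ q) ≤ k ∧ k' ≤ (N : ℤ) * 2 ^ q := by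
    intro n n' s s' hs hs' hss
    have e1 : dyadFloor n s = dyad (n + n') (⌊s * 2 ^ n⌋ * 2 ^ n') := (dyad_refine n n' _).symm
    have e2 : dyadFloor n' s' = dyad (n + n') (⌊s' * 2 ^ n'⌋ * 2 ^ n) := by
      rw [add_comm]; exact (dyad_refine n' n _).symm
    refine ⟨n + n', _, _, e1, e2, ?_, ?_, ?_⟩
    · rw [e1, e2, dyad, dyad] at hss
      have := le_of_mul_le_mul_right hss (by positivity)
      exact_mod_cast this
    · have := (floor_mem (n := n) hs).1
      have := mul_le_mul_of_nonneg_right this (show (0 : ℤ) ≤ 2 ^ n' by positivity)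
      rw [pow_add]; linarith
    · have := (floor_mem (n := n') hs').2
      have := mul_le_mul_of_nonneg_right this (show (0 : ℤ) ≤ 2 ^ n by positivity)
      rw [pow_add]; linarith
  obtain ⟨q, k, k', e1, e2, a1, a2, a3⟩ := key hs hs' hss
  obtain ⟨q', l, l', e1', e2', b1, b2, b3⟩ := key ht ht' htt
  rw [e1, e2, e1', e2']
  exact h.rect hγ hγ' hK a1 a2 a3 b1 b2 b3

end FracWave

end

/-! ### Convergence and regularity of the dyadic extension -/

noncomputable section

namespace FracWave

/-- Bounds of the increments in the first variable, for a function vanishing on the first axis. -/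
lemma RectBound.fst {γ γ' K : ℝ} {N : ℕ} {y : ℝ → ℝ → ℝ} (hγ' : 0 ≤ γ') (hK : 0 ≤ K)
    (h : RectBound γ γ' K (-N) N (-N) N y) (h0 : ∀ s, y s 0 = 0) {s₁ s₂ t : ℝ} (h1 : -(N : ℝ) ≤ s₁)
    (h12 : s₁ ≤ s₂) (h2 : s₂ ≤ N) (ht : -(N : ℝ) ≤ t) (ht' : t ≤ N) :
    |y s₂ t - y s₁ t| ≤ K * (N : ℝ) ^ γ' * (s₂ - s₁) ^ γ := by
  have hN : (0 : ℝ) ≤ N := Nat.cast_nonneg N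
  have hp : 0 ≤ (s₂ - s₁) ^ γ := Real.rpow_nonneg (sub_nonneg.2 h12) _
  have key : ∀ b : ℝ, 0 ≤ b → b ≤ N → K * ((s₂ - s₁) ^ γ * b ^ γ') ≤
      K * (N : ℝ) ^ γ' * (s₂ - s₁) ^ γ := fun b hb hbN => by
    have := Real.rpow_le_rpow hb hbN hγ'
    calc _ ≤ K * ((s₂ - s₁) ^ γ * (N : ℝ) ^ γ') := by gcongr
      _ = _ := by ring
  rcases le_total 0 t with h' | h'
  · have e := h s₁ s₂ 0 t h1 h12 h2 (by linarith) h' ht'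
    rw [rectIncr, h0, h0, sub_zero t] at e
    refine (le_of_eq ?_).trans (e.trans (key t h' ht'))
    congr 1; ring
  · have e := h s₁ s₂ t 0 h1 h12 h2 ht h' hN
    rw [rectIncr, h0, h0, zero_sub] at e
    refine (le_of_eq ?_).trans (e.trans (key (-t) (by linarith) (by linarith)))
    rw [← abs_neg]; congr 1; ring

/-- A function vanishing on the axes has increments in one variable that are, up to sign,
rectangular increments reaching to the axis, so continuity follows from the rectangle bounds alone.
-/
lemma IsDriver.of_bound {γ γ' : ℝ} {y : ℝ → ℝ → ℝ} (hγ : 0 < γ) (hγ' : 0 < γ')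
    (h : ∀ N : ℕ, ∃ K, 0 ≤ K ∧ RectBound γ γ' K (-N) N (-N) N y) (h0 : ∀ s, y s 0 = 0)
    (h0' : ∀ t, y 0 t = 0) : IsDriver γ γ' y := by
  refine ⟨continuous_iff_continuousAt.2 fun p => ?_, h⟩
  obtain ⟨N, hN⟩ := exists_nat_gt (max |p.1| |p.2|)
  have h1 := abs_lt.1 ((le_max_left _ _).trans_lt hN)
  have h2 := abs_lt.1 ((le_max_right _ _).trans_lt hN)
  obtain ⟨K, hK, hb⟩ := h N
  have : HolderRect γ γ' (|y (-N) (-N)|) (K * (N : ℝ) ^ γ') (K * (N : ℝ) ^ γ) K (-N) N (-N) N y :=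
    ⟨le_rfl, fun s₁ s₂ t a1 a2 a3 a4 a5 => hb.fst hγ'.le hK h0 a1 a2 a3 a4 a5,
      fun s t₁ t₂ a1 a2 a3 a4 a5 => hb.transpose.fst hγ.le hK h0' a3 a4 a5 a1 a2, hb⟩
  exact (this.continuousOn hγ hγ').continuousAt
    (prod_mem_nhds (Icc_mem_nhds h1.1 h1.2) (Icc_mem_nhds h2.1 h2.2))

lemma abs_dyadFloor_sub_le {n m q : ℕ} (hn : q ≤ n) (hm : q ≤ m) (s : ℝ) :
    |dyadFloor n s - dyadFloor m s| ≤ (1 / 2) ^ q := by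
  have e : ∀ n, q ≤ n → ((1 : ℝ) / 2) ^ n ≤ (1 / 2) ^ q := fun n hn =>
    pow_le_pow_of_le_one (by norm_num) (by norm_num) hn
  rw [abs_le]
  constructor <;> linarith [e n hn, e m hm, dyadFloor_le n s, dyadFloor_le m s,
    lt_dyadFloor_add n s, lt_dyadFloor_add m s]

lemma DyadicBound.abs_fst {γ γ' K : ℝ} {N : ℕ} {f : ℝ → ℝ → ℝ} (hγ : 0 < γ) (hγ' : 0 < γ')
    (hK : 0 ≤ K) (h : DyadicBound γ γ' K N f) (h0 : ∀ s, f s 0 = 0) {n n' m : ℕ} {s t : ℝ}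
    (hs : s ∈ Icc (-(N : ℝ)) N) (ht : t ∈ Icc (-(N : ℝ)) N) :
    |f (dyadFloor n s) (dyadFloor m t) - f (dyadFloor n' s) (dyadFloor m t)| ≤
      K * (chainConst N γ * chainConst N γ') * (N : ℝ) ^ γ' *
        |dyadFloor n s - dyadFloor n' s| ^ γ := by
  have hc := chainConst_nonneg N hγ
  have hc' := chainConst_nonneg N hγ'
  have hN : (0 : ℝ) ≤ N := Nat.cast_nonneg N
  set Q := K * (chainConst N γ * chainConst N γ') with hQ
  have hQ0 : 0 ≤ Q := by positivity
  have h00 : (0 : ℝ) ∈ Icc (-(N : ℝ)) N := ⟨by linarith, hN⟩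
  have hd : -(N : ℝ) ≤ dyadFloor m t ∧ dyadFloor m t ≤ N := by
    have h2 := floor_mem (n := m) ht
    refine ⟨?_, (dyadFloor_le m t).trans ht.2⟩
    have := dyad_mono m h2.1
    refine le_trans (le_of_eq ?_) this
    simp only [dyad]; push_cast
    have : (2 : ℝ) ^ m * (1 / 2) ^ m = 1 := by rw [← mul_pow]; norm_num
    linear_combination (N : ℝ) * this
  have key : ∀ b : ℝ, 0 ≤ b → b ≤ N → ∀ r : ℝ, 0 ≤ r → Q * (r ^ γ * b ^ γ') ≤
      Q * (N : ℝ) ^ γ' * r ^ γ := fun b hb hbN r hr => by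
    have := Real.rpow_le_rpow hb hbN hγ'.le
    have := Real.rpow_nonneg hr γ
    calc _ ≤ Q * (r ^ γ * (N : ℝ) ^ γ') := by gcongr
      _ = _ := by ring
  have main : ∀ n n', dyadFloor n s ≤ dyadFloor n' s →
      |f (dyadFloor n' s) (dyadFloor m t) - f (dyadFloor n s) (dyadFloor m t)| ≤
      Q * (N : ℝ) ^ γ' * (dyadFloor n' s - dyadFloor n s) ^ γ := by
    intro n n' hnn
    rcases le_total 0 (dyadFloor m t) with h1 | h1
    · have e := h.dyadFloor_rect (m := 0) (m' := m) hγ hγ' hK hs hs h00 ht hnn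
        (by rwa [dyadFloor_zero])
      rw [dyadFloor_zero, rectIncr, h0, h0, sub_zero (dyadFloor m t)] at e
      refine (le_of_eq ?_).trans (e.trans (key _ h1 hd.2 _ (sub_nonneg.2 hnn)))
      congr 1; ring
    · have e := h.dyadFloor_rect (m := m) (m' := 0) hγ hγ' hK hs hs ht h00 hnn
        (by rwa [dyadFloor_zero])
      rw [dyadFloor_zero, rectIncr, h0, h0, zero_sub (dyadFloor m t)] at e
      refine (le_of_eq ?_).trans (e.trans (key _ (by linarith) (by linarith [hd.1]) _
        (sub_nonneg.2 hnn)))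
      rw [← abs_neg]; congr 1; ring
  rcases le_total (dyadFloor n s) (dyadFloor n' s) with hnn | hnn
  · rw [abs_sub_comm, abs_sub_comm (dyadFloor n s), abs_of_nonneg (sub_nonneg.2 hnn)]
    exact main n n' hnn
  · rw [abs_of_nonneg (sub_nonneg.2 hnn)]
    exact main n' n hnn

lemma DyadicBound.transpose {γ γ' K : ℝ} {N : ℕ} {f : ℝ → ℝ → ℝ} (h : DyadicBound γ γ' K N f) :
    DyadicBound γ' γ K N (transpose f) := fun n m k l h1 h2 h3 h4 => by
  rw [rectIncr_transpose, mul_comm ((((1 : ℝ) / 2) ^ n) ^ γ')]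
  exact h m n l k h3 h4 h1 h2

lemma tendsto_dyadicExt {γ γ' : ℝ} {f : ℝ → ℝ → ℝ} (hγ : 0 < γ) (hγ' : 0 < γ')
    (h : ∀ N : ℕ, ∃ K, 0 ≤ K ∧ DyadicBound γ γ' K N f) (h0 : ∀ s, f s 0 = 0)
    (h0' : ∀ t, f 0 t = 0) (s t : ℝ) :
    Tendsto (fun n => f (dyadFloor n s) (dyadFloor n t)) atTop (𝓝 (dyadicExt f s t)) := by
  obtain ⟨N, hN⟩ := exists_nat_ge (max |s| |t|)
  have hs : s ∈ Icc (-(N : ℝ)) N := abs_le.1 ((le_max_left _ _).trans hN)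
  have ht : t ∈ Icc (-(N : ℝ)) N := abs_le.1 ((le_max_right _ _).trans hN)
  obtain ⟨K, hK, hb⟩ := h N
  have hc := chainConst_nonneg N hγ
  have hc' := chainConst_nonneg N hγ'
  set Q := K * (chainConst N γ * chainConst N γ') * (N : ℝ) ^ γ' with hQ
  set Q' := K * (chainConst N γ' * chainConst N γ) * (N : ℝ) ^ γ with hQ'
  have hQ0 : 0 ≤ Q := by positivity
  have hQ0' : 0 ≤ Q' := by positivity
  have t0 : ∀ κ : ℝ, 0 < κ → Tendsto (fun n : ℕ => (((1 : ℝ) / 2) ^ n) ^ κ) atTop (𝓝 0) := by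
    intro κ hκ
    have h := (Real.continuousAt_rpow_const 0 κ (Or.inr hκ.le)).tendsto
    rw [Real.zero_rpow hκ.ne'] at h
    exact h.comp (tendsto_pow_atTop_nhds_zero_of_lt_one (by norm_num) (by norm_num))
  have hcs : CauchySeq fun n => f (dyadFloor n s) (dyadFloor n t) := by
    refine cauchySeq_of_le_tendsto_0
      (fun q => Q * (((1 : ℝ) / 2) ^ q) ^ γ + Q' * (((1 : ℝ) / 2) ^ q) ^ γ') ?_ ?_
    · intro n m q hn hm
      rw [Real.dist_eq]
      have e1 := hb.abs_fst (n := n) (n' := m) (m := n) hγ hγ' hK h0 hs ht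
      have e2 := hb.transpose.abs_fst (n := n) (n' := m) (m := m) hγ' hγ hK h0' ht hs
      have e3 := Real.rpow_le_rpow (abs_nonneg _) (abs_dyadFloor_sub_le hn hm s) hγ.le
      have e4 := Real.rpow_le_rpow (abs_nonneg _) (abs_dyadFloor_sub_le hn hm t) hγ'.le
      refine (abs_sub_le _ (f (dyadFloor m s) (dyadFloor n t)) _).trans (add_le_add ?_ ?_)
      · exact e1.trans (mul_le_mul_of_nonneg_left e3 hQ0)
      · exact e2.trans (mul_le_mul_of_nonneg_left e4 hQ0')
    · simpa using ((t0 γ hγ).const_mul Q).add ((t0 γ' hγ').const_mul Q')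
  exact hcs.tendsto_limUnder

lemma isDriver_dyadicExt {γ γ' : ℝ} {f : ℝ → ℝ → ℝ} (hγ : 0 < γ) (hγ' : 0 < γ')
    (h : ∀ N : ℕ, ∃ K, 0 ≤ K ∧ DyadicBound γ γ' K N f) (h0 : ∀ s, f s 0 = 0)
    (h0' : ∀ t, f 0 t = 0) : IsDriver γ γ' (dyadicExt f) := by
  have hl := tendsto_dyadicExt hγ hγ' h h0 h0'
  refine IsDriver.of_bound hγ hγ' (fun N => ?_) (fun s => ?_) (fun t => ?_)
  · obtain ⟨K, hK, hb⟩ := h N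
    have hc := chainConst_nonneg N hγ
    have hc' := chainConst_nonneg N hγ'
    refine ⟨K * (chainConst N γ * chainConst N γ'), by positivity, ?_⟩
    intro s₁ s₂ t₁ t₂ h1 h2 h3 h4 h5 h6
    have l1 : Tendsto (fun n => rectIncr f (dyadFloor n s₁) (dyadFloor n s₂) (dyadFloor n t₁)
        (dyadFloor n t₂)) atTop (𝓝 (rectIncr (dyadicExt f) s₁ s₂ t₁ t₂)) :=
      (((hl s₁ t₁).sub (hl s₁ t₂)).sub (hl s₂ t₁)).add (hl s₂ t₂)
    have l2 : ∀ {κ a b : ℝ}, 0 < κ → Tendsto (fun n => (dyadFloor n b - dyadFloor n a) ^ κ) atTop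
        (𝓝 ((b - a) ^ κ)) := fun {κ a b} hκ =>
      ((tendsto_dyadFloor b).sub (tendsto_dyadFloor a)).rpow_const (Or.inr hκ.le)
    exact le_of_tendsto_of_tendsto' l1.abs (((l2 hγ).mul (l2 hγ')).const_mul _) fun n =>
      hb.dyadFloor_rect hγ hγ' hK ⟨h1, by linarith⟩ ⟨by linarith, h3⟩ ⟨h4, by linarith⟩
        ⟨by linarith, h6⟩ (dyadFloor_mono n h2) (dyadFloor_mono n h5)
  · refine tendsto_nhds_unique (hl s 0) ?_
    simp [dyadFloor_zero, h0]
  · refine tendsto_nhds_unique (hl 0 t) ?_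
    simp [dyadFloor_zero, h0']

/-! ### The two-parameter Kolmogorov criterion -/

section

variable {Ω : Type*} [MeasurableSpace Ω] {P : Measure Ω} {x : Ω → ℝ → ℝ → ℝ} {γ γ' η η' : ℝ}

/-- Bounds of all the moments of the rectangular increments of a random field. -/
def MomentBound (P : Measure Ω) (η η' : ℝ) (x : Ω → ℝ → ℝ → ℝ) : Prop :=
  ∀ N p : ℕ, ∃ C : ℝ, 0 ≤ C ∧ ∀ s₁ s₂ t₁ t₂ : ℝ, -(N : ℝ) ≤ s₁ → s₁ ≤ s₂ → s₂ ≤ N →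
    -(N : ℝ) ≤ t₁ → t₁ ≤ t₂ → t₂ ≤ N →
    eLpNorm (fun ω => rectIncr (x ω) s₁ s₂ t₁ t₂) p P ≤
      ENNReal.ofReal (C * ((s₂ - s₁) ^ η * (t₂ - t₁) ^ η'))

lemma tsum_ofReal_half_ne_top : ∑' n : ℕ, ENNReal.ofReal ((1 / 2) ^ n) ≠ ⊤ := by
  rw [← ENNReal.ofReal_tsum_of_nonneg (fun n => by positivity) summable_geometric_two]
  exact ENNReal.ofReal_ne_top

/-- The p-th powers of all dyadic increments, normalised by the target bound, are summed over all
levels. Levels n, m contain of the order of 2^n 2^m rectangles, each of expectation at most a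
constant times 4^(-n) 4^(-m) once p(η - γ) and p(η' - γ') are at least 2. The sum is therefore
integrable, hence almost surely finite, and it dominates each of its terms. -/
theorem ae_dyadicBound (hx : ∀ s t, AEStronglyMeasurable (fun ω => x ω s t) P)
    (hm : MomentBound P η η' x) (hγ : γ < η) (hγ' : γ' < η') (N : ℕ) :
    ∀ᵐ ω ∂P, ∃ K, 0 ≤ K ∧ DyadicBound γ γ' K N (x ω) := by
  obtain ⟨p, hp1, hp, hp'⟩ : ∃ p : ℕ, 1 ≤ p ∧ 2 ≤ (η - γ) * p ∧ 2 ≤ (η' - γ') * p := by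
    obtain ⟨p, hp⟩ := exists_nat_ge (max 1 (max (2 / (η - γ)) (2 / (η' - γ'))))
    refine ⟨p, by exact_mod_cast (le_max_left _ _).trans hp, ?_, ?_⟩
    · have := ((le_max_left _ _).trans (le_max_right _ _)).trans hp
      rwa [div_le_iff₀' (by linarith)] at this
    · have := ((le_max_right _ _).trans (le_max_right _ _)).trans hp
      rwa [div_le_iff₀' (by linarith)] at this
  obtain ⟨C, hC, hm⟩ := hm N p
  set c : ℕ → ℕ → ℝ := fun n m => (((1 / 2 : ℝ) ^ n) ^ γ * ((1 / 2 : ℝ) ^ m) ^ γ')⁻¹ with hc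
  have hc0 : ∀ n m, 0 < c n m := fun n m => by simp only [hc]; positivity
  set Δ : ℕ → ℕ → ℤ → ℤ → Ω → ℝ := fun n m k l ω =>
    rectIncr (x ω) (dyad n k) (dyad n (k + 1)) (dyad m l) (dyad m (l + 1)) with hΔ
  have hΔm : ∀ n m k l, AEStronglyMeasurable (Δ n m k l) P := fun n m k l =>
    (((hx _ _).sub (hx _ _)).sub (hx _ _)).add (hx _ _)
  set F : ℕ → ℕ → ℤ → ℤ → Ω → ENNReal := fun n m k l ω => ‖c n m * Δ n m k l ω‖ₑ ^ p with hF
  have hFm : ∀ n m k l, AEMeasurable (F n m k l) P := fun n m k l =>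
    (((hΔm n m k l).const_mul (c n m)).enorm).pow_const p
  set J : ℕ → Finset ℤ := fun n => Finset.Ico (-(N * 2 ^ n)) (N * 2 ^ n) with hJ
  have hJc : ∀ n, ((J n).card : ENNReal) = ENNReal.ofReal (2 * N * 2 ^ n) := by
    intro n
    have : (J n).card = 2 * N * 2 ^ n := by
      simp only [hJ, Int.card_Ico]
      have : (N : ℤ) * 2 ^ n - -(N * 2 ^ n) = ((2 * N * 2 ^ n : ℕ) : ℤ) := by push_cast; ring
      rw [this, Int.toNat_natCast]
    rw [this, ← ENNReal.ofReal_natCast]; push_cast; rfl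
  have hmem : ∀ n k, k ∈ J n → -(N : ℝ) ≤ dyad n k ∧ dyad n (k + 1) ≤ N := by
    intro n k hk
    rw [hJ, Finset.mem_Ico] at hk
    have h2 : (2 : ℝ) ^ n * (1 / 2) ^ n = 1 := by rw [← mul_pow]; norm_num
    have e : ∀ z : ℤ, dyad n (z * 2 ^ n) = z := fun z => by
      simp only [dyad]; push_cast; linear_combination (z : ℝ) * h2
    have a1 := dyad_mono n (show (-(N : ℤ)) * 2 ^ n ≤ k by linarith [hk.1])
    have a2 := dyad_mono n (show k + 1 ≤ (N : ℤ) * 2 ^ n by linarith [hk.2])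
    rw [e] at a1 a2
    push_cast at a1 a2
    exact ⟨a1, a2⟩
  have hFint : ∀ n m, ∀ k ∈ J n, ∀ l ∈ J m, ∫⁻ ω, F n m k l ω ∂P ≤
      ENNReal.ofReal (C ^ p * (((1 / 2) ^ n) ^ 2 * ((1 / 2) ^ m) ^ 2)) := by
    intro n m k hk l hl
    have b := hm (dyad n k) (dyad n (k + 1)) (dyad m l) (dyad m (l + 1)) (hmem n k hk).1
      (dyad_mono n (by omega)) (hmem n k hk).2 (hmem m l hl).1 (dyad_mono m (by omega))
      (hmem m l hl).2
    rw [dyad_add_one, dyad_add_one] at b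
    have e1 : eLpNorm (fun ω => c n m * Δ n m k l ω) p P ≤
        ENNReal.ofReal (C * (((1 / 2) ^ n) ^ (η - γ) * ((1 / 2) ^ m) ^ (η' - γ'))) := by
      have : (fun ω => c n m * Δ n m k l ω) = c n m • Δ n m k l := rfl
      rw [this, eLpNorm_const_smul, Real.enorm_eq_ofReal (hc0 n m).le]
      refine (mul_le_mul_right b _).trans ?_
      rw [← ENNReal.ofReal_mul (hc0 n m).le]
      refine ENNReal.ofReal_le_ofReal (le_of_eq ?_)
      simp only [hc]
      rw [Real.rpow_sub (by positivity), Real.rpow_sub (by positivity)]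
      field_simp
    have e2 : ∫⁻ ω, F n m k l ω ∂P = eLpNorm (fun ω => c n m * Δ n m k l ω) p P ^ p := by
      have := eLpNorm_nnreal_pow_eq_lintegral (μ := P) (f := fun ω => c n m * Δ n m k l ω)
        (p := (p : NNReal)) (by simp; omega)
      simp only [NNReal.coe_natCast, ENNReal.rpow_natCast, ENNReal.coe_natCast] at this
      exact this.symm
    rw [e2]
    refine (pow_le_pow_left' e1 p).trans ?_
    rw [← ENNReal.ofReal_pow (by positivity)]
    refine ENNReal.ofReal_le_ofReal ?_
    have e3 : ∀ (n : ℕ) (a : ℝ), 2 ≤ a * p → ((((1 : ℝ) / 2) ^ n) ^ a) ^ p ≤ ((1 / 2) ^ n) ^ 2 := by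
      intro n a ha
      rw [← Real.rpow_natCast (((((1 : ℝ) / 2) ^ n) ^ a)), ← Real.rpow_mul (by positivity),
        ← Real.rpow_natCast ((((1 : ℝ) / 2) ^ n)) 2]
      exact Real.rpow_le_rpow_of_exponent_ge (by positivity)
        (pow_le_one₀ (by norm_num) (by norm_num)) (by exact_mod_cast ha)
    rw [mul_pow, mul_pow]
    have := e3 n _ hp
    have := e3 m _ hp'
    gcongr
  set S : Ω → ENNReal := fun ω => ∑' n, ∑' m, ∑ k ∈ J n, ∑ l ∈ J m, F n m k l ω with hS
  have hSm2 : ∀ n m, AEMeasurable (fun ω => ∑ k ∈ J n, ∑ l ∈ J m, F n m k l ω) P := fun n m =>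
    Finset.aemeasurable_fun_sum _ fun k _ => Finset.aemeasurable_fun_sum _ fun l _ => hFm n m k l
  have hSm1 : ∀ n, AEMeasurable (fun ω => ∑' m, ∑ k ∈ J n, ∑ l ∈ J m, F n m k l ω) P := fun n =>
    AEMeasurable.tsum (hSm2 n)
  have hSm : AEMeasurable S P := AEMeasurable.tsum hSm1
  have hSint : ∫⁻ ω, S ω ∂P ≤ ∑' n : ℕ, ∑' m : ℕ, ENNReal.ofReal (4 * N * N * C ^ p) *
      ENNReal.ofReal ((1 / 2) ^ n) * ENNReal.ofReal ((1 / 2) ^ m) := by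
    rw [lintegral_tsum hSm1]
    refine ENNReal.tsum_le_tsum fun n => ?_
    rw [lintegral_tsum (hSm2 n)]
    refine ENNReal.tsum_le_tsum fun m => ?_
    rw [lintegral_finsetSum' _ fun k _ => Finset.aemeasurable_fun_sum _ fun l _ => hFm n m k l]
    calc ∑ k ∈ J n, ∫⁻ ω, ∑ l ∈ J m, F n m k l ω ∂P
        ≤ ∑ k ∈ J n, ∑ l ∈ J m,
          ENNReal.ofReal (C ^ p * (((1 / 2) ^ n) ^ 2 * ((1 / 2) ^ m) ^ 2)) := by
          refine Finset.sum_le_sum fun k hk => ?_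
          rw [lintegral_finsetSum' _ fun l _ => hFm n m k l]
          exact Finset.sum_le_sum fun l hl => hFint n m k hk l hl
      _ = ENNReal.ofReal (2 * N * 2 ^ n) * (ENNReal.ofReal (2 * N * 2 ^ m) *
          ENNReal.ofReal (C ^ p * (((1 / 2) ^ n) ^ 2 * ((1 / 2) ^ m) ^ 2))) := by
          rw [Finset.sum_const, Finset.sum_const, nsmul_eq_mul, nsmul_eq_mul, hJc, hJc]
      _ ≤ _ := by
          rw [← ENNReal.ofReal_mul (by positivity), ← ENNReal.ofReal_mul (by positivity),
            ← ENNReal.ofReal_mul (by positivity), ← ENNReal.ofReal_mul (by positivity)]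
          refine ENNReal.ofReal_le_ofReal (le_of_eq ?_)
          have h2 : ∀ n : ℕ, (2 : ℝ) ^ n * (1 / 2) ^ n = 1 := fun n => by
            rw [← mul_pow]; norm_num
          calc _ = 4 * N * N * C ^ p * ((2 : ℝ) ^ n * (1 / 2) ^ n) * ((2 : ℝ) ^ m * (1 / 2) ^ m) *
                (1 / 2) ^ n * (1 / 2) ^ m := by ring
            _ = _ := by rw [h2, h2]; ring
  have hfin : ∫⁻ ω, S ω ∂P ≠ ⊤ := by
    refine ne_top_of_le_ne_top ?_ hSint
    simp_rw [ENNReal.tsum_mul_left, ENNReal.tsum_mul_right, ENNReal.tsum_mul_left]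
    exact ENNReal.mul_ne_top (ENNReal.mul_ne_top ENNReal.ofReal_ne_top tsum_ofReal_half_ne_top)
      tsum_ofReal_half_ne_top
  filter_upwards [ae_lt_top' hSm hfin] with ω hω
  refine ⟨(S ω).toReal + 1, by positivity, ?_⟩
  intro n m k l hk hk' hl hl'
  have hkJ : k ∈ J n := by rw [hJ, Finset.mem_Ico]; exact ⟨hk, by linarith⟩
  have hlJ : l ∈ J m := by rw [hJ, Finset.mem_Ico]; exact ⟨hl, by linarith⟩
  have hle : F n m k l ω ≤ S ω :=
    calc F n m k l ω ≤ ∑ l ∈ J m, F n m k l ω :=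
          Finset.single_le_sum (f := fun l => F n m k l ω) (fun _ _ => zero_le) hlJ
      _ ≤ ∑ k ∈ J n, ∑ l ∈ J m, F n m k l ω :=
          Finset.single_le_sum (f := fun k => ∑ l ∈ J m, F n m k l ω) (fun _ _ => zero_le) hkJ
      _ ≤ ∑' m, ∑ k ∈ J n, ∑ l ∈ J m, F n m k l ω :=
          ENNReal.le_tsum (f := fun m => ∑ k ∈ J n, ∑ l ∈ J m, F n m k l ω) m
      _ ≤ S ω := ENNReal.le_tsum (f := fun n => ∑' m, ∑ k ∈ J n, ∑ l ∈ J m, F n m k l ω) n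
  have hle' : |c n m * Δ n m k l ω| ^ p ≤ (S ω).toReal := by
    have := ENNReal.toReal_mono hω.ne hle
    simpa [hF, ENNReal.toReal_pow, toReal_enorm] using this
  -- Adding 1 avoids taking a p-th root: a number is at most 1 or at most its p-th power.
  have h1 : |c n m * Δ n m k l ω| ≤ (S ω).toReal + 1 := by
    rcases le_total |c n m * Δ n m k l ω| 1 with h | h
    · have : 0 ≤ (S ω).toReal := ENNReal.toReal_nonneg
      linarith
    · have := le_self_pow₀ h (show p ≠ 0 by omega)
      linarith
  rw [abs_mul, abs_of_pos (hc0 n m)] at h1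
  simp only [hc] at h1
  rwa [inv_mul_le_iff₀ (by positivity), mul_comm] at h1

/-- The extension from the dyadic points is a modification. -/
theorem ae_eq_dyadicExt [IsProbabilityMeasure P]
    (hx : ∀ s t, AEStronglyMeasurable (fun ω => x ω s t) P) (hm : MomentBound P η η' x)
    (hη : 0 < η) (hη' : 0 < η') (h0 : ∀ ω s, x ω s 0 = 0) (h0' : ∀ ω t, x ω 0 t = 0) (s t : ℝ) :
    ∀ᵐ ω ∂P, dyadicExt (x ω) s t = x ω s t := by
  obtain ⟨N, hN⟩ := exists_nat_ge (max (|s| + 1) (|t| + 1))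
  have hs : |s| + 1 ≤ N := (le_max_left _ _).trans hN
  have ht : |t| + 1 ≤ N := (le_max_right _ _).trans hN
  obtain ⟨hs1, hs2⟩ := abs_le.1 (show |s| ≤ N - 1 by linarith)
  obtain ⟨ht1, ht2⟩ := abs_le.1 (show |t| ≤ N - 1 by linarith)
  have hN0 : (0 : ℝ) ≤ N := Nat.cast_nonneg N
  obtain ⟨C, hC, hm⟩ := hm N 1
  rw [Nat.cast_one] at hm
  have fl : ∀ n : ℕ, ∀ r : ℝ, r - 1 ≤ dyadFloor n r := fun n r => by
    have := lt_dyadFloor_add n r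
    have : ((1 : ℝ) / 2) ^ n ≤ 1 := pow_le_one₀ (by norm_num) (by norm_num)
    linarith
  set a : ℕ → ENNReal := fun n => ENNReal.ofReal (C * ((s - dyadFloor n s) ^ η * (N : ℝ) ^ η')) +
    ENNReal.ofReal (C * ((N : ℝ) ^ η * (t - dyadFloor n t) ^ η')) with ha
  -- The two coordinates are moved one at a time. As the field vanishes on the axes, each such
  -- increment is, up to sign, a rectangular increment, to which the first moment bound applies.
  have b1 : ∀ n, eLpNorm (fun ω => x ω s t - x ω (dyadFloor n s) t) 1 P ≤
      ENNReal.ofReal (C * ((s - dyadFloor n s) ^ η * (N : ℝ) ^ η')) := by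
    intro n
    have k1 := dyadFloor_le n s
    have k2 := fl n s
    have k3 : 0 ≤ (s - dyadFloor n s) ^ η := Real.rpow_nonneg (sub_nonneg.2 k1) _
    rcases le_total 0 t with h | h
    · refine le_trans (le_of_eq ?_) ((hm (dyadFloor n s) s 0 t (by linarith) k1 (by linarith)
        (by linarith) h (by linarith)).trans (ENNReal.ofReal_le_ofReal ?_))
      · congr 1; ext ω; rw [rectIncr, h0, h0]; ring
      · have := Real.rpow_le_rpow (z := η') (sub_nonneg.2 h) (show t - 0 ≤ N by linarith) hη'.le
        gcongr
    · refine le_trans (le_of_eq ?_) ((hm (dyadFloor n s) s t 0 (by linarith) k1 (by linarith)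
        (by linarith) h (by linarith)).trans (ENNReal.ofReal_le_ofReal ?_))
      · rw [← eLpNorm_neg]; congr 1; ext ω; simp only [Pi.neg_apply]; rw [rectIncr, h0, h0]; ring
      · have := Real.rpow_le_rpow (z := η') (sub_nonneg.2 h) (show 0 - t ≤ N by linarith) hη'.le
        gcongr
  have b2 : ∀ n, eLpNorm (fun ω => x ω (dyadFloor n s) t - x ω (dyadFloor n s) (dyadFloor n t)) 1 P ≤
      ENNReal.ofReal (C * ((N : ℝ) ^ η * (t - dyadFloor n t) ^ η')) := by
    intro n
    have k1 := dyadFloor_le n t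
    have k2 := fl n t
    have j1 := dyadFloor_le n s
    have j2 := fl n s
    have k3 : 0 ≤ (t - dyadFloor n t) ^ η' := Real.rpow_nonneg (sub_nonneg.2 k1) _
    rcases le_total 0 (dyadFloor n s) with h | h
    · refine le_trans (le_of_eq ?_) ((hm 0 (dyadFloor n s) (dyadFloor n t) t (by linarith) h
        (by linarith) (by linarith) k1 (by linarith)).trans (ENNReal.ofReal_le_ofReal ?_))
      · congr 1; ext ω; rw [rectIncr, h0', h0']; ring
      · have := Real.rpow_le_rpow (z := η) (sub_nonneg.2 h)
          (show dyadFloor n s - 0 ≤ N by linarith) hη.le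
        gcongr
    · refine le_trans (le_of_eq ?_) ((hm (dyadFloor n s) 0 (dyadFloor n t) t (by linarith) h
        (by linarith) (by linarith) k1 (by linarith)).trans (ENNReal.ofReal_le_ofReal ?_))
      · rw [← eLpNorm_neg]; congr 1; ext ω; simp only [Pi.neg_apply]; rw [rectIncr, h0', h0']; ring
      · have := Real.rpow_le_rpow (z := η) (sub_nonneg.2 h)
          (show 0 - dyadFloor n s ≤ N by linarith) hη.le
        gcongr
  have hlim : Tendsto a atTop (𝓝 0) := by
    have t0 : ∀ κ r : ℝ, 0 < κ → Tendsto (fun n => (r - dyadFloor n r) ^ κ) atTop (𝓝 0) := by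
      intro κ r hκ
      have := ((tendsto_const_nhds (x := r)).sub (tendsto_dyadFloor r)).rpow_const
        (p := κ) (Or.inr hκ.le)
      rwa [sub_self, Real.zero_rpow hκ.ne'] at this
    have l1 := ENNReal.tendsto_ofReal (((t0 η s hη).mul_const ((N : ℝ) ^ η')).const_mul C)
    have l2 := ENNReal.tendsto_ofReal (((t0 η' t hη').const_mul ((N : ℝ) ^ η)).const_mul C)
    simpa using l1.add l2
  have hL : Tendsto (fun n => eLpNorm ((fun ω => x ω (dyadFloor n s) (dyadFloor n t)) -
      fun ω => x ω s t) 1 P) atTop (𝓝 0) := by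
    refine tendsto_of_tendsto_of_tendsto_of_le_of_le tendsto_const_nhds hlim
      (fun _ => zero_le) fun n => ?_
    rw [eLpNorm_sub_comm]
    have : ((fun ω => x ω s t) - fun ω => x ω (dyadFloor n s) (dyadFloor n t)) =
        (fun ω => x ω s t - x ω (dyadFloor n s) t) +
          fun ω => x ω (dyadFloor n s) t - x ω (dyadFloor n s) (dyadFloor n t) := by
      ext ω; simp
    rw [this]
    exact (eLpNorm_add_le ((hx _ _).sub (hx _ _)) ((hx _ _).sub (hx _ _)) le_rfl).trans
      (add_le_add (b1 n) (b2 n))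
  -- The values at the dyadic approximations converge in measure to the field, by the L¹ bound, and
  -- to the extension, by almost sure convergence; limits in measure are unique.
  have m1 := tendstoInMeasure_of_tendsto_eLpNorm one_ne_zero (fun n => hx _ _) (hx s t) hL
  have hae : ∀ᵐ ω ∂P, ∀ N : ℕ, ∃ K, 0 ≤ K ∧ DyadicBound (η / 2) (η' / 2) K N (x ω) :=
    ae_all_iff.2 fun N => ae_dyadicBound hx ‹MomentBound P η η' x› (by linarith) (by linarith) N
  have m2 : TendstoInMeasure P (fun n ω => x ω (dyadFloor n s) (dyadFloor n t)) atTop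
      (fun ω => dyadicExt (x ω) s t) := by
    refine tendstoInMeasure_of_tendsto_ae (fun n => hx _ _) ?_
    filter_upwards [hae] with ω hω
    exact tendsto_dyadicExt (by positivity) (by positivity) hω (h0 ω) (h0' ω) s t
  exact tendstoInMeasure_ae_unique m2 m1

end

end FracWave

end

noncomputable section

namespace FracWave

/-! ### Integrals of products of powers of linear forms -/

/-- Let l i ≤ l j be the two smallest values. All other factors only get larger when replaced by the
same power of l j, and part of the exponent of l j can be traded against l i until both carry -ρ;
the surplus exponent 2ρ - Σ e is nonnegative and is paid by R. Summing over ordered pairs removes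
the dependence on which two are smallest. -/
lemma prod_rpow_le {ι : Type*} [Fintype ι] [DecidableEq ι] [Nontrivial ι] {l e : ι → ℝ} {ρ R : ℝ}
    (hl : ∀ i, 0 ≤ l i) (hlR : ∀ i, l i ≤ R) (he : ∀ i, 0 < e i) (heρ : ∀ i, e i ≤ ρ)
    (hsum : ∑ i, e i ≤ 2 * ρ) :
    ∏ i, l i ^ (-e i) ≤ R ^ (2 * ρ - ∑ i, e i) *
      ∑ p ∈ Finset.univ.offDiag, l p.1 ^ (-ρ) * l p.2 ^ (-ρ) := by
  have hR : 0 ≤ R := (hl (Classical.arbitrary ι)).trans (hlR _)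
  have hterm : ∀ p : ι × ι, 0 ≤ l p.1 ^ (-ρ) * l p.2 ^ (-ρ) := fun p =>
    mul_nonneg (Real.rpow_nonneg (hl _) _) (Real.rpow_nonneg (hl _) _)
  -- With the convention that 0 to a nonzero power is 0, a vanishing factor makes the left side 0.
  by_cases hz : ∃ i, l i = 0
  · obtain ⟨i, hi⟩ := hz
    rw [Finset.prod_eq_zero (Finset.mem_univ i)
      (by rw [hi, Real.zero_rpow (neg_ne_zero.2 (he i).ne')])]
    exact mul_nonneg (Real.rpow_nonneg hR _) (Finset.sum_nonneg fun p _ => hterm p)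
  push Not at hz
  have hl0 : ∀ i, 0 < l i := fun i => (hl i).lt_of_ne' (hz i)
  obtain ⟨i, -, hi⟩ := Finset.exists_min_image Finset.univ l Finset.univ_nonempty
  obtain ⟨j, hj, hij⟩ := Finset.exists_min_image (Finset.univ.erase i) l (by
    obtain ⟨j, hj⟩ := exists_ne i
    exact ⟨j, by simp [hj]⟩)
  have hji : j ≠ i := (Finset.mem_erase.1 hj).1
  have hle : ∏ k, l k ^ (-e k) ≤ l i ^ (-ρ) * l j ^ (-ρ) * R ^ (2 * ρ - ∑ i, e i) := by
    rw [← Finset.mul_prod_erase _ _ (Finset.mem_univ i)]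
    have s1 : ∏ k ∈ Finset.univ.erase i, l k ^ (-e k) ≤
        ∏ k ∈ Finset.univ.erase i, l j ^ (-e k) :=
      Finset.prod_le_prod (fun k _ => Real.rpow_nonneg (hl k) _) fun k hk =>
        Real.rpow_le_rpow_of_nonpos (hl0 j) (hij k hk) (by linarith [he k])
    have s2 : ∏ k ∈ Finset.univ.erase i, l j ^ (-e k) =
        l j ^ (-(∑ k ∈ Finset.univ.erase i, e k)) := by
      rw [← Real.rpow_sum_of_pos (hl0 j), Finset.sum_neg_distrib]
    have s3 : ∑ k, e k = e i + ∑ k ∈ Finset.univ.erase i, e k :=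
      (Finset.add_sum_erase _ _ (Finset.mem_univ i)).symm
    rw [s2] at s1
    set S := ∑ k ∈ Finset.univ.erase i, e k with hS
    have s4 : l i ^ (ρ - e i) ≤ l j ^ (ρ - e i) :=
      Real.rpow_le_rpow (hl i) (hi j (Finset.mem_univ j)) (by linarith [heρ i])
    have s5 : l j ^ (2 * ρ - ∑ i, e i) ≤ R ^ (2 * ρ - ∑ i, e i) :=
      Real.rpow_le_rpow (hl j) (hlR j) (by linarith)
    have p1 := Real.rpow_nonneg (hl i) (-ρ)
    have p2 := Real.rpow_nonneg (hl j) (-S)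
    have p3 := Real.rpow_nonneg (hl j) (-ρ)
    calc l i ^ (-e i) * ∏ k ∈ Finset.univ.erase i, l k ^ (-e k)
        ≤ l i ^ (-e i) * l j ^ (-S) :=
          mul_le_mul_of_nonneg_left s1 (Real.rpow_nonneg (hl i) _)
      _ = l i ^ (-ρ) * l i ^ (ρ - e i) * l j ^ (-S) := by
          rw [← Real.rpow_add (hl0 i)]; congr 2; ring
      _ ≤ l i ^ (-ρ) * l j ^ (ρ - e i) * l j ^ (-S) := by gcongr
      _ = l i ^ (-ρ) * l j ^ (-ρ) * l j ^ (2 * ρ - ∑ i, e i) := by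
          rw [mul_assoc, mul_assoc, ← Real.rpow_add (hl0 j), ← Real.rpow_add (hl0 j)]
          congr 2; rw [s3]; ring
      _ ≤ _ := by gcongr
  refine hle.trans ?_
  rw [mul_comm]
  exact mul_le_mul_of_nonneg_left (Finset.single_le_sum (f := fun p : ι × ι =>
    l p.1 ^ (-ρ) * l p.2 ^ (-ρ)) (fun p _ => hterm p) (a := (i, j)) (by simp [hji.symm]))
    (Real.rpow_nonneg hR _)

lemma lintegral_comp_linearMap {E : Type*} [NormedAddCommGroup E] [NormedSpace ℝ E]
    [MeasurableSpace E] [BorelSpace E] [FiniteDimensional ℝ E] (μ : Measure E)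
    [μ.IsAddHaarMeasure] (L : E →ₗ[ℝ] E) (hL : ∀ z, L z = 0 → z = 0) :
    ∃ c : ENNReal, c ≠ ⊤ ∧ ∀ f : E → ENNReal, Measurable f →
      ∫⁻ z, f (L z) ∂μ = c * ∫⁻ z, f z ∂μ := by
  have hdet : LinearMap.det L ≠ 0 := fun h =>
    LinearMap.det_eq_zero_iff_ker_ne_bot.1 h (LinearMap.ker_eq_bot'.2 hL)
  refine ⟨ENNReal.ofReal |(LinearMap.det L)⁻¹|, ENNReal.ofReal_ne_top, fun f hf => ?_⟩
  rw [← lintegral_map hf L.continuous_of_finiteDimensional.measurable,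
    Measure.map_linearMap_addHaar_eq_smul_addHaar μ hdet, lintegral_smul_measure, smul_eq_mul]

instance isAddHaarMeasure_plane : (volume : Measure (ℝ × ℝ)).IsAddHaarMeasure := by
  rw [Measure.volume_eq_prod]; infer_instance

instance isAddHaarMeasure_planes :
    (volume : Measure ((ℝ × ℝ) × (ℝ × ℝ))).IsAddHaarMeasure := by
  rw [Measure.volume_eq_prod]; infer_instance

/-- The truncated power `|u| ^ (-ρ)`. -/
def truncPow (R ρ u : ℝ) : ENNReal := (Icc (-R) R).indicator (fun u => ENNReal.ofReal (|u| ^ (-ρ))) u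

lemma measurable_truncPow (R ρ : ℝ) : Measurable (truncPow R ρ) :=
  Measurable.indicator (by fun_prop) measurableSet_Icc

lemma lintegral_truncPow_ne_top {R ρ : ℝ} (hρ : ρ < 1) :
    ∫⁻ u, truncPow R ρ u ≠ ⊤ := by
  have h1 : ∫⁻ u in Icc 0 R, ENNReal.ofReal (|u| ^ (-ρ)) < ⊤ := by
    have := (intervalIntegral.intervalIntegrable_rpow' (a := 0) (b := R)
      (show -1 < -ρ by linarith)).1
    rw [← integrableOn_Icc_iff_integrableOn_Ioc] at this
    have h := this.2
    rw [hasFiniteIntegral_iff_enorm] at h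
    refine lt_of_le_of_lt (setLIntegral_mono' measurableSet_Icc fun u hu => ?_) h
    rw [abs_of_nonneg hu.1, Real.enorm_eq_ofReal (Real.rpow_nonneg hu.1 _)]
  have h2 : ∫⁻ u in Icc (-R) 0, ENNReal.ofReal (|u| ^ (-ρ)) < ⊤ := by
    have := (Measure.measurePreserving_neg (volume : Measure ℝ)).setLIntegral_comp_preimage
      (measurableSet_Icc (a := 0) (b := R)) (f := fun u => ENNReal.ofReal (|u| ^ (-ρ)))
      (by fun_prop)
    simp only [neg_preimage, abs_neg, neg_Icc, neg_zero] at this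
    rw [this]; exact h1
  unfold truncPow
  rw [lintegral_indicator measurableSet_Icc]
  refine ne_top_of_le_ne_top ?_ (lintegral_mono_set
    (Icc_subset_Icc_union_Icc (a := -R) (b := 0) (c := R)))
  exact ((lintegral_union_le _ _ _).trans_lt (ENNReal.add_lt_top.2 ⟨h2, h1⟩)).ne

/-- The linear form with coefficients `v`. -/
def linForm (v p : ℝ × ℝ) : ℝ := v.1 * p.1 + v.2 * p.2

lemma continuous_linForm (v : ℝ × ℝ) : Continuous (linForm v) := by
  unfold linForm; fun_prop

/-- Two independent linear forms are coordinates after a linear change of variables, and the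
integral factors into two one-dimensional ones, finite because ρ < 1. -/
lemma lintegral_pair_ne_top {R ρ : ℝ} (hρ : ρ < 1) {v w : ℝ × ℝ}
    (hvw : v.1 * w.2 - v.2 * w.1 ≠ 0) :
    ∫⁻ p : ℝ × ℝ, truncPow R ρ (linForm v p) * truncPow R ρ (linForm w p) ≠ ⊤ := by
  let L : ℝ × ℝ →ₗ[ℝ] ℝ × ℝ :=
    { toFun := fun p => (linForm v p, linForm w p)
      map_add' := fun p q => by simp [linForm]; constructor <;> ring
      map_smul' := fun c p => by simp [linForm]; constructor <;> ring }
  obtain ⟨c, hc, h⟩ := lintegral_comp_linearMap (volume : Measure (ℝ × ℝ)) L (by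
    rintro ⟨a, b⟩ hz
    have h1 : v.1 * a + v.2 * b = 0 := congrArg Prod.fst hz
    have h2 : w.1 * a + w.2 * b = 0 := congrArg Prod.snd hz
    have ha : (v.1 * w.2 - v.2 * w.1) * a = 0 := by linear_combination w.2 * h1 - v.2 * h2
    have hb : (v.1 * w.2 - v.2 * w.1) * b = 0 := by linear_combination v.1 * h2 - w.1 * h1
    exact Prod.ext ((mul_eq_zero.1 ha).resolve_left hvw) ((mul_eq_zero.1 hb).resolve_left hvw))
  have := h (fun p => truncPow R ρ p.1 * truncPow R ρ p.2)
    (((measurable_truncPow R ρ).comp measurable_fst).mul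
      ((measurable_truncPow R ρ).comp measurable_snd))
  change ∫⁻ p : ℝ × ℝ, truncPow R ρ (linForm v p) * truncPow R ρ (linForm w p) = _ at this
  rw [this, Measure.volume_eq_prod, lintegral_prod_mul (measurable_truncPow R ρ).aemeasurable
    (measurable_truncPow R ρ).aemeasurable]
  have := lintegral_truncPow_ne_top (R := R) hρ
  exact ENNReal.mul_ne_top hc (ENNReal.mul_ne_top this this)

/-- Local integrability of products of negative powers of linear forms in the plane. -/
lemma lintegral_prod_forms_ne_top {ι : Type*} [Fintype ι] [DecidableEq ι] [Nontrivial ι]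
    {v : ι → ℝ × ℝ} {e : ι → ℝ} (hv : ∀ i j, i ≠ j → (v i).1 * (v j).2 - (v i).2 * (v j).1 ≠ 0)
    (he : ∀ i, 0 < e i) (he1 : ∀ i, e i < 1) (hsum : ∑ i, e i < 2) {R : ℝ} (hR : 0 ≤ R) :
    ∫⁻ p in {p : ℝ × ℝ | ∀ i, |linForm (v i) p| ≤ R},
      ENNReal.ofReal (∏ i, |linForm (v i) p| ^ (-e i)) ≠ ⊤ := by
  obtain ⟨i₀, -, hi₀⟩ := Finset.exists_max_image Finset.univ e Finset.univ_nonempty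
  -- The smallest common exponent that dominates every e i and half their sum; the two integrability
  -- conditions say precisely that it is below 1.
  set ρ := max (e i₀) ((∑ i, e i) / 2) with hρ
  have hρ1 : ρ < 1 := max_lt (he1 i₀) (by linarith)
  have heρ : ∀ i, e i ≤ ρ := fun i => (hi₀ i (Finset.mem_univ i)).trans (le_max_left _ _)
  have hsρ : ∑ i, e i ≤ 2 * ρ := by linarith [le_max_right (e i₀) ((∑ i, e i) / 2)]
  have hmeas : MeasurableSet {p : ℝ × ℝ | ∀ i, |linForm (v i) p| ≤ R} := by
    rw [ofPred_forall]
    exact (isClosed_iInter fun i =>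
      isClosed_le (continuous_linForm _).abs continuous_const).measurableSet
  have hb : ∫⁻ p in {p : ℝ × ℝ | ∀ i, |linForm (v i) p| ≤ R},
      ENNReal.ofReal (∏ i, |linForm (v i) p| ^ (-e i)) ≤
      ∫⁻ p : ℝ × ℝ, ENNReal.ofReal (R ^ (2 * ρ - ∑ i, e i)) *
        ∑ q ∈ (Finset.univ : Finset ι).offDiag, truncPow R ρ (linForm (v q.1) p) *
          truncPow R ρ (linForm (v q.2) p) := by
    rw [← lintegral_indicator hmeas]
    refine lintegral_mono fun p => ?_
    by_cases hp : p ∈ {p : ℝ × ℝ | ∀ i, |linForm (v i) p| ≤ R}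
    swap
    · rw [indicator_of_notMem hp]; exact zero_le
    rw [indicator_of_mem hp]
    have := prod_rpow_le (l := fun i => |linForm (v i) p|) (fun i => abs_nonneg _) hp he heρ hsρ
    refine (ENNReal.ofReal_le_ofReal this).trans (le_of_eq ?_)
    rw [ENNReal.ofReal_mul (Real.rpow_nonneg hR _), ENNReal.ofReal_sum_of_nonneg
      (fun q _ => by positivity)]
    congr 1
    refine Finset.sum_congr rfl fun q _ => ?_
    rw [ENNReal.ofReal_mul (by positivity), truncPow, truncPow,
      indicator_of_mem (mem_Icc.2 (abs_le.1 (hp q.1))),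
      indicator_of_mem (mem_Icc.2 (abs_le.1 (hp q.2)))]
  have hm : ∀ q : ι × ι, Measurable fun p => truncPow R ρ (linForm (v q.1) p) *
      truncPow R ρ (linForm (v q.2) p) := fun q =>
    ((measurable_truncPow R ρ).comp (continuous_linForm _).measurable).mul
      ((measurable_truncPow R ρ).comp (continuous_linForm _).measurable)
  refine ne_top_of_le_ne_top ?_ hb
  rw [lintegral_const_mul _ (Finset.measurable_fun_sum _ fun q _ => hm q),
    lintegral_finsetSum _ fun q _ => hm q]
  refine ENNReal.mul_ne_top ENNReal.ofReal_ne_top (ENNReal.sum_ne_top.2 fun q hq => ?_)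
  exact lintegral_pair_ne_top hρ1 (hv _ _ (Finset.mem_offDiag.1 hq).2.2)

/-! ### The covariance measure -/

/-- The measure on `((u, v), (x, y))` with density `|u - v| ^ (2H - 2) |x - y| ^ (-ν)`, the times
`u, v` being restricted to `[0, T]`. -/
def noiseMeasure (T H ν : ℝ) : Measure ((ℝ × ℝ) × (ℝ × ℝ)) :=
  (volume.restrict ((Icc 0 T ×ˢ Icc 0 T) ×ˢ univ)).withDensity fun z =>
    ENNReal.ofReal (|z.1.1 - z.1.2| ^ (2 * H - 2) * |z.2.1 - z.2.2| ^ (-ν))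

/-- The pairs of points of the characteristic rectangle `[s₁,s₂] × [t₁,t₂]`. -/
def charPairs (s₁ s₂ t₁ t₂ : ℝ) : Set ((ℝ × ℝ) × (ℝ × ℝ)) :=
  {z | toRot (z.1.1, z.2.1) ∈ Icc s₁ s₂ ×ˢ Icc t₁ t₂ ∧ toRot (z.1.2, z.2.2) ∈ Icc s₁ s₂ ×ˢ Icc t₁ t₂}

lemma continuous_toRot : Continuous toRot := by unfold toRot; fun_prop

lemma isClosed_charPairs (s₁ s₂ t₁ t₂ : ℝ) : IsClosed (charPairs s₁ s₂ t₁ t₂) := by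
  have h : IsClosed (Icc s₁ s₂ ×ˢ Icc t₁ t₂ : Set (ℝ × ℝ)) := isClosed_Icc.prod isClosed_Icc
  exact (h.preimage (f := fun z : (ℝ × ℝ) × (ℝ × ℝ) => toRot (z.1.1, z.2.1))
    (continuous_toRot.comp (by fun_prop))).inter (h.preimage
    (f := fun z : (ℝ × ℝ) × (ℝ × ℝ) => toRot (z.1.2, z.2.2)) (continuous_toRot.comp (by fun_prop)))

/-- Differences, and the second point, in the rotated coordinates. -/
def pairMap : ((ℝ × ℝ) × (ℝ × ℝ)) →ₗ[ℝ] ((ℝ × ℝ) × (ℝ × ℝ)) where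
  toFun z := (((z.1.1 - z.2.1) / √2 - (z.1.2 - z.2.2) / √2,
    (z.1.1 + z.2.1) / √2 - (z.1.2 + z.2.2) / √2), ((z.1.2 - z.2.2) / √2, (z.1.2 + z.2.2) / √2))
  map_add' z w := by
    ext <;> simp <;> ring
  map_smul' c z := by
    ext <;> simp <;> ring

lemma pairMap_injective (z : (ℝ × ℝ) × (ℝ × ℝ)) (hz : pairMap z = 0) : z = 0 := by
  obtain ⟨⟨u, v⟩, ⟨x, y⟩⟩ := z
  have h2 : √2 ≠ (0 : ℝ) := by positivity
  have e1 : (u - x) / √2 - (v - y) / √2 = 0 := congrArg (fun z => z.1.1) hz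
  have e2 : (u + x) / √2 - (v + y) / √2 = 0 := congrArg (fun z => z.1.2) hz
  have e3 : (v - y) / √2 = 0 := congrArg (fun z => z.2.1) hz
  have e4 : (v + y) / √2 = 0 := congrArg (fun z => z.2.2) hz
  rw [e3, sub_zero] at e1
  rw [e4, sub_zero] at e2
  have f1 := (div_eq_zero_iff.1 e1).resolve_right h2
  have f2 := (div_eq_zero_iff.1 e2).resolve_right h2
  have f3 := (div_eq_zero_iff.1 e3).resolve_right h2
  have f4 := (div_eq_zero_iff.1 e4).resolve_right h2
  have : u = 0 := by linarith
  have : v = 0 := by linarith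
  have : x = 0 := by linarith
  have : y = 0 := by linarith
  simp [*]

/-- The coefficients of the four linear forms. -/
def formCoeff : Fin 4 → ℝ × ℝ := ![(1, 0), (0, 1), (1, 1), (-1, 1)]

/-- The kernel in the rotated coordinates, truncated at a rectangle. -/
def rotKernel (μ ν a b : ℝ) (p : ℝ × ℝ) : ENNReal :=
  (Icc (-a) a ×ˢ Icc (-b) b).indicator
    (fun p => ENNReal.ofReal (|(p.2 + p.1) / √2| ^ (-μ) * |(p.2 - p.1) / √2| ^ (-ν))) p

lemma measurable_rotKernel (μ ν a b : ℝ) : Measurable (rotKernel μ ν a b) :=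
  Measurable.indicator (by fun_prop) (measurableSet_Icc.prod measurableSet_Icc)

/-- On the rectangle one has 1 ≤ (a/|p.1|)^α (b/|p.2|)^β. Inserting these factors produces the gain
a^α b^β and leaves an integrand with four pairwise independent singular forms, whose integral over a
fixed region is finite by the condition on the sum of the exponents. -/
lemma lintegral_rotKernel_le {α β μ ν : ℝ} (hα : α ∈ Ioo 0 1) (hβ : β ∈ Ioo 0 1)
    (hμ : μ ∈ Ioo 0 1) (hν : ν ∈ Ioo 0 1) (h : α + β + μ + ν < 2) {R : ℝ} (hR : 0 ≤ R) :
    ∃ C : ENNReal, C ≠ ⊤ ∧ ∀ a b : ℝ, 0 ≤ a → 0 ≤ b → a ≤ R → b ≤ R →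
      ∫⁻ p, rotKernel μ ν a b p ≤ C * ENNReal.ofReal (a ^ α * b ^ β) := by
  set e : Fin 4 → ℝ := ![α, β, μ, ν] with he
  have hI : ∫⁻ p in {p : ℝ × ℝ | ∀ i, |linForm (formCoeff i) p| ≤ 2 * R},
      ENNReal.ofReal (∏ i, |linForm (formCoeff i) p| ^ (-e i)) ≠ ⊤ := by
    refine lintegral_prod_forms_ne_top ?_ ?_ ?_ ?_ (by positivity)
    · intro i j hij
      fin_cases i <;> fin_cases j <;> (simp [formCoeff] at hij ⊢; try norm_num)
    · intro i; fin_cases i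
      exacts [hα.1, hβ.1, hμ.1, hν.1]
    · intro i; fin_cases i
      exacts [hα.2, hβ.2, hμ.2, hν.2]
    · rw [Fin.sum_univ_four]; simpa [he] using h
  set D := {p : ℝ × ℝ | ∀ i, |linForm (formCoeff i) p| ≤ 2 * R} with hD
  have hDm : MeasurableSet D := by
    rw [hD, ofPred_forall]
    exact (isClosed_iInter fun i =>
      isClosed_le (continuous_linForm _).abs continuous_const).measurableSet
  set I := ∫⁻ p in D, ENNReal.ofReal (∏ i, |linForm (formCoeff i) p| ^ (-e i)) with hIdef
  set k : ℝ := √2 ^ μ * √2 ^ ν with hk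
  have hk0 : 0 ≤ k := by positivity
  refine ⟨ENNReal.ofReal k * I, ENNReal.mul_ne_top ENNReal.ofReal_ne_top hI,
    fun a b ha hb haR hbR => ?_⟩
  -- On the axes the negative powers are 0 by convention and the inserted factors would not be at
  -- least 1; the axes are a null set.
  have hne : ∀ᵐ p : ℝ × ℝ, p.1 ≠ 0 ∧ p.2 ≠ 0 := by
    have h1 : ∀ᵐ p : ℝ × ℝ, p.1 ≠ 0 := by
      rw [Measure.volume_eq_prod]
      exact Measure.quasiMeasurePreserving_fst.ae (Measure.ae_ne volume (0 : ℝ))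
    have h2 : ∀ᵐ p : ℝ × ℝ, p.2 ≠ 0 := by
      rw [Measure.volume_eq_prod]
      exact Measure.quasiMeasurePreserving_snd.ae (Measure.ae_ne volume (0 : ℝ))
    exact h1.and h2
  have hle : ∫⁻ p, rotKernel μ ν a b p ≤ ∫⁻ p, ENNReal.ofReal (k * (a ^ α * b ^ β)) *
      D.indicator (fun p => ENNReal.ofReal (∏ i, |linForm (formCoeff i) p| ^ (-e i))) p := by
    refine lintegral_mono_ae ?_
    filter_upwards [hne] with p hp
    unfold rotKernel
    by_cases hpm : p ∈ Icc (-a) a ×ˢ Icc (-b) b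
    swap
    · rw [indicator_of_notMem hpm]; exact zero_le
    have h1 : |p.1| ≤ a := abs_le.2 hpm.1
    have h2 : |p.2| ≤ b := abs_le.2 hpm.2
    have hpD : p ∈ D := by
      obtain ⟨a1, a2⟩ := abs_le.1 h1
      obtain ⟨b1, b2⟩ := abs_le.1 h2
      intro i
      rw [abs_le]
      fin_cases i <;> simp [formCoeff, linForm] <;> constructor <;> linarith
    rw [indicator_of_mem hpm, indicator_of_mem hpD,
      ← ENNReal.ofReal_mul (by have := Real.rpow_nonneg ha α; have := Real.rpow_nonneg hb β; positivity)]
    refine ENNReal.ofReal_le_ofReal ?_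
    rw [Fin.prod_univ_four]
    have e0 : linForm (formCoeff 0) p = p.1 := by simp [formCoeff, linForm]
    have e1 : linForm (formCoeff 1) p = p.2 := by simp [formCoeff, linForm]
    have e2 : linForm (formCoeff 2) p = p.2 + p.1 := by simp [formCoeff, linForm]; ring
    have e3 : linForm (formCoeff 3) p = p.2 - p.1 := by simp [formCoeff, linForm]; ring
    rw [e0, e1, e2, e3]
    have q1 : 1 ≤ a ^ α * |p.1| ^ (-α) := by
      have h0 : 0 < |p.1| := abs_pos.2 hp.1
      rw [Real.rpow_neg h0.le, ← div_eq_mul_inv, one_le_div (by positivity)]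
      exact Real.rpow_le_rpow h0.le h1 hα.1.le
    have q2 : 1 ≤ b ^ β * |p.2| ^ (-β) := by
      have h0 : 0 < |p.2| := abs_pos.2 hp.2
      rw [Real.rpow_neg h0.le, ← div_eq_mul_inv, one_le_div (by positivity)]
      exact Real.rpow_le_rpow h0.le h2 hβ.1.le
    have q3 : ∀ r m : ℝ, |r / √2| ^ (-m) = √2 ^ m * |r| ^ (-m) := fun r m => by
      rw [abs_div, abs_of_nonneg (Real.sqrt_nonneg 2), Real.div_rpow (abs_nonneg _)
        (Real.sqrt_nonneg 2), Real.rpow_neg (Real.sqrt_nonneg 2), div_inv_eq_mul, mul_comm]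
    rw [q3, q3]
    have q := one_le_mul_of_one_le_of_one_le q1 q2
    have : 0 ≤ √2 ^ μ * |p.2 + p.1| ^ (-μ) * (√2 ^ ν * |p.2 - p.1| ^ (-ν)) := by positivity
    refine (le_mul_of_one_le_right this q).trans (le_of_eq ?_)
    simp only [he, hk, Matrix.cons_val]
    ring
  refine hle.trans (le_of_eq ?_)
  rw [lintegral_const_mul' _ _ ENNReal.ofReal_ne_top, lintegral_indicator hDm,
    ENNReal.ofReal_mul hk0]
  ring

/-- The covariance of the noise of a small rectangle. -/
theorem exists_noiseMeasure_le {T H ν η η' : ℝ} (hH : H ∈ Ioo (1 / 2) 1) (hν : ν ∈ Ioo 0 1)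
    (hη : η ∈ Ioo (1 / 2) 1) (hη' : η' ∈ Ioo (1 / 2) 1) (h : η + η' < 1 + H - ν / 2) (N : ℕ) :
    ∃ C : ℝ, 0 ≤ C ∧ ∀ s₁ s₂ t₁ t₂ : ℝ, -(N : ℝ) ≤ s₁ → s₁ ≤ s₂ → s₂ ≤ N →
      -(N : ℝ) ≤ t₁ → t₁ ≤ t₂ → t₂ ≤ N →
      noiseMeasure T H ν (charPairs s₁ s₂ t₁ t₂) ≤
        ENNReal.ofReal (C * ((s₂ - s₁) ^ (2 * η) * (t₂ - t₁) ^ (2 * η'))) := by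
  -- For these exponents the condition α + β + μ + ν < 2 is exactly η + η' < 1 + H - ν/2. The
  -- missing powers a and b come from the area of the rectangle.
  obtain ⟨C, hC, hker⟩ := lintegral_rotKernel_le (α := 2 * η - 1) (β := 2 * η' - 1)
    (μ := 2 - 2 * H) (ν := ν) ⟨by linarith [hη.1], by linarith [hη.2]⟩
    ⟨by linarith [hη'.1], by linarith [hη'.2]⟩ ⟨by linarith [hH.2], by linarith [hH.1]⟩ hν
    (by linarith) (R := 2 * N) (by positivity)
  obtain ⟨c, hc, hlin⟩ := lintegral_comp_linearMap
    (volume : Measure ((ℝ × ℝ) × (ℝ × ℝ))) pairMap pairMap_injective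
  refine ⟨(c * C).toReal, ENNReal.toReal_nonneg, ?_⟩
  intro s₁ s₂ t₁ t₂ h1 h2 h3 h4 h5 h6
  set a := s₂ - s₁ with ha
  set b := t₂ - t₁ with hb
  have ha0 : 0 ≤ a := sub_nonneg.2 h2
  have hb0 : 0 ≤ b := sub_nonneg.2 h5
  have hm := (isClosed_charPairs s₁ s₂ t₁ t₂).measurableSet
  set R : Set (ℝ × ℝ) := Icc s₁ s₂ ×ˢ Icc t₁ t₂ with hR
  have hRm : MeasurableSet R := measurableSet_Icc.prod measurableSet_Icc
  have hRv : volume R = ENNReal.ofReal (a * b) := by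
    rw [hR, Measure.volume_eq_prod, Measure.prod_prod, Real.volume_Icc, Real.volume_Icc,
      ← ENNReal.ofReal_mul ha0]
  set G : (ℝ × ℝ) × (ℝ × ℝ) → ENNReal := fun w =>
    rotKernel (2 - 2 * H) ν a b w.1 * R.indicator (fun _ => 1) w.2 with hG
  have hGm : Measurable G := ((measurable_rotKernel _ _ _ _).comp measurable_fst).mul
    ((measurable_const.indicator hRm).comp measurable_snd)
  have s2 : √2 * √2 = (2 : ℝ) := sqrt_two_mul_self
  have s20 : √2 ≠ (0 : ℝ) := by positivity
  calc noiseMeasure T H ν (charPairs s₁ s₂ t₁ t₂)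
      = ∫⁻ z in charPairs s₁ s₂ t₁ t₂,
        ENNReal.ofReal (|z.1.1 - z.1.2| ^ (2 * H - 2) * |z.2.1 - z.2.2| ^ (-ν))
          ∂(volume.restrict ((Icc 0 T ×ˢ Icc 0 T) ×ˢ univ)) := withDensity_apply _ hm
    _ ≤ ∫⁻ z in charPairs s₁ s₂ t₁ t₂,
        ENNReal.ofReal (|z.1.1 - z.1.2| ^ (2 * H - 2) * |z.2.1 - z.2.2| ^ (-ν)) :=
        lintegral_mono' (Measure.restrict_mono_measure Measure.restrict_le_self _) le_rfl
    -- In the coordinates of `pairMap` the kernel depends only on the difference of the two points,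
    -- which ranges over a box with half-sides a and b, while the second point ranges over the
    -- rectangle and contributes its area.
    _ ≤ ∫⁻ z, G (pairMap z) := by
        rw [← lintegral_indicator hm]
        refine lintegral_mono fun z => ?_
        by_cases hz : z ∈ charPairs s₁ s₂ t₁ t₂
        swap
        · rw [indicator_of_notMem hz]; exact zero_le
        rw [indicator_of_mem hz]
        obtain ⟨⟨z1, z2⟩, ⟨z3, z4⟩⟩ := hz
        simp only [toRot, mem_Icc] at z1 z2 z3 z4
        have m1 : (pairMap z).1 ∈ Icc (-a) a ×ˢ Icc (-b) b := by
          refine ⟨⟨?_, ?_⟩, ⟨?_, ?_⟩⟩ <;> simp only [pairMap, LinearMap.coe_mk, AddHom.coe_mk] <;>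
            linarith [z1.1, z1.2, z2.1, z2.2, z3.1, z3.2, z4.1, z4.2]
        have m2 : (pairMap z).2 ∈ R := ⟨z3, z4⟩
        have e1 : ((pairMap z).1.2 + (pairMap z).1.1) / √2 = z.1.1 - z.1.2 := by
          simp only [pairMap, LinearMap.coe_mk, AddHom.coe_mk]
          field_simp
          linear_combination (z.1.2 - z.1.1) * s2
        have e2 : ((pairMap z).1.2 - (pairMap z).1.1) / √2 = z.2.1 - z.2.2 := by
          simp only [pairMap, LinearMap.coe_mk, AddHom.coe_mk]
          field_simp
          linear_combination (z.2.2 - z.2.1) * s2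
        simp only [hG]
        rw [indicator_of_mem m2, rotKernel, indicator_of_mem m1, mul_one, e1, e2, neg_sub]
    _ = c * (∫⁻ p, rotKernel (2 - 2 * H) ν a b p) * ENNReal.ofReal (a * b) := by
        rw [hlin G hGm, Measure.volume_eq_prod, hG,
          lintegral_prod_mul (measurable_rotKernel _ _ _ _).aemeasurable
            (measurable_const.indicator hRm).aemeasurable, lintegral_indicator hRm, setLIntegral_one,
          hRv, mul_assoc]
    _ ≤ c * (C * ENNReal.ofReal (a ^ (2 * η - 1) * b ^ (2 * η' - 1))) * ENNReal.ofReal (a * b) := by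
        gcongr
        exact hker a b ha0 hb0 (by linarith) (by linarith)
    _ = ENNReal.ofReal ((c * C).toReal * (a ^ (2 * η) * b ^ (2 * η'))) := by
        rw [ENNReal.ofReal_mul ENNReal.toReal_nonneg, ENNReal.ofReal_toReal
          (ENNReal.mul_ne_top hc hC), ← mul_assoc, mul_assoc, ← ENNReal.ofReal_mul (by positivity)]
        congr 2
        have r1 : a ^ (2 * η) = a ^ (2 * η - 1) * a := by
          rw [← Real.rpow_add_one' ha0 (by linarith [hη.1])]; congr 1; ring
        have r2 : b ^ (2 * η') = b ^ (2 * η' - 1) * b := by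
          rw [← Real.rpow_add_one' hb0 (by linarith [hη'.1])]; congr 1; ring
        rw [r1, r2]; ring

end FracWave

end

noncomputable section

namespace FracWave

/-! ### The covariance as an integral with respect to a measure -/

/-- The function `φ(u, x) ψ(v, y)` of `((u, v), (x, y))`. -/
def tensor (φ ψ : ℝ × ℝ → ℝ) (z : (ℝ × ℝ) × (ℝ × ℝ)) : ℝ := φ (z.1.1, z.2.1) * ψ (z.1.2, z.2.2)

/-- The pairs of points of `K`. -/
def pairsOf (K : Set (ℝ × ℝ)) : Set ((ℝ × ℝ) × (ℝ × ℝ)) :=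
  {z | (z.1.1, z.2.1) ∈ K ∧ (z.1.2, z.2.2) ∈ K}

/-- Since H > 1/2 > ν/2, the bound 1 + H - ν/2 exceeds 1, so a common exponent slightly above 1/2 is
admissible. It drives the fixed point argument. -/
lemma exists_admissible {H ν : ℝ} (hH : H ∈ Ioo (1 / 2) 1) (hν : ν ∈ Ioo 0 1) :
    ∃ γ ∈ Ioo (1 / 2 : ℝ) 1, γ + γ < 1 + H - ν / 2 := by
  have h1 := hH.1
  have h2 := hν.2
  obtain ⟨γ, h3, h4⟩ := exists_between (show (1 / 2 : ℝ) < min 1 ((1 + H - ν / 2) / 2) from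
    lt_min (by norm_num) (by linarith))
  exact ⟨γ, ⟨h3, h4.trans_le (min_le_left _ _)⟩, by linarith [h4.trans_le (min_le_right _ _)]⟩

section

variable {T H ν : ℝ}

lemma noiseMeasure_pairsOf_lt_top (hH : H ∈ Ioo (1 / 2) 1) (hν : ν ∈ Ioo 0 1)
    {K : Set (ℝ × ℝ)} (hK : IsCompact K) : noiseMeasure T H ν (pairsOf K) < ⊤ := by
  obtain ⟨γ, hγ, h⟩ := exists_admissible hH hν
  obtain ⟨R, hR⟩ := (hK.image continuous_toRot).isBounded.subset_closedBall 0
  obtain ⟨N, hN⟩ := exists_nat_ge R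
  obtain ⟨C, -, hC⟩ := exists_noiseMeasure_le (T := T) hH hν hγ hγ h N
  have hN0 : (0 : ℝ) ≤ N := Nat.cast_nonneg N
  refine lt_of_le_of_lt (measure_mono ?_) ((hC (-N) N (-N) N le_rfl (by linarith) le_rfl le_rfl
    (by linarith) le_rfl).trans_lt ENNReal.ofReal_lt_top)
  have key : ∀ p ∈ K, toRot p ∈ Icc (-(N : ℝ)) N ×ˢ Icc (-(N : ℝ)) N := by
    intro p hp
    have := hR (mem_image_of_mem _ hp)
    rw [mem_closedBall_zero_iff, Prod.norm_def] at this
    exact ⟨abs_le.1 ((le_max_left _ _).trans (this.trans hN)),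
      abs_le.1 ((le_max_right _ _).trans (this.trans hN))⟩
  exact fun z hz => ⟨key _ hz.1, key _ hz.2⟩

lemma measurableSet_pairsOf {K : Set (ℝ × ℝ)} (hK : IsCompact K) : MeasurableSet (pairsOf K) :=
  ((hK.isClosed.preimage (f := fun z : (ℝ × ℝ) × (ℝ × ℝ) => (z.1.1, z.2.1)) (by fun_prop)).inter
    (hK.isClosed.preimage (f := fun z : (ℝ × ℝ) × (ℝ × ℝ) => (z.1.2, z.2.2))
      (by fun_prop))).measurableSet

lemma measurable_tensor {f g : ℝ × ℝ → ℝ} (hf : Measurable f) (hg : Measurable g) :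
    Measurable (tensor f g) :=
  (hf.comp (by fun_prop)).mul (hg.comp (by fun_prop))

lemma abs_tensor_le {f g : ℝ × ℝ → ℝ} {K : Set (ℝ × ℝ)} {C C' : ℝ} (hfC : ∀ p, |f p| ≤ C)
    (hgC : ∀ p, |g p| ≤ C') (hfK : ∀ p ∉ K, f p = 0) (hgK : ∀ p ∉ K, g p = 0)
    (z : (ℝ × ℝ) × (ℝ × ℝ)) : ‖tensor f g z‖ ≤ (pairsOf K).indicator (fun _ => C * C') z := by
  by_cases hz : z ∈ pairsOf K
  · rw [indicator_of_mem hz, tensor, norm_mul]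
    exact mul_le_mul (hfC _) (hgC _) (norm_nonneg _) ((abs_nonneg _).trans (hfC 0))
  · rw [indicator_of_notMem hz]
    have : (z.1.1, z.2.1) ∉ K ∨ (z.1.2, z.2.2) ∉ K := by
      by_contra h; push Not at h; exact hz h
    rcases this with h | h
    · simp [tensor, hfK _ h]
    · simp [tensor, hgK _ h]

lemma integrable_indicator_pairsOf (hH : H ∈ Ioo (1 / 2) 1) (hν : ν ∈ Ioo 0 1)
    {K : Set (ℝ × ℝ)} (hK : IsCompact K) (C : ℝ) :
    Integrable ((pairsOf K).indicator fun _ => C) (noiseMeasure T H ν) :=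
  (integrable_indicator_iff (measurableSet_pairsOf hK)).2
    (integrableOn_const (noiseMeasure_pairsOf_lt_top hH hν hK).ne)

lemma integrable_tensor (hH : H ∈ Ioo (1 / 2) 1) (hν : ν ∈ Ioo 0 1) {f g : ℝ × ℝ → ℝ}
    (hf : Measurable f) (hg : Measurable g) {K : Set (ℝ × ℝ)} (hK : IsCompact K) {C C' : ℝ}
    (hfC : ∀ p, |f p| ≤ C) (hgC : ∀ p, |g p| ≤ C') (hfK : ∀ p ∉ K, f p = 0)
    (hgK : ∀ p ∉ K, g p = 0) : Integrable (tensor f g) (noiseMeasure T H ν) :=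
  (integrable_indicator_pairsOf hH hν hK (C * C')).mono'
    (measurable_tensor hf hg).aestronglyMeasurable
    (Eventually.of_forall (abs_tensor_le hfC hgC hfK hgK))

lemma exists_bound_planeTest (φ : PlaneTest) : ∃ C, ∀ p, |φ p| ≤ C := by
  obtain ⟨C, hC⟩ := φ.hasCompactSupport.exists_bound_of_continuous φ.continuous
  exact ⟨C, hC⟩

lemma integrable_tensor_planeTest (hH : H ∈ Ioo (1 / 2) 1) (hν : ν ∈ Ioo 0 1) (φ ψ : PlaneTest) :
    Integrable (tensor φ ψ) (noiseMeasure T H ν) := by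
  obtain ⟨C, hC⟩ := exists_bound_planeTest φ
  obtain ⟨C', hC'⟩ := exists_bound_planeTest ψ
  refine integrable_tensor hH hν φ.continuous.measurable ψ.continuous.measurable
    (K := tsupport φ ∪ tsupport ψ) (φ.hasCompactSupport.isCompact.union
      ψ.hasCompactSupport.isCompact) hC hC' (fun p hp => ?_) (fun p hp => ?_)
  · exact image_eq_zero_of_notMem_tsupport fun h => hp (Or.inl h)
  · exact image_eq_zero_of_notMem_tsupport fun h => hp (Or.inr h)

/-- Fubini, legitimate because the singular kernel is integrable on pairs of points of a compact
set. In this form limits of test functions become instances of dominated convergence. -/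
lemma covariance_eq (hH : H ∈ Ioo (1 / 2) 1) (hν : ν ∈ Ioo 0 1) (φ ψ : PlaneTest) :
    (∫ u in Icc 0 T, ∫ v in Icc 0 T,
      |u - v| ^ (2 * H - 2) * ∫ x : ℝ, ∫ y : ℝ, |x - y| ^ (-ν) * (φ (u, x) * ψ (v, y))) =
      ∫ z, tensor φ ψ z ∂(noiseMeasure T H ν) := by
  set k : (ℝ × ℝ) × (ℝ × ℝ) → ℝ := fun z =>
    |z.1.1 - z.1.2| ^ (2 * H - 2) * |z.2.1 - z.2.2| ^ (-ν) with hk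
  have hk0 : ∀ z, 0 ≤ k z := fun z => by simp only [hk]; positivity
  have hkm : Measurable k := by simp only [hk]; fun_prop
  set m₁ : Measure ℝ := volume.restrict (Icc 0 T) with hm₁
  have hrestr : (volume.restrict ((Icc 0 T ×ˢ Icc 0 T) ×ˢ univ) : Measure ((ℝ × ℝ) × (ℝ × ℝ))) =
      (m₁.prod m₁).prod (volume.prod volume) := by
    rw [Measure.volume_eq_prod, ← Measure.prod_restrict, Measure.volume_eq_prod,
      ← Measure.prod_restrict, Measure.restrict_univ]
  have hint := integrable_tensor_planeTest (T := T) hH hν φ ψ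
  have hμ : noiseMeasure T H ν = ((m₁.prod m₁).prod (volume.prod volume)).withDensity
      fun z => ENNReal.ofReal (k z) := by rw [← hrestr]; rfl
  rw [hμ] at hint ⊢
  rw [integrable_withDensity_iff_integrable_smul' (hkm.ennreal_ofReal)
    (Eventually.of_forall fun z => ENNReal.ofReal_lt_top)] at hint
  rw [integral_withDensity_eq_integral_toReal_smul hkm.ennreal_ofReal
    (Eventually.of_forall fun z => ENNReal.ofReal_lt_top)]
  simp only [ENNReal.toReal_ofReal (hk0 _), smul_eq_mul] at hint ⊢
  rw [integral_prod _ hint]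
  have hae : (fun w : ℝ × ℝ => ∫ q, k (w, q) * tensor φ ψ (w, q) ∂(volume.prod volume))
      =ᵐ[m₁.prod m₁] fun w => |w.1 - w.2| ^ (2 * H - 2) *
        ∫ x : ℝ, ∫ y : ℝ, |x - y| ^ (-ν) * (φ (w.1, x) * ψ (w.2, y)) := by
    filter_upwards [hint.prod_right_ae] with w hw
    have e : ∀ q : ℝ × ℝ, k (w, q) * tensor φ ψ (w, q) = |w.1 - w.2| ^ (2 * H - 2) *
        (|q.1 - q.2| ^ (-ν) * (φ (w.1, q.1) * ψ (w.2, q.2))) := fun q => by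
      simp only [hk, tensor]; ring
    simp only [e] at hw ⊢
    rw [integral_const_mul]
    -- Fubini in the space variables needs integrability without the time factor. It follows by
    -- dividing by that factor; if the factor is 0, both sides vanish.
    by_cases hz : |w.1 - w.2| ^ (2 * H - 2) = 0
    · rw [hz, zero_mul, zero_mul]
    · have := hw.const_mul (|w.1 - w.2| ^ (2 * H - 2))⁻¹
      simp only [inv_mul_cancel_left₀ hz] at this
      rw [integral_prod _ this]
  rw [integral_congr_ae hae, integral_prod _ (hint.integral_prod_left.congr hae)]

/-! ### Finite combinations of the noise -/

variable {Ω : Type*} [MeasurableSpace Ω] {P : Measure Ω} {X : PlaneTest → Ω → ℝ}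

/-- The variance constant. -/
lemma noiseConst_nonneg (hH : H ∈ Ioo (1 / 2) 1) : 0 ≤ H * (2 * H - 1) := by
  have := hH.1
  nlinarith

lemma IsFractionalNoise.memLp (hX : IsFractionalNoise P T H ν X) (φ : PlaneTest) :
    MemLp (X φ) 2 P := (hX.gaussian.hasGaussianLaw_eval φ).memLp_two

lemma IsFractionalNoise.hasGaussianLaw_comb (hX : IsFractionalNoise P T H ν X) {ι : Type*}
    [Fintype ι] (c : ι → ℝ) (φ : ι → PlaneTest) :
    HasGaussianLaw (fun ω => ∑ i, c i * X (φ i) ω) P :=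
  ((hX.gaussian.comp_right φ).smul c).hasGaussianLaw_fun_sum

lemma IsFractionalNoise.integral_comb [IsProbabilityMeasure P]
    (hX : IsFractionalNoise P T H ν X) {ι : Type*}
    [Fintype ι] (c : ι → ℝ) (φ : ι → PlaneTest) :
    ∫ ω, ∑ i, c i * X (φ i) ω ∂P = 0 := by
  rw [integral_finsetSum _ fun i _ =>
    ((hX.memLp (φ i)).integrable (by norm_num)).const_mul (c i)]
  refine Finset.sum_eq_zero fun i _ => ?_
  rw [integral_const_mul, hX.centered, mul_zero]

lemma IsFractionalNoise.integral_comb_sq (hH : H ∈ Ioo (1 / 2) 1) (hν : ν ∈ Ioo 0 1)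
    (hX : IsFractionalNoise P T H ν X) {ι : Type*} [Fintype ι] (c : ι → ℝ) (φ : ι → PlaneTest) :
    ∫ ω, (∑ i, c i * X (φ i) ω) ^ 2 ∂P = H * (2 * H - 1) *
      ∫ z, tensor (fun p => ∑ i, c i * φ i p) (fun p => ∑ i, c i * φ i p) z
        ∂(noiseMeasure T H ν) := by
  have e1 : ∀ ω, (∑ i, c i * X (φ i) ω) ^ 2 =
      ∑ i, ∑ j, c i * c j * (X (φ i) ω * X (φ j) ω) := fun ω => by
    rw [sq, Finset.sum_mul_sum]
    exact Finset.sum_congr rfl fun i _ => Finset.sum_congr rfl fun j _ => by ring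
  have e2 : ∀ z, tensor (fun p => ∑ i, c i * φ i p) (fun p => ∑ i, c i * φ i p) z =
      ∑ i, ∑ j, c i * c j * tensor (φ i) (φ j) z := fun z => by
    rw [tensor, Finset.sum_mul_sum]
    exact Finset.sum_congr rfl fun i _ => Finset.sum_congr rfl fun j _ => by rw [tensor]; ring
  have i1 : ∀ i j, Integrable (fun ω => c i * c j * (X (φ i) ω * X (φ j) ω)) P := fun i j =>
    ((hX.memLp (φ i)).integrable_mul (hX.memLp (φ j))).const_mul _
  have i2 : ∀ i j, Integrable (fun z => c i * c j * tensor (φ i) (φ j) z)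
      (noiseMeasure T H ν) := fun i j => (integrable_tensor_planeTest hH hν _ _).const_mul _
  simp only [e1, e2]
  rw [integral_finsetSum _ fun i _ => integrable_finsetSum _ fun j _ => i1 i j,
    integral_finsetSum _ fun i _ => integrable_finsetSum _ fun j _ => i2 i j, Finset.mul_sum]
  refine Finset.sum_congr rfl fun i _ => ?_
  rw [integral_finsetSum _ fun j _ => i1 i j, integral_finsetSum _ fun j _ => i2 i j,
    Finset.mul_sum]
  refine Finset.sum_congr rfl fun j _ => ?_
  rw [integral_const_mul, integral_const_mul, hX.covariance, covariance_eq hH hν]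
  ring

lemma eLpNorm_two_eq {V : Ω → ℝ} (hV : MemLp V 2 P) :
    eLpNorm V 2 P = ENNReal.ofReal (√(∫ ω, V ω ^ 2 ∂P)) := by
  rw [hV.eLpNorm_eq_integral_rpow_norm (by norm_num) (by norm_num), Real.sqrt_eq_rpow]
  congr 2
  · refine integral_congr_ae (Eventually.of_forall fun ω => ?_)
    simp
  · norm_num

/-- The moments of a centred Gaussian variable. -/
lemma eLpNorm_gaussian {V : Ω → ℝ} (hV : HasGaussianLaw V P) (h0 : ∫ ω, V ω ∂P = 0) (p : ENNReal) :
    eLpNorm V p P = ENNReal.ofReal (√(∫ ω, V ω ^ 2 ∂P)) * eLpNorm id p (gaussianReal 0 1) := by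
  have hVm : AEMeasurable V P := hV.aemeasurable
  have hmap := hV.map_eq_gaussianReal
  rw [variance_eq_integral hVm, h0] at hmap
  simp only [sub_zero] at hmap
  set v := ∫ ω, V ω ^ 2 ∂P with hv
  have hv0 : 0 ≤ v := integral_nonneg fun ω => sq_nonneg _
  have e : P.map V = (gaussianReal 0 1).map (fun x => √v * x) := by
    rw [hmap, gaussianReal_map_const_mul, mul_zero, mul_one]
    congr 1
    ext
    simp [Real.sq_sqrt hv0, hv0]
  have e1 : eLpNorm V p P = eLpNorm id p (P.map V) := by
    rw [eLpNorm_map_measure aestronglyMeasurable_id hVm]; rfl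
  rw [e1, e, eLpNorm_map_measure aestronglyMeasurable_id (by fun_prop)]
  have e2 : (id ∘ fun x : ℝ => √v * x) = √v • (id : ℝ → ℝ) := by ext; simp
  rw [e2, eLpNorm_const_smul, Real.enorm_eq_ofReal (Real.sqrt_nonneg _)]

end

end FracWave

end

noncomputable section

namespace FracWave

/-! ### The noise of compact sets -/

/-- Approximation of the indicator function of a compact set by test functions. -/
lemma exists_approx {A : Set (ℝ × ℝ)} (hA : IsCompact A) : ∃ φ : ℕ → PlaneTest,
    (∃ K, IsCompact K ∧ ∀ n, tsupport (φ n) ⊆ K) ∧ (∀ n p, |φ n p| ≤ 1) ∧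
    ∀ p, Tendsto (fun n => φ n p) atTop (𝓝 (A.indicator (fun _ => (1 : ℝ)) p)) := by
  -- A smooth g with values in [0, 1] vanishing exactly on A, together with a cutoff χ equal to 1 on
  -- A: the functions χ (1 - g)^n converge to the indicator of A.
  obtain ⟨g, hgs, hg, hgr⟩ := hA.isClosed.isOpen_compl.exists_contDiff_support_eq (n := ⊤)
  obtain ⟨R, hR⟩ := hA.isBounded.subset_closedBall 0
  have hR1 : 0 < max R 1 := lt_max_of_lt_right one_pos
  let χ : ContDiffBump (0 : ℝ × ℝ) := ⟨max R 1, max R 1 + 1, hR1, by linarith⟩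
  have hχ1 : ∀ p ∈ A, χ p = 1 := fun p hp =>
    χ.one_of_mem_closedBall (Metric.closedBall_subset_closedBall (le_max_left _ _) (hR hp))
  have hg01 : ∀ p, 0 ≤ g p ∧ g p ≤ 1 := fun p => hgr ⟨p, rfl⟩
  have hsupp : ∀ n : ℕ, tsupport (fun p => χ p * (1 - g p) ^ n) ⊆ tsupport χ := fun n =>
    tsupport_mul_subset_left
  let φ : ℕ → PlaneTest := fun n =>
    ⟨fun p => χ p * (1 - g p) ^ n, χ.contDiff.mul ((contDiff_const.sub hg).pow n),
      χ.hasCompactSupport.of_isClosed_subset (isClosed_tsupport _) (hsupp n), subset_univ _⟩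
  have hφ : ∀ n p, φ n p = χ p * (1 - g p) ^ n := fun n p => rfl
  refine ⟨φ, ⟨tsupport χ, χ.hasCompactSupport, hsupp⟩, fun n p => ?_, fun p => ?_⟩
  · rw [hφ, abs_mul, abs_of_nonneg χ.nonneg, abs_of_nonneg (pow_nonneg (by linarith [hg01 p]) n)]
    exact mul_le_one₀ χ.le_one (pow_nonneg (by linarith [hg01 p]) n)
      (pow_le_one₀ (by linarith [hg01 p]) (by linarith [hg01 p]))
  · simp only [hφ]
    by_cases hp : p ∈ A
    · have : g p = 0 := by
        by_contra h
        have : p ∈ Function.support g := h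
        rw [hgs] at this
        exact this hp
      simp [indicator_of_mem hp, hχ1 p hp, this]
    · have h1 : 0 < g p := (hg01 p).1.lt_of_ne' (by
        have : p ∈ Function.support g := by rw [hgs]; exact hp
        exact this)
      rw [indicator_of_notMem hp]
      have := (tendsto_pow_atTop_nhds_zero_of_lt_one (r := 1 - g p) (by linarith [hg01 p])
        (by linarith)).const_mul (χ p)
      rwa [mul_zero] at this

section

variable {T H ν : ℝ}

lemma tendsto_integral_tensor (hH : H ∈ Ioo (1 / 2) 1) (hν : ν ∈ Ioo 0 1) {ι : Type*}
    {l : Filter ι} [l.IsCountablyGenerated] {F : ι → ℝ × ℝ → ℝ} {G : ℝ × ℝ → ℝ}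
    (hF : ∀ i, Measurable (F i)) {K : Set (ℝ × ℝ)} (hK : IsCompact K) {C : ℝ}
    (hFC : ∀ i p, |F i p| ≤ C) (hFK : ∀ i, ∀ p ∉ K, F i p = 0)
    (hlim : ∀ p, Tendsto (fun i => F i p) l (𝓝 (G p))) :
    Tendsto (fun i => ∫ z, tensor (F i) (F i) z ∂(noiseMeasure T H ν)) l
      (𝓝 (∫ z, tensor G G z ∂(noiseMeasure T H ν))) :=
  tendsto_integral_filter_of_dominated_convergence _
    (Eventually.of_forall fun i => (measurable_tensor (hF i) (hF i)).aestronglyMeasurable)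
    (Eventually.of_forall fun i => Eventually.of_forall
      (abs_tensor_le (hFC i) (hFC i) (hFK i) (hFK i)))
    (integrable_indicator_pairsOf hH hν hK (C * C))
    (Eventually.of_forall fun _ => (hlim _).mul (hlim _))

variable {Ω : Type*} [MeasurableSpace Ω] {P : Measure Ω} {X : PlaneTest → Ω → ℝ}

lemma IsFractionalNoise.eLpNorm_sub (hH : H ∈ Ioo (1 / 2) 1) (hν : ν ∈ Ioo 0 1)
    (hX : IsFractionalNoise P T H ν X) (φ ψ : PlaneTest) :
    eLpNorm (fun ω => X φ ω - X ψ ω) 2 P = ENNReal.ofReal (√(H * (2 * H - 1) *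
      ∫ z, tensor (fun p => φ p - ψ p) (fun p => φ p - ψ p) z ∂(noiseMeasure T H ν))) := by
  rw [eLpNorm_two_eq (V := fun ω => X φ ω - X ψ ω) ((hX.memLp φ).sub (hX.memLp ψ))]
  have := hX.integral_comb_sq hH hν ![1, -1] ![φ, ψ]
  simp only [Fin.sum_univ_two, Matrix.cons_val_zero, Matrix.cons_val_one, one_mul, neg_one_mul,
    ← sub_eq_add_neg] at this
  rw [← this]

/-- Sequences of test functions with the same limit give the same noise. -/
lemma IsFractionalNoise.tendsto_eLpNorm_sub (hH : H ∈ Ioo (1 / 2) 1) (hν : ν ∈ Ioo 0 1)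
    (hX : IsFractionalNoise P T H ν X) {ι : Type*} {l : Filter ι} [l.IsCountablyGenerated]
    {φ ψ : ι → PlaneTest} {K K' : Set (ℝ × ℝ)} (hK : IsCompact K) (hK' : IsCompact K')
    (hφK : ∀ i, tsupport (φ i) ⊆ K) (hψK : ∀ i, tsupport (ψ i) ⊆ K') {C C' : ℝ}
    (hφC : ∀ i p, |φ i p| ≤ C) (hψC : ∀ i p, |ψ i p| ≤ C') {f : ℝ × ℝ → ℝ}
    (hφ : ∀ p, Tendsto (fun i => φ i p) l (𝓝 (f p)))
    (hψ : ∀ p, Tendsto (fun i => ψ i p) l (𝓝 (f p))) :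
    Tendsto (fun i => eLpNorm (fun ω => X (φ i) ω - X (ψ i) ω) 2 P) l (𝓝 0) := by
  simp only [hX.eLpNorm_sub hH hν]
  have h := tendsto_integral_tensor (T := T) hH hν (l := l) (F := fun i p => φ i p - ψ i p)
    (G := fun _ => 0) (fun i => (φ i).continuous.measurable.sub (ψ i).continuous.measurable)
    (hK.union hK') (C := C + C')
    (fun i p => (abs_sub _ _).trans (add_le_add (hφC i p) (hψC i p)))
    (fun i p hp => by
      rw [image_eq_zero_of_notMem_tsupport fun h => hp (Or.inl (hφK i h)),
        image_eq_zero_of_notMem_tsupport fun h => hp (Or.inr (hψK i h)), sub_zero])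
    (fun p => by simpa using (hφ p).sub (hψ p))
  have h0 : ∫ z, tensor (fun _ => 0) (fun _ => 0) z ∂(noiseMeasure T H ν) = 0 := by
    simp [tensor]
  rw [h0] at h
  have := ENNReal.tendsto_ofReal ((h.const_mul (H * (2 * H - 1))).sqrt)
  simpa using this

/-- The L² distance of two noises is the covariance form of the difference of the test functions,
which tends to 0 by dominated convergence. Along pairs of indices of one approximating sequence this
is the Cauchy property; between two sequences it shows that the limit is the same. -/
theorem IsFractionalNoise.exists_isNoiseOfSet (hH : H ∈ Ioo (1 / 2) 1) (hν : ν ∈ Ioo 0 1)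
    (hX : IsFractionalNoise P T H ν X) {A : Set (ℝ × ℝ)} (hA : IsCompact A) :
    ∃ Z, IsNoiseOfSet P X A Z := by
  obtain ⟨φ, ⟨K, hK, hφK⟩, hφ1, hφ⟩ := exists_approx hA
  have : Fact ((1 : ENNReal) ≤ 2) := ⟨by norm_num⟩
  set f : ℕ → Lp ℝ 2 P := fun n => (hX.memLp (φ n)).toLp (X (φ n)) with hf
  have hfX : ∀ n, f n =ᵐ[P] X (φ n) := fun n => (hX.memLp (φ n)).coeFn_toLp
  have hc : CauchySeq f := by
    rw [Lp.cauchySeq_Lp_iff_cauchySeq_eLpNorm]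
    have hfst : Tendsto (Prod.fst : ℕ × ℕ → ℕ) atTop atTop := by
      rw [← prod_atTop_atTop_eq]; exact tendsto_fst
    have hsnd : Tendsto (Prod.snd : ℕ × ℕ → ℕ) atTop atTop := by
      rw [← prod_atTop_atTop_eq]; exact tendsto_snd
    have h := hX.tendsto_eLpNorm_sub hH hν (l := atTop) (φ := fun q : ℕ × ℕ => φ q.1)
      (ψ := fun q : ℕ × ℕ => φ q.2) hK hK (fun q => hφK _) (fun q => hφK _) (fun q => hφ1 _)
      (fun q => hφ1 _) (fun p => (hφ p).comp hfst)
      (fun p => (hφ p).comp hsnd)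
    refine h.congr fun q => eLpNorm_congr_ae ?_
    filter_upwards [hfX q.1, hfX q.2] with ω h1 h2
    simp [h1, h2]
  obtain ⟨g, hg⟩ := cauchySeq_tendsto_of_complete hc
  rw [Lp.tendsto_Lp_iff_tendsto_eLpNorm'] at hg
  refine ⟨g, Lp.memLp g, fun ψ ⟨K', hK', hψK⟩ ⟨C, hψC⟩ hψ => ?_⟩
  have h := hX.tendsto_eLpNorm_sub hH hν hK' hK hψK hφK hψC hφ1 hψ hφ
  have h2 := h.add hg
  rw [add_zero] at h2
  refine tendsto_of_tendsto_of_tendsto_of_le_of_le tendsto_const_nhds h2 (fun _ => zero_le)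
    fun n => ?_
  refine le_trans (le_of_eq (eLpNorm_congr_ae ?_)) (eLpNorm_add_le
    (((hX.memLp (ψ n)).sub (hX.memLp (φ n))).aestronglyMeasurable)
    ((Lp.memLp (f n)).sub (Lp.memLp g)).aestronglyMeasurable (by norm_num))
  filter_upwards [hfX n] with ω h1
  simp [h1]

/-- Uniqueness of the noise of a compact set. -/
lemma IsNoiseOfSet.ae_eq (hX : IsFractionalNoise P T H ν X) {A : Set (ℝ × ℝ)} (hA : IsCompact A)
    {Z Z' : Ω → ℝ} (hZ : IsNoiseOfSet P X A Z) (hZ' : IsNoiseOfSet P X A Z') : Z =ᵐ[P] Z' := by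
  obtain ⟨φ, hK, hφ1, hφ⟩ := exists_approx hA
  have m : ∀ {Z}, IsNoiseOfSet P X A Z → TendstoInMeasure P (fun n => X (φ n)) atTop Z := fun hZ =>
    tendstoInMeasure_of_tendsto_eLpNorm two_ne_zero
      (fun n => (hX.memLp (φ n)).aestronglyMeasurable) hZ.1.aestronglyMeasurable
      (hZ.2 φ hK ⟨1, hφ1⟩ hφ)
  exact tendstoInMeasure_ae_unique (m hZ) (m hZ')

lemma eLpNorm_gaussianReal_ne_top (p : ℕ) : eLpNorm id p (gaussianReal 0 1) ≠ ⊤ :=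
  (memLp_id_gaussianReal (μ := 0) (v := 1) (p : NNReal)).2.ne

/-- Moments of finite combinations of the noise of sets. -/
theorem IsFractionalNoise.eLpNorm_comb_le [IsProbabilityMeasure P] (hH : H ∈ Ioo (1 / 2) 1)
    (hν : ν ∈ Ioo 0 1) (hX : IsFractionalNoise P T H ν X) {ι : Type*} [Fintype ι]
    {A : ι → Set (ℝ × ℝ)} {Z : ι → Ω → ℝ} (hA : ∀ i, IsCompact (A i))
    (hZ : ∀ i, IsNoiseOfSet P X (A i) (Z i)) (c : ι → ℝ) (p : ℕ) :
    eLpNorm (fun ω => ∑ i, c i * Z i ω) p P ≤ ENNReal.ofReal (√(H * (2 * H - 1) *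
      ∫ z, tensor (fun q => ∑ i, c i * (A i).indicator (fun _ => 1) q)
        (fun q => ∑ i, c i * (A i).indicator (fun _ => 1) q) z ∂(noiseMeasure T H ν))) *
      eLpNorm id p (gaussianReal 0 1) := by
  choose φ hK hφ1 hφ using fun i => exists_approx (hA i)
  choose K hKc hφK using hK
  set V : ℕ → Ω → ℝ := fun n ω => ∑ i, c i * X (φ i n) ω with hV
  have hVm : ∀ n, AEStronglyMeasurable (V n) P := fun n =>
    (hX.hasGaussianLaw_comb c fun i => φ i n).aemeasurable.aestronglyMeasurable
  have hZm : AEStronglyMeasurable (fun ω => ∑ i, c i * Z i ω) P :=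
    Finset.aestronglyMeasurable_fun_sum _ fun i _ => (hZ i).1.aestronglyMeasurable.const_mul _
  have hL2 : Tendsto (fun n => eLpNorm (V n - fun ω => ∑ i, c i * Z i ω) 2 P) atTop (𝓝 0) := by
    have h1 : Tendsto (fun n => ∑ i, ‖c i‖ₑ * eLpNorm (fun ω => X (φ i n) ω - Z i ω) 2 P) atTop
        (𝓝 (∑ i : ι, ‖c i‖ₑ * 0)) :=
      tendsto_finsetSum _ fun i _ => ENNReal.Tendsto.const_mul
        ((hZ i).2 (φ i) ⟨K i, hKc i, hφK i⟩ ⟨1, hφ1 i⟩ (hφ i)) (Or.inr enorm_ne_top)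
    simp only [mul_zero, Finset.sum_const_zero] at h1
    refine tendsto_of_tendsto_of_tendsto_of_le_of_le tendsto_const_nhds h1 (fun _ => zero_le)
      fun n => ?_
    have e : (V n - fun ω => ∑ i, c i * Z i ω) =
        ∑ i, c i • fun ω => X (φ i n) ω - Z i ω := by
      ext ω
      simp only [hV, Pi.sub_apply, Finset.sum_apply, Pi.smul_apply, smul_eq_mul,
        ← Finset.sum_sub_distrib, mul_sub]
    rw [e]
    refine (eLpNorm_sum_le (fun i _ => (((hX.memLp (φ i n)).sub
      (hZ i).1).aestronglyMeasurable).const_smul (c i)) (by norm_num)).trans (le_of_eq ?_)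
    exact Finset.sum_congr rfl fun i _ => eLpNorm_const_smul _ _ _ _
  -- Fatou along an almost surely convergent subsequence: the norms of the approximations are
  -- explicit Gaussian moments and converge. Gaussianity of the limit itself is not needed.
  obtain ⟨ns, hns, hae⟩ := (tendstoInMeasure_of_tendsto_eLpNorm two_ne_zero hVm hZm
    hL2).exists_seq_tendsto_ae
  refine (Lp.eLpNorm_lim_le_liminf_eLpNorm (p := p) (fun k => hVm (ns k)) _ hae).trans
    (le_of_eq (Tendsto.liminf_eq ?_))
  have e : ∀ n, eLpNorm (V n) p P = ENNReal.ofReal (√(H * (2 * H - 1) *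
      ∫ z, tensor (fun q => ∑ i, c i * φ i n q) (fun q => ∑ i, c i * φ i n q) z
        ∂(noiseMeasure T H ν))) * eLpNorm id p (gaussianReal 0 1) := fun n => by
    rw [eLpNorm_gaussian (hX.hasGaussianLaw_comb c fun i => φ i n) (hX.integral_comb c _),
      hX.integral_comb_sq hH hν c fun i => φ i n]
  simp only [e]
  refine ENNReal.Tendsto.mul_const ?_ (Or.inr (eLpNorm_gaussianReal_ne_top p))
  have h := tendsto_integral_tensor (T := T) hH hν (l := atTop)
    (F := fun n q => ∑ i, c i * φ i n q)
    (G := fun q => ∑ i, c i * (A i).indicator (fun _ => 1) q)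
    (fun n => Finset.measurable_fun_sum _ fun i _ => (φ i n).continuous.measurable.const_mul _)
    (K := ⋃ i, K i) (isCompact_iUnion hKc) (C := ∑ i, |c i|)
    (fun n q => (Finset.abs_sum_le_sum_abs _ _).trans (Finset.sum_le_sum fun i _ => by
      rw [abs_mul]; exact mul_le_of_le_one_right (abs_nonneg _) (hφ1 i n q)))
    (fun n q hq => Finset.sum_eq_zero fun i _ => by
      rw [image_eq_zero_of_notMem_tsupport fun h => hq (mem_iUnion.2 ⟨i, hφK i n h⟩), mul_zero])
    (fun q => tendsto_finsetSum _ fun i _ => (hφ i q).const_mul (c i))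
  exact (ENNReal.tendsto_ofReal ((h.const_mul (H * (2 * H - 1))).sqrt)).comp hns.tendsto_atTop

end

end FracWave

end

noncomputable section

namespace FracWave

/-! ### The rotated noise -/

lemma isCompact_anchoredRect (T s t : ℝ) : IsCompact (anchoredRect T s t) := by
  have hc : IsCompact ((fun p : ℝ × ℝ => ((p.2 + p.1) / √2, (p.2 - p.1) / √2)) ''
      (uIcc 0 s ×ˢ uIcc 0 t)) :=
    (isCompact_uIcc.prod isCompact_uIcc).image (by fun_prop)
  refine hc.of_isClosed_subset ?_ ?_
  · have h1 : IsClosed {p : ℝ × ℝ | p.1 ∈ Icc 0 T} := isClosed_Icc.preimage continuous_fst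
    have h2 : IsClosed {p : ℝ × ℝ | (p.1 - p.2) / √2 ∈ uIcc 0 s} :=
      isClosed_Icc.preimage (by fun_prop)
    have h3 : IsClosed {p : ℝ × ℝ | (p.1 + p.2) / √2 ∈ uIcc 0 t} :=
      isClosed_Icc.preimage (by fun_prop)
    exact h1.inter (h2.inter h3)
  · rintro p ⟨-, h2, h3⟩
    refine ⟨((p.1 - p.2) / √2, (p.1 + p.2) / √2), ⟨h2, h3⟩, ?_⟩
    have h := sqrt_two_mul_self
    have h0 : √2 ≠ (0 : ℝ) := by positivity
    ext
    · simp only; field_simp; linear_combination (-p.1) * h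
    · simp only; field_simp; linear_combination (-p.2) * h

/-- The indicator function of the oriented interval from `0` to `s`. -/
def orientedInd (s r : ℝ) : ℝ := Real.sign s * (uIcc 0 s).indicator (fun _ => 1) r

/-- Outside `[s₁, s₂]` the two oriented indicators agree, and inside each is at most 1 in absolute
value. The value 2 does occur, at r = 0 when s₁ < 0 < s₂, because both closed intervals contain 0.
-/
lemma abs_orientedInd_sub_le {s₁ s₂ : ℝ} (h : s₁ ≤ s₂) (r : ℝ) :
    |orientedInd s₂ r - orientedInd s₁ r| ≤ (Icc s₁ s₂).indicator (fun _ => 2) r := by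
  have hval : ∀ s, orientedInd s r = if 0 < s ∧ 0 ≤ r ∧ r ≤ s then 1 else
      if s < 0 ∧ s ≤ r ∧ r ≤ 0 then -1 else 0 := by
    intro s
    rcases lt_trichotomy s 0 with hs | hs | hs
    · rw [orientedInd, Real.sign_of_neg hs, uIcc_of_ge hs.le]
      by_cases hr : r ∈ Icc s 0
      · rw [indicator_of_mem hr, if_neg (by intro h; linarith [h.1]), if_pos ⟨hs, hr⟩, mul_one]
      · rw [indicator_of_notMem hr, if_neg (by intro h; linarith [h.1]),
          if_neg (fun h => hr h.2), mul_zero]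
    · rw [orientedInd, hs, Real.sign_zero, zero_mul, if_neg (by simp), if_neg (by simp)]
    · rw [orientedInd, Real.sign_of_pos hs, uIcc_of_le hs.le]
      by_cases hr : r ∈ Icc 0 s
      · rw [indicator_of_mem hr, if_pos ⟨hs, hr⟩, mul_one]
      · rw [indicator_of_notMem hr, if_neg (fun h => hr h.2),
          if_neg (by intro h; linarith [h.1]), mul_zero]
  have hle : ∀ s, |orientedInd s r| ≤ 1 := fun s => by
    rw [hval]; split_ifs <;> simp
  by_cases hr : r ∈ Icc s₁ s₂
  · rw [indicator_of_mem hr]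
    have := abs_sub (orientedInd s₂ r) (orientedInd s₁ r)
    linarith [hle s₁, hle s₂]
  · rw [indicator_of_notMem hr]
    have : orientedInd s₂ r = orientedInd s₁ r := by
      rw [mem_Icc, not_and_or, not_le, not_le] at hr
      rw [hval, hval]
      rcases hr with hr | hr
      · split_ifs <;> first | rfl | (exfalso; grind)
      · split_ifs <;> first | rfl | (exfalso; grind)
    rw [this, sub_self, abs_zero]

/-- The factorisation makes the rectangular increment of the signed indicators a product of
increments in one variable. -/
lemma sign_mul_indicator_anchoredRect (T s t : ℝ) (q : ℝ × ℝ) :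
    Real.sign s * Real.sign t * (anchoredRect T s t).indicator (fun _ => 1) q =
      (Icc 0 T).indicator (fun _ => 1) q.1 *
        (orientedInd s (toRot q).1 * orientedInd t (toRot q).2) := by
  have e : (anchoredRect T s t).indicator (fun _ => (1 : ℝ)) q =
      (Icc 0 T).indicator (fun _ => 1) q.1 * ((uIcc 0 s).indicator (fun _ => 1) (toRot q).1 *
        (uIcc 0 t).indicator (fun _ => 1) (toRot q).2) := by
    by_cases k1 : q.1 ∈ Icc 0 T
    · by_cases k2 : (toRot q).1 ∈ uIcc 0 s
      · by_cases k3 : (toRot q).2 ∈ uIcc 0 t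
        · rw [indicator_of_mem k1, indicator_of_mem k2, indicator_of_mem k3,
            indicator_of_mem (show q ∈ anchoredRect T s t from ⟨k1, k2, k3⟩), mul_one, mul_one]
        · rw [indicator_of_notMem k3,
            indicator_of_notMem (show q ∉ anchoredRect T s t from fun h => k3 h.2.2),
            mul_zero, mul_zero]
      · rw [indicator_of_notMem k2,
          indicator_of_notMem (show q ∉ anchoredRect T s t from fun h => k2 h.2.1), zero_mul, mul_zero]
    · rw [indicator_of_notMem k1,
        indicator_of_notMem (show q ∉ anchoredRect T s t from fun h => k1 h.1), zero_mul]
  rw [e, orientedInd, orientedInd]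
  ring

section

variable {T H ν : ℝ} {Ω : Type*} [MeasurableSpace Ω] {P : Measure Ω} {X : PlaneTest → Ω → ℝ}

/-- The field obtained from the noise of the anchored rectangles. -/
def rotField (Z : ℝ → ℝ → Ω → ℝ) (ω : Ω) (s t : ℝ) : ℝ := Real.sign s * Real.sign t * Z s t ω

/-- A rectangular increment of the field is a combination of four noises of sets. The same
combination of indicators is bounded by 4 and vanishes off the rectangle, so the variance is at most
16 times the noise measure of its pairs; the square root halves the exponents 2η and 2η'. -/
theorem momentBound_rotField [IsProbabilityMeasure P] (hH : H ∈ Ioo (1 / 2) 1) (hν : ν ∈ Ioo 0 1)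
    (hX : IsFractionalNoise P T H ν X) {Z : ℝ → ℝ → Ω → ℝ}
    (hZ : ∀ s t, IsNoiseOfSet P X (anchoredRect T s t) (Z s t)) {η η' : ℝ}
    (hη : η ∈ Ioo (1 / 2) 1) (hη' : η' ∈ Ioo (1 / 2) 1) (h : η + η' < 1 + H - ν / 2) :
    MomentBound P η η' (rotField Z) := by
  intro N p
  obtain ⟨C, hC, hb⟩ := exists_noiseMeasure_le (T := T) hH hν hη hη' h N
  have hcH := noiseConst_nonneg hH
  set m := eLpNorm id p (gaussianReal 0 1) with hm
  refine ⟨√(H * (2 * H - 1) * (16 * C)) * m.toReal, by positivity, ?_⟩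
  intro s₁ s₂ t₁ t₂ h1 h2 h3 h4 h5 h6
  set c : Fin 4 → ℝ := ![Real.sign s₁ * Real.sign t₁, -(Real.sign s₁ * Real.sign t₂),
    -(Real.sign s₂ * Real.sign t₁), Real.sign s₂ * Real.sign t₂] with hc
  set A : Fin 4 → Set (ℝ × ℝ) := ![anchoredRect T s₁ t₁, anchoredRect T s₁ t₂,
    anchoredRect T s₂ t₁, anchoredRect T s₂ t₂] with hA
  set Y : Fin 4 → Ω → ℝ := ![Z s₁ t₁, Z s₁ t₂, Z s₂ t₁, Z s₂ t₂] with hY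
  have hAc : ∀ i, IsCompact (A i) := by
    intro i; fin_cases i <;> exact isCompact_anchoredRect _ _ _
  have hYA : ∀ i, IsNoiseOfSet P X (A i) (Y i) := by
    intro i; fin_cases i <;> exact hZ _ _
  have hle := hX.eLpNorm_comb_le hH hν hAc hYA c p
  have e1 : (fun ω => rectIncr (rotField Z ω) s₁ s₂ t₁ t₂) = fun ω => ∑ i, c i * Y i ω := by
    ext ω
    simp only [rectIncr, rotField, Fin.sum_univ_four, hc, hY, Matrix.cons_val]
    ring
  rw [e1]
  refine hle.trans ?_
  set F : ℝ × ℝ → ℝ := fun q => ∑ i, c i * (A i).indicator (fun _ => 1) q with hF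
  have hFle : ∀ q, |F q| ≤ (Icc s₁ s₂ ×ˢ Icc t₁ t₂).indicator (fun _ => 4) (toRot q) := by
    intro q
    have e : F q = (Icc 0 T).indicator (fun _ => 1) q.1 *
        ((orientedInd s₂ (toRot q).1 - orientedInd s₁ (toRot q).1) *
          (orientedInd t₂ (toRot q).2 - orientedInd t₁ (toRot q).2)) := by
      have i1 := sign_mul_indicator_anchoredRect T s₁ t₁ q
      have i2 := sign_mul_indicator_anchoredRect T s₁ t₂ q
      have i3 := sign_mul_indicator_anchoredRect T s₂ t₁ q
      have i4 := sign_mul_indicator_anchoredRect T s₂ t₂ q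
      simp only [hF, Fin.sum_univ_four, hc, hA, Matrix.cons_val]
      linear_combination i1 - i2 - i3 + i4
    have j1 := abs_orientedInd_sub_le h2 (toRot q).1
    have j2 := abs_orientedInd_sub_le h5 (toRot q).2
    have j3 : |(Icc 0 T).indicator (fun _ => (1 : ℝ)) q.1| ≤ 1 := by
      by_cases k : q.1 ∈ Icc 0 T
      · rw [indicator_of_mem k, abs_one]
      · rw [indicator_of_notMem k, abs_zero]; exact zero_le_one
    rw [e, abs_mul, abs_mul]
    refine (mul_le_of_le_one_left (by positivity) j3).trans
      ((mul_le_mul j1 j2 (abs_nonneg _) ((abs_nonneg _).trans j1)).trans (le_of_eq ?_))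
    by_cases k1 : (toRot q).1 ∈ Icc s₁ s₂
    · by_cases k2 : (toRot q).2 ∈ Icc t₁ t₂
      · rw [indicator_of_mem k1, indicator_of_mem k2,
          indicator_of_mem (show toRot q ∈ Icc s₁ s₂ ×ˢ Icc t₁ t₂ from ⟨k1, k2⟩)]
        norm_num
      · rw [indicator_of_notMem k2,
          indicator_of_notMem (show toRot q ∉ Icc s₁ s₂ ×ˢ Icc t₁ t₂ from fun h => k2 h.2), mul_zero]
    · rw [indicator_of_notMem k1,
        indicator_of_notMem (show toRot q ∉ Icc s₁ s₂ ×ˢ Icc t₁ t₂ from fun h => k1 h.1), zero_mul]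
  have hcp := hb s₁ s₂ t₁ t₂ h1 h2 h3 h4 h5 h6
  have hcpm := (isClosed_charPairs s₁ s₂ t₁ t₂).measurableSet
  have hr1 : 0 ≤ (s₂ - s₁) ^ (2 * η) := Real.rpow_nonneg (sub_nonneg.2 h2) _
  have hr2 : 0 ≤ (t₂ - t₁) ^ (2 * η') := Real.rpow_nonneg (sub_nonneg.2 h5) _
  have hint : ∫ z, tensor F F z ∂(noiseMeasure T H ν) ≤
      16 * C * ((s₂ - s₁) ^ (2 * η) * (t₂ - t₁) ^ (2 * η')) := by
    have b1 : ∀ z, ‖tensor F F z‖ ≤ (charPairs s₁ s₂ t₁ t₂).indicator (fun _ => 16) z := by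
      intro z
      rw [tensor, norm_mul]
      refine (mul_le_mul (hFle _) (hFle _) (abs_nonneg _)
        ((abs_nonneg _).trans (hFle _))).trans (le_of_eq ?_)
      by_cases k1 : toRot (z.1.1, z.2.1) ∈ Icc s₁ s₂ ×ˢ Icc t₁ t₂
      · by_cases k2 : toRot (z.1.2, z.2.2) ∈ Icc s₁ s₂ ×ˢ Icc t₁ t₂
        · rw [indicator_of_mem k1, indicator_of_mem k2,
            indicator_of_mem (show z ∈ charPairs s₁ s₂ t₁ t₂ from ⟨k1, k2⟩)]
          norm_num
        · rw [indicator_of_notMem k2,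
            indicator_of_notMem (show z ∉ charPairs s₁ s₂ t₁ t₂ from fun h => k2 h.2), mul_zero]
      · rw [indicator_of_notMem k1,
          indicator_of_notMem (show z ∉ charPairs s₁ s₂ t₁ t₂ from fun h => k1 h.1), zero_mul]
    have b2 : Integrable ((charPairs s₁ s₂ t₁ t₂).indicator fun _ => (16 : ℝ))
        (noiseMeasure T H ν) := (integrable_indicator_iff hcpm).2
      (integrableOn_const (hcp.trans_lt ENNReal.ofReal_lt_top).ne)
    have b3 := (le_abs_self _).trans (norm_integral_le_of_norm_le b2 (Eventually.of_forall b1))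
    refine b3.trans ?_
    rw [integral_indicator_const _ hcpm, smul_eq_mul, mul_comm, mul_assoc]
    refine mul_le_mul_of_nonneg_left ?_ (by norm_num)
    exact ENNReal.toReal_le_of_le_ofReal (by positivity) hcp
  have hsq : √(H * (2 * H - 1) * ∫ z, tensor F F z ∂(noiseMeasure T H ν)) ≤
      √(H * (2 * H - 1) * (16 * C)) * ((s₂ - s₁) ^ η * (t₂ - t₁) ^ η') := by
    refine (Real.sqrt_le_sqrt (mul_le_mul_of_nonneg_left hint hcH)).trans (le_of_eq ?_)
    have e2 : ∀ {a κ : ℝ}, 0 ≤ a → a ^ (2 * κ) = (a ^ κ) ^ 2 := fun {a κ} ha => by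
      rw [mul_comm, Real.rpow_mul ha]; norm_cast
    rw [← mul_assoc, Real.sqrt_mul (by positivity), e2 (sub_nonneg.2 h2), e2 (sub_nonneg.2 h5),
      ← mul_pow, Real.sqrt_sq (mul_nonneg (Real.rpow_nonneg (sub_nonneg.2 h2) _)
        (Real.rpow_nonneg (sub_nonneg.2 h5) _))]
  calc _ ≤ ENNReal.ofReal (√(H * (2 * H - 1) * (16 * C)) *
        ((s₂ - s₁) ^ η * (t₂ - t₁) ^ η')) * m := by gcongr
    _ = ENNReal.ofReal (√(H * (2 * H - 1) * (16 * C)) * ((s₂ - s₁) ^ η * (t₂ - t₁) ^ η')) *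
        ENNReal.ofReal m.toReal := by rw [ENNReal.ofReal_toReal (eLpNorm_gaussianReal_ne_top p)]
    _ = _ := by
        rw [← ENNReal.ofReal_mul' ENNReal.toReal_nonneg]; congr 1; ring

lemma rpow_le_mul_rpow {a L κ η : ℝ} (ha : 0 ≤ a) (haL : a ≤ L) (hκ : 0 < κ) (h : κ ≤ η) :
    a ^ η ≤ L ^ (η - κ) * a ^ κ := by
  rcases ha.eq_or_lt with rfl | ha
  · rw [Real.zero_rpow hκ.ne', Real.zero_rpow (hκ.trans_le h).ne', mul_zero]
  · calc a ^ η = a ^ (η - κ) * a ^ κ := by rw [← Real.rpow_add ha, sub_add_cancel]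
      _ ≤ L ^ (η - κ) * a ^ κ := mul_le_mul_of_nonneg_right
          (Real.rpow_le_rpow ha.le haL (sub_nonneg.2 h)) (Real.rpow_nonneg ha.le _)

lemma RectBound.exponent_mono {q q' η η' K : ℝ} {N : ℕ} {x : ℝ → ℝ → ℝ} (hK : 0 ≤ K)
    (hη : 0 < η) (hη' : 0 < η') (hq : η ≤ q) (hq' : η' ≤ q')
    (h : RectBound q q' K (-N) N (-N) N x) :
    RectBound η η' (K * ((2 * N : ℝ) ^ (q - η) * (2 * N : ℝ) ^ (q' - η'))) (-N) N (-N) N x := by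
  intro s₁ s₂ t₁ t₂ h1 h2 h3 h4 h5 h6
  refine (h s₁ s₂ t₁ t₂ h1 h2 h3 h4 h5 h6).trans ?_
  rw [mul_assoc]
  refine mul_le_mul_of_nonneg_left ?_ hK
  refine (mul_le_mul (rpow_le_mul_rpow (L := 2 * N) (sub_nonneg.2 h2) (by linarith) hη hq)
    (rpow_le_mul_rpow (L := 2 * N) (sub_nonneg.2 h5) (by linarith) hη' hq') (Real.rpow_nonneg (sub_nonneg.2 h5) _)
    (by have := Real.rpow_nonneg (sub_nonneg.2 h2) η; positivity)).trans (le_of_eq (by ring))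

lemma IsDriver.exponent_mono {q q' η η' : ℝ} {x : ℝ → ℝ → ℝ} (hη : 0 < η) (hη' : 0 < η')
    (hq : η ≤ q) (hq' : η' ≤ q') (h : IsDriver q q' x) : IsDriver η η' x :=
  ⟨h.continuous, fun N => by
    obtain ⟨K, hK, hb⟩ := h.bound N
    exact ⟨_, by positivity, hb.exponent_mono hK hη hη' hq hq'⟩⟩

/-- A larger admissible pair of exponents. -/
lemma exists_larger {H ν η η' : ℝ} (hη : η < 1) (hη' : η' < 1) (h : η + η' < 1 + H - ν / 2) :
    ∃ q q' : ℚ, η < q ∧ (q : ℝ) < 1 ∧ η' < q' ∧ (q' : ℝ) < 1 ∧ (q : ℝ) + q' < 1 + H - ν / 2 := by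
  set ε := (1 + H - ν / 2 - η - η') / 2 with hε
  have hε0 : 0 < ε := by rw [hε]; linarith
  obtain ⟨q, h1, h2⟩ := exists_rat_btwn (show η < min 1 (η + ε) from lt_min hη (by linarith))
  obtain ⟨q', h3, h4⟩ := exists_rat_btwn (show η' < min 1 (η' + ε) from lt_min hη' (by linarith))
  exact ⟨q, q', h1, h2.trans_le (min_le_left _ _), h3, h4.trans_le (min_le_left _ _), by
    linarith [h2.trans_le (min_le_right _ _), h4.trans_le (min_le_right _ _)]⟩

/-- A version of the rotated noise with regular paths. -/
theorem IsFractionalNoise.exists_regular_version [IsProbabilityMeasure P]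
    (hH : H ∈ Ioo (1 / 2) 1) (hν : ν ∈ Ioo 0 1) (hX : IsFractionalNoise P T H ν X) :
    ∃ (x : Ω → ℝ → ℝ → ℝ) (Z : ℝ → ℝ → Ω → ℝ),
      (∀ s t, IsNoiseOfSet P X (anchoredRect T s t) (Z s t)) ∧
      (∀ s t, ∀ᵐ ω ∂P, x ω s t = Real.sign s * Real.sign t * Z s t ω) ∧
      ∀ᵐ ω ∂P, ∀ η η' : ℝ, η ∈ Ioo (1 / 2) 1 → η' ∈ Ioo (1 / 2) 1 → η + η' < 1 + H - ν / 2 →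
        IsDriver η η' (x ω) := by
  choose Z hZ using fun s t => hX.exists_isNoiseOfSet hH hν (isCompact_anchoredRect T s t)
  have hm : ∀ s t, AEStronglyMeasurable (fun ω => rotField Z ω s t) P := fun s t =>
    (hZ s t).1.aestronglyMeasurable.const_mul _
  have h0 : ∀ ω s, rotField Z ω s 0 = 0 := fun ω s => by simp [rotField]
  have h0' : ∀ ω t, rotField Z ω 0 t = 0 := fun ω t => by simp [rotField]
  refine ⟨fun ω => dyadicExt (rotField Z ω), Z, hZ, fun s t => ?_, ?_⟩
  · obtain ⟨γ, hγ, hγγ⟩ := exists_admissible hH hν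
    exact ae_eq_dyadicExt hm (momentBound_rotField hH hν hX hZ hγ hγ hγγ) (by linarith [hγ.1])
      (by linarith [hγ.1]) h0 h0' s t
  -- Countably many rational pairs give a single null set; a real admissible pair is then dominated
  -- by a rational one.
  · have key : ∀ q : ℚ × ℚ, ∀ᵐ ω ∂P, (q.1 : ℝ) ∈ Ioo (1 / 2 : ℝ) 1 → (q.2 : ℝ) ∈ Ioo (1 / 2 : ℝ) 1 →
        (q.1 : ℝ) + q.2 < 1 + H - ν / 2 → IsDriver q.1 q.2 (dyadicExt (rotField Z ω)) := by
      intro q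
      by_cases hq : (q.1 : ℝ) ∈ Ioo (1 / 2 : ℝ) 1 ∧ (q.2 : ℝ) ∈ Ioo (1 / 2 : ℝ) 1 ∧
        (q.1 : ℝ) + q.2 < 1 + H - ν / 2
      swap
      · exact Eventually.of_forall fun ω a b c => absurd ⟨a, b, c⟩ hq
      obtain ⟨hq1, hq2, hq3⟩ := hq
      -- The Kolmogorov criterion loses a little regularity, so the moments are estimated with
      -- slightly larger exponents.
      obtain ⟨r, r', a1, a2, a3, a4, a5⟩ := exists_larger hq1.2 hq2.2 hq3
      have hmb := momentBound_rotField hH hν hX hZ (η := r) (η' := r')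
        ⟨hq1.1.trans a1, a2⟩ ⟨hq2.1.trans a3, a4⟩ a5
      have hd : ∀ᵐ ω ∂P, ∀ N : ℕ, ∃ K, 0 ≤ K ∧ DyadicBound q.1 q.2 K N (rotField Z ω) :=
        ae_all_iff.2 fun N => ae_dyadicBound hm hmb a1 a3 N
      filter_upwards [hd] with ω hω _ _ _
      exact isDriver_dyadicExt (by linarith [hq1.1]) (by linarith [hq2.1]) hω (h0 ω) (h0' ω)
    filter_upwards [ae_all_iff.2 key] with ω hω η η' hη hη' hηη
    obtain ⟨q, q', a1, a2, a3, a4, a5⟩ := exists_larger hη.2 hη'.2 hηη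
    exact (hω (q, q') ⟨hη.1.trans a1, a2⟩ ⟨hη'.1.trans a3, a4⟩ a5).exponent_mono
      (by linarith [hη.1]) (by linarith [hη'.1]) a1.le a3.le

end

end FracWave

end

/-! ### Transfer of regularity between triangles and boxes in the strip -/

noncomputable section
namespace FracWave

lemma HolderTri.exponent_mono {κ κ' η η' M S₀ T₀ : ℝ} {f : ℝ → ℝ → ℝ} (hκ : 0 < κ) (hκ' : 0 < κ')
    (h : κ ≤ η) (h' : κ' ≤ η') (hf : HolderTri η η' M S₀ T₀ f) :
    ∃ M', HolderTri κ κ' M' S₀ T₀ f := by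
  set L := max 1 (S₀ + T₀) with hL
  have hL1 : 1 ≤ L := le_max_left _ _
  have hLS : S₀ + T₀ ≤ L := le_max_right _ _
  have l1 : 1 ≤ L ^ (η - κ) := Real.one_le_rpow hL1 (sub_nonneg.2 h)
  have l2 : 1 ≤ L ^ (η' - κ') := Real.one_le_rpow hL1 (sub_nonneg.2 h')
  have m0 : M ≤ |M| := le_abs_self M
  have m1 : |M| * L ^ (η - κ) ≤ |M| * (L ^ (η - κ) * L ^ (η' - κ')) :=
    mul_le_mul_of_nonneg_left (le_mul_of_one_le_right (by positivity) l2) (abs_nonneg _)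
  have m2 : |M| * L ^ (η' - κ') ≤ |M| * (L ^ (η - κ) * L ^ (η' - κ')) :=
    mul_le_mul_of_nonneg_left (le_mul_of_one_le_left (by positivity) l1) (abs_nonneg _)
  have r1 : ∀ {a}, 0 ≤ a → a ≤ S₀ + T₀ → a ^ η ≤ L ^ (η - κ) * a ^ κ := fun h0 h1 =>
    rpow_le_mul_rpow h0 (h1.trans hLS) hκ h
  have r2 : ∀ {a}, 0 ≤ a → a ≤ S₀ + T₀ → a ^ η' ≤ L ^ (η' - κ') * a ^ κ' := fun h0 h1 =>
    rpow_le_mul_rpow h0 (h1.trans hLS) hκ' h'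
  refine ⟨|M| * (L ^ (η - κ) * L ^ (η' - κ')), ⟨fun s t h1 h2 h3 => ?_,
    fun s₁ s₂ t h1 h2 h3 h4 => ?_, fun s t₁ t₂ h1 h2 h3 h4 => ?_,
    fun s₁ s₂ t₁ t₂ h1 h2 h3 h4 h5 => ?_⟩⟩
  · exact (hf.sup s t h1 h2 h3).trans (m0.trans
      ((le_mul_of_one_le_right (abs_nonneg _) l1).trans m1))
  · have p := Real.rpow_nonneg (sub_nonneg.2 h2) η
    have p' := Real.rpow_nonneg (sub_nonneg.2 h2) κ
    calc _ ≤ M * (s₂ - s₁) ^ η := hf.fst s₁ s₂ t h1 h2 h3 h4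
      _ ≤ |M| * (L ^ (η - κ) * (s₂ - s₁) ^ κ) :=
        mul_le_mul m0 (r1 (sub_nonneg.2 h2) (by linarith)) p (abs_nonneg _)
      _ ≤ _ := by rw [← mul_assoc]; exact mul_le_mul_of_nonneg_right m1 p'
  · have p := Real.rpow_nonneg (sub_nonneg.2 h2) η'
    have p' := Real.rpow_nonneg (sub_nonneg.2 h2) κ'
    calc _ ≤ M * (t₂ - t₁) ^ η' := hf.snd s t₁ t₂ h1 h2 h3 h4
      _ ≤ |M| * (L ^ (η' - κ') * (t₂ - t₁) ^ κ') :=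
        mul_le_mul m0 (r2 (sub_nonneg.2 h2) (by linarith)) p (abs_nonneg _)
      _ ≤ _ := by rw [← mul_assoc]; exact mul_le_mul_of_nonneg_right m2 p'
  · have p := Real.rpow_nonneg (sub_nonneg.2 h2) η
    have p' := Real.rpow_nonneg (sub_nonneg.2 h3) η'
    have p'' := Real.rpow_nonneg (sub_nonneg.2 h2) κ
    calc _ ≤ M * ((s₂ - s₁) ^ η * (t₂ - t₁) ^ η') := hf.rect s₁ s₂ t₁ t₂ h1 h2 h3 h4 h5
      _ ≤ |M| * ((L ^ (η - κ) * (s₂ - s₁) ^ κ) * (L ^ (η' - κ') * (t₂ - t₁) ^ κ')) :=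
        mul_le_mul m0 (mul_le_mul (r1 (sub_nonneg.2 h2) (by linarith))
          (r2 (sub_nonneg.2 h3) (by linarith)) p' (by positivity)) (by positivity) (abs_nonneg _)
      _ = _ := by ring

lemma HolderTri.const_mono {κ κ' M M' S₀ T₀ : ℝ} {f : ℝ → ℝ → ℝ} (hM : M ≤ M')
    (hf : HolderTri κ κ' M S₀ T₀ f) : HolderTri κ κ' M' S₀ T₀ f where
  sup s t h1 h2 h3 := (hf.sup s t h1 h2 h3).trans hM
  fst s₁ s₂ t h1 h2 h3 h4 := (hf.fst s₁ s₂ t h1 h2 h3 h4).trans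
    (mul_le_mul_of_nonneg_right hM (Real.rpow_nonneg (sub_nonneg.2 h2) _))
  snd s t₁ t₂ h1 h2 h3 h4 := (hf.snd s t₁ t₂ h1 h2 h3 h4).trans
    (mul_le_mul_of_nonneg_right hM (Real.rpow_nonneg (sub_nonneg.2 h2) _))
  rect s₁ s₂ t₁ t₂ h1 h2 h3 h4 h5 := (hf.rect s₁ s₂ t₁ t₂ h1 h2 h3 h4 h5).trans
    (mul_le_mul_of_nonneg_right hM (mul_nonneg (Real.rpow_nonneg (sub_nonneg.2 h2) _)
      (Real.rpow_nonneg (sub_nonneg.2 h3) _)))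

/-- Hölder regularity on all triangles gives Hölder regularity on bounded parts of the strip. -/
lemma memH_of_holderTri {κ κ' : ℝ} {f : ℝ → ℝ → ℝ} (hκ : 0 < κ) (hκ' : 0 < κ')
    (hf : ∀ N : ℕ, ∃ M, HolderTri κ κ' M N N f) (T a b c d : ℝ) : MemH κ κ' (box T a b c d) f := by
  obtain ⟨N, hN⟩ := exists_nat_ge (max b d)
  have hb : b ≤ N := (le_max_left _ _).trans hN
  have hd : d ≤ N := (le_max_right _ _).trans hN
  obtain ⟨M, hM⟩ := hf N
  have mem : ∀ {p : ℝ × ℝ}, p ∈ box T a b c d → 0 ≤ p.1 + p.2 ∧ p.1 ≤ N ∧ p.2 ≤ N := fun hp =>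
    ⟨hp.2.1, hp.1.1.2.trans hb, hp.1.2.2.trans hd⟩
  refine { continuousOn := (hM.continuousOn hκ hκ').mono fun p hp => mem hp
           rect := ⟨M, fun s₁ s₂ t₁ t₂ hs ht hsub => ?_⟩
           fst := ⟨M, fun s₁ s₂ t h1 h2 => ?_⟩
           snd := ⟨M, fun s t₁ t₂ h1 h2 => ?_⟩ }
  · have h1 := mem (hsub (show (s₁, t₁) ∈ _ from ⟨⟨le_rfl, hs.le⟩, ⟨le_rfl, ht.le⟩⟩))
    have h2 := mem (hsub (show (s₂, t₂) ∈ _ from ⟨⟨hs.le, le_rfl⟩, ⟨ht.le, le_rfl⟩⟩))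
    exact hM.rect s₁ s₂ t₁ t₂ h1.1 hs.le ht.le h2.2.1 h2.2.2
  · rcases le_total s₁ s₂ with h | h
    · rw [abs_of_nonneg (sub_nonneg.2 h)]
      exact hM.fst s₁ s₂ t (mem h1).1 h (mem h2).2.1 (mem h1).2.2
    · rw [abs_sub_comm, abs_sub_comm s₂, abs_of_nonneg (sub_nonneg.2 h)]
      exact hM.fst s₂ s₁ t (mem h2).1 h (mem h1).2.1 (mem h1).2.2
  · rcases le_total t₁ t₂ with h | h
    · rw [abs_of_nonneg (sub_nonneg.2 h)]
      exact hM.snd s t₁ t₂ (mem h1).1 h (mem h1).2.1 (mem h2).2.2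
    · rw [abs_sub_comm, abs_sub_comm t₂, abs_of_nonneg (sub_nonneg.2 h)]
      exact hM.snd s t₂ t₁ (mem h2).1 h (mem h1).2.1 (mem h1).2.2

lemma closedTri_subset_box {T S₀ T₀ : ℝ} (hST : S₀ + T₀ ≤ √2 * T) :
    closedTri S₀ T₀ ⊆ box T (-T₀) S₀ (-S₀) T₀ := fun p hp =>
  ⟨⟨⟨by linarith [hp.1, hp.2.2], hp.2.1⟩, ⟨by linarith [hp.1, hp.2.1], hp.2.2⟩⟩,
    hp.1, by linarith [hp.2.1, hp.2.2]⟩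

lemma MemC.exists_triBound {T γ γ' S₀ T₀ : ℝ} {x : ℝ → ℝ → ℝ}
    (h : MemC γ γ' (box T (-T₀) S₀ (-S₀) T₀) x) (hST : S₀ + T₀ ≤ √2 * T) :
    ∃ K, 0 ≤ K ∧ TriBound γ γ' K S₀ T₀ x := by
  obtain ⟨C, hC⟩ := h.rect
  refine ⟨|C|, abs_nonneg _, fun s₁ s₂ t₁ t₂ h0 hs ht hS hT => ?_⟩
  have p : 0 ≤ (s₂ - s₁) ^ γ * (t₂ - t₁) ^ γ' := mul_nonneg
    (Real.rpow_nonneg (sub_nonneg.2 hs) _) (Real.rpow_nonneg (sub_nonneg.2 ht) _)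
  rcases hs.eq_or_lt with rfl | hs
  · rw [show rectIncr x s₁ s₁ t₁ t₂ = 0 by unfold rectIncr; ring, abs_zero]
    positivity
  rcases ht.eq_or_lt with rfl | ht
  · rw [show rectIncr x s₁ s₂ t₁ t₁ = 0 by unfold rectIncr; ring, abs_zero]
    positivity
  refine (hC s₁ s₂ t₁ t₂ hs ht fun q hq => closedTri_subset_box hST
    ⟨?_, hq.1.2.trans hS, hq.2.2.trans hT⟩).trans (mul_le_mul_of_nonneg_right (le_abs_self _) p)
  linarith [hq.1.1, hq.2.1]

lemma MemH.exists_holderTri {T κ κ' S₀ T₀ : ℝ} {f : ℝ → ℝ → ℝ}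
    (h : MemH κ κ' (box T (-T₀) S₀ (-S₀) T₀) f) (hST : S₀ + T₀ ≤ √2 * T) :
    ∃ M, HolderTri κ κ' M S₀ T₀ f := by
  have hsub := closedTri_subset_box hST
  obtain ⟨M₀, hM₀⟩ := (isCompact_closedTri S₀ T₀).exists_bound_of_continuousOn
    (h.continuousOn.mono hsub)
  obtain ⟨M₁, hM₁⟩ := h.fst
  obtain ⟨M₂, hM₂⟩ := h.snd
  obtain ⟨M₃, -, hM₃⟩ := h.toMemC.exists_triBound hST
  set M := max (max M₀ M₁) (max M₂ M₃)
  have l0 : M₀ ≤ M := (le_max_left _ _).trans (le_max_left _ _)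
  have l1 : M₁ ≤ M := (le_max_right _ _).trans (le_max_left _ _)
  have l2 : M₂ ≤ M := (le_max_left _ _).trans (le_max_right _ _)
  have l3 : M₃ ≤ M := (le_max_right _ _).trans (le_max_right _ _)
  refine ⟨M, fun s t h1 h2 h3 => (hM₀ (s, t) ⟨h1, h2, h3⟩).trans l0,
    fun s₁ s₂ t h1 h2 h3 h4 => ?_, fun s t₁ t₂ h1 h2 h3 h4 => ?_,
    fun s₁ s₂ t₁ t₂ h1 h2 h3 h4 h5 => (hM₃ s₁ s₂ t₁ t₂ h1 h2 h3 h4 h5).trans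
      (mul_le_mul_of_nonneg_right l3 (mul_nonneg (Real.rpow_nonneg (sub_nonneg.2 h2) _)
        (Real.rpow_nonneg (sub_nonneg.2 h3) _)))⟩
  · have := hM₁ s₁ s₂ t (hsub ⟨h1, h2.trans h3, h4⟩)
      (hsub ⟨by simp only; linarith, h3, h4⟩)
    rw [abs_of_nonneg (sub_nonneg.2 h2)] at this
    exact this.trans (mul_le_mul_of_nonneg_right l1 (Real.rpow_nonneg (sub_nonneg.2 h2) _))
  · have := hM₂ s t₁ t₂ (hsub ⟨h1, h3, h2.trans h4⟩)
      (hsub ⟨by simp only; linarith, h3, h4⟩)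
    rw [abs_of_nonneg (sub_nonneg.2 h2)] at this
    exact this.trans (mul_le_mul_of_nonneg_right l2 (Real.rpow_nonneg (sub_nonneg.2 h2) _))

lemma IsDriver.memC {T γ γ' : ℝ} {x x' : ℝ → ℝ → ℝ} (hx : IsDriver γ γ' x)
    (h : ∀ p ∈ strip T, x' p.1 p.2 = x p.1 p.2) (a b c d : ℝ) : MemC γ γ' (box T a b c d) x' := by
  obtain ⟨N, hN⟩ := exists_nat_ge (max (max (-a) b) (max (-c) d))
  have ha : -a ≤ N := ((le_max_left _ _).trans (le_max_left _ _)).trans hN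
  have hb : b ≤ N := ((le_max_right _ _).trans (le_max_left _ _)).trans hN
  have hc : -c ≤ N := ((le_max_left _ _).trans (le_max_right _ _)).trans hN
  have hd : d ≤ N := ((le_max_right _ _).trans (le_max_right _ _)).trans hN
  obtain ⟨K, -, hK⟩ := hx.bound N
  refine ⟨hx.continuous.continuousOn.congr fun p hp => h p hp.2,
    K, fun s₁ s₂ t₁ t₂ hs ht hsub => ?_⟩
  have h1 := hsub (show (s₁, t₁) ∈ _ from ⟨⟨le_rfl, hs.le⟩, ⟨le_rfl, ht.le⟩⟩)
  have h2 := hsub (show (s₁, t₂) ∈ _ from ⟨⟨le_rfl, hs.le⟩, ⟨ht.le, le_rfl⟩⟩)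
  have h3 := hsub (show (s₂, t₁) ∈ _ from ⟨⟨hs.le, le_rfl⟩, ⟨le_rfl, ht.le⟩⟩)
  have h4 := hsub (show (s₂, t₂) ∈ _ from ⟨⟨hs.le, le_rfl⟩, ⟨ht.le, le_rfl⟩⟩)
  have e : rectIncr x' s₁ s₂ t₁ t₂ = rectIncr x s₁ s₂ t₁ t₂ := by
    have e1 := h _ h1.2
    have e2 := h _ h2.2
    have e3 := h _ h3.2
    have e4 := h _ h4.2
    simp only at e1 e2 e3 e4
    rw [rectIncr, rectIncr, e1, e2, e3, e4]
  rw [e]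
  exact hK s₁ s₂ t₁ t₂ (by linarith [h1.1.1.1]) hs.le (by linarith [h4.1.1.2])
    (by linarith [h1.1.2.1]) ht.le (by linarith [h4.1.2.2])

/-- Nondegenerate tiles have their closures in the closed triangle, so only values of the driver
there matter. Degenerate tiles may lie anywhere, but their integrals vanish for every driver. -/
lemma HasTriIntegral.congr {γ γ' s t z : ℝ} {f x x' : ℝ → ℝ → ℝ}
    (h : HasTriIntegral γ γ' f x s t z)
    (hx : ∀ u v, 0 ≤ u + v → u ≤ s → v ≤ t → x u v = x' u v) : HasTriIntegral γ γ' f x' s t z := by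
  refine ⟨h.1, fun a b c d ht => ?_⟩
  obtain ⟨I, hI, hsum⟩ := h.2 a b c d ht
  refine ⟨I, fun n => ?_, hsum⟩
  rcases (ht.fst_le n).eq_or_lt with h1 | h1
  · have e := hI n
    rw [← h1] at e ⊢
    rw [e.unique le_rfl (ht.snd_le n) (hasYoungIntegral_of_eq_fst f x _ _ _)]
    exact hasYoungIntegral_of_eq_fst f x' _ _ _
  rcases (ht.snd_le n).eq_or_lt with h2 | h2
  · have e := hI n
    rw [← h2] at e ⊢
    rw [e.unique h1.le le_rfl (hasYoungIntegral_of_eq_snd f x _ _ _)]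
    exact hasYoungIntegral_of_eq_snd f x' _ _ _
  obtain ⟨m1, m2, m3⟩ := ht.mem h1 h2
  exact (hI n).congr fun u hu v hv => hx u v (by linarith [hu.1, hv.1]) (hu.2.trans m2)
    (hv.2.trans m3)

end FracWave
end

/-! ### Mild solutions along a given path, and the almost sure statement -/

noncomputable section
namespace FracWave

/-- A function of the rotated coordinates written as a function of `(time, position)`. -/
def unrotate (y : ℝ → ℝ → ℝ) : ℝ → ℝ → ℝ := fun u v => y ((u - v) / √2) ((u + v) / √2)

lemma rotate_unrotate (y : ℝ → ℝ → ℝ) : rotate (unrotate y) = y := by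
  funext s t
  have h := toRot_rot s t
  simp only [toRot, Prod.mk.injEq] at h
  rw [rotate, unrotate, h.1, h.2]

lemma unrotate_rotate (Y : ℝ → ℝ → ℝ) : unrotate (rotate Y) = Y := by
  funext u v
  have h : √2 ≠ 0 := by positivity
  have h2 : √2 ^ 2 = (2 : ℝ) := Real.sq_sqrt (by norm_num)
  rw [unrotate, rotate]
  congr 1 <;> field_simp <;> rw [h2] <;> ring

lemma fst_add_snd_rot (u v : ℝ) : (u - v) / √2 + (u + v) / √2 = √2 * u := by
  have h : √2 ≠ 0 := by positivity
  have h2 : √2 ^ 2 = (2 : ℝ) := Real.sq_sqrt (by norm_num)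
  field_simp
  rw [h2]
  ring

lemma abs_div_sqrt_two_le (r : ℝ) : |r / √2| ≤ |r| := by
  rw [abs_div, abs_of_pos (by positivity : (0 : ℝ) < √2)]
  exact div_le_self (abs_nonneg _) (Real.one_le_sqrt.2 (by norm_num))

section

variable {T C : ℝ} {σ : ℝ → ℝ} {x x' y : ℝ → ℝ → ℝ}

/-- The exponents of Y are lowered to at most 1/2. As γ and γ' exceed 1/2, this keeps the sums above
1, ensures κ ≤ γ as the contraction requires, and makes them exponents of the constructed solution
as well, which has exponents 1/2. -/
lemma IsMildSolution.exists_isPotential {Y : ℝ → ℝ → ℝ}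
    (h : IsMildSolution T σ x Y) {S₀ T₀ : ℝ} (hST : S₀ + T₀ ≤ √2 * T) :
    ∃ γ γ' κ κ' K M, 1 / 2 < γ ∧ 1 / 2 < γ' ∧ 0 < κ ∧ 0 < κ' ∧ κ ≤ 1 / 2 ∧ κ' ≤ 1 / 2 ∧
      1 < κ + γ ∧ 1 < κ' + γ' ∧ 0 ≤ K ∧ TriBound γ γ' K S₀ T₀ x ∧
      HolderTri κ κ' M S₀ T₀ (rotate Y) ∧
      IsPotential (fun s t => σ (rotate Y s t)) x S₀ T₀ (rotate Y) := by
  obtain ⟨γ, γ', κ, κ', hγ, hγ', hκ, hκ', hx, hY, hint⟩ := h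
  obtain ⟨K, hK, hxK⟩ := (hx (-T₀) S₀ (-S₀) T₀).exists_triBound hST
  obtain ⟨M, hM⟩ := (hY (-T₀) S₀ (-S₀) T₀).exists_holderTri hST
  have k : 1 - γ < min κ (1 / 2) := lt_min hκ.1 (by linarith [hγ.1])
  have k' : 1 - γ' < min κ' (1 / 2) := lt_min hκ'.1 (by linarith [hγ'.1])
  have k0 : 0 < min κ (1 / 2) := by linarith [hγ.2]
  have k0' : 0 < min κ' (1 / 2) := by linarith [hγ'.2]
  obtain ⟨M', hM'⟩ := hM.exponent_mono k0 k0' (min_le_left _ _) (min_le_left _ _)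
  refine ⟨γ, γ', min κ (1 / 2), min κ' (1 / 2), K, M', hγ.1, hγ'.1, k0, k0', min_le_right _ _,
    min_le_right _ _, by linarith, by linarith, hK, hxK, hM', ?_⟩
  refine isPotential_of_hasTriIntegral (γ := γ) (γ' := γ') (by linarith [hγ.1]) (by linarith [hγ'.1])
    (by linarith [hγ.1, hγ'.1]) fun s t h0 hs ht => ?_
  have h2 : 0 < √2 := by positivity
  have hmem : (t + s) / √2 ∈ Icc 0 T := ⟨div_nonneg (by linarith) h2.le, by
    rw [div_le_iff₀ h2]; linarith⟩
  have h3 := hasConeIntegral_iff.1 (hint _ hmem ((t - s) / √2))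
  have h4 := toRot_rot s t
  simp only [toRot, Prod.mk.injEq] at h4
  rw [h4.1, h4.2] at h3
  exact h3

/-- A function that is controlled near time zero by a power larger than one has zero velocity. -/
lemma hasDerivWithinAt_zero_of_le {f : ℝ → ℝ} {A θ : ℝ} (hθ : 1 < θ) (h0 : f 0 = 0)
    (h : ∀ s ∈ Icc 0 T, |f s| ≤ A * s ^ θ) : HasDerivWithinAt f 0 (Icc 0 T) 0 := by
  rw [hasDerivWithinAt_iff_tendsto]
  have hlim : Tendsto (fun s : ℝ => A * s ^ (θ - 1)) (𝓝[Icc 0 T] 0) (𝓝 0) := by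
    have h1 := ((Real.continuousAt_rpow_const 0 (θ - 1) (Or.inr (by linarith))).tendsto).const_mul A
    rw [Real.zero_rpow (by linarith), mul_zero] at h1
    exact h1.mono_left nhdsWithin_le_nhds
  refine squeeze_zero' (Eventually.of_forall fun s => by positivity) ?_ hlim
  filter_upwards [self_mem_nhdsWithin] with s hs
  rcases hs.1.eq_or_lt with rfl | hs0
  · rw [Real.zero_rpow (by linarith)]; simp
  · rw [h0, sub_zero, sub_zero, smul_zero, sub_zero, Real.norm_eq_abs, Real.norm_eq_abs,
      abs_of_pos hs0]
    calc s⁻¹ * |f s| ≤ s⁻¹ * (A * s ^ θ) :=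
          mul_le_mul_of_nonneg_left (h s hs) (inv_nonneg.2 hs0.le)
      _ = A * s ^ (θ - 1) := by rw [Real.rpow_sub_one hs0.ne']; ring

/-- Existence, uniqueness and regularity of the mild solution for a given path. -/
theorem exists_mildSolution {H ν : ℝ} (hH : H ∈ Ioo (1 / 2 : ℝ) 1)
    (hν : ν ∈ Ioo (0 : ℝ) 1) (hσ : SmoothBound C σ) (hσ' : SmoothBound C (deriv σ))
    (hx : ∀ η η', η ∈ Ioo (1 / 2) 1 → η' ∈ Ioo (1 / 2) 1 → η + η' < 1 + H - ν / 2 →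
      IsDriver η η' x)
    (hxx : ∀ p ∈ strip T, x' p.1 p.2 = x p.1 p.2) :
    ∃ Y : ℝ → ℝ → ℝ, IsMildSolution T σ x' Y ∧
      (∀ Y', IsMildSolution T σ x' Y' → ∀ s ∈ Icc 0 T, ∀ t, Y' s t = Y s t) ∧
      (∀ t, Y 0 t = 0 ∧ HasDerivWithinAt (fun s => Y s t) 0 (Icc 0 T) 0) ∧
      ∀ η η' : ℝ, η ∈ Ioo (0 : ℝ) 1 → η' ∈ Ioo (0 : ℝ) 1 → η + η' < 1 + H - ν / 2 →
        η < H + (1 - ν) / 2 → η' < H + (1 - ν) / 2 →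
        ∀ a b c d, MemH η η' (box T a b c d) (rotate Y) := by
  obtain ⟨γ, hγ, hγγ⟩ := exists_admissible hH hν
  have hd := hx γ γ hγ hγ hγγ
  have half : (0 : ℝ) < 1 / 2 := by norm_num
  have h1γ : 1 < 1 / 2 + γ := by linarith [hγ.1]
  have h0γ : 0 < γ := by linarith [hγ.1]
  have h2γ : 1 < γ + γ := by linarith [hγ.1]
  have h2 : 0 < √2 := by positivity
  -- The equation is solved in the whole half plane 0 ≤ s + t for the regular version x; the driver
  -- x' is known to agree with it only on the strip, which contains every triangle that is used.
  obtain ⟨y, hy, hyM⟩ := exists_fixedPoint half half hγ.1.le hγ.1.le h1γ h1γ h2γ hd hσ hσ'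
  have hpot : ∀ S₀ T₀, IsPotential (fun s t => σ (y s t)) x S₀ T₀ y := fun S₀ T₀ =>
    isPotential_of_hasTriIntegral h0γ h0γ h2γ fun s t h0 _ _ => hy s t h0
  have hy' : ∀ s t, 0 ≤ s + t → s + t ≤ √2 * T →
      HasTriIntegral γ γ (fun s t => σ (y s t)) x' s t (y s t) := fun s t h0 h1 =>
    (hy s t h0).congr fun u v a b c => (hxx (u, v) ⟨a, by simp only; linarith⟩).symm
  have hcone : ∀ u ∈ Icc 0 T, ∀ v : ℝ, 0 ≤ (u - v) / √2 + (u + v) / √2 ∧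
      (u - v) / √2 + (u + v) / √2 ≤ √2 * T := fun u hu v => by
    rw [fst_add_snd_rot]
    exact ⟨mul_nonneg h2.le hu.1, mul_le_mul_of_nonneg_left hu.2 h2.le⟩
  refine ⟨unrotate y, ⟨γ, γ, 1 / 2, 1 / 2, hγ, hγ, ⟨by linarith [hγ.1], by norm_num⟩,
    ⟨by linarith [hγ.1], by norm_num⟩, hd.memC hxx, fun a b c d => ?_, fun u hu v => ?_⟩,
    fun Y' hY' u hu v => ?_, fun t => ?_, fun η η' hη hη' hs h1 h1' a b c d => ?_⟩
  · rw [rotate_unrotate]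
    exact memH_of_holderTri half half hyM T a b c d
  · rw [hasConeIntegral_iff]
    have e : rotate (fun u v => σ (unrotate y u v)) = fun s t => σ (y s t) := by
      conv_rhs => rw [← rotate_unrotate y]
      rfl
    rw [e]
    exact hy' _ _ (hcone u hu v).1 (hcone u hu v).2
  · obtain ⟨c0, c1⟩ := hcone u hu v
    obtain ⟨γ₁, γ₁', κ, κ', K, M, g1, g1', k0, k0', kh, kh', k1, k1', hK, hxK, hM, hP⟩ :=
      hY'.exists_isPotential c1
    obtain ⟨N, hN⟩ := exists_nat_ge (max ((u - v) / √2) ((u + v) / √2))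
    obtain ⟨M₁, hM₁⟩ := hyM N
    obtain ⟨M₂, hM₂⟩ := (hM₁.mono ((le_max_left _ _).trans hN)
      ((le_max_right _ _).trans hN)).exponent_mono k0 k0' kh kh'
    have hPy : IsPotential (fun s t => σ (y s t)) x' ((u - v) / √2) ((u + v) / √2) y :=
      isPotential_of_hasTriIntegral h0γ h0γ h2γ fun s t h0 hs ht => hy' s t h0 (by linarith)
    -- The comparison takes place on the triangle whose vertex is the point under consideration,
    -- with the exponents supplied by the competing solution.
    have := eq_of_isPotential k0 k0' (by linarith) (by linarith) k1 k1' (by linarith) hK hσ hσ' hxK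
      (hM.const_mono (le_max_left M M₂)) (hM₂.const_mono (le_max_right M M₂)) hP hPy c0 le_rfl le_rfl
    rw [← unrotate_rotate Y']
    exact this
  · have hY0 : unrotate y 0 t = 0 := by
      have := (hpot ((0 - t) / √2) ((0 + t) / √2)).eq_zero (s := (0 - t) / √2) le_rfl
        (le_of_eq (by ring))
      rw [unrotate, show (0 + t) / √2 = -((0 - t) / √2) by ring]
      exact this
    obtain ⟨N, hN⟩ := exists_nat_ge (T + |t|)
    obtain ⟨M, hM⟩ := hyM N
    -- The sum of the rotated coordinates is √2 times the time, so near time zero the solution is of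
    -- order s^(2γ) with 2γ > 1.
    obtain ⟨A, -, hA⟩ := (hpot N N).regularity half half h1γ h1γ h0γ h0γ h2γ hd hσ hM
    refine ⟨hY0, hasDerivWithinAt_zero_of_le (A := A * √2 ^ (γ + γ)) h2γ hY0 fun s hs => ?_⟩
    have b1 : (s - t) / √2 ≤ N := by
      have h3 := (le_abs_self _).trans (abs_div_sqrt_two_le (s - t))
      have h4 := abs_sub s t
      rw [abs_of_nonneg hs.1] at h4
      linarith [hs.2]
    have b2 : (s + t) / √2 ≤ N := by
      have h3 := (le_abs_self _).trans (abs_div_sqrt_two_le (s + t))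
      have h4 := abs_add_le s t
      rw [abs_of_nonneg hs.1] at h4
      linarith [hs.2]
    refine (hA _ _ (hcone s hs t).1 b1 b2).trans (le_of_eq ?_)
    rw [fst_add_snd_rot, Real.mul_rpow h2.le hs.1, mul_assoc]
  · rw [rotate_unrotate]
    -- Exponents not above 1/2 are raised to 1/2 + ε. The pair stays admissible if both are raised
    -- because ε < H/2 - ν/4, and if only one is raised because the other is below H + (1 - ν)/2 -
    -- ε; this is the role of the two last hypotheses on the exponents.
    obtain ⟨ε, hε0, hε⟩ : ∃ ε : ℝ, 0 < ε ∧ ε < min (1 / 2) (min (H / 2 - ν / 4)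
        (min (H + (1 - ν) / 2 - η) (H + (1 - ν) / 2 - η'))) :=
      exists_between (lt_min half (lt_min (by linarith [hH.1, hν.2])
        (lt_min (by linarith) (by linarith))))
    obtain ⟨e1, hε⟩ := lt_min_iff.1 hε
    obtain ⟨e2, hε⟩ := lt_min_iff.1 hε
    obtain ⟨e3, e4⟩ := lt_min_iff.1 hε
    set q := max η (1 / 2 + ε) with hq
    set q' := max η' (1 / 2 + ε) with hq'
    have q1 : q ∈ Ioo (1 / 2) 1 := ⟨lt_max_of_lt_right (by linarith), max_lt hη.2 (by linarith)⟩
    have q1' : q' ∈ Ioo (1 / 2) 1 := ⟨lt_max_of_lt_right (by linarith), max_lt hη'.2 (by linarith)⟩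
    have qs : q + q' < 1 + H - ν / 2 := by
      rcases max_choice η (1 / 2 + ε) with m | m <;> rcases max_choice η' (1 / 2 + ε) with m' | m' <;>
        rw [hq, hq', m, m'] <;> linarith
    refine memH_of_holderTri hη.1 hη'.1 (fun N => ?_) T a b c d
    obtain ⟨M, hM⟩ := hyM N
    obtain ⟨A, hA, -⟩ := (hpot N N).regularity half half (by linarith [q1.1]) (by linarith [q1'.1])
      (by linarith [q1.1]) (by linarith [q1'.1]) (by linarith [q1.1, q1'.1])
      (hx q q' q1 q1' qs) hσ hM
    exact hA.exponent_mono hη.1 hη'.1 (le_max_left _ _) (le_max_left _ _)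

end

/-- Two continuous versions of the rotated noise agree on the strip. -/
lemma IsRotatedNoise.ae_eq {Ω : Type*} [MeasurableSpace Ω] {P : Measure Ω}
    [IsProbabilityMeasure P] {T H ν : ℝ} {X : PlaneTest → Ω → ℝ} {x x' : Ω → ℝ → ℝ → ℝ}
    (hX : IsFractionalNoise P T H ν X)
    (hx : IsRotatedNoise P T X x) (hx' : IsRotatedNoise P T X x') :
    ∀ᵐ ω ∂P, ∀ p ∈ strip T, x ω p.1 p.2 = x' ω p.1 p.2 := by
  -- Versions agree almost surely at each point; a countable dense set and continuity give agreement
  -- on the whole strip outside one null set.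
  obtain ⟨S, hS, hSd⟩ := TopologicalSpace.exists_countable_dense (strip T)
  have key : ∀ᵐ ω ∂P, ∀ p ∈ S, x ω p.1.1 p.1.2 = x' ω p.1.1 p.1.2 := by
    refine (ae_ball_iff hS).2 fun p _ => ?_
    obtain ⟨Z, hZ, h⟩ := hx.version p.1.1 p.1.2 p.2
    obtain ⟨Z', hZ', h'⟩ := hx'.version p.1.1 p.1.2 p.2
    filter_upwards [h, h', IsNoiseOfSet.ae_eq hX (isCompact_anchoredRect T _ _) hZ hZ']
      with ω a b c
    rw [a, b, c]
  filter_upwards [key, hx.continuous_paths, hx'.continuous_paths] with ω h c c' p hp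
  have := Continuous.ext_on hSd (continuousOn_iff_continuous_domRestrict.1 c)
    (continuousOn_iff_continuous_domRestrict.1 c') fun p hp => h p hp
  exact congrFun this ⟨p, hp⟩

end FracWave
end

theorem theorem1p1 {Ω : Type*} [MeasurableSpace Ω] (P : MeasureTheory.Measure Ω)
    [MeasureTheory.IsProbabilityMeasure P]
    (T H ν : ℝ) (hT : 0 < T) (hH : H ∈ Set.Ioo (1 / 2 : ℝ) 1) (hν : ν ∈ Set.Ioo (0 : ℝ) 1)
    (X : FracWave.PlaneTest → Ω → ℝ) (hX : FracWave.IsFractionalNoise P T H ν X)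
    (σ : ℝ → ℝ) (hσ : ContDiff ℝ 3 σ)
    (hσb : ∃ C : ℝ, ∀ k ≤ 3, ∀ r : ℝ, |iteratedDeriv k σ r| ≤ C) :
    (∃ x : Ω → ℝ → ℝ → ℝ, FracWave.IsRotatedNoise P T X x) ∧
    ∀ x : Ω → ℝ → ℝ → ℝ, FracWave.IsRotatedNoise P T X x →
      ∀ᵐ ω ∂P, ∃ Y : ℝ → ℝ → ℝ,
        FracWave.IsMildSolution T σ (x ω) Y ∧
        (∀ Y' : ℝ → ℝ → ℝ, FracWave.IsMildSolution T σ (x ω) Y' →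
          ∀ s ∈ Set.Icc 0 T, ∀ t : ℝ, Y' s t = Y s t) ∧
        (∀ t : ℝ, Y 0 t = 0 ∧
          HasDerivWithinAt (fun s => Y s t) 0 (Set.Icc 0 T) 0) ∧
        ∀ η η' : ℝ, η ∈ Set.Ioo (0 : ℝ) 1 → η' ∈ Set.Ioo (0 : ℝ) 1 →
          η + η' < 1 + H - ν / 2 →
          η < H + (1 - ν) / 2 → η' < H + (1 - ν) / 2 →
          ∀ a b c d : ℝ, FracWave.MemH η η' (FracWave.box T a b c d) (FracWave.rotate Y) := by
  obtain ⟨x₀, Z, hZ, hv, hd⟩ := hX.exists_regular_version hH hν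
  obtain ⟨γ, hγ, hγγ⟩ := FracWave.exists_admissible hH hν
  have hx₀ : FracWave.IsRotatedNoise P T X x₀ :=
    ⟨fun s t _ => ⟨Z s t, hZ s t, hv s t⟩, by
      filter_upwards [hd] with ω h
      exact (h γ γ hγ hγ hγγ).continuous.continuousOn⟩
  obtain ⟨C, hC, hC'⟩ := FracWave.exists_smoothBound hσ hσb
  refine ⟨⟨x₀, hx₀⟩, fun x hx => ?_⟩
  -- From here on the path is fixed: the exceptional set comes only from the noise, and existence,
  -- uniqueness and regularity are deterministic.
  filter_upwards [hd, hx.ae_eq hX hx₀] with ω h hω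
  exact FracWave.exists_mildSolution hH hν hC hC' h hω
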